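/- **Setting.** An object allocation framework (OAF) $F=(A,B,\succ,E)$ consists of a set $A$ of agents, a set $B$ of objects with $|A|=|B|=n$, a strict linear order $\succ_a$ on $B$ for every agent $a$, and an undirected graph $(B,E)$. If $\mu$ is a perfect matching of agents to objects, $\{\mu(a),\mu(a')\}\in E$, $\mu(a')\succ_a\mu(a)$ and $\mu(a)\succ_{a'}\mu(a')$, then $a$ and $a'$ may swap their objects. For a configuration $\chi=(F,\mu)$ (we write $\chi(a)=\mu(a)$), $\mathrm{Reach}(\chi)$ is the set of perfect matchings obtained from $\mu$ by finitely many swaps, and for a set $\tau$ of agent–object pairs $\mathrm{Reach}(\chi,\tau)$ is the set of those that contain $\tau$. The Pareto-efficient matching problem asks, given $\chi_0=(F,\mu_0)$, for a matching in $\mathrm{Reach}(\chi_0)$ that no other matching in $\mathrm{Reach}(\chi_0)$ Pareto-dominates. The best match of $a$ in a nonempty set of matchings is the $\succ_a$-best object that $a$ gets in one of them. For a sequence $\sigma=a_1,\dots,a_s$ of agents, $\mathrm{Serial}(\sigma)=\tau_s$, where $\tau_0=\emptyset$ and $\tau_t=\tau_{t-1}\cup\{(a_t,b_t)\}$ with $b_t$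 the best match of $a_t$ in $\mathrm{Reach}(\chi_0,\tau_{t-1})$. Let $(B,E)$ be a generalized star: a tree with at most one vertex of degree greater than $2$. Fix a center $o$ (a vertex such that all other vertices have degree at most $2$), number the branches at $o$ by $i=1,\dots,m$, and let $b_{i,1},\dots,b_{i,\ell_i}$ be the vertices of branch $i$, with $b_{i,j}$ at distance $j$ from $o=b_{i,0}$. A pair $(\chi,\tau)$ is *nice* if $\mathrm{Reach}(\chi,\tau)\neq\emptyset$ and for every $i$ there are $1\le j_1<\dots<j_s\le\ell_i$ (the sequence $\mathrm{Dests}(\chi,\tau,i)$) such that $\tau$ matches $\chi^{-1}(b_{i,t})$ to $b_{i,j_t}$ for $1\le t\le s$ and leaves $\chi^{-1}(b_{i,t})$ unmatched for $s<t\le\ell_i$. **The two-phase algorithm.** *Phase 1.* Start with $\chi=\chi_0$, $\sigma=(\chi_0^{-1}(o))$ and $\tau=\{(\chi_0^{-1}(o),b)\}$, $b$ the best match of $\chi_0^{-1}(o)$ in $\mathrm{Reach}(\chi_0)$. While $\tau(\chi^{-1}(o))\ne o$: let $i$ be the branch containing $\tau(\chi^{-1}(o))$, let $s=|\mathrm{Dests}(\chi,\tau,i)|$,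 append the dictator $a=\chi^{-1}(b_{i,s+1})$ to $\sigma$, and let $k$ be the largest $j\in\{1,\dots,\ell_i\}$ such that $b_{i,j}$ is a match of $a$ in some member of $\mathrm{Reach}(\chi,\tau)$ ($k=0$ if there is none). If $o\succ_a b_{i,1}\succ_a\dots\succ_a b_{i,s+1}$, let $\chi^*$ be the configuration obtained from $\chi$ by moving $a$ along the branch to $o$ by $s+1$ exchanges and let $b$ be the best match of $a$ in $\mathrm{Reach}(\chi^*,\tau)$; if moreover $k=0$ or $b\succ_a b_{i,k}$, replace $\chi$ by $\chi^*$ and $\tau$ by $\tau\cup\{(a,b)\}$. In all other cases with $k>0$, replace $\tau$ by $\tau\cup\{(a,b_{i,k})\}$. *Phase 2.* Let $\chi_1$ be the configuration at the end of phase 1. For each branch $i$, in any order, and for $j=|\mathrm{Dests}(\chi_1,\tau,i)|+1,\dots,\ell_i$ in this order, append $a=\chi_1^{-1}(b_{i,j})$ to $\sigma$ and add $(a,b)$ to $\tau$, with $b$ the best match of $a$ in $\mathrm{Reach}(\chi_1,\tau)$. Output $\tau$. **Theorem.** (1) There are a single program for the unit-cost word RAM (words of $O(\log n)$ bits) and a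 function $T(n)=O(n^2\log n)$ such that, for every $n$, every OAF with $n$ agents and $n$ objects whose graph is a generalized star, and every initial perfect matching $\mu_0$, the program, given the preference lists, the adjacency matrix of the graph and $\mu_0$, halts within $T(n)$ steps and outputs a matching in $\mathrm{Reach}(\chi_0)$ that is not Pareto-dominated by any matching in $\mathrm{Reach}(\chi_0)$, together with a dictator sequence; the two are the result of a run of the two-phase algorithm for some choice of the center and numbering of the branches. (2) For every such instance and every choice of the center and numbering of the branches: (a) Throughout phase 1, $(\chi,\tau)$ is nice, the agent $\chi^{-1}(o)$ is matched in $\tau$, $\mathrm{Reach}(\chi,\tau)=\mathrm{Reach}(\chi_0,\tau)$, $\tau=\mathrm{Serial}(\sigma)$, and the agents in $\sigma$ are distinct; and as long as $\tau(\chi^{-1}(o))\neq o$, a further iteration can be performed. (b) When phase 1 has ended with $\tau(\chi_1^{-1}(o))=o$, then for every $\tau'\supseteq\tau$ we have $\mathrm{Reach}(\chi_1,\tau')=\mathrm{Reach}(\chi_0,\tau')$, and the problem splits into independent path problems: a perfect matching $\mu$ lies in $\mathrm{Reach}(\chi_1,\tau')$ if and only if $\mu\supseteq\tau'$ and, for each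 branch, the restriction of $\mu$ to the agents that $\chi_1$ places on that branch is a matching to the objects of that branch that is reachable from the restriction of $\chi_1$ within that branch. (c) The algorithm has a complete run, and in every complete run the final $\sigma$ is a permutation of all agents and the output equals $\mathrm{Serial}(\sigma)$ and is a Pareto-efficient matching for $\chi_0$. -/

import Mathlib

open Filter Asymptotics

/-! ### Object allocation frameworks (agent-moving model) -/

/-- An object allocation framework with agents `A` and objects `B`: `pref a b b'` says that agent
`a` strictly prefers `b` to `b'`, and `graph` is the network of objects. Perfect matchings are
bijections `A ≃ B` (which forces `|A| = |B|`). -/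
structure OAF (A B : Type*) where
  pref : A → B → B → Prop
  strict : ∀ a, IsStrictTotalOrder B (pref a)
  graph : SimpleGraph B

namespace OAF

variable {A B : Type*}

/-- `F.Swap μ μ'`: a Pareto-improving swap between the agents `a`, `a'` holding the endpoints of an
edge of the object network turns the perfect matching `μ` into `μ'`. -/
def Swap (F : OAF A B) (μ μ' : A ≃ B) : Prop :=
  ∃ a a' : A, F.graph.Adj (μ a) (μ a') ∧ F.pref a (μ a') (μ a) ∧ F.pref a' (μ a) (μ a') ∧
    μ' a = μ a' ∧ μ' a' = μ a ∧ ∀ c, c ≠ a → c ≠ a' → μ' c = μ c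

/-- The perfect matchings reachable from `μ` by a finite sequence of swaps. -/
def Reach (F : OAF A B) (μ : A ≃ B) : Set (A ≃ B) :=
  {μ' | Relation.ReflTransGen F.Swap μ μ'}

/-- The reachable perfect matchings that contain every pair of `τ`. -/
def ReachAgain (F : OAF A B) (μ : A ≃ B) (τ : Set (A × B)) : Set (A ≃ B) :=
  {μ' | μ' ∈ F.Reach μ ∧ ∀ p ∈ τ, μ' p.1 = p.2}

/-- `μ'` Pareto-dominates `μ`. -/
def Dominates (F : OAF A B) (μ' μ : A ≃ B) : Prop :=
  (∀ a, μ' a = μ a ∨ F.pref a (μ' a) (μ a)) ∧ ∃ a, F.pref a (μ' a) (μ a)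

/-- `μ` solves the Pareto-efficient matching problem for the configuration `(F, μ₀)`. -/
def IsParetoEfficientReachable (F : OAF A B) (μ₀ μ : A ≃ B) : Prop :=
  μ ∈ F.Reach μ₀ ∧ ∀ μ' ∈ F.Reach μ₀, ¬ F.Dominates μ' μ

/-- `b` is a possible match of `a` in `F.ReachAgain μ τ`. -/
def PossibleMatch (F : OAF A B) (μ : A ≃ B) (τ : Set (A × B)) (a : A) (b : B) : Prop :=
  ∃ μ' ∈ F.ReachAgain μ τ, μ' a = b

/-- `b` is the best match of `a` in `F.ReachAgain μ τ`. -/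
def BestMatch (F : OAF A B) (μ : A ≃ B) (τ : Set (A × B)) (a : A) (b : B) : Prop :=
  F.PossibleMatch μ τ a b ∧ ∀ b', F.PossibleMatch μ τ a b' → b' = b ∨ F.pref a b b'

/-- `F.SerialFrom μ τ σ τ'`: starting with the pairs `τ` already fixed, the dictators in the list
`σ` choose, one after the other, their best match among the matchings reachable from `μ` that
contain all pairs fixed so far; afterwards the set of fixed pairs is `τ'`. -/
inductive SerialFrom (F : OAF A B) (μ : A ≃ B) : Set (A × B) → List A → Set (A × B) → Prop
  | nil (τ : Set (A × B)) : SerialFrom F μ τ [] τ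
  | cons {τ τ' : Set (A × B)} {a : A} {b : B} {σ : List A} (hb : F.BestMatch μ τ a b)
      (h : SerialFrom F μ (insert (a, b) τ) σ τ') : SerialFrom F μ τ (a :: σ) τ'

/-- `τ` is the outcome of serial dictatorship from `μ₀` with dictator sequence `σ`. -/
def IsSerial (F : OAF A B) (μ₀ : A ≃ B) (σ : List A) (τ : Set (A × B)) : Prop :=
  F.SerialFrom μ₀ ∅ σ τ

/-- The framework with only the agents in `S` and the objects in `U`. -/
def restrict (F : OAF A B) (S : Set A) (U : Set B) : OAF S U where
  pref a b b' := F.pref a b b'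
  strict a :=
    haveI := F.strict a
    (Subrel.relEmbedding (F.pref a) (· ∈ U)).isStrictTotalOrder
  graph := F.graph.induce U

end OAF

/-- The set of pairs of a perfect matching. -/
def matchingPairs {A B : Type*} (μ : A ≃ B) : Set (A × B) := {p | μ p.1 = p.2}

/-- A perfect matching restricted to the objects in `U` and the agents holding them. -/
def restrictMatching {A B : Type*} (μ : A ≃ B) (U : Set B) : (μ ⁻¹' U : Set A) ≃ U :=
  μ.subtypeEquiv fun _ => Iff.rfl

/-! ### Generalized stars -/

/-- A generalized star: a tree in which at most one vertex has degree greater than two. -/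
def IsGeneralizedStar {B : Type*} (G : SimpleGraph B) : Prop :=
  G.IsTree ∧ {v : B | 2 < (G.neighborSet v).encard}.Subsingleton

/-- A choice of a center and a numbering of the branches of a generalized star: branch `i` has
`len i > 0` vertices `obj i 1, …, obj i (len i)`, and `obj i j` is at distance `j` from the center
`obj i 0`. Values `obj i j` with `j > len i` are irrelevant. -/
structure StarLabelling {B : Type*} (G : SimpleGraph B) where
  center : B
  m : ℕ
  len : Fin m → ℕ
  obj : Fin m → ℕ → B
  len_pos : ∀ i, 0 < len i
  obj_zero : ∀ i, obj i 0 = center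
  obj_ne : ∀ i j, 1 ≤ j → j ≤ len i → obj i j ≠ center
  obj_inj : ∀ i j i' j', 1 ≤ j → j ≤ len i → 1 ≤ j' → j' ≤ len i' →
    obj i j = obj i' j' → i = i' ∧ j = j'
  cover : ∀ b, b ≠ center → ∃ i j, 1 ≤ j ∧ j ≤ len i ∧ b = obj i j
  adj_iff : ∀ b b', G.Adj b b' ↔ ∃ i j, j < len i ∧
    ((b = obj i j ∧ b' = obj i (j + 1)) ∨ (b' = obj i j ∧ b = obj i (j + 1)))

/-- The objects on branch `i` (without the center). -/
def StarLabelling.branch {B : Type*} {G : SimpleGraph B} (L : StarLabelling G) (i : Fin L.m) :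
    Set B :=
  {b | ∃ j, 1 ≤ j ∧ j ≤ L.len i ∧ b = L.obj i j}

/-! ### The two-phase algorithm -/

namespace OAF

variable {A B : Type*}

/-- `js` is the increasing sequence `j₁ < ⋯ < jₛ` such that `τ` matches the agent at `obj i t` to
`obj i jₜ` for `1 ≤ t ≤ s` and leaves the agents further out on branch `i` unmatched. -/
def IsDests {F : OAF A B} (L : StarLabelling F.graph) (χ : A ≃ B) (τ : Set (A × B))
    (i : Fin L.m) (js : List ℕ) : Prop :=
  js.Pairwise (· < ·) ∧ (∀ j ∈ js, 1 ≤ j ∧ j ≤ L.len i) ∧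
  (∀ (t : ℕ) (h : t < js.length), (χ.symm (L.obj i (t + 1)), L.obj i js[t]) ∈ τ) ∧
  ∀ t, js.length < t → t ≤ L.len i → ∀ b, (χ.symm (L.obj i t), b) ∉ τ

/-- Nice pairs. -/
def IsNice (F : OAF A B) (L : StarLabelling F.graph) (χ : A ≃ B) (τ : Set (A × B)) : Prop :=
  (F.ReachAgain χ τ).Nonempty ∧ ∀ i, ∃ js, IsDests L χ τ i js

/-- `χ'` is obtained from `χ` by moving the agent at `obj i p` along the branch to the center, so
that the agents at `obj i 0, …, obj i (p - 1)` are each shifted outward by one. -/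
def IsMoveToCenter {F : OAF A B} (L : StarLabelling F.graph) (i : Fin L.m) (p : ℕ)
    (χ χ' : A ≃ B) : Prop :=
  χ' (χ.symm (L.obj i p)) = L.center ∧
  (∀ t, t < p → χ' (χ.symm (L.obj i t)) = L.obj i (t + 1)) ∧
  ∀ c, (∀ t, t ≤ p → χ c ≠ L.obj i t) → χ' c = χ c

/-- One iteration of the first phase, from (dictator sequence, configuration, fixed pairs)
`(σ, χ, τ)` to `(σ', χ', τ')`. The agent at the center is to end at `obj i j₀` on branch `i`; the
next dictator `a` is the agent closest to the center on that branch that is not yet matched. With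
`k` the outermost possible match of `a` on branch `i` (`0` if there is none), `a` is either moved
to the center first and then matched to its best match from there, or matched to `obj i k`. -/
def Phase1Step (F : OAF A B) (L : StarLabelling F.graph)
    (σ : List A) (χ : A ≃ B) (τ : Set (A × B))
    (σ' : List A) (χ' : A ≃ B) (τ' : Set (A × B)) : Prop :=
  ∃ (i : Fin L.m) (j₀ : ℕ) (js : List ℕ) (a : A) (k : ℕ),
    1 ≤ j₀ ∧ j₀ ≤ L.len i ∧ (χ.symm L.center, L.obj i j₀) ∈ τ ∧
    IsDests L χ τ i js ∧ js.length < L.len i ∧ χ a = L.obj i (js.length + 1) ∧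
    σ' = σ ++ [a] ∧
    IsGreatest {j | j = 0 ∨ (1 ≤ j ∧ j ≤ L.len i ∧ F.PossibleMatch χ τ a (L.obj i j))} k ∧
    (((∀ j, j ≤ js.length → F.pref a (L.obj i j) (L.obj i (j + 1))) ∧
        IsMoveToCenter L i (js.length + 1) χ χ' ∧
        ∃ b, F.BestMatch χ' τ a b ∧ (k = 0 ∨ F.pref a b (L.obj i k)) ∧ τ' = insert (a, b) τ) ∨
      (0 < k ∧ χ' = χ ∧ τ' = insert (a, L.obj i k) τ ∧
        ((∀ j, j ≤ js.length → F.pref a (L.obj i j) (L.obj i (j + 1))) →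
          ∃ χs b, IsMoveToCenter L i (js.length + 1) χ χs ∧ F.BestMatch χs τ a b ∧
            ¬ F.pref a b (L.obj i k))))

/-- The states that occur in the first phase, started at the configuration `(F, μ₀)`: the first
dictator is the agent at the center, and iterations are performed as long as the agent at the
center is not to stay there. -/
inductive Phase1 (F : OAF A B) (L : StarLabelling F.graph) (μ₀ : A ≃ B) :
    List A → (A ≃ B) → Set (A × B) → Prop
  | init {b : B} (hb : F.BestMatch μ₀ ∅ (μ₀.symm L.center) b) :
      Phase1 F L μ₀ [μ₀.symm L.center] μ₀ {(μ₀.symm L.center, b)}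
  | step {σ : List A} {χ : A ≃ B} {τ : Set (A × B)} {σ' : List A} {χ' : A ≃ B}
      {τ' : Set (A × B)} (h : Phase1 F L μ₀ σ χ τ) (hc : (χ.symm L.center, L.center) ∉ τ)
      (hs : F.Phase1Step L σ χ τ σ' χ' τ') : Phase1 F L μ₀ σ' χ' τ'

/-- The loop invariant of the first phase. The last clause says that no agent is dictator twice. -/
def Phase1Invariant (F : OAF A B) (L : StarLabelling F.graph) (μ₀ : A ≃ B)
    (σ : List A) (χ : A ≃ B) (τ : Set (A × B)) : Prop :=
  F.IsNice L χ τ ∧ (∃ b, (χ.symm L.center, b) ∈ τ) ∧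
  F.ReachAgain χ τ = F.ReachAgain μ₀ τ ∧ F.IsSerial μ₀ σ τ ∧ σ.Nodup

/-- A complete run of the two-phase algorithm with dictator sequence `σ` and output `μ`. After the
first phase the branches are processed in some order, and on each branch the agents not yet
matched become dictators in the order of their distance from the center. -/
def TwoPhaseRun (F : OAF A B) (L : StarLabelling F.graph) (μ₀ : A ≃ B)
    (σ : List A) (μ : A ≃ B) : Prop :=
  ∃ (σ₁ : List A) (χ : A ≃ B) (τ : Set (A × B)) (js : Fin L.m → List ℕ)
    (order : List (Fin L.m)) (σ₂ : List A),
    F.Phase1 L μ₀ σ₁ χ τ ∧ (χ.symm L.center, L.center) ∈ τ ∧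
    (∀ i, IsDests L χ τ i (js i)) ∧ order.Perm (List.finRange L.m) ∧
    σ₂ = order.flatMap (fun i =>
      (List.range' ((js i).length + 1) (L.len i - (js i).length)).map
        fun j => χ.symm (L.obj i j)) ∧
    F.SerialFrom χ τ σ₂ (matchingPairs μ) ∧ σ = σ₁ ++ σ₂

/-- Reachability from `χ` under the constraints `τ` splits into independent reachability problems
on the branches (which are paths): a perfect matching belongs to `F.ReachAgain χ τ` iff it contains
`τ` and, on each branch, is reachable within that branch. -/
def SplitsIntoBranches (F : OAF A B) (L : StarLabelling F.graph) (χ : A ≃ B)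
    (τ : Set (A × B)) : Prop :=
  ∀ μ : A ≃ B, μ ∈ F.ReachAgain χ τ ↔
    (∀ p ∈ τ, μ p.1 = p.2) ∧
    ∀ i, ∃ ν ∈ (F.restrict (χ ⁻¹' L.branch i) (L.branch i)).Reach
        (restrictMatching χ (L.branch i)),
      ∀ a : (χ ⁻¹' L.branch i : Set A), μ a = ν a

end OAF

/-! ### A word RAM with unit-cost instructions

Programs are structured programs over finitely many word variables and finitely many arrays of
words (a program mentions only finitely many names). Every instruction and every test of a
condition is a constant number of machine instructions and costs one step. -/

namespace WordRAM

inductive Op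
  | add
  | sub
  | mul
  | div

def Op.eval : Op → ℕ → ℕ → ℕ
  | .add, x, y => x + y
  | .sub, x, y => x - y
  | .mul, x, y => x * y
  | .div, x, y => x / y

inductive Cmd
  /-- no operation -/
  | skip
  /-- `x := c` -/
  | const (x c : ℕ)
  /-- `x := y op z` -/
  | arith (o : Op) (x y z : ℕ)
  /-- `x := r[y]` -/
  | load (x r y : ℕ)
  /-- `r[y] := x` -/
  | store (r y x : ℕ)
  /-- first `c`, then `d` -/
  | seq (c d : Cmd)
  /-- if `x < y` then `c` else `d` -/
  | ite (x y : ℕ) (c d : Cmd)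
  /-- while `x < y` do `c` -/
  | loop (x y : ℕ) (c : Cmd)

structure Mem where
  var : ℕ → ℕ
  arr : ℕ → ℕ → ℕ

def Mem.setVar (s : Mem) (x v : ℕ) : Mem :=
  { s with var := Function.update s.var x v }

def Mem.setArr (s : Mem) (r p v : ℕ) : Mem :=
  { s with arr := Function.update s.arr r (Function.update (s.arr r) p v) }

/-- `Exec W c s s' t`: on a machine whose words hold the numbers `0, …, W`, the program `c`, started
with memory `s`, halts after exactly `t` steps with memory `s'`. A computed value exceeding `W`
blocks the execution. -/
inductive Exec (W : ℕ) : Cmd → Mem → Mem → ℕ → Prop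
  | skip (s : Mem) : Exec W .skip s s 1
  | const (s : Mem) (x c : ℕ) (h : c ≤ W) : Exec W (.const x c) s (s.setVar x c) 1
  | arith (s : Mem) (o : Op) (x y z : ℕ) (h : o.eval (s.var y) (s.var z) ≤ W) :
      Exec W (.arith o x y z) s (s.setVar x (o.eval (s.var y) (s.var z))) 1
  | load (s : Mem) (x r y : ℕ) : Exec W (.load x r y) s (s.setVar x (s.arr r (s.var y))) 1
  | store (s : Mem) (r y x : ℕ) : Exec W (.store r y x) s (s.setArr r (s.var y) (s.var x)) 1
  | seq {c d : Cmd} {s s' s'' : Mem} {t t' : ℕ} (h : Exec W c s s' t) (h' : Exec W d s' s'' t') :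
      Exec W (.seq c d) s s'' (t + t')
  | ite_true {x y : ℕ} {c d : Cmd} {s s' : Mem} {t : ℕ} (hxy : s.var x < s.var y)
      (h : Exec W c s s' t) : Exec W (.ite x y c d) s s' (t + 1)
  | ite_false {x y : ℕ} {c d : Cmd} {s s' : Mem} {t : ℕ} (hxy : ¬ s.var x < s.var y)
      (h : Exec W d s s' t) : Exec W (.ite x y c d) s s' (t + 1)
  | loop_true {x y : ℕ} {c : Cmd} {s s' s'' : Mem} {t t' : ℕ} (hxy : s.var x < s.var y)
      (h : Exec W c s s' t) (h' : Exec W (.loop x y c) s' s'' t') :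
      Exec W (.loop x y c) s s'' (t + t' + 1)
  | loop_false {x y : ℕ} {c : Cmd} {s : Mem} (hxy : ¬ s.var x < s.var y) :
      Exec W (.loop x y c) s s 1

/-- The input memory for a configuration with agents and objects `0, …, n - 1`: variable `0` holds
`n`; array `0` holds, row by row, the preference lists (row `a` lists the objects from best to
worst for agent `a`); array `1` holds the adjacency matrix of the object network; array `2` holds
the initial matching. Everything else is zero. -/
structure IsInput {n : ℕ} (F : OAF (Fin n) (Fin n)) (μ₀ : Fin n ≃ Fin n) (s : Mem) : Prop where
  size : s.var 0 = n
  prefs : ∀ a b : Fin n, s.arr 0 (a * n + {b' | F.pref a b' b}.ncard) = b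
  adj : ∀ b b' : Fin n, F.graph.Adj b b' → s.arr 1 (b * n + b') = 1
  not_adj : ∀ b b' : Fin n, ¬ F.graph.Adj b b' → s.arr 1 (b * n + b') = 0
  matching : ∀ a : Fin n, s.arr 2 a = μ₀ a
  var_zero : ∀ x, x ≠ 0 → s.var x = 0
  arr_zero : ∀ r p, (r < 2 ∧ n * n ≤ p) ∨ (r = 2 ∧ n ≤ p) ∨ 2 < r → s.arr r p = 0

/-- The output convention: array `3` holds a perfect matching, array `4` a sequence of agents. -/
def IsOutput {n : ℕ} (μ : Fin n ≃ Fin n) (σ : List (Fin n)) (s : Mem) : Prop :=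
  (∀ a : Fin n, s.arr 3 a = μ a) ∧ ∀ (k : ℕ) (h : k < σ.length), s.arr 4 k = σ[k]

end WordRAM

/-!
On a branch `i`, write `pos i b` for the distance of the object `b` from the center, which is `0` off
the branch. A swap moves two adjacent agents past each other, and both gain. Hence an agent that has
to go outward along a branch never goes inward, and conversely, and agents with the same direction
never overtake each other. Suppose that destinations are prescribed for the first `s` agents on a
branch (and possibly for the agent at the center, which may enter it), in increasing order. Then the
other agents of the branch are forced: the greedy procedure `Greedy` considers them one after the
other and lets each walk inward to the innermost free position if it likes to, and otherwise pushes
it outward to the position just beyond the agents placed so far. It succeeds if and only if the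
prescribed destinations can be reached (`branchGreedy_of_reach`, `exists_reach_of_greedy`, and
`State.nonempty_iff` for all branches together). Success is preserved when destinations move inward
(`Greedy.mono`).

*The two phases.* `Phase1State` is the invariant of the first phase. The agent next in line on the
branch that the agent at the center is going to enter either ends beyond all destinations fixed so
far (`Phase1State.push`) or goes to the center and is free to enter any branch (`Phase1State.move`).
In both cases the algorithm gives it its best match. In the second case the configuration changes,
but not the set of reachable matchings that respect the choices made so far, because every such
matching requires this move (`State.reachAgain_move`). So the algorithm is serial dictatorship, and
its output is Pareto-efficient (`IsSerial.paretoEfficient`): in a dominating matching, the first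
dictator with another object would have had a better match. Once the agent at the center is to stay
there, the branches do not interact any more (`splitsIntoBranches`).

*The running time.* How far each agent is willing to walk inward and outward from its initial position
is tabulated in advance, so that the greedy procedure on a branch of length `ℓ` takes `O(ℓ)` steps.
By monotonicity, the best match of a dictator on a branch is found by binary search in `O(ℓ log n)`
steps. In the second phase, a dictator can only end at the innermost free object or beyond all
destinations fixed so far (`State.possible_cases`), so the search applies there as well. The branches
have at most `n` vertices altogether, which makes `O(n log n)` steps for each of the `n` dictators.
The program is written in a small structured language that is compiled to RAM code; the predicate `Wp`
bounds its running time and describes its result (`Wp.seq`, `Wp.ite`, `Wp.loop`).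
-/

/-! ### Coordinates along a branch -/

namespace StarLabelling

variable {B : Type*} {G : SimpleGraph B} (L : StarLabelling G)

open Classical in
/-- The coordinate along branch `i`: the vertex `obj i j` with `1 ≤ j ≤ len i` has coordinate `j`,
and all vertices outside the branch, including the center, have coordinate `0`. -/
noncomputable def pos (i : Fin L.m) (b : B) : ℕ :=
  if h : ∃ j, 1 ≤ j ∧ j ≤ L.len i ∧ b = L.obj i j then h.choose else 0

theorem pos_obj (i : Fin L.m) {j : ℕ} (hj : j ≤ L.len i) : L.pos i (L.obj i j) = j := by
  unfold pos
  split_ifs with h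
  · obtain ⟨h1, h2, h3⟩ := h.choose_spec
    rcases Nat.eq_zero_or_pos j with rfl | hj0
    · exact absurd (h3.symm.trans (L.obj_zero i)) (L.obj_ne i _ h1 h2)
    · exact (L.obj_inj i j i _ hj0 hj h1 h2 h3).2.symm
  · by_contra hne
    exact h ⟨j, by omega, hj, rfl⟩

theorem pos_le (i : Fin L.m) (b : B) : L.pos i b ≤ L.len i := by
  unfold pos
  split_ifs with h
  · exact h.choose_spec.2.1
  · exact Nat.zero_le _

theorem obj_pos {i : Fin L.m} {b : B} (h : L.pos i b ≠ 0) : L.obj i (L.pos i b) = b := by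
  unfold pos at h ⊢
  split_ifs at h ⊢ with h'
  · exact h'.choose_spec.2.2.symm
  · exact absurd rfl h

theorem eq_obj_of_pos {i : Fin L.m} {b : B} {j : ℕ} (h : L.pos i b = j) (hj : 1 ≤ j) :
    b = L.obj i j := by
  rw [← h, L.obj_pos (by omega)]

theorem pos_center (i : Fin L.m) : L.pos i L.center = 0 := by
  rw [← L.obj_zero i]; exact L.pos_obj i (Nat.zero_le _)

theorem pos_obj_of_ne {i i' : Fin L.m} (hi : i ≠ i') {j : ℕ} (hj : j ≤ L.len i') :
    L.pos i (L.obj i' j) = 0 := by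
  rcases Nat.eq_zero_or_pos j with rfl | hj0
  · rw [L.obj_zero, pos_center]
  · by_contra h
    exact hi (L.obj_inj i _ i' j (by omega) (L.pos_le i _) hj0 hj (L.obj_pos h)).1

theorem obj_injOn (i : Fin L.m) {j j' : ℕ} (hj : j ≤ L.len i) (hj' : j' ≤ L.len i)
    (h : L.obj i j = L.obj i j') : j = j' := by
  rw [← L.pos_obj i hj, h, L.pos_obj i hj']

theorem eq_of_pos_eq {i : Fin L.m} {b b' : B} (h : L.pos i b = L.pos i b')
    (h0 : L.pos i b ≠ 0) : b = b' := by
  rw [← L.obj_pos h0, h, L.obj_pos (h ▸ h0)]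

theorem exists_pos_ne_zero {b : B} (hb : b ≠ L.center) : ∃ i, L.pos i b ≠ 0 := by
  obtain ⟨i, j, h1, h2, rfl⟩ := L.cover b hb
  exact ⟨i, by rw [L.pos_obj i h2]; omega⟩

theorem pos_eq_zero_of_ne {i i' : Fin L.m} (hi : i' ≠ i) {b : B} (h : L.pos i b ≠ 0) :
    L.pos i' b = 0 := by
  rw [← L.obj_pos h]; exact L.pos_obj_of_ne hi (L.pos_le i b)

theorem adj_pos (i : Fin L.m) {x y : B} (h : G.Adj x y) :
    (L.pos i x = 0 ∧ L.pos i y = 0) ∨ ∃ j < L.len i,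
      (x = L.obj i j ∧ y = L.obj i (j + 1)) ∨ (y = L.obj i j ∧ x = L.obj i (j + 1)) := by
  obtain ⟨i', j, hj, hxy⟩ := (L.adj_iff x y).1 h
  by_cases hi : i = i'
  · subst hi; exact Or.inr ⟨j, hj, hxy⟩
  · left
    rcases hxy with ⟨rfl, rfl⟩ | ⟨rfl, rfl⟩ <;>
    exact ⟨L.pos_obj_of_ne hi (by omega), L.pos_obj_of_ne hi (by omega)⟩

theorem adj_obj (i : Fin L.m) {j : ℕ} (hj : j < L.len i) :
    G.Adj (L.obj i j) (L.obj i (j + 1)) :=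
  (L.adj_iff _ _).2 ⟨i, j, hj, Or.inl ⟨rfl, rfl⟩⟩

end StarLabelling

/-! ### Swaps seen from a branch -/

namespace OAF

variable {A B : Type*} {F : OAF A B}

theorem pref_irrefl (F : OAF A B) (a : A) (b : B) : ¬ F.pref a b b :=
  haveI := F.strict a; irrefl b

theorem pref_trans (F : OAF A B) {a : A} {b c d : B} (h : F.pref a b c) (h' : F.pref a c d) :
    F.pref a b d :=
  haveI := F.strict a; _root_.trans h h'

theorem pref_asymm (F : OAF A B) {a : A} {b c : B} (h : F.pref a b c) : ¬ F.pref a c b :=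
  fun h' => F.pref_irrefl a b (F.pref_trans h h')

theorem pref_trichotomy (F : OAF A B) (a : A) (b c : B) : F.pref a b c ∨ b = c ∨ F.pref a c b :=
  haveI := F.strict a; trichotomous b c

theorem mem_reach_refl (F : OAF A B) (χ : A ≃ B) : χ ∈ F.Reach χ := Relation.ReflTransGen.refl

theorem reach_trans {χ χ' μ : A ≃ B} (h : χ' ∈ F.Reach χ) (h' : μ ∈ F.Reach χ') : μ ∈ F.Reach χ :=
  Relation.ReflTransGen.trans h h'

theorem reach_improves {χ μ : A ≃ B} (h : μ ∈ F.Reach χ) (a : A) :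
    μ a = χ a ∨ F.pref a (μ a) (χ a) := by
  induction h with
  | refl => exact Or.inl rfl
  | @tail μ' μ _ hs ih =>
    obtain ⟨c, c', -, h1, h2, e1, e2, e3⟩ := hs
    have key : μ a = μ' a ∨ F.pref a (μ a) (μ' a) := by
      by_cases hc : a = c
      · subst hc; rw [e1]; exact Or.inr h1
      by_cases hc' : a = c'
      · subst hc'; rw [e2]; exact Or.inr h2
      exact Or.inl (e3 a hc hc')
    rcases key with k | k
    · rw [k]; exact ih
    · rcases ih with i | i
      · rw [i] at k; exact Or.inr k
      · exact Or.inr (F.pref_trans k i)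

section Star

variable (L : StarLabelling F.graph)

/-- Seen from branch `i`, a swap either is invisible or exchanges the agents at two consecutive
vertices of the branch. -/
theorem swap_pos {χ χ' : A ≃ B} (h : F.Swap χ χ') (i : Fin L.m) :
    (∀ c, L.pos i (χ' c) = L.pos i (χ c)) ∨
    ∃ a a' j, j < L.len i ∧ χ a = L.obj i j ∧ χ a' = L.obj i (j + 1) ∧
      χ' a = L.obj i (j + 1) ∧ χ' a' = L.obj i j ∧
      F.pref a (L.obj i (j + 1)) (L.obj i j) ∧ F.pref a' (L.obj i j) (L.obj i (j + 1)) ∧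
      ∀ c, c ≠ a → c ≠ a' → χ' c = χ c := by
  obtain ⟨a, a', hadj, h1, h2, e1, e2, e3⟩ := h
  rcases L.adj_pos i hadj with ⟨p1, p2⟩ | ⟨j, hj, ⟨x, y⟩ | ⟨x, y⟩⟩
  · left
    intro c
    by_cases hc : c = a
    · subst hc; rw [e1, p1, p2]
    by_cases hc' : c = a'
    · subst hc'; rw [e2, p1, p2]
    rw [e3 c hc hc']
  · right
    refine ⟨a, a', j, hj, x, y, by rw [e1, y], by rw [e2, x], ?_, ?_, e3⟩
    · rw [← x, ← y]; exact h1
    · rw [← x, ← y]; exact h2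
  · right
    refine ⟨a', a, j, hj, x, y, by rw [e2, y], by rw [e1, x], ?_, ?_, fun c hc hc' => e3 c hc' hc⟩
    · rw [← x, ← y]; exact h2
    · rw [← x, ← y]; exact h1

/-- The effect of a swap on the coordinate of one agent. -/
theorem swap_pos_agent {χ χ' : A ≃ B} (h : F.Swap χ χ') (i : Fin L.m) (c : A) :
    L.pos i (χ' c) = L.pos i (χ c) ∨
    (∃ j, j < L.len i ∧ L.pos i (χ c) = j ∧ L.pos i (χ' c) = j + 1 ∧ χ c = L.obj i j ∧
      F.pref c (L.obj i (j + 1)) (L.obj i j)) ∨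
    (∃ j, j < L.len i ∧ L.pos i (χ c) = j + 1 ∧ L.pos i (χ' c) = j ∧
      F.pref c (L.obj i j) (L.obj i (j + 1))) := by
  rcases F.swap_pos L h i with h0 | ⟨a, a', j, hj, x, y, x', y', p, p', e⟩
  · exact Or.inl (h0 c)
  · by_cases hc : c = a
    · subst hc
      exact Or.inr (Or.inl ⟨j, hj, by rw [x, L.pos_obj i hj.le], by rw [x', L.pos_obj i hj], x, p⟩)
    by_cases hc' : c = a'
    · subst hc'
      exact Or.inr (Or.inr ⟨j, hj, by rw [y, L.pos_obj i hj], by rw [y', L.pos_obj i hj.le], p'⟩)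
    exact Or.inl (by rw [e c hc hc'])

/-- An agent that ends further out on branch `i` than it starts has crossed every edge in between, and
each time it got an object that it prefers. -/
theorem chain_out {χ μ : A ≃ B} (h : μ ∈ F.Reach χ) {i : Fin L.m} {a : A} {j : ℕ}
    (h1 : L.pos i (χ a) ≤ j) (h2 : j < L.pos i (μ a)) :
    F.pref a (L.obj i (j + 1)) (L.obj i j) := by
  induction h using Relation.ReflTransGen.head_induction_on with
  | refl => omega
  | @head χ χ' hs hr ih =>
    by_cases hle : L.pos i (χ' a) ≤ j
    · exact ih hle
    · rcases F.swap_pos_agent L hs i a with h | ⟨j', _, h3, h4, _, hp⟩ | ⟨j', _, h3, h4, hp⟩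
      · omega
      · obtain rfl : j' = j := by omega
        exact hp
      · omega

/-- The same for an agent that ends further inward. -/
theorem chain_in {χ μ : A ≃ B} (h : μ ∈ F.Reach χ) {i : Fin L.m} {a : A} {j : ℕ}
    (h1 : L.pos i (μ a) ≤ j) (h2 : j < L.pos i (χ a)) :
    F.pref a (L.obj i j) (L.obj i (j + 1)) := by
  induction h using Relation.ReflTransGen.head_induction_on with
  | refl => omega
  | @head χ χ' hs hr ih =>
    by_cases hle : j < L.pos i (χ' a)
    · exact ih hle
    · rcases F.swap_pos_agent L hs i a with h | ⟨j', _, h3, h4, _, hp⟩ | ⟨j', _, h3, h4, hp⟩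
      · omega
      · omega
      · obtain rfl : j' = j := by omega
        exact hp

/-- An agent that has to go outward never goes inward: it would lose an object and could not get it
back. -/
theorem mono_out {χ χ' μ : A ≃ B} (hs : F.Swap χ χ') (h : μ ∈ F.Reach χ') {i : Fin L.m} {c : A}
    (hc : L.pos i (χ c) ≤ L.pos i (μ c)) :
    L.pos i (χ c) ≤ L.pos i (χ' c) ∧ L.pos i (χ' c) ≤ L.pos i (μ c) ∧
      L.pos i (χ' c) ≤ L.pos i (χ c) + 1 := by
  rcases F.swap_pos_agent L hs i c with h' | ⟨j, _, h3, h4, _, hp⟩ | ⟨j, _, h3, h4, hp⟩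
  · omega
  · refine ⟨by omega, ?_, by omega⟩
    by_contra hlt
    exact F.pref_asymm hp (F.chain_in L h (j := j) (by omega) (by omega))
  · exact absurd (F.chain_out L h (i := i) (a := c) (j := j) (by omega) (by omega))
      (F.pref_asymm hp)

/-- An agent that has to go inward never goes outward. -/
theorem mono_in {χ χ' μ : A ≃ B} (hs : F.Swap χ χ') (h : μ ∈ F.Reach χ') {i : Fin L.m} {c : A}
    (hc : L.pos i (μ c) ≤ L.pos i (χ c)) :
    L.pos i (μ c) ≤ L.pos i (χ' c) ∧ L.pos i (χ' c) ≤ L.pos i (χ c) := by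
  rcases F.swap_pos_agent L hs i c with h' | ⟨j, _, h3, h4, _, hp⟩ | ⟨j, _, h3, h4, hp⟩
  · omega
  · exact absurd (F.chain_in L h (i := i) (a := c) (j := j) (by omega) (by omega))
      (F.pref_asymm hp)
  · refine ⟨?_, by omega⟩
    by_contra hlt
    exact F.pref_asymm hp (F.chain_out L h (j := j) (by omega) (by omega))

/-- Agents that move outward (weakly) on a branch never overtake each other. -/
theorem order_out {χ μ : A ≃ B} (h : μ ∈ F.Reach χ) {i : Fin L.m} {c c' : A}
    (h1 : L.pos i (χ c) < L.pos i (χ c')) (h2 : L.pos i (χ c) ≤ L.pos i (μ c))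
    (h3 : L.pos i (χ c') ≤ L.pos i (μ c')) : L.pos i (μ c) < L.pos i (μ c') := by
  have hne : c ≠ c' := by rintro rfl; omega
  induction h using Relation.ReflTransGen.head_induction_on with
  | refl => exact h1
  | @head χ χ' hs hr ih =>
    have m := F.mono_out L hs hr h2
    have m' := F.mono_out L hs hr h3
    refine ih ?_ m.2.1 m'.2.1
    by_contra hle
    have heq : L.pos i (χ' c) = L.pos i (χ' c') := by omega
    exact hne (χ'.injective (L.eq_of_pos_eq heq (by omega)))

/-- An agent further out than an agent that moves inward (weakly) within the branch stays further
out. -/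
theorem order_in {χ μ : A ≃ B} (h : μ ∈ F.Reach χ) {i : Fin L.m} {a d : A}
    (h0 : 1 ≤ L.pos i (μ a)) (h1 : L.pos i (μ a) ≤ L.pos i (χ a))
    (h2 : L.pos i (χ a) < L.pos i (χ d)) : L.pos i (μ a) < L.pos i (μ d) := by
  have hne : a ≠ d := by rintro rfl; omega
  induction h using Relation.ReflTransGen.head_induction_on with
  | refl => exact h2
  | @head χ χ' hs hr ih =>
    have m := F.mono_in L hs hr h1
    refine ih m.1 ?_
    have hd : L.pos i (χ d) ≤ L.pos i (χ' d) + 1 := by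
      rcases F.swap_pos_agent L hs i d with h' | ⟨j, _, h3, h4, _, hp⟩ | ⟨j, _, h3, h4, hp⟩ <;> omega
    by_contra hle
    have heq : L.pos i (χ' a) = L.pos i (χ' d) := by omega
    exact hne (χ'.injective (L.eq_of_pos_eq heq (by omega)))

/-- An agent that has left the center for another branch never enters branch `i`. -/
theorem pos_eq_zero_of_left_center {χ μ : A ≃ B} (h : μ ∈ F.Reach χ) {i : Fin L.m} {a : A}
    (h0 : L.pos i (χ a) = 0) (h1 : F.pref a (χ a) L.center) : L.pos i (μ a) = 0 := by
  induction h using Relation.ReflTransGen.head_induction_on with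
  | refl => exact h0
  | @head χ χ' hs hr ih =>
    have himp := F.reach_improves (Relation.ReflTransGen.single hs) a
    rcases F.swap_pos_agent L hs i a with h' | ⟨j, _, h3, h4, he, hp⟩ | ⟨j, _, h3, h4, hp⟩
    · refine ih (by omega) ?_
      rcases himp with e | e
      · rw [e]; exact h1
      · exact F.pref_trans e h1
    · obtain rfl : j = 0 := by omega
      rw [he, L.obj_zero] at h1
      exact absurd h1 (F.pref_irrefl _ _)
    · omega

theorem swap_trans_swap [DecidableEq B] {χ : A ≃ B} {a a' : A} {u v : B} (ha : χ a = u)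
    (ha' : χ a' = v) (hadj : F.graph.Adj u v) (h1 : F.pref a v u) (h2 : F.pref a' u v) :
    F.Swap χ (χ.trans (Equiv.swap u v)) := by
  refine ⟨a, a', by rwa [ha, ha'], by rwa [ha, ha'], by rwa [ha, ha'], ?_, ?_, ?_⟩
  · simp [ha, ha']
  · simp [ha, ha']
  · intro c hc hc'
    have e1 : χ c ≠ u := fun e => hc (χ.injective (e.trans ha.symm))
    have e2 : χ c ≠ v := fun e => hc' (χ.injective (e.trans ha'.symm))
    simp [Equiv.swap_apply_of_ne_of_ne e1 e2]

/-- If two neighbours on a branch have to pass each other on the way to `μ`, then they may just as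
well swap at once. -/
theorem swap_first [DecidableEq B] {χ μ : A ≃ B} (h : μ ∈ F.Reach χ) {i : Fin L.m} {a a' : A}
    {t : ℕ} (ht : t < L.len i) (ha' : χ a' = L.obj i t) (ha : χ a = L.obj i (t + 1))
    (h1 : L.pos i (μ a) ≤ t) (h2 : t + 1 ≤ L.pos i (μ a')) :
    F.Swap χ (χ.trans (Equiv.swap (L.obj i t) (L.obj i (t + 1)))) ∧
      μ ∈ F.Reach (χ.trans (Equiv.swap (L.obj i t) (L.obj i (t + 1)))) := by
  have pa : L.pos i (χ a) = t + 1 := by rw [ha, L.pos_obj i ht]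
  have pa' : L.pos i (χ a') = t := by rw [ha', L.pos_obj i ht.le]
  refine ⟨swap_trans_swap ha' ha (L.adj_obj i ht) (F.chain_out L h (by omega) (by omega))
    (F.chain_in L h h1 (by omega)), ?_⟩
  have hne : a ≠ a' := by rintro rfl; omega
  induction h using Relation.ReflTransGen.head_induction_on with
  | refl => omega
  | @head χ χ₁ hs hr ih =>
    have m := F.mono_in L hs hr (i := i) (c := a) (by omega)
    have m' := F.mono_out L hs hr (i := i) (c := a') (by omega)
    -- if the first swap does not involve `a` and `a'`, it commutes with theirs; otherwise it is theirs,
    -- since neither of them may go in the wrong direction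
    by_cases hfix : χ₁ a = χ a ∧ χ₁ a' = χ a'
    · obtain ⟨f, f'⟩ := hfix
      have ihh := ih (by rw [f', ha']) (by rw [f, ha]) (by rw [f, pa]) (by rw [f', pa'])
      refine reach_trans (Relation.ReflTransGen.single ?_) ihh
      obtain ⟨c, c', hadj, p, p', e1, e2, e3⟩ := hs
      have ne : ∀ x y : A, (χ x ≠ χ y) → χ₁ x = χ y → χ₁ x ≠ χ x := fun x y hxy e e' =>
        hxy (e'.symm.trans e)
      have hca : c ≠ a := fun e => by subst e; exact ne _ _ hadj.ne e1 f
      have hca' : c ≠ a' := fun e => by subst e; exact ne _ _ hadj.ne e1 f'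
      have hc'a : c' ≠ a := fun e => by subst e; exact ne _ _ hadj.ne.symm e2 f
      have hc'a' : c' ≠ a' := fun e => by subst e; exact ne _ _ hadj.ne.symm e2 f'
      have sw : ∀ x, x ≠ a → x ≠ a' → ∀ (ξ : A ≃ B), ξ a = L.obj i (t + 1) → ξ a' = L.obj i t →
          (ξ.trans (Equiv.swap (L.obj i t) (L.obj i (t + 1)))) x = ξ x := by
        intro x hx hx' ξ g g'
        refine Equiv.swap_apply_of_ne_of_ne ?_ ?_
        · rw [← g']; exact fun e => hx' (ξ.injective e)
        · rw [← g]; exact fun e => hx (ξ.injective e)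
      refine ⟨c, c', ?_, ?_, ?_, ?_, ?_, ?_⟩
      · rw [sw c hca hca' χ ha ha', sw c' hc'a hc'a' χ ha ha']; exact hadj
      · rw [sw c hca hca' χ ha ha', sw c' hc'a hc'a' χ ha ha']; exact p
      · rw [sw c hca hca' χ ha ha', sw c' hc'a hc'a' χ ha ha']; exact p'
      · rw [sw c hca hca' χ₁ (f.trans ha) (f'.trans ha'), sw c' hc'a hc'a' χ ha ha', e1]
      · rw [sw c' hc'a hc'a' χ₁ (f.trans ha) (f'.trans ha'), sw c hca hca' χ ha ha', e2]
      · intro x hx hx'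
        simp only [Equiv.trans_apply, e3 x hx hx']
    · rcases F.swap_pos L hs i with h0 | ⟨c, c', j, hj, x, y, x', y', p, p', e⟩
      · exfalso
        have q := h0 a
        have q' := h0 a'
        apply hfix
        refine ⟨(L.eq_of_pos_eq q (by omega)), ?_⟩
        -- if `a'` left the center for another branch, it could not come back to branch `i`
        by_cases ht0 : t = 0
        · subst ht0
          by_contra hneq
          have hp : F.pref a' (χ₁ a') L.center := by
            rcases F.reach_improves (Relation.ReflTransGen.single hs) a' with e | e
            · exact absurd e hneq
            · rwa [ha', L.obj_zero] at e
          have := F.pos_eq_zero_of_left_center L hr (q'.trans pa') hp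
          omega
        · exact L.eq_of_pos_eq q' (by omega)
      · by_cases hjt : j = t
        · subst hjt
          have hc : c = a' := χ.injective (x.trans ha'.symm)
          have hc' : c' = a := χ.injective (y.trans ha.symm)
          subst hc hc'
          have : χ.trans (Equiv.swap (L.obj i j) (L.obj i (j + 1))) = χ₁ := by
            ext z
            by_cases hz : z = c
            · subst hz; simp [ha', x']
            by_cases hz' : z = c'
            · subst hz'; simp [ha, y']
            rw [e z hz hz']
            refine Equiv.swap_apply_of_ne_of_ne ?_ ?_
            · rw [← ha']; exact fun e => hz (χ.injective e)
            · rw [← ha]; exact fun e => hz' (χ.injective e)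
          rw [this]; exact hr
        · exfalso
          have hca' : a' ≠ c := by
            rintro rfl
            rw [x, L.pos_obj i hj.le] at pa'; exact hjt pa'
          have hc'a : a ≠ c' := by
            rintro rfl
            rw [y, L.pos_obj i hj] at pa; omega
          have hca : a ≠ c := by
            rintro rfl
            have k := m.2
            rw [x', x, L.pos_obj i hj.le, L.pos_obj i hj] at k; omega
          have hc'a' : a' ≠ c' := by
            rintro rfl
            have k := m'.1
            rw [y', y, L.pos_obj i hj.le, L.pos_obj i hj] at k; omega
          exact hfix ⟨e a hca hc'a, e a' hca' hc'a'⟩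

/-! ### Moving an agent inward along a branch -/

/-- `χ'` is obtained from `χ` by moving the agent at `obj i p` inward to `obj i r`; the agents at
`obj i r, …, obj i (p - 1)` are each shifted outward by one. -/
structure IsMove (i : Fin L.m) (p r : ℕ) (χ χ' : A ≃ B) : Prop where
  mover : χ' (χ.symm (L.obj i p)) = L.obj i r
  shifted : ∀ t, r ≤ t → t < p → χ' (χ.symm (L.obj i t)) = L.obj i (t + 1)
  fixed : ∀ c, (∀ t, r ≤ t → t ≤ p → χ c ≠ L.obj i t) → χ' c = χ c

variable {L}

theorem isMoveToCenter_iff {i : Fin L.m} {p : ℕ} {χ χ' : A ≃ B} :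
    IsMoveToCenter L i p χ χ' ↔ IsMove L i p 0 χ χ' := by
  constructor
  · rintro ⟨h1, h2, h3⟩
    exact ⟨by rw [h1, L.obj_zero], fun t _ ht => h2 t ht, fun c hc => h3 c fun t ht =>
      hc t (Nat.zero_le _) ht⟩
  · rintro ⟨h1, h2, h3⟩
    exact ⟨by rw [h1, L.obj_zero], fun t ht => h2 t (Nat.zero_le _) ht, fun c hc => h3 c fun t _ ht =>
      hc t ht⟩

theorem IsMove.unique {i : Fin L.m} {p r : ℕ} {χ χ' χ'' : A ≃ B}
    (h : IsMove L i p r χ χ') (h' : IsMove L i p r χ χ'') : χ' = χ'' := by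
  ext c
  by_cases hc : ∀ t, r ≤ t → t ≤ p → χ c ≠ L.obj i t
  · rw [h.fixed c hc, h'.fixed c hc]
  · push Not at hc
    obtain ⟨t, h1, h2, h3⟩ := hc
    have e : c = χ.symm (L.obj i t) := by rw [← h3]; simp
    rcases h2.lt_or_eq with h2 | rfl
    · rw [e, h.shifted t h1 h2, h'.shifted t h1 h2]
    · rw [e, h.mover, h'.mover]

variable (L) in
/-- The move exists; it is a sequence of swaps if all agents concerned like it; and it may be
performed at once on the way to any matching in which all agents concerned pass each other. -/
theorem exists_isMove (i : Fin L.m) {p r : ℕ} (hp : p ≤ L.len i) (hr : r ≤ p) (χ : A ≃ B) :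
    ∃ χ', IsMove L i p r χ χ' ∧
      ((∀ t, r ≤ t → t < p → F.pref (χ.symm (L.obj i p)) (L.obj i t) (L.obj i (t + 1)) ∧
        F.pref (χ.symm (L.obj i t)) (L.obj i (t + 1)) (L.obj i t)) → χ' ∈ F.Reach χ) ∧
      ∀ μ ∈ F.Reach χ, L.pos i (μ (χ.symm (L.obj i p))) ≤ r →
        (∀ t, r ≤ t → t < p → t + 1 ≤ L.pos i (μ (χ.symm (L.obj i t)))) → μ ∈ F.Reach χ' := by
  classical
  induction p generalizing χ with
  | zero =>
    obtain rfl : r = 0 := by omega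
    exact ⟨χ, ⟨by simp, fun t _ h => by omega, fun _ _ => rfl⟩, fun _ => F.mem_reach_refl χ,
      fun μ h _ _ => h⟩
  | succ p ih =>
    rcases hr.lt_or_eq with hr' | rfl
    swap
    · exact ⟨χ, ⟨by simp, fun t h h' => by omega, fun _ _ => rfl⟩, fun _ => F.mem_reach_refl χ,
        fun μ h _ _ => h⟩
    -- `a` first changes places with the agent at `obj i p`, and then moves on from there
    set u := L.obj i p with hu
    set v := L.obj i (p + 1) with hv
    have huv : u ≠ v := fun e => by have := L.obj_injOn i (by omega) hp e; omega
    obtain ⟨χ', hm, hreach, hfirst⟩ := ih (by omega) (by omega) (χ.trans (Equiv.swap u v))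
    have s1 : (χ.trans (Equiv.swap u v)).symm (L.obj i p) = χ.symm v := by
      simp [← hu]
    have s2 : ∀ t, t < p → (χ.trans (Equiv.swap u v)).symm (L.obj i t) = χ.symm (L.obj i t) := by
      intro t ht
      rw [Equiv.symm_trans_apply, Equiv.symm_swap, Equiv.swap_apply_of_ne_of_ne]
      · intro e; have := L.obj_injOn i (by omega) (by omega) e; omega
      · intro e; have := L.obj_injOn i (by omega) (by omega) e; omega
    refine ⟨χ', ⟨?_, ?_, ?_⟩, ?_, ?_⟩
    · rw [← hv, ← s1, hm.mover]
    · intro t h1 h2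
      rcases Nat.lt_or_ge t p with h3 | h3
      · rw [← s2 t h3, hm.shifted t h1 h3]
      · obtain rfl : t = p := by omega
        rw [hm.fixed]
        · simp [← hu, ← hv]
        · intro t' _ h4 e
          simp only [← hu, Equiv.trans_apply, Equiv.apply_symm_apply, Equiv.swap_apply_left] at e
          have := L.obj_injOn i hp (by omega) e
          omega
    · intro c hc
      have e1 : χ c ≠ u := hc p (by omega) (by omega)
      have e2 : χ c ≠ v := hc (p + 1) (by omega) (by omega)
      have e3 : (χ.trans (Equiv.swap u v)) c = χ c := Equiv.swap_apply_of_ne_of_ne e1 e2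
      rw [hm.fixed c, e3]
      intro t h1 h2
      rw [e3]
      exact hc t h1 (by omega)
    · intro hw
      have w := hw p (by omega) (by omega)
      refine reach_trans (Relation.ReflTransGen.single (swap_trans_swap (a := χ.symm u)
        (a' := χ.symm v) (by simp [hu]) (by simp [hv]) (L.adj_obj i (by omega)) w.2 w.1)) (hreach ?_)
      intro t h1 h2
      rw [s1, s2 t h2]
      exact ⟨(hw t h1 (by omega)).1, (hw t h1 (by omega)).2⟩
    · intro μ hμ h1 h2
      have := (swap_first L hμ (i := i) (t := p) (by omega) (a := χ.symm v) (a' := χ.symm u)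
        (by simp [hu]) (by simp [hv]) (by omega) (h2 p (by omega) (by omega))).2
      refine hfirst μ this ?_ ?_
      · rw [s1]; exact h1
      · intro t h3 h4
        rw [s2 t h4]
        exact h2 t h3 (by omega)

theorem IsMove.mem_reach {i : Fin L.m} {p r : ℕ} {χ χ' : A ≃ B} (h : IsMove L i p r χ χ')
    (hp : p ≤ L.len i) (hr : r ≤ p)
    (hw : ∀ t, r ≤ t → t < p → F.pref (χ.symm (L.obj i p)) (L.obj i t) (L.obj i (t + 1)) ∧
        F.pref (χ.symm (L.obj i t)) (L.obj i (t + 1)) (L.obj i t)) : χ' ∈ F.Reach χ := by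
  obtain ⟨χ'', h1, h2, -⟩ := exists_isMove L i hp hr χ
  rw [h.unique h1]
  exact h2 hw

theorem IsMove.reach_of_reach {i : Fin L.m} {p r : ℕ} {χ χ' μ : A ≃ B} (h : IsMove L i p r χ χ')
    (hp : p ≤ L.len i) (hr : r ≤ p) (hμ : μ ∈ F.Reach χ)
    (h1 : L.pos i (μ (χ.symm (L.obj i p))) ≤ r)
    (h2 : ∀ t, r ≤ t → t < p → t + 1 ≤ L.pos i (μ (χ.symm (L.obj i t)))) : μ ∈ F.Reach χ' := by
  obtain ⟨χ'', h1', -, h2'⟩ := exists_isMove L i hp hr χ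
  rw [h.unique h1']
  exact h2' μ hμ h1 h2

end Star

end OAF

/-! ### The greedy procedure on one branch -/

/-- The greedy procedure that decides whether a branch of length `ℓ` can be completed. The vertices
in `D` are the destinations of the agents already fixed, `J` is the largest of them, `p` is the
vertex of the next agent that is not fixed, `r` is the vertex to be filled next, and `v` counts the
agents that have been pushed outward. An agent is sent inward to the first vertex that is neither a
destination nor filled if it likes to go there (`wi`), and otherwise it has to be pushed outward to
the first vertex beyond all the destinations (`wo`). -/
inductive Greedy (wi wo : ℕ → ℕ → Prop) (ℓ : ℕ) (D : Finset ℕ) (J : ℕ) : ℕ → ℕ → ℕ → Prop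
  | done {p r v : ℕ} (h : J < r) : Greedy wi wo ℓ D J p r v
  | skip {p r v : ℕ} (h : r ≤ J) (hr : r ∈ D) (h' : Greedy wi wo ℓ D J p (r + 1) v) :
      Greedy wi wo ℓ D J p r v
  | inward {p r v : ℕ} (h : r ≤ J) (hr : r ∉ D) (hp : p ≤ ℓ) (hw : wi p r)
      (h' : Greedy wi wo ℓ D J (p + 1) (r + 1) v) : Greedy wi wo ℓ D J p r v
  | outward {p r v : ℕ} (h : r ≤ J) (hr : r ∉ D) (hp : p ≤ ℓ) (hw : ¬ wi p r)
      (hw' : wo p (J + v + 1)) (h' : Greedy wi wo ℓ D J (p + 1) r (v + 1)) :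
      Greedy wi wo ℓ D J p r v

namespace Greedy

variable {wi wo : ℕ → ℕ → Prop} {ℓ J J' : ℕ} {D D' : Finset ℕ}

theorem skip_iff {p r v : ℕ} (h : r ≤ J) (hr : r ∈ D) :
    Greedy wi wo ℓ D J p r v ↔ Greedy wi wo ℓ D J p (r + 1) v := by
  refine ⟨fun g => ?_, Greedy.skip h hr⟩
  cases g with
  | done h' => omega
  | skip _ _ h' => exact h'
  | inward _ hr' => exact absurd hr hr'
  | outward _ hr' => exact absurd hr hr'

theorem inward_iff {p r v : ℕ} (h : r ≤ J) (hr : r ∉ D) (hp : p ≤ ℓ) (hw : wi p r) :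
    Greedy wi wo ℓ D J p r v ↔ Greedy wi wo ℓ D J (p + 1) (r + 1) v := by
  refine ⟨fun g => ?_, Greedy.inward h hr hp hw⟩
  cases g with
  | done h' => omega
  | skip _ hr' => exact absurd hr' hr
  | inward _ _ _ _ h' => exact h'
  | outward _ _ _ hw' => exact absurd hw hw'

theorem outward_iff {p r v : ℕ} (h : r ≤ J) (hr : r ∉ D) (hp : p ≤ ℓ) (hw : ¬ wi p r)
    (hw' : wo p (J + v + 1)) :
    Greedy wi wo ℓ D J p r v ↔ Greedy wi wo ℓ D J (p + 1) r (v + 1) := by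
  refine ⟨fun g => ?_, Greedy.outward h hr hp hw hw'⟩
  cases g with
  | done h' => omega
  | skip _ hr' => exact absurd hr' hr
  | inward _ _ _ hw' => exact absurd hw' hw
  | outward _ _ _ _ _ h' => exact h'

theorem not_of_stuck {p r v : ℕ} (h : r ≤ J) (hr : r ∉ D)
    (hs : ℓ < p ∨ (¬ wi p r ∧ ¬ wo p (J + v + 1))) : ¬ Greedy wi wo ℓ D J p r v := by
  intro g
  cases g with
  | done h' => omega
  | skip _ hr' => exact hr hr'
  | inward _ _ hp hw =>
    rcases hs with hs | hs
    · omega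
    · exact hs.1 hw
  | outward _ _ hp hw hw' =>
    rcases hs with hs | hs
    · omega
    · exact hs.2 hw'

theorem of_skips {p r r' v : ℕ} (hle : r ≤ r') (h : ∀ x, r ≤ x → x < r' → x ∈ D)
    (g : Greedy wi wo ℓ D J p r' v) : Greedy wi wo ℓ D J p r v := by
  induction r', hle using Nat.le_induction with
  | base => exact g
  | succ r' hle ih =>
    refine ih (fun x h1 h2 => h x h1 (by omega)) ?_
    by_cases hJ : r' ≤ J
    · exact Greedy.skip hJ (h r' hle (by omega)) g
    · exact Greedy.done (by omega)

theorem congr {p r v : ℕ} (h : ∀ x, r ≤ x → (x ∈ D ↔ x ∈ D')) (g : Greedy wi wo ℓ D J p r v) :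
    Greedy wi wo ℓ D' J p r v := by
  induction g with
  | done h0 => exact .done h0
  | @skip p r v hr hD _ ih =>
    exact .skip hr ((h _ le_rfl).1 hD) (ih fun x hx => h x (by omega))
  | @inward p r v hr hD hp hw _ ih =>
    exact .inward hr (fun e => hD ((h _ le_rfl).2 e)) hp hw (ih fun x hx => h x (by omega))
  | @outward p r v hr hD hp hw hw' _ ih =>
    exact .outward hr (fun e => hD ((h _ le_rfl).2 e)) hp hw hw' (ih h)

theorem congr_agents {wi' wo' : ℕ → ℕ → Prop} {p r v : ℕ}
    (h : ∀ q, p ≤ q → q ≤ ℓ → (∀ x, wi q x ↔ wi' q x) ∧ (∀ x, wo q x ↔ wo' q x))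
    (g : Greedy wi wo ℓ D J p r v) : Greedy wi' wo' ℓ D J p r v := by
  induction g with
  | done h0 => exact .done h0
  | skip hr hD _ ih => exact .skip hr hD (ih h)
  | @inward p r v hr hD hp hw _ ih =>
    exact .inward hr hD hp (((h p le_rfl hp).1 r).1 hw) (ih fun q hq => h q (by omega))
  | @outward p r v hr hD hp hw hw' _ ih =>
    exact .outward hr hD hp (fun e => hw (((h p le_rfl hp).1 r).2 e))
      (((h p le_rfl hp).2 _).1 hw') (ih fun q hq => h q (by omega))

/-- If the next agent likes to go inward to the first free vertex, it may be fixed there. -/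
theorem insert_inward {p r : ℕ} (g : Greedy wi wo ℓ D J p 0 0) (hr : r ∉ D)
    (hlt : ∀ x < r, x ∈ D) (hJ : r ≤ J) (hw : wi p r) :
    p ≤ ℓ ∧ Greedy wi wo ℓ (insert r D) J (p + 1) 0 0 := by
  have key : ∀ k ≤ r, Greedy wi wo ℓ D J p k 0 := by
    intro k hk
    induction k with
    | zero => exact g
    | succ k ih => exact (skip_iff (by omega) (hlt k (by omega))).1 (ih (by omega))
  have hp : p ≤ ℓ := by
    by_contra hp
    exact not_of_stuck hJ hr (Or.inl (by omega)) (key r le_rfl)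
  refine ⟨hp, ?_⟩
  have g1 := (inward_iff hJ hr hp hw).1 (key r le_rfl)
  refine of_skips (r' := r + 1) (by omega) ?_ (g1.congr ?_)
  · intro x _ hx
    rcases Nat.lt_or_ge x r with h | h
    · exact Finset.mem_insert_of_mem (hlt x h)
    · rw [show x = r by omega]; exact Finset.mem_insert_self _ _
  · intro x hx
    rw [Finset.mem_insert]
    constructor
    · exact Or.inr
    · rintro (h | h)
      · omega
      · exact h

/-- The number of elements of `D` below `y`. -/
def numBelow (D : Finset ℕ) (y : ℕ) : ℕ := (D.filter (· < y)).card

theorem numBelow_succ_of_mem {y : ℕ} (h : y ∈ D) : numBelow D (y + 1) = numBelow D y + 1 := by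
  unfold numBelow
  rw [← Finset.card_insert_of_notMem (a := y) (s := D.filter (· < y)) (by simp)]
  congr 1
  ext x
  simp only [Finset.mem_filter, Finset.mem_insert]
  constructor
  · rintro ⟨h1, h2⟩
    rcases Nat.lt_or_ge x y with h3 | h3
    · exact Or.inr ⟨h1, h3⟩
    · exact Or.inl (by omega)
  · rintro (rfl | ⟨h1, h2⟩)
    · exact ⟨h, by omega⟩
    · exact ⟨h1, by omega⟩

theorem numBelow_succ_of_notMem {y : ℕ} (h : y ∉ D) : numBelow D (y + 1) = numBelow D y := by
  unfold numBelow
  congr 1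
  ext x
  simp only [Finset.mem_filter]
  constructor
  · rintro ⟨h1, h2⟩
    refine ⟨h1, ?_⟩
    rcases Nat.lt_or_ge x y with h3 | h3
    · exact h3
    · exact absurd ((show x = y by omega) ▸ h1) h
  · rintro ⟨h1, h2⟩
    exact ⟨h1, by omega⟩

theorem numBelow_le_succ (D : Finset ℕ) (y : ℕ) : numBelow D (y + 1) ≤ numBelow D y + 1 := by
  by_cases h : y ∈ D
  · exact (numBelow_succ_of_mem h).le
  · rw [numBelow_succ_of_notMem h]; omega

/-- The number of elements up to `x` outside `D` is monotone in `x`. -/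
theorem free_mono (D : Finset ℕ) {x y : ℕ} (h : x ≤ y) : x + numBelow D y ≤ y + numBelow D x := by
  induction y, h using Nat.le_induction with
  | base => exact le_rfl
  | succ y _ ih => have := numBelow_le_succ D y; omega

theorem numBelow_insert (D : Finset ℕ) {q y : ℕ} (hq : q ∉ D) :
    numBelow (insert q D) y = numBelow D y + if q < y then 1 else 0 := by
  unfold numBelow
  rw [Finset.filter_insert]
  split_ifs with h
  · rw [Finset.card_insert_of_notMem (by simp [hq])]
  · rfl

/-- The greedy procedure stays successful if the destinations are moved inward. -/
theorem mono (hwi : ∀ p x y, x ≤ y → wi p x → wi p y) (hwo : ∀ p x y, x ≤ y → wo p y → wo p x)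
    (hJ : J' ≤ J) (hD : ∀ y, numBelow D y ≤ numBelow D' y) {p r v : ℕ}
    (g : Greedy wi wo ℓ D J p r v) :
    ∀ r' v', r + numBelow D' r' ≤ r' + numBelow D r → v' ≤ v → Greedy wi wo ℓ D' J' p r' v' := by
  -- `r''` is the first free vertex from `r'` on
  have next : ∀ r', ∃ r'', r' ≤ r'' ∧ r'' ∉ D' ∧ (∀ x, r' ≤ x → x < r'' → x ∈ D') ∧
      r' + numBelow D' r'' = r'' + numBelow D' r' := by
    intro r'
    have hex : ∃ x, r' ≤ x ∧ x ∉ D' := by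
      refine ⟨r' + D'.sup id + 1, by omega, fun h => ?_⟩
      have := Finset.le_sup (f := id) h
      simp only [id] at this
      omega
    classical
    refine ⟨Nat.find hex, (Nat.find_spec hex).1, (Nat.find_spec hex).2, ?_, ?_⟩
    · intro x h1 h2
      have := Nat.find_min hex h2
      by_contra h3
      exact this ⟨h1, h3⟩
    · have : ∀ y, r' ≤ y → y ≤ Nat.find hex → r' + numBelow D' y = y + numBelow D' r' := by
        intro y hy
        induction y, hy using Nat.le_induction with
        | base => intro _; rfl
        | succ y hy ih =>
          intro hle
          have hm : y ∈ D' := by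
            have := Nat.find_min hex (m := y) (by omega)
            by_contra h3
            exact this ⟨hy, h3⟩
          rw [numBelow_succ_of_mem hm]
          have := ih (by omega)
          omega
      exact this _ (Nat.find_spec hex).1 le_rfl
  -- the procedure for `D'` fills a vertex that is not nearer to the center than the one for `D`
  have cmp : ∀ r r', r' ∉ D' → r + numBelow D' r' ≤ r' + numBelow D r → r ≤ r' := by
    intro r r' h1 h2
    by_contra hlt
    have e1 := numBelow_succ_of_notMem h1
    have e2 := hD (r' + 1)
    have e3 := free_mono D (x := r' + 1) (y := r) (by omega)
    omega
  induction g with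
  | @done p r v h =>
    intro r' v' h1 _
    obtain ⟨r'', k1, k2, k3, k4⟩ := next r'
    refine of_skips k1 k3 (.done ?_)
    have := cmp r r'' k2 (by omega)
    omega
  | @skip p r v h hr _ ih =>
    intro r' v' h1 h2
    refine ih r' v' ?_ h2
    rw [numBelow_succ_of_mem hr]; omega
  | @inward p r v h hr hp hw _ ih =>
    intro r' v' h1 h2
    obtain ⟨r'', k1, k2, k3, k4⟩ := next r'
    refine of_skips k1 k3 ?_
    by_cases hJ' : r'' ≤ J'
    · refine .inward hJ' k2 hp (hwi p r r'' (cmp r r'' k2 (by omega)) hw) (ih _ _ ?_ h2)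
      rw [numBelow_succ_of_notMem hr, numBelow_succ_of_notMem k2]; omega
    · exact .done (by omega)
  | @outward p r v h hr hp hw hw' _ ih =>
    intro r' v' h1 h2
    obtain ⟨r'', k1, k2, k3, k4⟩ := next r'
    refine of_skips k1 k3 ?_
    by_cases hJ' : r'' ≤ J'
    -- an agent pushed outward for `D` may go inward for `D'`
    · by_cases hwr : wi p r''
      · refine .inward hJ' k2 hp hwr (ih _ _ ?_ (by omega))
        rw [numBelow_succ_of_notMem k2]; omega
      · exact .outward hJ' k2 hp hwr (hwo p _ _ (by omega) hw') (ih _ _ (by omega) (by omega))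
    · exact .done (by omega)

end Greedy

namespace OAF

variable {A B : Type*} {F : OAF A B}

/-- Agent `a` likes to walk inward along branch `i` from `obj i p` to `obj i r`. -/
def LikesIn (L : StarLabelling F.graph) (i : Fin L.m) (a : A) (p r : ℕ) : Prop :=
  ∀ j, r ≤ j → j < p → F.pref a (L.obj i j) (L.obj i (j + 1))

/-- Agent `a` likes to walk outward along branch `i` from `obj i p` to `obj i q`. -/
def LikesOut (L : StarLabelling F.graph) (i : Fin L.m) (a : A) (p q : ℕ) : Prop :=
  q ≤ L.len i ∧ ∀ j, p ≤ j → j < q → F.pref a (L.obj i (j + 1)) (L.obj i j)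

/-- The greedy procedure for branch `i` when the agents at `obj i 0, …, obj i s` are fixed to the
destinations in `D`, and `ag q` is the agent at `obj i q` for `s < q`. -/
def BranchGreedy (L : StarLabelling F.graph) (i : Fin L.m) (ag : ℕ → A) (D : Finset ℕ)
    (J s : ℕ) : Prop :=
  Greedy (fun p r => LikesIn L i (ag p) p r) (fun p q => LikesOut L i (ag p) p q) (L.len i) D J
    (s + 1) 0 0

section

variable {L : StarLabelling F.graph} {i : Fin L.m}

theorem LikesIn.mono {a : A} {p r r' : ℕ} (h : LikesIn L i a p r) (hr : r ≤ r') :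
    LikesIn L i a p r' := fun j h1 h2 => h j (by omega) h2

theorem LikesOut.mono {a : A} {p q p' q' : ℕ} (h : LikesOut L i a p q) (hp : p ≤ p')
    (hq : q' ≤ q) : LikesOut L i a p' q' :=
  ⟨hq.trans h.1, fun j h1 h2 => h.2 j (by omega) (by omega)⟩

theorem LikesOut.pref {a : A} {p q q' : ℕ} (h : LikesOut L i a p q) (h1 : p ≤ q') (h2 : q' < q) :
    F.pref a (L.obj i q) (L.obj i q') := by
  induction q, h2 using Nat.le_induction with
  | base => exact h.2 q' h1 (by omega)
  | succ q hq ih =>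
    exact F.pref_trans (h.2 q (by omega) (by omega)) (ih (h.mono le_rfl (by omega)))

theorem likesIn_of_reach {χ μ : A ≃ B} (h : μ ∈ F.Reach χ) {a : A} {r : ℕ}
    (hr : L.pos i (μ a) ≤ r) : LikesIn L i a (L.pos i (χ a)) r :=
  fun _ h1 h2 => F.chain_in L h (by omega) h2

theorem likesOut_of_reach {χ μ : A ≃ B} (h : μ ∈ F.Reach χ) {a : A} :
    LikesOut L i a (L.pos i (χ a)) (L.pos i (μ a)) :=
  ⟨L.pos_le i _, fun _ h1 h2 => F.chain_out L h h1 h2⟩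

theorem BranchGreedy.mono {ag : ℕ → A} {D D' : Finset ℕ} {J J' s : ℕ}
    (h : BranchGreedy L i ag D J s) (hJ : J' ≤ J)
    (hD : ∀ y, Greedy.numBelow D y ≤ Greedy.numBelow D' y) : BranchGreedy L i ag D' J' s :=
  Greedy.mono (wi := fun p r => LikesIn L i (ag p) p r)
    (wo := fun p q => LikesOut L i (ag p) p q) (fun _ _ _ h1 h2 => LikesIn.mono h2 h1)
    (fun _ _ _ h1 h2 => LikesOut.mono h2 le_rfl h1) hJ hD h 0 0 (by simp [Greedy.numBelow]) le_rfl

theorem BranchGreedy.congr_agents {ag ag' : ℕ → A} {D : Finset ℕ} {J s : ℕ}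
    (h : BranchGreedy L i ag D J s) (he : ∀ q, s < q → q ≤ L.len i → ag q = ag' q) :
    BranchGreedy L i ag' D J s :=
  Greedy.congr_agents (wi := fun p r => LikesIn L i (ag p) p r)
    (wo := fun p q => LikesOut L i (ag p) p q) (fun q h1 h2 => by
      simp only [he q h1 h2, implies_true, and_self]) h

/-- A strictly increasing sequence of destinations is bounded below by the starting points. -/
theorem strictMono_le {d : ℕ → ℕ} {s : ℕ} (hd : ∀ t t', t < t' → t' ≤ s → d t < d t') :
    ∀ t ≤ s, t ≤ d t := by
  intro t ht
  induction t with
  | zero => omega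
  | succ t ih => have := ih (by omega); have := hd t (t + 1) (by omega) ht; omega

/-- Counting lemma: in a reachable matching in which the agents at `obj i 0, …, obj i s` end at
their destinations, an agent further out that does not end further out than it starts cannot end
beyond a vertex `r` that is too large to be filled by the other agents. -/
theorem pos_le_of_inward [Finite A] {χ μ : A ≃ B} (h : μ ∈ F.Reach χ) {s : ℕ} {d : ℕ → ℕ}
    (hd : ∀ t t', t < t' → t' ≤ s → d t < d t')
    (hend : ∀ t ≤ s, L.pos i (μ (χ.symm (L.obj i t))) = d t) {p r : ℕ} (hsp : s < p)
    (hp : p ≤ L.len i) (hin : L.pos i (μ (χ.symm (L.obj i p))) ≤ p) (hr : r ≤ d s)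
    (hcount : ((Finset.range (s + 1)).filter (fun t => d t ≤ r)).card +
      ((Finset.Ioo s p).filter (fun q => L.pos i (μ (χ.symm (L.obj i q))) ≤ q)).card ≤ r) :
    L.pos i (μ (χ.symm (L.obj i p))) ≤ r := by
  classical
  have := Fintype.ofFinite A
  by_contra hlt
  set y := L.pos i (μ (χ.symm (L.obj i p))) with hy
  have hpos : ∀ t ≤ L.len i, L.pos i (χ (χ.symm (L.obj i t))) = t := fun t ht => by
    simp [L.pos_obj i ht]
  have hrlen : r ≤ L.len i := by omega
  have hinj : ∀ t t', t ≤ L.len i → t' ≤ L.len i → χ.symm (L.obj i t) = χ.symm (L.obj i t') →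
      t = t' := fun t t' h1 h2 e => L.obj_injOn i h1 h2 (χ.symm.injective e)
  have dle := strictMono_le hd
  -- the agents ending within distance `r`, and the agents starting there
  let X : Finset A := Finset.univ.filter fun c => L.pos i (μ c) ≤ r
  let Y : Finset A := Finset.univ.filter fun c => L.pos i (χ c) ≤ r
  let Z : Finset A := Finset.univ.filter fun c => L.pos i (χ c) = 0
  let S : Finset ℕ := (Finset.range (s + 1)).filter fun t => d t ≤ r
  let I : Finset ℕ := (Finset.Ioo s p).filter fun q => L.pos i (μ (χ.symm (L.obj i q))) ≤ q
  have hXY : X.card = Y.card := by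
    refine Finset.card_bij (fun c _ => χ.symm (μ c)) ?_ ?_ ?_
    · intro c hc; simpa [X, Y] using hc
    · intro c _ c' _ e; exact μ.injective (χ.symm.injective e)
    · intro c hc; exact ⟨μ.symm (χ c), by simpa [X, Y] using hc, by simp⟩
  have hYcard : Z.card + r ≤ Y.card := by
    have h1 : ((Finset.Icc 1 r).image fun t => χ.symm (L.obj i t)).card = r := by
      rw [Finset.card_image_of_injOn]
      · simp
      · intro t ht t' ht' e
        simp only [Finset.coe_Icc, Set.mem_Icc] at ht ht'
        exact hinj t t' (by omega) (by omega) e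
    have h2 : Disjoint Z ((Finset.Icc 1 r).image fun t => χ.symm (L.obj i t)) := by
      rw [Finset.disjoint_left]
      intro c hc hc'
      simp only [Finset.mem_image, Finset.mem_Icc] at hc'
      obtain ⟨t, ht, rfl⟩ := hc'
      have := (Finset.mem_filter.1 hc).2
      rw [hpos t (by omega)] at this
      omega
    rw [← h1, ← Finset.card_union_of_disjoint h2]
    refine Finset.card_le_card fun c hc => ?_
    rcases Finset.mem_union.1 hc with hc | hc
    · have := (Finset.mem_filter.1 hc).2
      exact Finset.mem_filter.2 ⟨Finset.mem_univ _, by omega⟩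
    · simp only [Finset.mem_image, Finset.mem_Icc] at hc
      obtain ⟨t, ht, rfl⟩ := hc
      exact Finset.mem_filter.2 ⟨Finset.mem_univ _, by rw [hpos t (by omega)]; omega⟩
  have hc0 : χ.symm (L.obj i 0) ∈ Z :=
    Finset.mem_filter.2 ⟨Finset.mem_univ _, hpos 0 (Nat.zero_le _)⟩
  have hXsub : X ⊆ (S.image fun t => χ.symm (L.obj i t)) ∪ (Z.erase (χ.symm (L.obj i 0))) ∪
      (I.image fun t => χ.symm (L.obj i t)) := by
    intro c hc
    have hcr : L.pos i (μ c) ≤ r := (Finset.mem_filter.1 hc).2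
    simp only [Finset.mem_union, Finset.mem_image, Finset.mem_erase]
    by_cases h0 : L.pos i (χ c) = 0
    · by_cases hcc : c = χ.symm (L.obj i 0)
      · left; left
        refine ⟨0, Finset.mem_filter.2 ⟨by simp, ?_⟩, hcc.symm⟩
        rw [← hend 0 (Nat.zero_le _), ← hcc]; exact hcr
      · left; right
        exact ⟨hcc, Finset.mem_filter.2 ⟨Finset.mem_univ _, h0⟩⟩
    · obtain ⟨t, ht⟩ : ∃ t, t = L.pos i (χ c) := ⟨_, rfl⟩
      have htl : t ≤ L.len i := ht ▸ L.pos_le i _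
      have hct : c = χ.symm (L.obj i t) := by
        rw [ht, L.obj_pos h0]; simp
      -- an agent that starts further out than the fixed agents is one of those counted, since an agent
      -- that goes outward stays beyond the last fixed agent, and one from beyond `p` stays beyond `p`
      rcases Nat.lt_or_ge s t with hst | hst
      · rcases Nat.lt_trichotomy t p with htp | rfl | htp
        · right
          refine ⟨t, Finset.mem_filter.2 ⟨Finset.mem_Ioo.2 ⟨hst, htp⟩, ?_⟩, hct.symm⟩
          by_contra hout
          rw [← hct] at hout
          have := F.order_out L h (i := i) (c := χ.symm (L.obj i s)) (c' := c)
            (by rw [hpos s (by omega)]; omega)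
            (by rw [hpos s (by omega), hend s le_rfl]; exact dle s le_rfl) (by omega)
          rw [hend s le_rfl] at this
          omega
        · rw [← hct] at hy; omega
        · have := F.order_in L h (i := i) (a := χ.symm (L.obj i p)) (d := c) (by omega)
            (by rw [hpos p hp]; exact hin) (by rw [hpos p hp]; omega)
          omega
      · left; left
        refine ⟨t, Finset.mem_filter.2 ⟨Finset.mem_range.2 (by omega), ?_⟩, hct.symm⟩
        rw [← hend t hst, ← hct]; exact hcr
  have hXcard := (Finset.card_le_card hXsub).trans ((Finset.card_union_le _ _).trans
    (Nat.add_le_add_right (Finset.card_union_le _ _) _))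
  have e1 : (S.image fun t => χ.symm (L.obj i t)).card ≤ S.card := Finset.card_image_le
  have e2 : (I.image fun t => χ.symm (L.obj i t)).card ≤ I.card := Finset.card_image_le
  have e3 := Finset.card_erase_of_mem hc0
  have e4 : 0 < Z.card := Finset.card_pos.2 ⟨_, hc0⟩
  have e5 : S.card + I.card ≤ r := hcount
  omega

/-- The greedy procedure succeeds if some reachable matching realizes the destinations. -/
theorem branchGreedy_of_reach [Finite A] {χ μ : A ≃ B} (h : μ ∈ F.Reach χ) {s : ℕ} {d : ℕ → ℕ}
    (hs : s ≤ L.len i) (hd : ∀ t t', t < t' → t' ≤ s → d t < d t')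
    (hend : ∀ t ≤ s, L.pos i (μ (χ.symm (L.obj i t))) = d t) :
    BranchGreedy L i (fun q => χ.symm (L.obj i q)) ((Finset.range (s + 1)).image d) (d s) s := by
  classical
  have hpos : ∀ t ≤ L.len i, L.pos i (χ (χ.symm (L.obj i t))) = t := fun t ht => by
    simp [L.pos_obj i ht]
  have dle := strictMono_le hd
  have dmono : ∀ t ≤ s, d t ≤ d s := fun t ht => by
    rcases ht.lt_or_eq with h | rfl
    · exact (hd t s h le_rfl).le
    · exact le_rfl
  have dinj : ∀ t ≤ s, ∀ t' ≤ s, d t = d t' → t = t' := by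
    intro t ht t' ht' e
    by_contra hne
    rcases Nat.lt_or_gt_of_ne hne with h | h
    · have := hd t t' h ht'; omega
    · have := hd t' t h ht; omega
  -- `cnt r` destinations lie below `r`
  let cnt : ℕ → ℕ := fun r => ((Finset.range (s + 1)).filter fun t => d t < r).card
  let inw : ℕ → ℕ := fun p =>
    ((Finset.Ioo s p).filter fun q => L.pos i (μ (χ.symm (L.obj i q))) ≤ q).card
  have cnt_mem : ∀ r, r ∈ (Finset.range (s + 1)).image d → cnt (r + 1) = cnt r + 1 := by
    intro r hr
    obtain ⟨t, ht, rfl⟩ := Finset.mem_image.1 hr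
    rw [Finset.mem_range] at ht
    simp only [cnt]
    rw [← Finset.card_insert_of_notMem (a := t)
      (s := (Finset.range (s + 1)).filter fun t' => d t' < d t) (by simp)]
    congr 1
    ext x
    simp only [Finset.mem_filter, Finset.mem_insert, Finset.mem_range]
    constructor
    · rintro ⟨h1, h2⟩
      rcases Nat.lt_or_ge (d x) (d t) with h3 | h3
      · exact Or.inr ⟨h1, h3⟩
      · exact Or.inl (dinj x (by omega) t (by omega) (by omega))
    · rintro (rfl | ⟨h1, h2⟩)
      · exact ⟨ht, by omega⟩
      · exact ⟨h1, by omega⟩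
  have cnt_notMem : ∀ r, r ∉ (Finset.range (s + 1)).image d →
      ((Finset.range (s + 1)).filter fun t => d t ≤ r) =
        (Finset.range (s + 1)).filter fun t => d t < r := by
    intro r hr
    refine Finset.filter_congr fun t ht => ⟨fun h => lt_of_le_of_ne h fun e => ?_, fun h => h.le⟩
    exact hr (e ▸ Finset.mem_image_of_mem d ht)
  have inw_succ : ∀ p, inw (p + 1) ≤ inw p + 1 := by
    intro p
    simp only [inw]
    refine (Finset.card_le_card (t := _ ∪ {p}) ?_).trans (Finset.card_union_le _ _)
    intro x hx
    simp only [Finset.mem_filter, Finset.mem_Ioo, Finset.mem_union, Finset.mem_singleton] at hx ⊢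
    rcases Nat.lt_or_ge x p with h | h
    · exact Or.inl ⟨⟨hx.1.1, h⟩, hx.2⟩
    · exact Or.inr (by omega)
  have inw_succ' : ∀ p, p < L.pos i (μ (χ.symm (L.obj i p))) → inw (p + 1) = inw p := by
    intro p hp
    simp only [inw]
    congr 1
    ext x
    simp only [Finset.mem_filter, Finset.mem_Ioo]
    constructor
    · rintro ⟨⟨h1, h2⟩, h3⟩
      rcases Nat.lt_or_ge x p with h | h
      · exact ⟨⟨h1, h⟩, h3⟩
      · obtain rfl : x = p := by omega
        omega
    · rintro ⟨⟨h1, h2⟩, h3⟩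
      exact ⟨⟨h1, by omega⟩, h3⟩
  -- the witness `w` is the outermost agent so far that moves outward in `μ`
  have main : ∀ k p r v, (d s + 1 - r) + (L.len i + 1 - p) ≤ k → s < p → p ≤ L.len i + 1 →
      r ≤ d s + 1 → inw p + v + s + 1 ≤ p → cnt r + p = r + 1 + s + v →
      (∃ w, s ≤ w ∧ w < p ∧ w ≤ L.pos i (μ (χ.symm (L.obj i w))) ∧
        d s + v ≤ L.pos i (μ (χ.symm (L.obj i w)))) →
      Greedy (fun p r => LikesIn L i (χ.symm (L.obj i p)) p r)
        (fun p q => LikesOut L i (χ.symm (L.obj i p)) p q) (L.len i)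
        ((Finset.range (s + 1)).image d) (d s) p r v := by
    intro k
    induction k with
    | zero =>
      intro p r v hk hsp hp hr _ _ _
      exact .done (by omega)
    | succ k ih =>
      intro p r v hk hsp hp hr hinw hcnt hw
      by_cases hrJ : d s < r
      · exact .done hrJ
      have hrJ' : r ≤ d s := by omega
      by_cases hrD : r ∈ (Finset.range (s + 1)).image d
      · refine .skip hrJ' hrD (ih p (r + 1) v (by omega) hsp hp (by omega) hinw ?_ hw)
        rw [cnt_mem r hrD]; omega
      obtain ⟨w, w1, w2, w3, w4⟩ := hw
      have hcr : cnt (r + 1) = cnt r := by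
        have := cnt_notMem r hrD
        simp only [cnt]
        rw [← this]
        congr 1
        exact Finset.filter_congr fun t _ => Nat.lt_succ_iff
      have hpl : p ≤ L.len i := by
        by_contra hpl
        -- otherwise all agents are placed, and there is no room for the destinations beyond `r`
        have e1 : ((Finset.range (s + 1)).filter fun t => ¬ d t < r).card ≤
            (Finset.Ioc r (d s)).card := by
          refine Finset.card_le_card_of_injOn d ?_ ?_
          · intro t ht
            simp only [Finset.coe_filter, Finset.mem_range, Set.mem_ofPred_eq] at ht
            simp only [Finset.coe_Ioc, Set.mem_Ioc]
            refine ⟨lt_of_le_of_ne (by omega) fun e => hrD ?_, dmono t (by omega)⟩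
            exact e ▸ Finset.mem_image_of_mem d (Finset.mem_range.2 ht.1)
          · intro t ht t' ht' e
            simp only [Finset.coe_filter, Finset.mem_range, Set.mem_ofPred_eq] at ht ht'
            exact dinj t (by omega) t' (by omega) e
        have e2 := Finset.card_filter_add_card_filter_not (s := Finset.range (s + 1))
          (fun t => d t < r)
        rw [Finset.card_range] at e2
        rw [Nat.card_Ioc] at e1
        have e3 := L.pos_le i (μ (χ.symm (L.obj i w)))
        have e4 : cnt r = ((Finset.range (s + 1)).filter fun t => d t < r).card := rfl
        omega
      by_cases hwi : LikesIn L i (χ.symm (L.obj i p)) p r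
      · refine .inward hrJ' hrD hpl hwi (ih (p + 1) (r + 1) v (by omega) (by omega) (by omega)
          (by omega) ?_ ?_ ⟨w, w1, by omega, w3, w4⟩)
        · have := inw_succ p; omega
        · omega
      · have hout : p < L.pos i (μ (χ.symm (L.obj i p))) := by
          by_contra hin
          apply hwi
          have := likesIn_of_reach (i := i) h (a := χ.symm (L.obj i p)) (r := r)
            (pos_le_of_inward h hd hend hsp hpl (by omega) hrJ' ?_)
          · rwa [hpos p hpl] at this
          · rw [cnt_notMem r hrD]
            have e4 : cnt r = ((Finset.range (s + 1)).filter fun t => d t < r).card := rfl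
            have e5 : inw p = ((Finset.Ioo s p).filter fun q =>
              L.pos i (μ (χ.symm (L.obj i q))) ≤ q).card := rfl
            omega
        -- `p` goes outward in `μ` and so stays beyond the previous witness; it is the next witness
        have hbeyond := F.order_out L h (i := i) (c := χ.symm (L.obj i w))
          (c' := χ.symm (L.obj i p)) (by rw [hpos w (by omega), hpos p hpl]; exact w2)
          (by rw [hpos w (by omega)]; exact w3) (by rw [hpos p hpl]; omega)
        refine .outward hrJ' hrD hpl hwi ?_ (ih (p + 1) r (v + 1) (by omega) (by omega) (by omega)
          (by omega) ?_ (by omega) ⟨p, by omega, by omega, by omega, by omega⟩)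
        · have := likesOut_of_reach (i := i) h (a := χ.symm (L.obj i p))
          rw [hpos p hpl] at this
          exact this.mono le_rfl (by omega)
        · rw [inw_succ' p hout]; omega
  refine main _ (s + 1) 0 0 le_rfl (by omega) (by omega) (by omega) ?_ ?_
    ⟨s, le_rfl, by omega, ?_, ?_⟩
  · simp [inw]
  · simp [cnt]; omega
  · rw [hend s le_rfl]; exact dle s le_rfl
  · rw [hend s le_rfl]; omega

end

end OAF

/-! ### Carrying out the greedy procedure by swaps -/

namespace OAF

variable {A B : Type*} {F : OAF A B} {L : StarLabelling F.graph} {i : Fin L.m}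

theorem pos_symm_obj (χ : A ≃ B) {t : ℕ} (ht : t ≤ L.len i) :
    L.pos i (χ (χ.symm (L.obj i t))) = t := by simp [L.pos_obj i ht]

theorem symm_obj_inj (χ : A ≃ B) {t t' : ℕ} (ht : t ≤ L.len i) (ht' : t' ≤ L.len i)
    (h : χ.symm (L.obj i t) = χ.symm (L.obj i t')) : t = t' :=
  L.obj_injOn i ht ht' (χ.symm.injective h)

/-- Who sits where on the branch after a move. -/
theorem IsMove.symm_obj {p r : ℕ} {χ χ' : A ≃ B} (h : IsMove L i p r χ χ')
    (hp : p ≤ L.len i) :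
    χ'.symm (L.obj i r) = χ.symm (L.obj i p) ∧
    (∀ t, r ≤ t → t < p → χ'.symm (L.obj i (t + 1)) = χ.symm (L.obj i t)) ∧
    ∀ t, t ≤ L.len i → (t < r ∨ p < t) → χ'.symm (L.obj i t) = χ.symm (L.obj i t) := by
  refine ⟨?_, ?_, ?_⟩
  · rw [Equiv.symm_apply_eq, h.mover]
  · intro t h1 h2
    rw [Equiv.symm_apply_eq, h.shifted t h1 h2]
  · intro t ht h1
    rw [Equiv.symm_apply_eq, h.fixed]
    · simp
    · intro t' h2 h3 e
      rw [Equiv.apply_symm_apply] at e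
      have := L.obj_injOn i ht (by omega) e
      omega

theorem IsMove.apply_of_pos_zero {p r : ℕ} {χ χ' : A ≃ B} (h : IsMove L i p r χ χ')
    (hp : p ≤ L.len i) {c : A} (hc : L.pos i (χ c) = 0) (hc' : c ≠ χ.symm L.center) :
    χ' c = χ c := by
  refine h.fixed c fun t _ h2 e => ?_
  rw [e, L.pos_obj i (by omega)] at hc
  subst hc
  apply hc'
  rw [L.obj_zero] at e
  rw [← e]; simp

/-- The destinations after the agent next in line has been moved inward to the free vertex `r`. -/
def insertDest (d : ℕ → ℕ) (r : ℕ) : ℕ → ℕ :=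
  fun t => if t < r then d t else if t = r then r else d (t - 1)

/-- If the destinations below `r` are all taken, then by the agents that start there. -/
theorem eq_self_of_filled {d : ℕ → ℕ} {p r : ℕ} (hd : ∀ t t', t < t' → t' < p → d t < d t')
    (h : ∀ x < r, ∃ t < p, d t = x) : ∀ x < r, x < p ∧ d x = x := by
  intro x
  induction x using Nat.strong_induction_on with
  | _ x ih =>
    intro hx
    obtain ⟨t, ht, e⟩ := h x hx
    have hle : ∀ t < p, t ≤ d t := by
      intro t ht
      induction t with
      | zero => omega
      | succ t iht => have := iht (by omega); have := hd t (t + 1) (by omega) ht; omega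
    have h1 := hle t ht
    rcases Nat.lt_or_ge t x with h2 | h2
    · have := (ih t h2 (by omega)).2; omega
    · obtain rfl : t = x := by omega
      exact ⟨ht, e⟩

/-- If the vertices below `r` are filled and `r` is free, all further agents go beyond their
vertices. -/
theorem lt_dest_of_free {d : ℕ → ℕ} {p r : ℕ} (hd : ∀ t t', t < t' → t' < p → d t < d t')
    (h : ∀ x < r, ∃ t < p, d t = x) (hr : ∀ t < p, d t ≠ r) :
    ∀ t, r ≤ t → t < p → t < d t := by
  intro t h1 h2
  induction t, h1 using Nat.le_induction with
  | base =>
    have hne := hr r h2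
    by_contra hlt
    rcases Nat.eq_zero_or_pos r with rfl | h0
    · omega
    · have e := (eq_self_of_filled hd h (r - 1) (by omega)).2
      have := hd (r - 1) r (by omega) h2
      omega
  | succ t h1 ih => have := ih (by omega); have := hd t (t + 1) (by omega) h2; omega

section insertDest

variable {d : ℕ → ℕ} {p r : ℕ}

theorem insertDest_lt {t : ℕ} (ht : t < r) : insertDest d r t = d t := by simp [insertDest, ht]

theorem insertDest_self : insertDest d r r = r := by simp [insertDest]

theorem insertDest_succ {t : ℕ} (ht : r ≤ t) : insertDest d r (t + 1) = d t := by
  have h1 : ¬ t + 1 < r := by omega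
  have h2 : t + 1 ≠ r := by omega
  simp [insertDest, h1, h2]

theorem insertDest_strictMono (hd : ∀ t t', t < t' → t' < p → d t < d t')
    (h : ∀ x < r, ∃ t < p, d t = x) (hr : ∀ t < p, d t ≠ r) :
    ∀ t t', t < t' → t' < p + 1 → insertDest d r t < insertDest d r t' := by
  have h1 := eq_self_of_filled hd h
  have h2 := lt_dest_of_free hd h hr
  intro t t' htt ht'
  rcases Nat.lt_trichotomy t' r with h3 | rfl | h3
  · rw [insertDest_lt h3, insertDest_lt (by omega), (h1 t (by omega)).2, (h1 t' h3).2]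
    exact htt
  · rw [insertDest_self, insertDest_lt htt, (h1 t htt).2]
    exact htt
  · obtain ⟨u, rfl⟩ : ∃ u, t' = u + 1 := ⟨t' - 1, by omega⟩
    rw [insertDest_succ (by omega)]
    have h4 := h2 u (by omega) (by omega)
    rcases Nat.lt_trichotomy t r with h5 | rfl | h5
    · rw [insertDest_lt h5, (h1 t h5).2]; omega
    · rw [insertDest_self]; omega
    · obtain ⟨w, rfl⟩ : ∃ w, t = w + 1 := ⟨t - 1, by omega⟩
      rw [insertDest_succ (by omega)]
      exact hd w u (by omega) (by omega)

theorem insertDest_image (hrp : r ≤ p) (x : ℕ) :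
    (∃ t < p + 1, insertDest d r t = x) ↔ x = r ∨ ∃ t < p, d t = x := by
  constructor
  · rintro ⟨t, ht, rfl⟩
    rcases Nat.lt_trichotomy t r with h3 | rfl | h3
    · exact Or.inr ⟨t, by omega, (insertDest_lt h3).symm⟩
    · exact Or.inl insertDest_self
    · obtain ⟨u, rfl⟩ : ∃ u, t = u + 1 := ⟨t - 1, by omega⟩
      exact Or.inr ⟨u, by omega, (insertDest_succ (by omega)).symm⟩
  · rintro (rfl | ⟨t, ht, rfl⟩)
    · exact ⟨x, by omega, insertDest_self⟩
    · rcases Nat.lt_or_ge t r with h3 | h3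
      · exact ⟨t, by omega, insertDest_lt h3⟩
      · exact ⟨t + 1, by omega, insertDest_succ h3⟩

end insertDest

/-- Carrying out the greedy procedure: the agents at `obj i 0, …, obj i (p - 1)` reach their
destinations `e`, and nobody outside the branch is affected. -/
theorem exists_reach_of_greedy_aux {ag : ℕ → A} {D : Finset ℕ} {J p r v : ℕ}
    (g : Greedy (fun p r => LikesIn L i (ag p) p r) (fun p q => LikesOut L i (ag p) p q) (L.len i)
      D J p r v) :
    ∀ (χ : A ≃ B) (e : ℕ → ℕ), 1 ≤ p → p ≤ L.len i + 1 →
      (∀ q, p ≤ q → q ≤ L.len i → χ.symm (L.obj i q) = ag q) →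
      (∀ t t', t < t' → t' < p → e t < e t') →
      (∀ t < p, LikesOut L i (χ.symm (L.obj i t)) t (e t)) → e (p - 1) = J + v →
      (∀ x < r, x ≤ J → ∃ t < p, e t = x) →
      (∀ x, r ≤ x → x ≤ J → ((∃ t < p, e t = x) ↔ x ∈ D)) →
      (∀ x, J < x → x ≤ J + v → ∃ t < p, e t = x) →
      ∃ χ' ∈ F.Reach χ, (∀ t < p, χ' (χ.symm (L.obj i t)) = L.obj i (e t)) ∧
        ∀ c, L.pos i (χ c) = 0 → c ≠ χ.symm L.center → χ' c = χ c := by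
  induction g with
  | @done p r v hJr =>
    intro χ e hp1 hp hag he hlike hlast h1 _ h3
    -- the destinations are exactly the vertices up to `J + v`, so everybody is there already
    have hall : ∀ x < J + v + 1, ∃ t < p, e t = x := by
      intro x hx
      rcases Nat.lt_or_ge J x with h | h
      · exact h3 x h (by omega)
      · exact h1 x (by omega) h
    have hid := eq_self_of_filled he hall
    have hlast' : p = J + v + 1 := by
      have := (hid (J + v) (by omega)).1
      have hle := strictMono_le (d := e) (s := p - 1) (fun t t' h h' => he t t' h (by omega))
        (p - 1) le_rfl
      omega
    refine ⟨χ, F.mem_reach_refl χ, fun t ht => ?_, fun _ _ _ => rfl⟩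
    rw [(hid t (by omega)).2]; simp
  | @skip p r v hr hD _ ih =>
    intro χ e hp1 hp hag he hlike hlast h1 h2 h3
    refine ih χ e hp1 hp hag he hlike hlast ?_ (fun x hx => h2 x (by omega)) h3
    intro x hx hxJ
    rcases Nat.lt_or_ge x r with h | h
    · exact h1 x h hxJ
    · obtain rfl : x = r := by omega
      exact (h2 x le_rfl hxJ).2 hD
  | @inward p r v hr hD hpl hw _ ih =>
    intro χ e hp1 hp hag he hlike hlast h1 h2 h3
    have hfill : ∀ x < r, ∃ t < p, e t = x := fun x hx => h1 x hx (by omega)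
    have hfree : ∀ t < p, e t ≠ r := fun t ht h => hD ((h2 r le_rfl hr).1 ⟨t, ht, h⟩)
    have hid := eq_self_of_filled he hfill
    have hgt := lt_dest_of_free he hfill hfree
    have hrp : r < p := by
      by_contra hrp
      have := (hid (p - 1) (by omega)).2
      have := hfree (p - 1) (by omega)
      omega
    -- agent `p` moves inward to `r`; all agents that it passes are to go outward anyway
    obtain ⟨χ', hm, hreach, -⟩ := F.exists_isMove L i hpl hrp.le χ
    have hχ' : χ' ∈ F.Reach χ := by
      refine hreach fun t ht1 ht2 => ⟨?_, ?_⟩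
      · rw [hag p le_rfl hpl]; exact hw t ht1 ht2
      · exact (hlike t ht2).2 t le_rfl (hgt t ht1 ht2)
    obtain ⟨s1, s2, s3⟩ := hm.symm_obj hpl
    obtain ⟨χ'', hr'', hd'', hf''⟩ := ih χ' (insertDest e r) (by omega) (by omega)
      (fun q hq1 hq2 => by rw [s3 q hq2 (Or.inr (by omega)), hag q (by omega) hq2])
      (insertDest_strictMono he hfill hfree)
      (by
        intro t ht
        rcases Nat.lt_trichotomy t r with h | rfl | h
        · rw [s3 t (by omega) (Or.inl h), insertDest_lt h]
          exact hlike t (by omega)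
        · rw [insertDest_self]
          exact ⟨by omega, fun j h h' => by omega⟩
        · obtain ⟨u, rfl⟩ : ∃ u, t = u + 1 := ⟨t - 1, by omega⟩
          rw [s2 u (by omega) (by omega), insertDest_succ (by omega)]
          exact (hlike u (by omega)).mono (by omega) le_rfl)
      (by
        obtain ⟨u, rfl⟩ : ∃ u, p = u + 1 := ⟨p - 1, by omega⟩
        rw [Nat.add_sub_cancel, insertDest_succ (by omega)]
        simpa using hlast)
      (by
        intro x hx hxJ
        refine (insertDest_image hrp.le x).2 ?_
        rcases Nat.lt_or_ge x r with h | h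
        · exact Or.inr (hfill x h)
        · exact Or.inl (by omega))
      (by
        intro x hx hxJ
        rw [insertDest_image hrp.le x, ← h2 x (by omega) hxJ]
        constructor
        · rintro (h | h)
          · omega
          · exact h
        · exact Or.inr)
      (fun x hx hxJ => (insertDest_image hrp.le x).2 (Or.inr (h3 x hx hxJ)))
    refine ⟨χ'', reach_trans hχ' hr'', ?_, ?_⟩
    · intro t ht
      rcases Nat.lt_or_ge t r with h | h
      · rw [← s3 t (by omega) (Or.inl h), hd'' t (by omega), insertDest_lt h]
      · rw [← s2 t h ht, hd'' (t + 1) (by omega), insertDest_succ h]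
    · intro c hc hc'
      have e1 := hm.apply_of_pos_zero hpl hc hc'
      rw [hf'' c (by rw [e1]; exact hc) ?_, e1]
      intro e2
      have e3 : χ' c = L.center := by rw [e2]; simp
      rw [e1] at e3
      exact hc' (by rw [← e3]; simp)
  | @outward p r v hr hD hpl hw hw' _ ih =>
    intro χ e hp1 hp hag he hlike hlast h1 h2 h3
    -- agent `p` does not move yet, but gets the destination `J + v + 1`
    let e' : ℕ → ℕ := fun t => if t < p then e t else J + v + 1
    have e'lt : ∀ t, t < p → e' t = e t := fun t ht => by simp [e', ht]
    have e'p : e' p = J + v + 1 := by simp [e']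
    have hle : ∀ t < p, e t ≤ J + v := by
      intro t ht
      rw [← hlast]
      rcases Nat.lt_or_ge t (p - 1) with h | h
      · exact (he t (p - 1) h (by omega)).le
      · rw [show t = p - 1 by omega]
    have him : ∀ x, (∃ t < p + 1, e' t = x) ↔ x = J + v + 1 ∨ ∃ t < p, e t = x := by
      intro x
      constructor
      · rintro ⟨t, ht, rfl⟩
        rcases Nat.lt_or_ge t p with h | h
        · exact Or.inr ⟨t, h, (e'lt t h).symm⟩
        · obtain rfl : t = p := by omega
          exact Or.inl e'p
      · rintro (rfl | ⟨t, ht, rfl⟩)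
        · exact ⟨p, by omega, e'p⟩
        · exact ⟨t, by omega, e'lt t ht⟩
    obtain ⟨χ'', hr'', hd'', hf''⟩ := ih χ e' (by omega) (by omega)
      (fun q hq1 hq2 => hag q (by omega) hq2)
      (by
        intro t t' htt ht'
        rcases Nat.lt_or_ge t' p with h | h
        · rw [e'lt t (by omega), e'lt t' h]; exact he t t' htt h
        · obtain rfl : t' = p := by omega
          rw [e'lt t htt, e'p]
          have := hle t htt
          omega)
      (by
        intro t ht
        rcases Nat.lt_or_ge t p with h | h
        · rw [e'lt t h]; exact hlike t h
        · obtain rfl : t = p := by omega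
          rw [e'p, hag t le_rfl hpl]
          exact hw')
      (by rw [Nat.add_sub_cancel, e'p]; omega)
      (fun x hx hxJ => (him x).2 (Or.inr (h1 x hx hxJ)))
      (by
        intro x hx hxJ
        rw [him x, ← h2 x hx hxJ]
        constructor
        · rintro (h | h)
          · omega
          · exact h
        · exact Or.inr)
      (by
        intro x hx hxJ
        rcases Nat.lt_or_ge (J + v) x with h | h
        · exact (him x).2 (Or.inl (by omega))
        · exact (him x).2 (Or.inr (h3 x hx h)))
    refine ⟨χ'', hr'', fun t ht => ?_, hf''⟩
    rw [hd'' t (by omega), e'lt t ht]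

theorem exists_reach_of_greedy {s : ℕ} {d : ℕ → ℕ} {χ : A ≃ B} (hs : s ≤ L.len i)
    (hd : ∀ t t', t < t' → t' ≤ s → d t < d t')
    (hlike : ∀ t ≤ s, LikesOut L i (χ.symm (L.obj i t)) t (d t))
    (g : BranchGreedy L i (fun q => χ.symm (L.obj i q)) ((Finset.range (s + 1)).image d) (d s) s) :
    ∃ χ' ∈ F.Reach χ, (∀ t ≤ s, χ' (χ.symm (L.obj i t)) = L.obj i (d t)) ∧
      ∀ c, L.pos i (χ c) = 0 → c ≠ χ.symm L.center → χ' c = χ c := by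
  obtain ⟨χ', h1, h2, h3⟩ := exists_reach_of_greedy_aux g χ d (by omega) (by omega)
    (fun _ _ _ => rfl) (fun t t' h h' => hd t t' h (by omega)) (fun t ht => hlike t (by omega))
    (by simp) (fun x hx => by omega)
    (fun x _ _ => by
      simp only [Finset.mem_image, Finset.mem_range])
    (fun x h h' => by omega)
  exact ⟨χ', h1, fun t ht => h2 t (by omega), h3⟩

variable {A B : Type*} {F : OAF A B} {L : StarLabelling F.graph}

/-! ### Possible and best matches, and serial dictatorship -/

theorem reachAgain_congr {χ χ' : A ≃ B} {τ τ' : Set (A × B)} (h : τ ⊆ τ')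
    (he : F.ReachAgain χ τ = F.ReachAgain χ' τ) : F.ReachAgain χ τ' = F.ReachAgain χ' τ' := by
  have key : ∀ ξ ξ' : A ≃ B, F.ReachAgain ξ τ = F.ReachAgain ξ' τ →
      F.ReachAgain ξ τ' ⊆ F.ReachAgain ξ' τ' := by
    rintro ξ ξ' he μ ⟨h1, h2⟩
    have : μ ∈ F.ReachAgain ξ τ := ⟨h1, fun p hp => h2 p (h hp)⟩
    rw [he] at this
    exact ⟨this.1, h2⟩
  exact (key χ χ' he).antisymm (key χ' χ he.symm)

theorem mem_reachAgain_insert {χ μ : A ≃ B} {τ : Set (A × B)} {a : A} {b : B} :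
    μ ∈ F.ReachAgain χ (insert (a, b) τ) ↔ μ ∈ F.ReachAgain χ τ ∧ μ a = b := by
  constructor
  · rintro ⟨h1, h2⟩
    exact ⟨⟨h1, fun p hp => h2 p (Set.mem_insert_of_mem _ hp)⟩, h2 _ (Set.mem_insert _ _)⟩
  · rintro ⟨⟨h1, h2⟩, h3⟩
    refine ⟨h1, fun p hp => ?_⟩
    rcases hp with rfl | hp
    · exact h3
    · exact h2 p hp

theorem possibleMatch_iff {χ : A ≃ B} {τ : Set (A × B)} {a : A} {b : B} :
    F.PossibleMatch χ τ a b ↔ (F.ReachAgain χ (insert (a, b) τ)).Nonempty := by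
  constructor
  · rintro ⟨μ, h1, h2⟩; exact ⟨μ, mem_reachAgain_insert.2 ⟨h1, h2⟩⟩
  · rintro ⟨μ, h⟩; exact ⟨μ, (mem_reachAgain_insert.1 h).1, (mem_reachAgain_insert.1 h).2⟩

theorem bestMatch_congr {χ χ' : A ≃ B} {τ : Set (A × B)} {a : A} {b : B}
    (h : F.ReachAgain χ τ = F.ReachAgain χ' τ) : F.BestMatch χ τ a b ↔ F.BestMatch χ' τ a b := by
  unfold BestMatch PossibleMatch
  rw [h]

theorem exists_bestMatch [Finite B] {χ : A ≃ B} {τ : Set (A × B)}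
    (h : (F.ReachAgain χ τ).Nonempty) (a : A) : ∃ b, F.BestMatch χ τ a b := by
  have := F.strict a
  obtain ⟨μ, hμ⟩ := h
  have wf : WellFounded (F.pref a) := Finite.wellFounded_of_trans_of_irrefl (F.pref a)
  obtain ⟨b, hb, hmin⟩ := wf.has_min {b | F.PossibleMatch χ τ a b} ⟨μ a, μ, hμ, rfl⟩
  refine ⟨b, hb, fun b' hb' => ?_⟩
  rcases F.pref_trichotomy a b' b with h | h | h
  · exact absurd h (hmin b' hb')
  · exact Or.inl h
  · exact Or.inr h

theorem SerialFrom.subset {χ : A ≃ B} {τ τ' : Set (A × B)} {σ : List A}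
    (h : F.SerialFrom χ τ σ τ') : τ ⊆ τ' := by
  induction h with
  | nil => exact subset_rfl
  | cons _ _ ih => exact (Set.subset_insert _ _).trans ih

theorem SerialFrom.append {χ : A ≃ B} {τ τ' τ'' : Set (A × B)} {σ σ' : List A}
    (h : F.SerialFrom χ τ σ τ') (h' : F.SerialFrom χ τ' σ' τ'') :
    F.SerialFrom χ τ (σ ++ σ') τ'' := by
  induction h with
  | nil => exact h'
  | cons hb _ ih => exact .cons hb (ih h')

theorem SerialFrom.congr {χ χ' : A ≃ B} {τ τ' : Set (A × B)} {σ : List A}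
    (h : F.SerialFrom χ τ σ τ') (he : F.ReachAgain χ τ = F.ReachAgain χ' τ) :
    F.SerialFrom χ' τ σ τ' := by
  induction h with
  | nil => exact .nil _
  | cons hb _ ih =>
    exact .cons ((bestMatch_congr he).1 hb) (ih (reachAgain_congr (Set.subset_insert _ _) he))

theorem SerialFrom.nonempty {χ : A ≃ B} {τ τ' : Set (A × B)} {σ : List A}
    (h : F.SerialFrom χ τ σ τ') (he : (F.ReachAgain χ τ).Nonempty) :
    (F.ReachAgain χ τ').Nonempty := by
  induction h with
  | nil => exact he
  | cons hb _ ih => exact ih (possibleMatch_iff.1 hb.1)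

theorem SerialFrom.exists_mem {χ : A ≃ B} {τ τ' : Set (A × B)} {σ : List A}
    (h : F.SerialFrom χ τ σ τ') {a : A} (ha : a ∈ σ) : ∃ b, (a, b) ∈ τ' := by
  induction h with
  | nil => simp at ha
  | @cons τ τ' a' b σ hb h ih =>
    rcases List.mem_cons.1 ha with rfl | ha
    · exact ⟨b, h.subset (Set.mem_insert _ _)⟩
    · exact ih ha

theorem exists_serialFrom [Finite B] (χ : A ≃ B) (σ : List A) :
    ∀ τ : Set (A × B), (F.ReachAgain χ τ).Nonempty → ∃ τ', F.SerialFrom χ τ σ τ' := by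
  induction σ with
  | nil => exact fun τ _ => ⟨τ, .nil τ⟩
  | cons a σ ih =>
    intro τ h
    obtain ⟨b, hb⟩ := exists_bestMatch h a
    obtain ⟨τ', h'⟩ := ih _ (possibleMatch_iff.1 hb.1)
    exact ⟨τ', .cons hb h'⟩

/-- Serial dictatorship of all agents is Pareto-efficient: a dominating matching would have to give
each dictator in turn the same object. -/
theorem IsSerial.paretoEfficient {μ₀ μ : A ≃ B} {σ : List A}
    (h : F.IsSerial μ₀ σ (matchingPairs μ)) (hall : ∀ a, a ∈ σ) :
    F.IsParetoEfficientReachable μ₀ μ := by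
  constructor
  · obtain ⟨ν, h1, h2⟩ := SerialFrom.nonempty h ⟨μ₀, F.mem_reach_refl μ₀, by simp⟩
    have : ν = μ := Equiv.ext fun a => h2 (a, μ a) rfl
    exact this ▸ h1
  · rintro μ' hμ' ⟨hw, a, ha⟩
    have key : ∀ (τ τ' : Set (A × B)) (σ : List A), F.SerialFrom μ₀ τ σ τ' →
        (∀ p ∈ τ', μ p.1 = p.2) → (∀ p ∈ τ, μ' p.1 = p.2) → ∀ p ∈ τ', μ' p.1 = p.2 := by
      intro τ τ' σ hs
      induction hs with
      | nil => exact fun _ h => h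
      | @cons τ τ' a b σ hb hs ih =>
        intro h1 h2
        refine ih h1 fun p hp => ?_
        rcases hp with rfl | hp
        · have e : μ a = b := h1 _ (hs.subset (Set.mem_insert _ _))
          rcases hb.2 (μ' a) ⟨μ', ⟨hμ', h2⟩, rfl⟩ with h3 | h3
          · exact h3
          · rcases hw a with h4 | h4
            · exact h4.trans e
            · rw [e] at h4; exact absurd h4 (F.pref_asymm h3)
        · exact h2 p hp
    obtain ⟨b, hb⟩ := SerialFrom.exists_mem h (hall a)
    have h1 := key _ _ _ h (fun p hp => hp) (by simp) _ hb
    have h2 : μ a = b := hb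
    simp only at h1
    rw [h1, h2] at ha
    exact F.pref_irrefl _ _ ha

/-! ### States of the algorithm -/

/-- A state of the algorithm: in the configuration `χ` the agent at the center is fixed to the
object `e`, on branch `i` the agents at `obj i 1, …, obj i (s i)` are fixed to
`obj i (d i 1), …, obj i (d i (s i))`, and no other agent is fixed. The number `d i 0` is the
coordinate of `e` on branch `i`, so that the agent at the center can be treated as an agent at
`obj i 0` on every branch. -/
structure State (L : StarLabelling F.graph) (χ : A ≃ B) (τ : Set (A × B)) (s : Fin L.m → ℕ)
    (d : Fin L.m → ℕ → ℕ) (e : B) : Prop where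
  s_le : ∀ i, s i ≤ L.len i
  d_zero : ∀ i, d i 0 = L.pos i e
  d_one : ∀ i t, 1 ≤ t → t ≤ s i → 1 ≤ d i t
  d_le : ∀ i t, 1 ≤ t → t ≤ s i → d i t ≤ L.len i
  d_lt : ∀ i t t', 1 ≤ t → t < t' → t' ≤ s i → d i t < d i t'
  mem_iff : ∀ p, p ∈ τ ↔ p = (χ.symm L.center, e) ∨
    ∃ i t, 1 ≤ t ∧ t ≤ s i ∧ p = (χ.symm (L.obj i t), L.obj i (d i t))

namespace State

variable {χ : A ≃ B} {τ : Set (A × B)} {s : Fin L.m → ℕ} {d : Fin L.m → ℕ → ℕ} {e : B}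

theorem realizes_iff (S : State L χ τ s d e) (μ : A ≃ B) :
    (∀ p ∈ τ, μ p.1 = p.2) ↔ μ (χ.symm L.center) = e ∧
      ∀ i t, 1 ≤ t → t ≤ s i → μ (χ.symm (L.obj i t)) = L.obj i (d i t) := by
  constructor
  · intro h
    exact ⟨h (χ.symm L.center, e) ((S.mem_iff _).2 (Or.inl rfl)), fun i t h1 h2 =>
      h (χ.symm (L.obj i t), L.obj i (d i t)) ((S.mem_iff _).2 (Or.inr ⟨i, t, h1, h2, rfl⟩))⟩
  · rintro ⟨h1, h2⟩ p hp
    rcases (S.mem_iff p).1 hp with rfl | ⟨i, t, h3, h4, rfl⟩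
    · exact h1
    · exact h2 i t h3 h4

theorem pos_eq (S : State L χ τ s d e) {μ : A ≃ B} (h : ∀ p ∈ τ, μ p.1 = p.2) (i : Fin L.m) :
    ∀ t ≤ s i, L.pos i (μ (χ.symm (L.obj i t))) = d i t := by
  obtain ⟨h1, h2⟩ := (S.realizes_iff μ).1 h
  intro t ht
  rcases Nat.eq_zero_or_pos t with rfl | h0
  · rw [L.obj_zero, h1, S.d_zero]
  · rw [h2 i t h0 ht, L.pos_obj i (S.d_le i t h0 ht)]

theorem not_mem_of_lt (S : State L χ τ s d e) {i : Fin L.m} {t : ℕ} (h1 : s i < t)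
    (h2 : t ≤ L.len i) (b : B) : (χ.symm (L.obj i t), b) ∉ τ := by
  intro h
  rcases (S.mem_iff _).1 h with h | ⟨i', t', h3, h4, h⟩
  · have := χ.symm.injective (Prod.mk.inj h).1
    exact L.obj_ne i t (by omega) h2 this
  · have := χ.symm.injective (Prod.mk.inj h).1
    obtain ⟨rfl, rfl⟩ := L.obj_inj i t i' t' (by omega) h2 h3 (h4.trans (S.s_le i')) this
    omega

theorem le_d (S : State L χ τ s d e) (i : Fin L.m) : ∀ t ≤ s i, t ≤ d i t := by
  intro t ht
  induction t with
  | zero => omega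
  | succ t ih =>
    rcases Nat.eq_zero_or_pos t with rfl | h0
    · exact S.d_one i 1 le_rfl ht
    · have := ih (by omega); have := S.d_lt i t (t + 1) h0 (by omega) ht; omega

/-- Since agents moving outward do not overtake each other, the agent at the center cannot go
beyond the destinations on a branch. -/
theorem strictMono (S : State L χ τ s d e) (h : (F.ReachAgain χ τ).Nonempty) (i : Fin L.m) :
    ∀ t t', t < t' → t' ≤ s i → d i t < d i t' := by
  intro t t' h1 h2
  rcases Nat.eq_zero_or_pos t with rfl | h0
  · obtain ⟨μ, hμ, hr⟩ := h
    have p0 := S.pos_eq hr i 0 (Nat.zero_le _)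
    have p1 := S.pos_eq hr i t' h2
    have hl := (h2.trans (S.s_le i))
    rw [← p0, ← p1]
    refine F.order_out L hμ ?_ ?_ ?_
    · rw [pos_symm_obj χ (Nat.zero_le _), pos_symm_obj χ hl]; exact h1
    · rw [pos_symm_obj χ (Nat.zero_le _)]; exact Nat.zero_le _
    · rw [pos_symm_obj χ hl, p1]; exact S.le_d i t' h2
  · exact S.d_lt i t t' h0 h1 h2

/-- The condition on a single branch under which the fixed destinations can be realized. -/
def Feasible (L : StarLabelling F.graph) (χ : A ≃ B) (s : Fin L.m → ℕ) (d : Fin L.m → ℕ → ℕ)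
    (i : Fin L.m) : Prop :=
  (∀ t t', t < t' → t' ≤ s i → d i t < d i t') ∧
  (∀ t ≤ s i, LikesOut L i (χ.symm (L.obj i t)) t (d i t)) ∧
  BranchGreedy L i (fun q => χ.symm (L.obj i q)) ((Finset.range (s i + 1)).image (d i))
    (d i (s i)) (s i)

/-- The conditions on the branches are necessary. -/
theorem feasible [Finite A] (S : State L χ τ s d e) (h : (F.ReachAgain χ τ).Nonempty)
    (i : Fin L.m) : Feasible L χ s d i := by
  have hd := S.strictMono h i
  obtain ⟨μ, hμ, hr⟩ := h
  have hp := S.pos_eq hr i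
  refine ⟨hd, fun t ht => ?_, branchGreedy_of_reach hμ (S.s_le i) hd hp⟩
  have := likesOut_of_reach (i := i) hμ (a := χ.symm (L.obj i t))
  rwa [hp t ht, pos_symm_obj χ (ht.trans (S.s_le i))] at this

/-- Branches that the agent at the center does not enter can be completed one after the other. -/
theorem exists_reach_of_feasible (P : Finset (Fin L.m)) (hs : ∀ i, s i ≤ L.len i)
    (h0 : ∀ i ∈ P, d i 0 = 0) (hf : ∀ i ∈ P, Feasible L χ s d i) :
    ∃ χ' ∈ F.Reach χ, (∀ i ∈ P, ∀ t, 1 ≤ t → t ≤ s i →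
        χ' (χ.symm (L.obj i t)) = L.obj i (d i t)) ∧
      ∀ c, (∀ i ∈ P, L.pos i (χ c) = 0) → χ' c = χ c := by
  classical
  induction P using Finset.induction_on with
  | empty => exact ⟨χ, F.mem_reach_refl χ, by simp, fun _ _ => rfl⟩
  | @insert i P hi ih =>
    obtain ⟨χ₁, r1, d1, f1⟩ := ih (fun i hi => h0 i (Finset.mem_insert_of_mem hi))
      (fun i hi => hf i (Finset.mem_insert_of_mem hi))
    have hsame : ∀ q, q ≤ L.len i → χ₁.symm (L.obj i q) = χ.symm (L.obj i q) := by
      intro q hq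
      rw [Equiv.symm_apply_eq, f1]
      · simp
      · intro i' hi'
        rw [Equiv.apply_symm_apply]
        exact L.pos_obj_of_ne (by rintro rfl; exact hi hi') hq
    obtain ⟨g1, g2, g3⟩ := hf i (Finset.mem_insert_self _ _)
    have h0i := h0 i (Finset.mem_insert_self _ _)
    obtain ⟨χ₂, r2, d2, f2⟩ := exists_reach_of_greedy (χ := χ₁) (hs i) g1
      (fun t ht => by rw [hsame t (ht.trans (hs i))]; exact g2 t ht)
      (g3.congr_agents fun q _ hq => (hsame q hq).symm)
    have hcen : χ₂ (χ₁.symm L.center) = L.center := by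
      have := d2 0 (Nat.zero_le _)
      rwa [h0i, L.obj_zero] at this
    have hout : ∀ c, L.pos i (χ₁ c) = 0 → χ₂ c = χ₁ c := by
      intro c hc
      by_cases hcc : c = χ₁.symm L.center
      · rw [hcc, hcen]; simp
      · exact f2 c hc hcc
    refine ⟨χ₂, reach_trans r1 r2, ?_, ?_⟩
    · intro i' hi' t ht1 ht2
      rcases Finset.mem_insert.1 hi' with rfl | hi'
      · rw [← hsame t (ht2.trans (hs i'))]; exact d2 t ht2
      · have e := d1 i' hi' t ht1 ht2
        rw [hout, e]
        rw [e]
        refine L.pos_obj_of_ne (by rintro rfl; exact hi hi') ?_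
        exact ((hf i' (Finset.mem_insert_of_mem hi')).2.1 t ht2).1
    · intro c hc
      have e1 := f1 c fun i' hi' => hc i' (Finset.mem_insert_of_mem hi')
      rw [hout c (by rw [e1]; exact hc i (Finset.mem_insert_self _ _)), e1]

/-- The fixed destinations can be realized if and only if the greedy procedure succeeds on every
branch. -/
theorem nonempty_iff [Finite A] (S : State L χ τ s d e) :
    (F.ReachAgain χ τ).Nonempty ↔ ∀ i, Feasible L χ s d i := by
  classical
  refine ⟨S.feasible, fun h => ?_⟩
  by_cases he : e = L.center
  · have h0 : ∀ i, d i 0 = 0 := fun i => by rw [S.d_zero, he, L.pos_center]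
    obtain ⟨χ', h1, h2, h3⟩ := exists_reach_of_feasible Finset.univ S.s_le (fun i _ => h0 i)
      (fun i _ => h i)
    refine ⟨χ', h1, (S.realizes_iff χ').2 ⟨?_, fun i t => h2 i (Finset.mem_univ _) t⟩⟩
    rw [h3, Equiv.apply_symm_apply, he]
    intro i _
    rw [Equiv.apply_symm_apply, L.pos_center]
  -- first the branch that the agent at the center is to enter; afterwards the center is left alone
  · obtain ⟨i, hi⟩ := L.exists_pos_ne_zero he
    obtain ⟨g1, g2, g3⟩ := h i
    obtain ⟨χ₁, r1, d1, f1⟩ := exists_reach_of_greedy (S.s_le i) g1 g2 g3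
    have hsame : ∀ i' q, i' ≠ i → 1 ≤ q → q ≤ L.len i' →
        χ₁.symm (L.obj i' q) = χ.symm (L.obj i' q) := by
      intro i' q hi' hq1 hq
      rw [Equiv.symm_apply_eq, f1]
      · simp
      · rw [Equiv.apply_symm_apply]
        exact L.pos_obj_of_ne hi'.symm hq
      · intro e
        exact L.obj_ne i' q hq1 hq (χ.symm.injective e)
    have h0 : ∀ i', i' ≠ i → d i' 0 = 0 := fun i' hi' => by
      rw [S.d_zero]; exact L.pos_eq_zero_of_ne hi' hi
    obtain ⟨χ₂, r2, d2, f2⟩ := exists_reach_of_feasible (χ := χ₁) (Finset.univ.erase i) S.s_le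
      (d := d) (fun i' hi' => h0 i' (Finset.ne_of_mem_erase hi')) (by
        intro i' hi'
        have hne := Finset.ne_of_mem_erase hi'
        obtain ⟨k1, k2, k3⟩ := h i'
        refine ⟨k1, fun t ht => ?_, k3.congr_agents fun q hq1 hq => ?_⟩
        · rcases Nat.eq_zero_or_pos t with rfl | ht0
          · rw [h0 i' hne]; exact ⟨Nat.zero_le _, fun j h h' => by omega⟩
          · rw [hsame i' t hne ht0 (ht.trans (S.s_le i'))]; exact k2 t ht
        · exact (hsame i' q hne (by omega) hq).symm)
    have hbranch : ∀ c j, j ≤ L.len i → χ₁ c = L.obj i j → χ₂ c = χ₁ c := by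
      intro c j hj hc
      refine f2 c fun i' hi' => ?_
      rw [hc]
      exact L.pos_obj_of_ne (Finset.ne_of_mem_erase hi') hj
    refine ⟨χ₂, reach_trans r1 r2, (S.realizes_iff χ₂).2 ⟨?_, ?_⟩⟩
    · have e1 := d1 0 (Nat.zero_le _)
      rw [L.obj_zero, S.d_zero] at e1
      rw [hbranch _ _ (L.pos_le i e) e1, e1, L.obj_pos hi]
    · intro i' t ht1 ht2
      by_cases hi' : i' = i
      · subst hi'
        have e1 := d1 t ht2
        rw [hbranch _ _ (S.d_le i' t ht1 ht2) e1, e1]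
      · rw [← hsame i' t hi' ht1 (ht2.trans (S.s_le i'))]
        exact d2 i' (Finset.mem_erase.2 ⟨hi', Finset.mem_univ _⟩) t ht1 ht2

/-! ### The lists of destinations -/

/-- The list of destinations on branch `i`. -/
def dests (s : Fin L.m → ℕ) (d : Fin L.m → ℕ → ℕ) (i : Fin L.m) : List ℕ :=
  (List.range (s i)).map fun t => d i (t + 1)

theorem isDests (S : State L χ τ s d e) (i : Fin L.m) : IsDests L χ τ i (dests s d i) := by
  refine ⟨?_, ?_, ?_, ?_⟩
  · rw [dests, List.pairwise_map, List.pairwise_iff_getElem]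
    intro a b ha hb hab
    simp only [List.length_range] at ha hb
    simp only [List.getElem_range]
    exact S.d_lt i _ _ (by omega) (by omega) (by omega)
  · intro j hj
    simp only [dests, List.mem_map, List.mem_range] at hj
    obtain ⟨t, ht, rfl⟩ := hj
    exact ⟨S.d_one i _ (by omega) (by omega), S.d_le i _ (by omega) (by omega)⟩
  · intro t ht
    simp only [dests, List.length_map, List.length_range] at ht
    simp only [dests, List.getElem_map, List.getElem_range]
    exact (S.mem_iff _).2 (Or.inr ⟨i, t + 1, by omega, by omega, rfl⟩)
  · intro t ht1 ht2 b
    simp only [dests, List.length_map, List.length_range] at ht1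
    exact S.not_mem_of_lt ht1 ht2 b

theorem length_of_isDests (S : State L χ τ s d e) {i : Fin L.m} {js : List ℕ}
    (h : IsDests L χ τ i js) : js.length = s i := by
  obtain ⟨h1, h2, h3, h4⟩ := h
  have hlen : js.length ≤ L.len i := by
    have hnd : js.Nodup := h1.imp fun h => h.ne
    have := (List.subperm_of_subset hnd (l₂ := List.range' 1 (L.len i)) fun j hj => by
      have := h2 j hj
      rw [List.mem_range'_1]; omega).length_le
    simpa using this
  apply le_antisymm
  · by_contra hlt
    exact S.not_mem_of_lt (i := i) (t := s i + 1) (by omega) (by omega) _ (h3 (s i) (by omega))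
  · by_contra hlt
    exact h4 (s i) (by omega) (S.s_le i) _
      ((S.mem_iff _).2 (Or.inr ⟨i, s i, by omega, le_rfl, rfl⟩))

end State

variable {A B : Type*} {F : OAF A B} {L : StarLabelling F.graph}

namespace State

variable {χ χ' : A ≃ B} {τ : Set (A × B)} {s : Fin L.m → ℕ} {d : Fin L.m → ℕ → ℕ} {e : B}
  {i : Fin L.m}

/-! ### Transitions between states -/

/-- The destinations after the agent next in line on branch `i` has been fixed to `obj i k`. -/
noncomputable def pushDest (s : Fin L.m → ℕ) (d : Fin L.m → ℕ → ℕ) (i : Fin L.m) (k : ℕ) : Fin L.m → ℕ → ℕ :=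
  Function.update d i (Function.update (d i) (s i + 1) k)

/-- The destinations after the agent next in line on branch `i` has been moved to the center and
fixed to `b`: the agent previously at the center becomes the first agent on the branch. -/
noncomputable def centerDest (L : StarLabelling F.graph) (d : Fin L.m → ℕ → ℕ) (i : Fin L.m) (b : B) :
    Fin L.m → ℕ → ℕ :=
  fun i' t => if t = 0 then L.pos i' b else if i' = i then d i (t - 1) else d i' t

theorem pushDest_self {k t : ℕ} (ht : t ≤ s i) : pushDest s d i k i t = d i t := by
  simp [pushDest, Function.update_of_ne (show t ≠ s i + 1 by omega)]

theorem pushDest_last {k : ℕ} : pushDest s d i k i (s i + 1) = k := by simp [pushDest]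

theorem pushDest_ne {k : ℕ} {i' : Fin L.m} (h : i' ≠ i) : pushDest s d i k i' = d i' := by
  simp [pushDest, h]

/-- The state after the agent next in line on branch `i` has been fixed to `obj i k`. -/
theorem push (S : State L χ τ s d e) (hs : s i < L.len i) {k : ℕ} (hk : d i (s i) < k)
    (hk' : k ≤ L.len i) :
    State L χ (insert (χ.symm (L.obj i (s i + 1)), L.obj i k) τ)
      (Function.update s i (s i + 1)) (pushDest s d i k) e := by
  have hself : ∀ t ≤ s i, pushDest s d i k i t = d i t := fun t ht => pushDest_self ht
  refine ⟨?_, ?_, ?_, ?_, ?_, ?_⟩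
  · intro i'
    by_cases h : i' = i
    · subst h; simpa using hs
    · simpa [h] using S.s_le i'
  · intro i'
    by_cases h : i' = i
    · subst h; rw [hself 0 (Nat.zero_le _), S.d_zero]
    · rw [pushDest_ne h, S.d_zero]
  · intro i' t h1 h2
    by_cases h : i' = i
    · subst h
      rw [Function.update_self] at h2
      rcases Nat.lt_or_ge (s i') t with h3 | h3
      · obtain rfl : t = s i' + 1 := by omega
        rw [pushDest_last]; omega
      · rw [hself t h3]; exact S.d_one i' t h1 h3
    · rw [Function.update_of_ne h] at h2
      rw [pushDest_ne h]; exact S.d_one i' t h1 h2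
  · intro i' t h1 h2
    by_cases h : i' = i
    · subst h
      rw [Function.update_self] at h2
      rcases Nat.lt_or_ge (s i') t with h3 | h3
      · obtain rfl : t = s i' + 1 := by omega
        rw [pushDest_last]; exact hk'
      · rw [hself t h3]; exact S.d_le i' t h1 h3
    · rw [Function.update_of_ne h] at h2
      rw [pushDest_ne h]; exact S.d_le i' t h1 h2
  · intro i' t t' h1 h2 h3
    by_cases h : i' = i
    · subst h
      rw [Function.update_self] at h3
      rcases Nat.lt_or_ge (s i') t' with h4 | h4
      · obtain rfl : t' = s i' + 1 := by omega
        rw [pushDest_last, hself t (by omega)]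
        rcases Nat.lt_or_ge t (s i') with h5 | h5
        · exact (S.d_lt i' t (s i') h1 h5 le_rfl).trans hk
        · rwa [show t = s i' by omega]
      · rw [hself t (by omega), hself t' h4]; exact S.d_lt i' t t' h1 h2 h4
    · rw [Function.update_of_ne h] at h3
      rw [pushDest_ne h]; exact S.d_lt i' t t' h1 h2 h3
  · intro p
    rw [Set.mem_insert_iff, S.mem_iff]
    constructor
    · rintro (rfl | rfl | ⟨i', t, h1, h2, rfl⟩)
      · exact Or.inr ⟨i, s i + 1, by omega, by simp, by rw [pushDest_last]⟩
      · exact Or.inl rfl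
      · right
        by_cases h : i' = i
        · subst h
          exact ⟨i', t, h1, by simp; omega, by rw [hself t h2]⟩
        · exact ⟨i', t, h1, by simpa [h] using h2, by rw [pushDest_ne h]⟩
    · rintro (rfl | ⟨i', t, h1, h2, rfl⟩)
      · exact Or.inr (Or.inl rfl)
      · by_cases h : i' = i
        · subst h
          rw [Function.update_self] at h2
          rcases Nat.lt_or_ge (s i') t with h3 | h3
          · obtain rfl : t = s i' + 1 := by omega
            left; rw [pushDest_last]
          · right; right; exact ⟨i', t, h1, h3, by rw [hself t h3]⟩
        · rw [Function.update_of_ne h] at h2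
          right; right; exact ⟨i', t, h1, h2, by rw [pushDest_ne h]⟩

theorem centerDest_zero {b : B} {i' : Fin L.m} : centerDest L d i b i' 0 = L.pos i' b := by
  simp [centerDest]

theorem centerDest_succ {b : B} {t : ℕ} : centerDest L d i b i (t + 1) = d i t := by
  simp [centerDest]

theorem centerDest_ne {b : B} {i' : Fin L.m} (h : i' ≠ i) {t : ℕ} (ht : 1 ≤ t) :
    centerDest L d i b i' t = d i' t := by
  simp [centerDest, h, show t ≠ 0 by omega]

/-- The state after the agent next in line on branch `i` has moved to the center and been fixed to `b`. -/
theorem moveCenter (S : State L χ τ s d e) (hs : s i < L.len i) (h0 : 0 < d i 0)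
    (hd : ∀ t t', t < t' → t' ≤ s i → d i t < d i t') (hm : IsMove L i (s i + 1) 0 χ χ') (b : B) :
    State L χ' (insert (χ.symm (L.obj i (s i + 1)), b) τ) (Function.update s i (s i + 1))
      (centerDest L d i b) b := by
  obtain ⟨m1, m2, m3⟩ := hm.symm_obj hs
  rw [L.obj_zero] at m1
  have he : L.obj i (d i 0) = e := by
    rw [S.d_zero] at h0 ⊢; exact L.obj_pos (by omega)
  have hc : χ'.symm (L.obj i 1) = χ.symm L.center := by
    rw [← L.obj_zero i]; exact m2 0 le_rfl (by omega)
  have dpos : ∀ t ≤ s i, 0 < d i t := by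
    intro t ht
    rcases Nat.eq_zero_or_pos t with rfl | h
    · exact h0
    · exact S.d_one i t h ht
  have dle : ∀ t ≤ s i, d i t ≤ L.len i := by
    intro t ht
    rcases Nat.eq_zero_or_pos t with rfl | h
    · rw [S.d_zero]; exact L.pos_le _ _
    · exact S.d_le i t h ht
  have hother : ∀ i' t, i' ≠ i → 1 ≤ t → t ≤ L.len i' →
      χ'.symm (L.obj i' t) = χ.symm (L.obj i' t) := by
    intro i' t hi h1 h2
    rw [Equiv.symm_apply_eq, hm.apply_of_pos_zero hs]
    · simp
    · rw [Equiv.apply_symm_apply]; exact L.pos_obj_of_ne hi.symm h2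
    · intro e'; exact L.obj_ne i' t h1 h2 (χ.symm.injective e')
  refine ⟨?_, ?_, ?_, ?_, ?_, ?_⟩
  · intro i'
    by_cases h : i' = i
    · subst h; simpa using hs
    · simpa [h] using S.s_le i'
  · intro i'; exact centerDest_zero
  · intro i' t h1 h2
    obtain ⟨u, rfl⟩ : ∃ u, t = u + 1 := ⟨t - 1, by omega⟩
    by_cases h : i' = i
    · subst h
      rw [Function.update_self] at h2
      rw [centerDest_succ]; exact dpos u (by omega)
    · rw [Function.update_of_ne h] at h2
      rw [centerDest_ne h h1]; exact S.d_one i' _ h1 h2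
  · intro i' t h1 h2
    obtain ⟨u, rfl⟩ : ∃ u, t = u + 1 := ⟨t - 1, by omega⟩
    by_cases h : i' = i
    · subst h
      rw [Function.update_self] at h2
      rw [centerDest_succ]; exact dle u (by omega)
    · rw [Function.update_of_ne h] at h2
      rw [centerDest_ne h h1]; exact S.d_le i' _ h1 h2
  · intro i' t t' h1 h2 h3
    by_cases h : i' = i
    · subst h
      rw [Function.update_self] at h3
      obtain ⟨u, rfl⟩ : ∃ u, t = u + 1 := ⟨t - 1, by omega⟩
      obtain ⟨w, rfl⟩ : ∃ w, t' = w + 1 := ⟨t' - 1, by omega⟩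
      rw [centerDest_succ, centerDest_succ]; exact hd u w (by omega) (by omega)
    · rw [Function.update_of_ne h] at h3
      rw [centerDest_ne h h1, centerDest_ne h (by omega)]; exact S.d_lt i' t t' h1 h2 h3
  · intro p
    rw [Set.mem_insert_iff, S.mem_iff, m1]
    refine or_congr Iff.rfl ?_
    constructor
    · rintro (rfl | ⟨i', t, h1, h2, rfl⟩)
      · exact ⟨i, 1, le_rfl, by simp, by rw [hc, centerDest_succ, he]⟩
      · by_cases h : i' = i
        · subst h
          exact ⟨i', t + 1, by omega, by simp; omega,
            by rw [centerDest_succ, m2 t (Nat.zero_le _) (by omega)]⟩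
        · exact ⟨i', t, h1, by simpa [h] using h2, by
            rw [centerDest_ne h h1, hother i' t h h1 (h2.trans (S.s_le i'))]⟩
    · rintro ⟨i', t, h1, h2, rfl⟩
      by_cases h : i' = i
      · subst h
        rw [Function.update_self] at h2
        obtain ⟨u, rfl⟩ : ∃ u, t = u + 1 := ⟨t - 1, by omega⟩
        rw [centerDest_succ, m2 u (Nat.zero_le _) (by omega)]
        rcases Nat.eq_zero_or_pos u with rfl | h3
        · left; rw [he, L.obj_zero]
        · right; exact ⟨i', u, h3, by omega, rfl⟩
      · rw [Function.update_of_ne h] at h2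
        right
        exact ⟨i', t, h1, h2, by
          rw [centerDest_ne h h1, hother i' t h h1 (h2.trans (S.s_le i'))]⟩

/-- The state after the agent next in line has moved inward to the first free vertex `r` and been fixed
there. -/
theorem moveIn (S : State L χ τ s d e) (hs : s i < L.len i)
    (hd : ∀ t t', t < t' → t' ≤ s i → d i t < d i t') {r : ℕ} (hr : 1 ≤ r) (hrs : r ≤ s i + 1)
    (hfill : ∀ x < r, ∃ t < s i + 1, d i t = x) (hfree : ∀ t < s i + 1, d i t ≠ r)
    (hm : IsMove L i (s i + 1) r χ χ') :
    State L χ' (insert (χ.symm (L.obj i (s i + 1)), L.obj i r) τ)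
      (Function.update s i (s i + 1)) (Function.update d i (insertDest (d i) r)) e := by
  obtain ⟨m1, m2, m3⟩ := hm.symm_obj hs
  have hc : χ'.symm L.center = χ.symm L.center := by
    rw [← L.obj_zero i]; exact m3 0 (Nat.zero_le _) (Or.inl hr)
  have hmono := insertDest_strictMono (fun t t' h h' => hd t t' h (by omega)) hfill hfree
  have hother : ∀ i' t, i' ≠ i → 1 ≤ t → t ≤ L.len i' →
      χ'.symm (L.obj i' t) = χ.symm (L.obj i' t) := by
    intro i' t hi h1 h2
    rw [Equiv.symm_apply_eq, hm.apply_of_pos_zero hs]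
    · simp
    · rw [Equiv.apply_symm_apply]; exact L.pos_obj_of_ne hi.symm h2
    · intro e'; exact L.obj_ne i' t h1 h2 (χ.symm.injective e')
  refine ⟨?_, ?_, ?_, ?_, ?_, ?_⟩
  · intro i'
    by_cases h : i' = i
    · subst h; simpa using hs
    · simpa [h] using S.s_le i'
  · intro i'
    by_cases h : i' = i
    · subst h; rw [Function.update_self, insertDest_lt hr, S.d_zero]
    · rw [Function.update_of_ne h, S.d_zero]
  · intro i' t h1 h2
    by_cases h : i' = i
    · subst h
      rw [Function.update_self] at h2 ⊢
      have := hmono 0 t (by omega) (by omega); omega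
    · rw [Function.update_of_ne h] at h2 ⊢
      exact S.d_one i' t h1 h2
  · intro i' t h1 h2
    by_cases h : i' = i
    · subst h
      rw [Function.update_self] at h2 ⊢
      rcases (insertDest_image hrs _).1 ⟨t, by omega, rfl⟩ with h3 | ⟨u, h3, h4⟩
      · rw [h3]; omega
      · rw [← h4]
        rcases Nat.eq_zero_or_pos u with rfl | h5
        · rw [S.d_zero]; exact L.pos_le _ _
        · exact S.d_le i' u h5 (by omega)
    · rw [Function.update_of_ne h] at h2 ⊢
      exact S.d_le i' t h1 h2
  · intro i' t t' h1 h2 h3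
    by_cases h : i' = i
    · subst h
      rw [Function.update_self] at h3 ⊢
      exact hmono t t' h2 (by omega)
    · rw [Function.update_of_ne h] at h3 ⊢
      exact S.d_lt i' t t' h1 h2 h3
  · intro p
    rw [Set.mem_insert_iff, S.mem_iff, hc]
    constructor
    · rintro (rfl | rfl | ⟨i', t, h1, h2, rfl⟩)
      · exact Or.inr ⟨i, r, hr, by simpa using hrs, by
          rw [Function.update_self, m1, insertDest_self]⟩
      · exact Or.inl rfl
      · right
        by_cases h : i' = i
        · subst h
          rcases Nat.lt_or_ge t r with h3 | h3
          · exact ⟨i', t, h1, by simp; omega, by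
              rw [Function.update_self, insertDest_lt h3, m3 t (h2.trans (S.s_le i')) (Or.inl h3)]⟩
          · exact ⟨i', t + 1, by omega, by simp; omega, by
              rw [Function.update_self, insertDest_succ h3, m2 t h3 (by omega)]⟩
        · exact ⟨i', t, h1, by simpa [h] using h2, by
            rw [Function.update_of_ne h, hother i' t h h1 (h2.trans (S.s_le i'))]⟩
    · rintro (rfl | ⟨i', t, h1, h2, rfl⟩)
      · exact Or.inr (Or.inl rfl)
      · by_cases h : i' = i
        · subst h
          rw [Function.update_self] at h2 ⊢
          rcases Nat.lt_trichotomy t r with h3 | rfl | h3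
          · right; right
            exact ⟨i', t, h1, by omega, by
              rw [insertDest_lt h3, m3 t (by omega) (Or.inl h3)]⟩
          · left; rw [m1, insertDest_self]
          · obtain ⟨u, rfl⟩ : ∃ u, t = u + 1 := ⟨t - 1, by omega⟩
            right; right
            exact ⟨i', u, by omega, by omega, by
              rw [insertDest_succ (by omega), m2 u (by omega) (by omega)]⟩
        · rw [Function.update_of_ne h] at h2 ⊢
          right; right
          exact ⟨i', t, h1, h2, by rw [hother i' t h h1 (h2.trans (S.s_le i'))]⟩

/-! ### The dictator of an iteration of the first phase -/

/-- An agent that has moved to the center does not go back to the branch from which it came. -/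
theorem pos_eq_zero_of_move {μ : A ≃ B} (hm : IsMove L i (s i + 1) 0 χ χ')
    (hl : LikesIn L i (χ.symm (L.obj i (s i + 1))) (s i + 1) 0) (hμ : μ ∈ F.Reach χ') :
    L.pos i (μ (χ.symm (L.obj i (s i + 1)))) = 0 := by
  by_contra h
  have h1 : F.pref (χ.symm (L.obj i (s i + 1))) (L.obj i (0 + 1)) (L.obj i 0) := by
    refine F.chain_out L hμ ?_ (by omega)
    rw [hm.mover, L.pos_obj i (Nat.zero_le _)]
  exact F.pref_asymm h1 (hl 0 le_rfl (by omega))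

section Next

variable (S : State L χ τ s d e) (hne : (F.ReachAgain χ τ).Nonempty)

include S hne

/-- If the agent at the center has to enter branch `i`, some agent on the branch is not fixed, since the
agents fixed so far have to make room. -/
theorem lt_len (h0 : 0 < d i 0) : s i < L.len i := by
  have hd := S.strictMono hne i
  by_contra hlt
  have hs := S.s_le i
  have h1 : ∀ t ≤ s i, t + 1 ≤ d i t := by
    intro t ht
    induction t with
    | zero => exact h0
    | succ t ih => have := ih (by omega); have := hd t (t + 1) (by omega) ht; omega
  have h2 := h1 (s i) le_rfl
  rcases Nat.eq_zero_or_pos (s i) with h3 | h3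
  · have := L.len_pos i; omega
  · have := S.d_le i (s i) h3 le_rfl; omega

theorem lt_dest (h0 : 0 < d i 0) : ∀ t ≤ s i, t < d i t := by
  have hd := S.strictMono hne i
  intro t ht
  induction t with
  | zero => exact h0
  | succ t ih => have := ih (by omega); have := hd t (t + 1) (by omega) ht; omega

/-- An agent that is next in line and is not moved inward ends beyond all the destinations. -/
theorem dest_lt_pos {μ : A ≃ B} (hμ : μ ∈ F.ReachAgain χ τ) (hs : s i < L.len i)
    (h : s i + 1 ≤ L.pos i (μ (χ.symm (L.obj i (s i + 1))))) :
    d i (s i) < L.pos i (μ (χ.symm (L.obj i (s i + 1)))) := by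
  have hd := S.strictMono hne i
  rw [← S.pos_eq hμ.2 i (s i) le_rfl]
  refine F.order_out L hμ.1 ?_ ?_ ?_
  · rw [pos_symm_obj χ hs.le, pos_symm_obj χ hs]; omega
  · rw [pos_symm_obj χ hs.le, S.pos_eq hμ.2 i (s i) le_rfl]
    exact strictMono_le hd _ le_rfl
  · rwa [pos_symm_obj χ hs]

/-- An agent that is next in line and is moved inward ends at most at the first free vertex. -/
theorem pos_le_free [Finite A] {μ : A ≃ B} (hμ : μ ∈ F.ReachAgain χ τ) (hs : s i < L.len i) {r : ℕ}
    (hr : r ≤ d i (s i)) (hfill : ∀ x < r, ∃ t < s i + 1, d i t = x)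
    (hfree : ∀ t < s i + 1, d i t ≠ r)
    (h : L.pos i (μ (χ.symm (L.obj i (s i + 1)))) ≤ s i + 1) :
    L.pos i (μ (χ.symm (L.obj i (s i + 1)))) ≤ r := by
  have hd := S.strictMono hne i
  refine pos_le_of_inward hμ.1 hd (S.pos_eq hμ.2 i) (Nat.lt_succ_self _) hs h hr ?_
  have h1 : (Finset.Ioo (s i) (s i).succ) = ∅ := by
    ext x; simp only [Finset.mem_Ioo, Finset.notMem_empty, iff_false]; omega
  rw [h1, Finset.filter_empty, Finset.card_empty, Nat.add_zero]
  have hd' : ∀ t t', t < t' → t' < s i + 1 → d i t < d i t' := fun t t' h h' => hd t t' h (by omega)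
  have h2 := lt_dest_of_free hd' hfill hfree
  calc _ ≤ (Finset.range r).card := by
        refine Finset.card_le_card fun t ht => ?_
        simp only [Finset.mem_filter, Finset.mem_range] at ht ⊢
        by_contra hlt
        have := h2 t (by omega) ht.1
        omega
    _ = r := Finset.card_range r

/-- If the agent at the center has to enter branch `i`, then the agent next in line leaves the branch or
ends beyond all the destinations. -/
theorem pos_cases [Finite A] {μ : A ≃ B} (hμ : μ ∈ F.ReachAgain χ τ) (h0 : 0 < d i 0) :
    L.pos i (μ (χ.symm (L.obj i (s i + 1)))) = 0 ∨
      (s i + 1 < L.pos i (μ (χ.symm (L.obj i (s i + 1)))) ∧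
        d i (s i) < L.pos i (μ (χ.symm (L.obj i (s i + 1))))) := by
  have hs := S.lt_len hne h0
  have hlt := S.lt_dest hne h0
  rcases Nat.lt_or_ge (s i + 1) (L.pos i (μ (χ.symm (L.obj i (s i + 1))))) with h | h
  · exact Or.inr ⟨h, S.dest_lt_pos hne hμ hs h.le⟩
  · left
    have := S.pos_le_free hne hμ hs (r := 0) (Nat.zero_le _) (fun x hx => by omega)
      (fun t ht h => by have := hlt t (by omega); omega) h
    omega

/-- If the agent next in line ends at or below the first free vertex `r`, it may be moved to `obj i r`
right away, since all agents that it passes have to go outward. -/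
theorem reach_move {μ : A ≃ B} (hμ : μ ∈ F.ReachAgain χ τ) (hs : s i < L.len i) {r : ℕ}
    (hr : r ≤ s i + 1) (hfill : ∀ x < r, ∃ t < s i + 1, d i t = x)
    (hfree : ∀ t < s i + 1, d i t ≠ r) (hm : IsMove L i (s i + 1) r χ χ')
    (h : L.pos i (μ (χ.symm (L.obj i (s i + 1)))) ≤ r) :
    LikesIn L i (χ.symm (L.obj i (s i + 1))) (s i + 1) r ∧ μ ∈ F.ReachAgain χ' τ := by
  have hd := S.strictMono hne i
  have h2 := lt_dest_of_free (fun t t' h h' => hd t t' h (by omega)) hfill hfree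
  refine ⟨?_, hm.reach_of_reach hs hr hμ.1 h fun t h3 h4 => ?_, hμ.2⟩
  · have := likesIn_of_reach (i := i) hμ.1 h
    rwa [pos_symm_obj χ hs] at this
  · rw [S.pos_eq hμ.2 i t (by omega)]
    exact h2 t h3 h4

theorem move_mem_reach [Finite A] (hs : s i < L.len i) {r : ℕ} (hr : r ≤ s i + 1)
    (hfill : ∀ x < r, ∃ t < s i + 1, d i t = x) (hfree : ∀ t < s i + 1, d i t ≠ r)
    (hm : IsMove L i (s i + 1) r χ χ')
    (hl : LikesIn L i (χ.symm (L.obj i (s i + 1))) (s i + 1) r) : χ' ∈ F.Reach χ := by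
  have hd := S.strictMono hne i
  have h2 := lt_dest_of_free (fun t t' h h' => hd t t' h (by omega)) hfill hfree
  refine hm.mem_reach hs hr fun t h3 h4 => ⟨hl t h3 h4, ?_⟩
  exact ((S.feasible hne i).2.1 t (by omega)).2 t le_rfl (h2 t h3 h4)

theorem reachAgain_move [Finite A] (hs : s i < L.len i) {r : ℕ} (hr : r ≤ s i + 1)
    (hfill : ∀ x < r, ∃ t < s i + 1, d i t = x) (hfree : ∀ t < s i + 1, d i t ≠ r)
    (hm : IsMove L i (s i + 1) r χ χ')
    (hl : LikesIn L i (χ.symm (L.obj i (s i + 1))) (s i + 1) r) {b : B} (hb : L.pos i b ≤ r) :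
    F.ReachAgain χ' (insert (χ.symm (L.obj i (s i + 1)), b) τ) =
      F.ReachAgain χ (insert (χ.symm (L.obj i (s i + 1)), b) τ) := by
  ext μ
  rw [mem_reachAgain_insert, mem_reachAgain_insert]
  constructor
  · rintro ⟨⟨h1, h2⟩, h3⟩
    exact ⟨⟨reach_trans (S.move_mem_reach hne hs hr hfill hfree hm hl) h1, h2⟩, h3⟩
  · rintro ⟨h1, h3⟩
    exact ⟨(S.reach_move hne h1 hs hr hfill hfree hm (by rw [h3]; exact hb)).2, h3⟩

/-- If the agent next in line likes to go to the center, it can stay there. -/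
theorem nonempty_move [Finite A] (h0 : 0 < d i 0) (hm : IsMove L i (s i + 1) 0 χ χ')
    (hl : LikesIn L i (χ.symm (L.obj i (s i + 1))) (s i + 1) 0) :
    (F.ReachAgain χ' (insert (χ.symm (L.obj i (s i + 1)), L.center) τ)).Nonempty := by
  have hs := S.lt_len hne h0
  have hd := S.strictMono hne i
  have hlt := S.lt_dest hne h0
  obtain ⟨m1, m2, m3⟩ := hm.symm_obj hs
  have he : e ≠ L.center := by
    rintro rfl
    rw [S.d_zero, L.pos_center] at h0; omega
  refine (S.moveCenter hs h0 hd hm L.center).nonempty_iff.2 fun i' => ?_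
  obtain ⟨f1, f2, f3⟩ := S.feasible hne i'
  by_cases hi : i' = i
  -- on branch `i`, the procedure sends the agent inward to the center, which is free
  · subst hi
    unfold Feasible
    rw [Function.update_self]
    refine ⟨?_, ?_, ?_⟩
    · intro t t' h1 h2
      obtain ⟨w, rfl⟩ : ∃ w, t' = w + 1 := ⟨t' - 1, by omega⟩
      rw [centerDest_succ]
      rcases Nat.eq_zero_or_pos t with rfl | h3
      · rw [centerDest_zero, L.pos_center]
        have := hlt w (by omega); omega
      · obtain ⟨u, rfl⟩ : ∃ u, t = u + 1 := ⟨t - 1, by omega⟩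
        rw [centerDest_succ]
        exact hd u w (by omega) (by omega)
    · intro t ht
      rcases Nat.eq_zero_or_pos t with rfl | h3
      · rw [centerDest_zero, L.pos_center]
        exact ⟨Nat.zero_le _, fun j h h' => by omega⟩
      · obtain ⟨u, rfl⟩ : ∃ u, t = u + 1 := ⟨t - 1, by omega⟩
        rw [centerDest_succ, m2 u (Nat.zero_le _) (by omega)]
        exact (f2 u (by omega)).mono (by omega) le_rfl
    · have h1 := Greedy.insert_inward f3 (r := 0) (by
        simp only [Finset.mem_image, Finset.mem_range, not_exists, not_and]
        intro t ht h
        have := hlt t (by omega); omega) (fun x hx => by omega) (Nat.zero_le _) hl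
      have h2 : (Finset.range (s i' + 1 + 1)).image (centerDest L d i' L.center i') =
          insert 0 ((Finset.range (s i' + 1)).image (d i')) := by
        ext x
        simp only [Finset.mem_image, Finset.mem_range, Finset.mem_insert]
        constructor
        · rintro ⟨t, ht, rfl⟩
          rcases Nat.eq_zero_or_pos t with rfl | h3
          · left; rw [centerDest_zero, L.pos_center]
          · obtain ⟨u, rfl⟩ : ∃ u, t = u + 1 := ⟨t - 1, by omega⟩
            right; exact ⟨u, by omega, centerDest_succ.symm⟩
        · rintro (rfl | ⟨u, hu, rfl⟩)
          · exact ⟨0, by omega, by rw [centerDest_zero, L.pos_center]⟩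
          · exact ⟨u + 1, by omega, centerDest_succ⟩
      rw [h2, centerDest_succ]
      exact BranchGreedy.congr_agents (ag := fun q => χ.symm (L.obj i' q)) h1.2
        fun q h3 h4 => (m3 q h4 (Or.inr h3)).symm
  -- nothing changes on the other branches
  · have hother : ∀ t, 1 ≤ t → t ≤ L.len i' → χ'.symm (L.obj i' t) = χ.symm (L.obj i' t) := by
      intro t h1 h2
      rw [Equiv.symm_apply_eq, hm.apply_of_pos_zero hs]
      · simp
      · rw [Equiv.apply_symm_apply]; exact L.pos_obj_of_ne (Ne.symm hi) h2
      · intro e'; exact L.obj_ne i' t h1 h2 (χ.symm.injective e')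
    have hde : centerDest L d i L.center i' = d i' := by
      funext t
      rcases Nat.eq_zero_or_pos t with rfl | h
      · rw [centerDest_zero, L.pos_center, S.d_zero]
        exact (L.pos_eq_zero_of_ne hi (by rw [← S.d_zero]; omega)).symm
      · rw [centerDest_ne hi h]
    unfold Feasible
    rw [Function.update_of_ne hi, hde]
    refine ⟨f1, ?_, f3.congr_agents fun q h1 h2 => (hother q (by omega) h2).symm⟩
    intro t ht
    rcases Nat.eq_zero_or_pos t with rfl | h
    · rw [S.d_zero, L.pos_eq_zero_of_ne hi (b := e) (by rw [← S.d_zero]; omega)]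
      exact ⟨Nat.zero_le _, fun j h h' => by omega⟩
    · rw [hother t h (ht.trans (S.s_le i'))]; exact f2 t ht

/-- Among its possible matches on the branch, the agent next in line prefers those further out. -/
theorem pref_of_possible [Finite A] (h0 : 0 < d i 0) {k j : ℕ} (hj1 : 1 ≤ j) (hjk : j < k)
    (hk : k ≤ L.len i)
    (hpk : F.PossibleMatch χ τ (χ.symm (L.obj i (s i + 1))) (L.obj i k))
    (hpj : F.PossibleMatch χ τ (χ.symm (L.obj i (s i + 1))) (L.obj i j)) :
    F.pref (χ.symm (L.obj i (s i + 1))) (L.obj i k) (L.obj i j) := by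
  have hs := S.lt_len hne h0
  obtain ⟨μ, hμ, e1⟩ := hpk
  obtain ⟨ν, hν, e2⟩ := hpj
  have h1 := S.pos_cases hne hν h0
  rw [e2, L.pos_obj i (by omega)] at h1
  have h2 := likesOut_of_reach (i := i) hμ.1 (a := χ.symm (L.obj i (s i + 1)))
  rw [e1, pos_symm_obj χ hs, L.pos_obj i hk] at h2
  exact h2.pref (by omega) hjk

end Next

end State

variable {A B : Type*} {F : OAF A B} {L : StarLabelling F.graph}

/-! ### The first phase -/

/-- The invariant of the first phase, in terms of states. -/
structure Phase1State (L : StarLabelling F.graph) (μ₀ : A ≃ B) (σ : List A) (χ : A ≃ B)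
    (τ : Set (A × B)) (s : Fin L.m → ℕ) (d : Fin L.m → ℕ → ℕ) (e : B) : Prop where
  state : State L χ τ s d e
  reach : F.ReachAgain χ τ = F.ReachAgain μ₀ τ
  nonempty : (F.ReachAgain χ τ).Nonempty
  serial : F.IsSerial μ₀ σ τ
  nodup : σ.Nodup
  mem : ∀ a, a ∈ σ ↔ ∃ b, (a, b) ∈ τ
  agree : ∀ i q, s i < q → q ≤ L.len i → χ.symm (L.obj i q) = μ₀.symm (L.obj i q)

/-- At the beginning only the agent at the center is matched. -/
theorem State.init {χ : A ≃ B} {d : Fin L.m → ℕ → ℕ} {e : B} (hd : ∀ i, d i 0 = L.pos i e) :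
    State L χ (insert (χ.symm L.center, e) ∅) (fun _ => 0) d e := by
  refine ⟨fun _ => Nat.zero_le _, hd, fun i t h h' => by omega, fun i t h h' => by omega,
    fun i t t' h h' h'' => by omega, fun p => ?_⟩
  rw [insert_empty_eq, Set.mem_singleton_iff]
  constructor
  · exact Or.inl
  · rintro (h | ⟨i, t, h, h', -⟩)
    · exact h
    · omega

theorem phase1State_init {μ₀ : A ≃ B} {b : B} (hb : F.BestMatch μ₀ ∅ (μ₀.symm L.center) b) :
    Phase1State L μ₀ [μ₀.symm L.center] μ₀ {(μ₀.symm L.center, b)} (fun _ => 0)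
      (fun i _ => L.pos i b) b where
  state := by
    have := State.init (L := L) (χ := μ₀) (e := b) (d := fun i _ => L.pos i b) fun _ => rfl
    rwa [insert_empty_eq] at this
  reach := rfl
  nonempty := by
    have := possibleMatch_iff.1 hb.1
    rwa [insert_empty_eq] at this
  serial := by
    have := SerialFrom.cons (F := F) hb (.nil _)
    rwa [insert_empty_eq] at this
  nodup := List.nodup_singleton _
  mem := by simp
  agree := fun _ _ _ _ => rfl

namespace Phase1State

variable {μ₀ χ : A ≃ B} {σ : List A} {τ : Set (A × B)} {s : Fin L.m → ℕ}
  {d : Fin L.m → ℕ → ℕ} {e : B} {i : Fin L.m}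

theorem invariant (H : Phase1State L μ₀ σ χ τ s d e) : F.Phase1Invariant L μ₀ σ χ τ :=
  ⟨⟨H.nonempty, fun i => ⟨_, H.state.isDests i⟩⟩, ⟨e, (H.state.mem_iff _).2 (Or.inl rfl)⟩,
    H.reach, H.serial, H.nodup⟩

theorem append_serial (H : Phase1State L μ₀ σ χ τ s d e) {a : A} {b : B}
    (hb : F.BestMatch χ τ a b) : F.IsSerial μ₀ (σ ++ [a]) (insert (a, b) τ) :=
  SerialFrom.append H.serial (.cons ((bestMatch_congr H.reach).1 hb) (.nil _))

theorem append_mem (H : Phase1State L μ₀ σ χ τ s d e) (a : A) (b : B) (c : A) :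
    c ∈ σ ++ [a] ↔ ∃ b', (c, b') ∈ insert (a, b) τ := by
  rw [List.mem_append, H.mem, List.mem_singleton]
  constructor
  · rintro (⟨b', h⟩ | rfl)
    · exact ⟨b', Set.mem_insert_of_mem _ h⟩
    · exact ⟨b, Set.mem_insert _ _⟩
  · rintro ⟨b', h⟩
    rcases Set.mem_insert_iff.1 h with h | h
    · exact Or.inr (Prod.mk.inj h).1
    · exact Or.inl ⟨b', h⟩

theorem append_nodup (H : Phase1State L μ₀ σ χ τ s d e) (hs : s i < L.len i) :
    (σ ++ [χ.symm (L.obj i (s i + 1))]).Nodup := by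
  rw [List.nodup_append]
  refine ⟨H.nodup, List.nodup_singleton _, ?_⟩
  rintro a ha a' ha' rfl
  rw [List.mem_singleton] at ha'
  obtain ⟨b, hb⟩ := (H.mem a).1 ha
  rw [ha'] at hb
  exact H.state.not_mem_of_lt (Nat.lt_succ_self _) hs b hb

/-- Fixing the agent next in line on the branch. -/
theorem push (H : Phase1State L μ₀ σ χ τ s d e) (hs : s i < L.len i) {k : ℕ}
    (hk : d i (s i) < k) (hk' : k ≤ L.len i)
    (hb : F.BestMatch χ τ (χ.symm (L.obj i (s i + 1))) (L.obj i k)) :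
    Phase1State L μ₀ (σ ++ [χ.symm (L.obj i (s i + 1))]) χ
      (insert (χ.symm (L.obj i (s i + 1)), L.obj i k) τ) (Function.update s i (s i + 1))
      (State.pushDest s d i k) e where
  state := H.state.push hs hk hk'
  reach := reachAgain_congr (Set.subset_insert _ _) H.reach
  nonempty := possibleMatch_iff.1 hb.1
  serial := H.append_serial hb
  nodup := H.append_nodup hs
  mem := H.append_mem _ _
  agree := by
    intro i' q h1 h2
    refine H.agree i' q (lt_of_le_of_lt ?_ h1) h2
    by_cases h : i' = i
    · subst h; simp
    · simp [h]

/-- The move does not affect the agents that are not matched yet. -/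
theorem agree_move (H : Phase1State L μ₀ σ χ τ s d e) (hs : s i < L.len i) {χ' : A ≃ B}
    (hm : IsMove L i (s i + 1) 0 χ χ') : ∀ i' q, Function.update s i (s i + 1) i' < q →
      q ≤ L.len i' → χ'.symm (L.obj i' q) = μ₀.symm (L.obj i' q) := by
  obtain ⟨m1, m2, m3⟩ := hm.symm_obj hs
  intro i' q h1 h2
  by_cases h : i' = i
  · subst h
    rw [Function.update_self] at h1
    rw [m3 q h2 (Or.inr h1)]
    exact H.agree i' q (by omega) h2
  · rw [Function.update_of_ne h] at h1
    rw [← H.agree i' q h1 h2, Equiv.symm_apply_eq, hm.apply_of_pos_zero hs]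
    · simp
    · rw [Equiv.apply_symm_apply]; exact L.pos_obj_of_ne (Ne.symm h) h2
    · intro e'; exact L.obj_ne i' q (by omega) h2 (χ.symm.injective e')

/-- Moving the agent next in line to the center and fixing it from there. -/
theorem move [Finite A] (H : Phase1State L μ₀ σ χ τ s d e) (h0 : 0 < d i 0) {χ' : A ≃ B}
    (hm : IsMove L i (s i + 1) 0 χ χ')
    (hl : LikesIn L i (χ.symm (L.obj i (s i + 1))) (s i + 1) 0) {b : B} (hp : L.pos i b = 0)
    (hb : F.BestMatch χ τ (χ.symm (L.obj i (s i + 1))) b) :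
    Phase1State L μ₀ (σ ++ [χ.symm (L.obj i (s i + 1))]) χ'
      (insert (χ.symm (L.obj i (s i + 1)), b) τ) (Function.update s i (s i + 1))
      (State.centerDest L d i b) b := by
  have hs := H.state.lt_len H.nonempty h0
  have hlt := H.state.lt_dest H.nonempty h0
  have hre := H.state.reachAgain_move H.nonempty hs (r := 0) (Nat.zero_le _)
    (fun x hx => by omega) (fun t ht h => by have := hlt t (by omega); omega) hm hl hp.le
  refine ⟨H.state.moveCenter hs h0 (H.state.strictMono H.nonempty i) hm b, ?_, ?_,
    H.append_serial hb, H.append_nodup hs, H.append_mem _ _, ?_⟩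
  · rw [hre]; exact reachAgain_congr (Set.subset_insert _ _) H.reach
  · rw [hre]; exact possibleMatch_iff.1 hb.1
  · exact H.agree_move hs hm

/-- If the outermost possible match on the branch is at least as good as what the dictator gets
from the center, it is the best match. -/
theorem bestMatch_push [Finite A] (H : Phase1State L μ₀ σ χ τ s d e) (h0 : 0 < d i 0) {k : ℕ}
    (hk : IsGreatest {j | j = 0 ∨ (1 ≤ j ∧ j ≤ L.len i ∧
      F.PossibleMatch χ τ (χ.symm (L.obj i (s i + 1))) (L.obj i j))} k) (hk0 : 0 < k)
    (hc : LikesIn L i (χ.symm (L.obj i (s i + 1))) (s i + 1) 0 →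
      ∃ χ' b, IsMove L i (s i + 1) 0 χ χ' ∧ F.BestMatch χ' τ (χ.symm (L.obj i (s i + 1))) b ∧
        ¬ F.pref (χ.symm (L.obj i (s i + 1))) b (L.obj i k)) :
    k ≤ L.len i ∧ d i (s i) < k ∧
      F.BestMatch χ τ (χ.symm (L.obj i (s i + 1))) (L.obj i k) := by
  have hs := H.state.lt_len H.nonempty h0
  have hlt := H.state.lt_dest H.nonempty h0
  obtain ⟨hk1, hk2⟩ := hk
  obtain ⟨-, hkl, hkp⟩ := hk1.resolve_left (by omega)
  refine ⟨hkl, ?_, hkp, ?_⟩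
  · obtain ⟨μ, hμ, hk⟩ := hkp
    have := H.state.pos_cases H.nonempty hμ h0
    rw [hk, L.pos_obj i hkl] at this
    omega
  · rintro b' ⟨μ, hμ, rfl⟩
    -- a match off the branch requires the move to the center, and is no better than the best match after it
    rcases Nat.eq_zero_or_pos (L.pos i (μ (χ.symm (L.obj i (s i + 1))))) with hz | hz
    · obtain ⟨χ', hm, -, -⟩ := F.exists_isMove L i hs (Nat.zero_le _) χ
      obtain ⟨hl, -⟩ := H.state.reach_move H.nonempty hμ hs (r := 0) (Nat.zero_le _)
        (fun x hx => by omega) (fun t ht h => by have := hlt t (by omega); omega) hm hz.le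
      obtain ⟨χs, b, hms, hbest, hnp⟩ := hc hl
      obtain ⟨-, hμs⟩ := H.state.reach_move H.nonempty hμ hs (r := 0) (Nat.zero_le _)
        (fun x hx => by omega) (fun t ht h => by have := hlt t (by omega); omega) hms hz.le
      have hbz : L.pos i b = 0 := by
        obtain ⟨ν, hν, hνb⟩ := hbest.1
        rw [← hνb]
        exact State.pos_eq_zero_of_move hms hl hν.1
      have hbk : F.pref (χ.symm (L.obj i (s i + 1))) (L.obj i k) b := by
        rcases F.pref_trichotomy (χ.symm (L.obj i (s i + 1))) (L.obj i k) b with h | h | h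
        · exact h
        · rw [← h, L.pos_obj i hkl] at hbz; omega
        · exact absurd h hnp
      right
      rcases hbest.2 _ ⟨μ, hμs, rfl⟩ with h | h
      · rw [h]; exact hbk
      · exact F.pref_trans hbk h
    · have hobj := L.obj_pos hz.ne'
      have hposs : F.PossibleMatch χ τ (χ.symm (L.obj i (s i + 1)))
          (L.obj i (L.pos i (μ (χ.symm (L.obj i (s i + 1)))))) := ⟨μ, hμ, hobj.symm⟩
      have hle := hk2 (Or.inr ⟨hz, L.pos_le i _, hposs⟩)
      rcases hle.lt_or_eq with h | h
      · right
        have := H.state.pref_of_possible H.nonempty h0 hz h hkl hkp hposs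
        rwa [hobj] at this
      · left; rw [← hobj, h]

/-- If the dictator does better from the center than on the branch, the best match from the center
is the best match. -/
theorem bestMatch_move [Finite A] (H : Phase1State L μ₀ σ χ τ s d e) (h0 : 0 < d i 0) {k : ℕ}
    (hk : IsGreatest {j | j = 0 ∨ (1 ≤ j ∧ j ≤ L.len i ∧
      F.PossibleMatch χ τ (χ.symm (L.obj i (s i + 1))) (L.obj i j))} k) {χ' : A ≃ B}
    (hm : IsMove L i (s i + 1) 0 χ χ')
    (hl : LikesIn L i (χ.symm (L.obj i (s i + 1))) (s i + 1) 0) {b : B}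
    (hb : F.BestMatch χ' τ (χ.symm (L.obj i (s i + 1))) b)
    (hc : k = 0 ∨ F.pref (χ.symm (L.obj i (s i + 1))) b (L.obj i k)) :
    L.pos i b = 0 ∧ F.BestMatch χ τ (χ.symm (L.obj i (s i + 1))) b := by
  have hs := H.state.lt_len H.nonempty h0
  have hlt := H.state.lt_dest H.nonempty h0
  obtain ⟨hk1, hk2⟩ := hk
  have hbz : L.pos i b = 0 := by
    obtain ⟨ν, hν, hνb⟩ := hb.1
    rw [← hνb]
    exact State.pos_eq_zero_of_move hm hl hν.1
  have hre := H.state.reachAgain_move H.nonempty hs (r := 0) (Nat.zero_le _)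
    (fun x hx => by omega) (fun t ht h => by have := hlt t (by omega); omega) hm hl hbz.le
  refine ⟨hbz, possibleMatch_iff.2 (hre ▸ possibleMatch_iff.1 hb.1), ?_⟩
  rintro b' ⟨μ, hμ, rfl⟩
  rcases Nat.eq_zero_or_pos (L.pos i (μ (χ.symm (L.obj i (s i + 1))))) with hz | hz
  · obtain ⟨-, hμs⟩ := H.state.reach_move H.nonempty hμ hs (r := 0) (Nat.zero_le _)
      (fun x hx => by omega) (fun t ht h => by have := hlt t (by omega); omega) hm hz.le
    exact hb.2 _ ⟨μ, hμs, rfl⟩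
  · have hobj := L.obj_pos hz.ne'
    have hposs : F.PossibleMatch χ τ (χ.symm (L.obj i (s i + 1)))
        (L.obj i (L.pos i (μ (χ.symm (L.obj i (s i + 1)))))) := ⟨μ, hμ, hobj.symm⟩
    have hle := hk2 (Or.inr ⟨hz, L.pos_le i _, hposs⟩)
    right
    have hbk := hc.resolve_left (by omega)
    obtain ⟨-, hkl, hkp⟩ := hk1.resolve_left (by omega)
    rcases hle.lt_or_eq with h | h
    · have := H.state.pref_of_possible H.nonempty h0 hz h hkl hkp hposs
      rw [hobj] at this
      exact F.pref_trans hbk this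
    · rw [← hobj, h]; exact hbk

theorem likesIn_iff {a : A} {p : ℕ} :
    (∀ j, j ≤ p → F.pref a (L.obj i j) (L.obj i (j + 1))) ↔ LikesIn L i a (p + 1) 0 :=
  ⟨fun h j _ h2 => h j (by omega), fun h j h2 => h j (Nat.zero_le _) (by omega)⟩

/-- Every iteration of the first phase preserves the invariant. -/
theorem step [Finite A] (H : Phase1State L μ₀ σ χ τ s d e) {σ' : List A} {χ' : A ≃ B}
    {τ' : Set (A × B)} (h : F.Phase1Step L σ χ τ σ' χ' τ') :
    ∃ s' d' e', Phase1State L μ₀ σ' χ' τ' s' d' e' := by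
  obtain ⟨i, j₀, js, a, k, hj1, hj2, hc, hjs, hlen, ha, rfl, hk, h⟩ := h
  have hsl := H.state.length_of_isDests hjs
  rw [hsl] at hlen ha h
  obtain rfl : a = χ.symm (L.obj i (s i + 1)) := by rw [← ha]; simp
  have he : L.obj i j₀ = e := by
    rcases (H.state.mem_iff _).1 hc with h | ⟨i', t, h1, h2, h⟩
    · exact (Prod.mk.inj h).2
    · exact absurd (χ.symm.injective (Prod.mk.inj h).1).symm
        (L.obj_ne i' t h1 (h2.trans (H.state.s_le i')))
  have h0 : 0 < d i 0 := by rw [H.state.d_zero, ← he, L.pos_obj i hj2]; exact hj1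
  rcases h with ⟨hl, hm, b, hb, hkb, rfl⟩ | ⟨hk0, rfl, rfl, hcond⟩
  · rw [likesIn_iff] at hl
    rw [isMoveToCenter_iff] at hm
    obtain ⟨h1, h2⟩ := H.bestMatch_move h0 hk hm hl hb hkb
    exact ⟨_, _, _, H.move h0 hm hl h1 h2⟩
  · obtain ⟨h1, h2, h3⟩ := H.bestMatch_push h0 hk hk0 (by
      intro hl
      obtain ⟨χs, b, g1, g2, g3⟩ := hcond (likesIn_iff.2 hl)
      exact ⟨χs, b, isMoveToCenter_iff.1 g1, g2, g3⟩)
    exact ⟨_, _, _, H.push hlen h2 h1 h3⟩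

theorem exists_isGreatest (χ : A ≃ B) (τ : Set (A × B)) (i : Fin L.m) (a : A) :
    ∃ k, IsGreatest {j | j = 0 ∨ (1 ≤ j ∧ j ≤ L.len i ∧ F.PossibleMatch χ τ a (L.obj i j))} k := by
  have hfin : {j | j = 0 ∨ (1 ≤ j ∧ j ≤ L.len i ∧ F.PossibleMatch χ τ a (L.obj i j))}.Finite := by
    refine (Set.finite_Iic (L.len i)).subset ?_
    rintro j (rfl | h)
    · exact Nat.zero_le _
    · exact h.2.1
  obtain ⟨k, h1, h2⟩ := hfin.exists_maximal ⟨0, Or.inl rfl⟩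
  refine ⟨k, h1, fun j hj => ?_⟩
  rcases le_total j k with h | h
  · exact h
  · exact h2 hj h

/-- The agent next in line must have a possible match on the branch if it does not like to go to
the center. -/
theorem greatest_pos [Finite A] (H : Phase1State L μ₀ σ χ τ s d e) (h0 : 0 < d i 0) {k : ℕ}
    (hk : IsGreatest {j | j = 0 ∨ (1 ≤ j ∧ j ≤ L.len i ∧
      F.PossibleMatch χ τ (χ.symm (L.obj i (s i + 1))) (L.obj i j))} k)
    (hl : ¬ LikesIn L i (χ.symm (L.obj i (s i + 1))) (s i + 1) 0) : 0 < k := by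
  have hs := H.state.lt_len H.nonempty h0
  have hlt := H.state.lt_dest H.nonempty h0
  obtain ⟨μ, hμ⟩ := H.nonempty
  rcases Nat.eq_zero_or_pos (L.pos i (μ (χ.symm (L.obj i (s i + 1))))) with hz | hz
  · obtain ⟨χ', hm, -, -⟩ := F.exists_isMove L i hs (Nat.zero_le _) χ
    exact absurd (H.state.reach_move H.nonempty hμ hs (r := 0) (Nat.zero_le _)
      (fun x hx => by omega) (fun t ht h => by have := hlt t (by omega); omega) hm hz.le).1 hl
  · exact hz.trans_le (hk.2 (Or.inr ⟨hz, L.pos_le i _, μ, hμ, (L.obj_pos hz.ne').symm⟩))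

theorem phase1Step_push [Finite A] (H : Phase1State L μ₀ σ χ τ s d e) (h0 : 0 < d i 0) {k : ℕ}
    (hk : IsGreatest {j | j = 0 ∨ (1 ≤ j ∧ j ≤ L.len i ∧
      F.PossibleMatch χ τ (χ.symm (L.obj i (s i + 1))) (L.obj i j))} k) (hk0 : 0 < k)
    (hc : LikesIn L i (χ.symm (L.obj i (s i + 1))) (s i + 1) 0 → ∃ χs b,
      IsMove L i (s i + 1) 0 χ χs ∧ F.BestMatch χs τ (χ.symm (L.obj i (s i + 1))) b ∧
      ¬ F.pref (χ.symm (L.obj i (s i + 1))) b (L.obj i k)) :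
    F.Phase1Step L σ χ τ (σ ++ [χ.symm (L.obj i (s i + 1))]) χ
      (insert (χ.symm (L.obj i (s i + 1)), L.obj i k) τ) := by
  have hs := H.state.lt_len H.nonempty h0
  have hi : L.pos i e ≠ 0 := by rw [← H.state.d_zero]; omega
  have hdl : (State.dests s d i).length = s i := H.state.length_of_isDests (H.state.isDests i)
  refine ⟨i, L.pos i e, State.dests s d i, χ.symm (L.obj i (s i + 1)), k, by omega,
    L.pos_le i e, (H.state.mem_iff _).2 (Or.inl (by rw [L.obj_pos hi])), H.state.isDests i,
    by rw [hdl]; exact hs, by rw [hdl]; simp, rfl, hk, Or.inr ⟨hk0, rfl, rfl, fun hl => ?_⟩⟩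
  rw [hdl, likesIn_iff] at hl
  obtain ⟨χs, b, g1, g2, g3⟩ := hc hl
  exact ⟨χs, b, by rw [hdl]; exact isMoveToCenter_iff.2 g1, g2, g3⟩

theorem phase1Step_move [Finite A] (H : Phase1State L μ₀ σ χ τ s d e) (h0 : 0 < d i 0) {k : ℕ}
    (hk : IsGreatest {j | j = 0 ∨ (1 ≤ j ∧ j ≤ L.len i ∧
      F.PossibleMatch χ τ (χ.symm (L.obj i (s i + 1))) (L.obj i j))} k)
    (hl : LikesIn L i (χ.symm (L.obj i (s i + 1))) (s i + 1) 0) {χ' : A ≃ B}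
    (hm : IsMove L i (s i + 1) 0 χ χ') {b : B}
    (hb : F.BestMatch χ' τ (χ.symm (L.obj i (s i + 1))) b)
    (hkb : k = 0 ∨ F.pref (χ.symm (L.obj i (s i + 1))) b (L.obj i k)) :
    F.Phase1Step L σ χ τ (σ ++ [χ.symm (L.obj i (s i + 1))]) χ'
      (insert (χ.symm (L.obj i (s i + 1)), b) τ) := by
  have hs := H.state.lt_len H.nonempty h0
  have hi : L.pos i e ≠ 0 := by rw [← H.state.d_zero]; omega
  have hdl : (State.dests s d i).length = s i := H.state.length_of_isDests (H.state.isDests i)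
  refine ⟨i, L.pos i e, State.dests s d i, χ.symm (L.obj i (s i + 1)), k, by omega,
    L.pos_le i e, (H.state.mem_iff _).2 (Or.inl (by rw [L.obj_pos hi])), H.state.isDests i,
    by rw [hdl]; exact hs, by rw [hdl]; simp, rfl, hk, Or.inl ⟨?_, ?_, b, hb, hkb, rfl⟩⟩
  · rw [hdl]; exact likesIn_iff.2 hl
  · rw [hdl]; exact isMoveToCenter_iff.2 hm

/-- As long as the agent at the center has to leave it, a further iteration can be performed. -/
theorem exists_step [Finite A] [Finite B] (H : Phase1State L μ₀ σ χ τ s d e)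
    (hc : (χ.symm L.center, L.center) ∉ τ) : ∃ σ' χ' τ', F.Phase1Step L σ χ τ σ' χ' τ' := by
  have he : e ≠ L.center := by
    rintro rfl
    exact hc ((H.state.mem_iff _).2 (Or.inl rfl))
  obtain ⟨i, hi⟩ := L.exists_pos_ne_zero he
  have h0 : 0 < d i 0 := by rw [H.state.d_zero]; omega
  have hs := H.state.lt_len H.nonempty h0
  obtain ⟨k, hk⟩ := exists_isGreatest χ τ i (χ.symm (L.obj i (s i + 1)))
  by_cases hl : LikesIn L i (χ.symm (L.obj i (s i + 1))) (s i + 1) 0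
  · obtain ⟨χ', hm, -, -⟩ := F.exists_isMove L i hs (Nat.zero_le _) χ
    obtain ⟨μ, hμ⟩ := H.state.nonempty_move H.nonempty h0 hm hl
    obtain ⟨b, hb⟩ := exists_bestMatch ⟨μ, (mem_reachAgain_insert.1 hμ).1⟩
      (χ.symm (L.obj i (s i + 1)))
    by_cases hkb : k = 0 ∨ F.pref (χ.symm (L.obj i (s i + 1))) b (L.obj i k)
    · exact ⟨_, _, _, H.phase1Step_move h0 hk hl hm hb hkb⟩
    · push Not at hkb
      exact ⟨_, _, _, H.phase1Step_push h0 hk (by omega) fun _ => ⟨χ', b, hm, hb, hkb.2⟩⟩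
  · exact ⟨_, _, _, H.phase1Step_push h0 hk (H.greatest_pos h0 hk hl) fun h => absurd h hl⟩

end Phase1State

theorem Phase1.exists_state [Finite A] {μ₀ χ : A ≃ B} {σ : List A} {τ : Set (A × B)}
    (h : F.Phase1 L μ₀ σ χ τ) : ∃ s d e, Phase1State L μ₀ σ χ τ s d e := by
  induction h with
  | init hb => exact ⟨_, _, _, phase1State_init hb⟩
  | step _ _ hs ih =>
    obtain ⟨s, d, e, H⟩ := ih
    exact H.step hs

/-- The first phase comes to an end, since no agent is dictator twice. -/
theorem exists_phase1_end [Finite A] [Finite B] (L : StarLabelling F.graph) (μ₀ : A ≃ B) :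
    ∃ σ χ τ, F.Phase1 L μ₀ σ χ τ ∧ (χ.symm L.center, L.center) ∈ τ := by
  have : Fintype A := Fintype.ofFinite A
  have key : ∀ k σ χ τ, F.Phase1 L μ₀ σ χ τ → Fintype.card A ≤ σ.length + k →
      ∃ σ χ τ, F.Phase1 L μ₀ σ χ τ ∧ (χ.symm L.center, L.center) ∈ τ := by
    intro k
    induction k with
    | zero =>
      intro σ χ τ h hk
      by_cases hc : (χ.symm L.center, L.center) ∈ τ
      · exact ⟨σ, χ, τ, h, hc⟩
      obtain ⟨s, d, e, H⟩ := h.exists_state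
      obtain ⟨σ', χ', τ', hs⟩ := H.exists_step hc
      obtain ⟨s', d', e', H'⟩ := H.step hs
      obtain ⟨i, j₀, js, a, k, -, -, -, -, -, -, rfl, -⟩ := hs
      have := H'.nodup.length_le_card
      rw [List.length_append, List.length_singleton] at this
      omega
    | succ k ih =>
      intro σ χ τ h hk
      by_cases hc : (χ.symm L.center, L.center) ∈ τ
      · exact ⟨σ, χ, τ, h, hc⟩
      obtain ⟨s, d, e, H⟩ := h.exists_state
      obtain ⟨σ', χ', τ', hs⟩ := H.exists_step hc
      refine ih σ' χ' τ' (.step h hc hs) ?_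
      obtain ⟨i, j₀, js, a, k, -, -, -, -, -, -, rfl, -⟩ := hs
      rw [List.length_append, List.length_singleton]
      omega
  obtain ⟨b, hb⟩ := exists_bestMatch (F := F) (χ := μ₀) (τ := ∅) ⟨μ₀, F.mem_reach_refl μ₀, by simp⟩
    (μ₀.symm L.center)
  exact key _ _ _ _ (.init hb) (Nat.le_add_left _ _)

/-! ### The second phase -/

namespace Phase1State

variable {μ₀ χ : A ≃ B} {σ : List A} {τ : Set (A × B)} {s : Fin L.m → ℕ}
  {d : Fin L.m → ℕ → ℕ} {e : B}

/-- The dictators of the second phase. -/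
def phase2Dictators (L : StarLabelling F.graph) (χ : A ≃ B) (s : Fin L.m → ℕ)
    (order : List (Fin L.m)) : List A :=
  order.flatMap fun i => (List.range' (s i + 1) (L.len i - s i)).map fun j => χ.symm (L.obj i j)

theorem mem_phase2Dictators {order : List (Fin L.m)} {a : A} :
    a ∈ phase2Dictators L χ s order ↔
      ∃ i ∈ order, ∃ j, s i < j ∧ j ≤ L.len i ∧ a = χ.symm (L.obj i j) := by
  simp only [phase2Dictators, List.mem_flatMap, List.mem_map, List.mem_range'_1]
  constructor
  · rintro ⟨i, hi, j, hj, rfl⟩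
    exact ⟨i, hi, j, by omega, by omega, rfl⟩
  · rintro ⟨i, hi, j, h1, h2, rfl⟩
    exact ⟨i, hi, j, by omega, rfl⟩

theorem nodup_phase2Dictators {order : List (Fin L.m)} (ho : order.Nodup) :
    (phase2Dictators L χ s order).Nodup := by
  rw [phase2Dictators, List.nodup_flatMap]
  constructor
  · intro i _
    refine List.Nodup.map_on ?_ List.nodup_range'
    intro j hj j' hj' h
    rw [List.mem_range'_1] at hj hj'
    exact symm_obj_inj χ (by omega) (by omega) h
  · refine ho.imp fun {i i'} hne => ?_
    rw [Function.onFun, List.disjoint_left]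
    intro a ha ha'
    simp only [List.mem_map, List.mem_range'_1] at ha ha'
    obtain ⟨j, hj, rfl⟩ := ha
    obtain ⟨j', hj', h⟩ := ha'
    exact hne (L.obj_inj i j i' j' (by omega) (by omega) (by omega) (by omega)
      (χ.symm.injective h.symm)).1

/-- The dictators of the two phases together are all agents, each of them once. -/
theorem dictators_perm (H : Phase1State L μ₀ σ χ τ s d e) {order : List (Fin L.m)}
    (ho : order.Perm (List.finRange L.m)) :
    (σ ++ phase2Dictators L χ s order).Nodup ∧ ∀ a, a ∈ σ ++ phase2Dictators L χ s order := by
  constructor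
  · rw [List.nodup_append]
    refine ⟨H.nodup, nodup_phase2Dictators (ho.nodup_iff.2 (List.nodup_finRange _)), ?_⟩
    rintro a ha a' ha' rfl
    obtain ⟨b, hb⟩ := (H.mem a).1 ha
    obtain ⟨i, -, j, h1, h2, rfl⟩ := mem_phase2Dictators.1 ha'
    exact H.state.not_mem_of_lt h1 h2 b hb
  · intro a
    rw [List.mem_append, H.mem]
    by_cases hc : χ a = L.center
    · left
      exact ⟨e, (H.state.mem_iff _).2 (Or.inl (by rw [← hc]; simp))⟩
    · obtain ⟨i, j, h1, h2, h3⟩ := L.cover _ hc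
      have ha : a = χ.symm (L.obj i j) := by rw [← h3]; simp
      rcases Nat.lt_or_ge (s i) j with h | h
      · right
        exact mem_phase2Dictators.2 ⟨i, ho.mem_iff.2 (List.mem_finRange i), j, h, h2, ha⟩
      · left
        exact ⟨_, (H.state.mem_iff _).2 (Or.inr ⟨i, j, h1, h, by rw [ha]⟩)⟩

end Phase1State

/-- A complete run, in terms of states. -/
theorem twoPhaseRun_iff [Finite A] {μ₀ μ : A ≃ B} {σ : List A} :
    F.TwoPhaseRun L μ₀ σ μ ↔ ∃ σ₁ χ τ s d, ∃ order : List (Fin L.m),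
      F.Phase1 L μ₀ σ₁ χ τ ∧ Phase1State L μ₀ σ₁ χ τ s d L.center ∧
      order.Perm (List.finRange L.m) ∧
      F.SerialFrom χ τ (Phase1State.phase2Dictators L χ s order) (matchingPairs μ) ∧
      σ = σ₁ ++ Phase1State.phase2Dictators L χ s order := by
  constructor
  · rintro ⟨σ₁, χ, τ, js, order, σ₂, h1, h2, h3, h4, rfl, h6, rfl⟩
    obtain ⟨s, d, e, H⟩ := h1.exists_state
    have he : e = L.center := by
      rcases (H.state.mem_iff _).1 h2 with h | ⟨i', t, g1, g2, h⟩
      · exact (Prod.mk.inj h).2.symm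
      · exact absurd (χ.symm.injective (Prod.mk.inj h).1).symm
          (L.obj_ne i' t g1 (g2.trans (H.state.s_le i')))
    subst he
    have hjs : ∀ i, (js i).length = s i := fun i => H.state.length_of_isDests (h3 i)
    simp only [hjs] at h6 ⊢
    exact ⟨σ₁, χ, τ, s, d, order, h1, H, h4, h6, rfl⟩
  · rintro ⟨σ₁, χ, τ, s, d, order, h1, H, h4, h6, rfl⟩
    refine ⟨σ₁, χ, τ, State.dests s d, order, _, h1, (H.state.mem_iff _).2 (Or.inl rfl),
      H.state.isDests, h4, rfl, ?_, ?_⟩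
    · simpa only [H.state.length_of_isDests (H.state.isDests _), Phase1State.phase2Dictators] using h6
    · simp only [H.state.length_of_isDests (H.state.isDests _)]
      rfl

theorem TwoPhaseRun.correct [Finite A] {μ₀ μ : A ≃ B} {σ : List A}
    (h : F.TwoPhaseRun L μ₀ σ μ) : σ.Nodup ∧ (∀ a, a ∈ σ) ∧ F.IsSerial μ₀ σ (matchingPairs μ) ∧
      F.IsParetoEfficientReachable μ₀ μ := by
  obtain ⟨σ₁, χ, τ, s, d, order, -, H, ho, hs, rfl⟩ := twoPhaseRun_iff.1 h
  obtain ⟨h1, h2⟩ := H.dictators_perm ho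
  have h3 : F.IsSerial μ₀ (σ₁ ++ Phase1State.phase2Dictators L χ s order) (matchingPairs μ) :=
    SerialFrom.append H.serial (hs.congr H.reach)
  exact ⟨h1, h2, h3, h3.paretoEfficient h2⟩

/-- Once all agents have been dictators, the fixed pairs form a perfect matching. -/
theorem SerialFrom.exists_matching {χ : A ≃ B} {τ τ' : Set (A × B)} {σ : List A}
    (h : F.SerialFrom χ τ σ τ') (hne : (F.ReachAgain χ τ).Nonempty)
    (hall : ∀ a, (∃ b, (a, b) ∈ τ) ∨ a ∈ σ) : ∃ μ, τ' = matchingPairs μ := by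
  obtain ⟨μ, hμ⟩ := h.nonempty hne
  refine ⟨μ, Set.Subset.antisymm (fun p hp => hμ.2 p hp) ?_⟩
  rintro ⟨a, b⟩ hp
  have hp' : μ a = b := hp
  have : ∃ b', (a, b') ∈ τ' := by
    rcases hall a with ⟨b', hb'⟩ | ha
    · exact ⟨b', h.subset hb'⟩
    · exact h.exists_mem ha
  obtain ⟨b', hb'⟩ := this
  have e : μ a = b' := hμ.2 _ hb'
  rw [← hp', e]; exact hb'

theorem exists_twoPhaseRun [Finite A] [Finite B] (L : StarLabelling F.graph) (μ₀ : A ≃ B) :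
    ∃ σ μ, F.TwoPhaseRun L μ₀ σ μ := by
  obtain ⟨σ₁, χ, τ, h1, h2⟩ := exists_phase1_end L μ₀
  obtain ⟨s, d, e, H⟩ := h1.exists_state
  obtain ⟨τ', h⟩ := exists_serialFrom χ
    (Phase1State.phase2Dictators L χ s (List.finRange L.m)) τ H.nonempty
  obtain ⟨μ, rfl⟩ := h.exists_matching H.nonempty fun a => by
    have := (H.dictators_perm (List.Perm.refl _)).2 a
    rwa [List.mem_append, H.mem] at this
  refine ⟨_, μ, σ₁, χ, τ, State.dests s d, List.finRange L.m, _, h1, h2, H.state.isDests,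
    List.Perm.refl _, rfl, ?_, rfl⟩
  simpa only [H.state.length_of_isDests (H.state.isDests _), Phase1State.phase2Dictators] using h

variable {A B : Type*} {F : OAF A B} {L : StarLabelling F.graph}

/-! ### Independence of the branches -/

theorem mem_branch_iff {i : Fin L.m} {b : B} : b ∈ L.branch i ↔ L.pos i b ≠ 0 := by
  constructor
  · rintro ⟨j, h1, h2, rfl⟩
    rw [L.pos_obj i h2]; omega
  · intro h
    exact ⟨L.pos i b, by omega, L.pos_le i b, (L.obj_pos h).symm⟩

/-- As long as the agent at the center stays there, a sequence of swaps decomposes into sequences of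
swaps within the branches. -/
theorem restrict_reach_of_reach {χ μ : A ≃ B} (h : μ ∈ F.Reach χ)
    (hc : μ (χ.symm L.center) = L.center) :
    ∃ hb : ∀ i, ∀ a, a ∈ χ ⁻¹' L.branch i ↔ μ a ∈ L.branch i, ∀ i,
      μ.subtypeEquiv (hb i) ∈ (F.restrict (χ ⁻¹' L.branch i) (L.branch i)).Reach
        (restrictMatching χ (L.branch i)) := by
  induction h with
  | refl => exact ⟨fun i a => Iff.rfl, fun i => Relation.ReflTransGen.refl⟩
  | @tail ξ ξ' hr hs ih =>
    -- having left the center, the agent could not come back, since each swap improves its object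
    have hc' : ξ (χ.symm L.center) = L.center := by
      have h1 := F.reach_improves hr (χ.symm L.center)
      have h2 := F.reach_improves (Relation.ReflTransGen.single hs) (χ.symm L.center)
      rw [Equiv.apply_symm_apply] at h1
      rw [hc] at h2
      rcases h1 with h1 | h1
      · exact h1
      · rcases h2 with h2 | h2
        · exact h2.symm
        · exact absurd h1 (F.pref_asymm h2)
    obtain ⟨hb, ih⟩ := ih hc'
    -- the swap does not involve the center, so no agent enters or leaves a branch
    have hpos : ∀ i a, L.pos i (ξ' a) ≠ 0 ↔ L.pos i (ξ a) ≠ 0 := by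
      intro i a
      rcases F.swap_pos_agent L hs i a with h | ⟨j, _, h1, h2, h3, _⟩ | ⟨j, _, h1, h2, h3⟩
      · rw [h]
      · by_cases hj : j = 0
        · subst hj
          rw [L.obj_zero] at h3
          have : a = χ.symm L.center := ξ.injective (h3.trans hc'.symm)
          rw [this, hc, L.pos_center] at h2
          omega
        · omega
      · by_cases hj : j = 0
        · subst hj
          exfalso
          rcases F.swap_pos L hs i with h0 | ⟨x, x', j', hj', e1, e2, e3, e4, -, -, e5⟩
          · have := h0 a; omega
          · have hax' : a = x' := by
              by_contra hne
              by_cases hax : a = x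
              · rw [hax, e1, L.pos_obj i hj'.le] at h1
                rw [hax, e3, L.pos_obj i hj'] at h2
                omega
              · rw [e5 a hax hne] at h2; omega
            rw [hax', e2, L.pos_obj i hj'] at h1
            obtain rfl : j' = 0 := by omega
            rw [L.obj_zero] at e1
            have hx : x = χ.symm L.center := ξ.injective (e1.trans hc'.symm)
            rw [← hx, e3] at hc
            exact L.obj_ne i 1 le_rfl hj' hc
        · omega
    have hb' : ∀ i, ∀ a, a ∈ χ ⁻¹' L.branch i ↔ ξ' a ∈ L.branch i := by
      intro i a
      rw [hb i a, mem_branch_iff, mem_branch_iff, hpos]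
    refine ⟨hb', fun i => ?_⟩
    rcases F.swap_pos L hs i with h0 | ⟨a, a', j, hj, e1, e2, e3, e4, p, p', e5⟩
    · have : ξ'.subtypeEquiv (hb' i) = ξ.subtypeEquiv (hb i) := by
        ext ⟨a, ha⟩
        have h1 : L.pos i (ξ' a) ≠ 0 := mem_branch_iff.1 ((hb' i a).1 ha)
        simpa using L.eq_of_pos_eq (h0 a) h1
      rw [this]; exact ih i
    · refine Relation.ReflTransGen.tail (ih i) ?_
      have hj0 : j ≠ 0 := by
        rintro rfl
        have h1 := (hpos i a).1 (by rw [e3, L.pos_obj i hj]; omega)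
        rw [e1, L.pos_obj i hj.le] at h1
        exact h1 rfl
      have ha : a ∈ χ ⁻¹' L.branch i := (hb i a).2 (mem_branch_iff.2 (by
        rw [e1, L.pos_obj i hj.le]; exact hj0))
      have ha' : a' ∈ χ ⁻¹' L.branch i := (hb i a').2 (mem_branch_iff.2 (by
        rw [e2, L.pos_obj i hj]; omega))
      refine ⟨⟨a, ha⟩, ⟨a', ha'⟩, ?_, ?_, ?_, ?_, ?_, ?_⟩
      · change F.graph.Adj (ξ a) (ξ a')
        rw [e1, e2]; exact L.adj_obj i hj
      · change F.pref a (ξ a') (ξ a)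
        rw [e1, e2]; exact p
      · change F.pref a' (ξ a) (ξ a')
        rw [e1, e2]; exact p'
      · exact Subtype.ext (e3.trans e2.symm)
      · exact Subtype.ext (e4.trans e1.symm)
      · rintro ⟨c, hc⟩ h1 h2
        exact Subtype.ext (e5 c (fun h => h1 (Subtype.ext h)) fun h => h2 (Subtype.ext h))

/-- Swaps within one branch can be performed in any configuration that agrees with `χ` there. -/
theorem exists_reach_of_restrict {χ ξ : A ≃ B} {i : Fin L.m}
    (hξ : ∀ a ∈ χ ⁻¹' L.branch i, ξ a = χ a) {ν : (χ ⁻¹' L.branch i : Set A) ≃ L.branch i}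
    (h : ν ∈ (F.restrict (χ ⁻¹' L.branch i) (L.branch i)).Reach
      (restrictMatching χ (L.branch i))) :
    ∃ ξ' ∈ F.Reach ξ, (∀ a : (χ ⁻¹' L.branch i : Set A), ξ' a = ν a) ∧
      ∀ a, a ∉ χ ⁻¹' L.branch i → ξ' a = ξ a := by
  classical
  induction h with
  | refl => exact ⟨ξ, F.mem_reach_refl ξ, fun a => hξ a a.2, fun _ _ => rfl⟩
  | @tail ν ν' _ hs ih =>
    obtain ⟨ξ', h1, h2, h3⟩ := ih
    obtain ⟨a, a', hadj, p, p', e1, e2, e3⟩ := hs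
    have hadj' : F.graph.Adj (ν a : B) (ν a') := hadj
    refine ⟨ξ'.trans (Equiv.swap (ν a : B) (ν a')), reach_trans h1 (Relation.ReflTransGen.single
      (swap_trans_swap (h2 a) (h2 a') hadj' p p')), ?_, ?_⟩
    · intro c
      rw [Equiv.trans_apply, h2 c]
      by_cases hc : c = a
      · subst hc; rw [Equiv.swap_apply_left, e1]
      by_cases hc' : c = a'
      · subst hc'; rw [Equiv.swap_apply_right, e2]
      rw [e3 c hc hc', Equiv.swap_apply_of_ne_of_ne]
      · exact fun h => hc (ν.injective (Subtype.ext h))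
      · exact fun h => hc' (ν.injective (Subtype.ext h))
    · intro c hc
      rw [Equiv.trans_apply, ← h3 c hc, Equiv.swap_apply_of_ne_of_ne]
      · intro h
        rw [← h2 a] at h
        exact hc (ξ'.injective h ▸ a.2)
      · intro h
        rw [← h2 a'] at h
        exact hc (ξ'.injective h ▸ a'.2)

/-- If the agent at the center is to stay there, the branches are independent: a sequence of swaps
decomposes into sequences within the branches, and conversely such sequences can be performed one
branch after the other. -/
theorem splitsIntoBranches {χ : A ≃ B} {τ : Set (A × B)}
    (hc : (χ.symm L.center, L.center) ∈ τ) : F.SplitsIntoBranches L χ τ := by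
  classical
  intro μ
  constructor
  · rintro ⟨h1, h2⟩
    refine ⟨h2, fun i => ?_⟩
    obtain ⟨hb, h⟩ := restrict_reach_of_reach (L := L) h1 (h2 _ hc)
    exact ⟨_, h i, fun a => rfl⟩
  · rintro ⟨h1, h2⟩
    refine ⟨?_, h1⟩
    choose ν hν hμ using h2
    -- carry out the swaps of the branches in `P`
    have key : ∀ P : Finset (Fin L.m), ∃ ξ ∈ F.Reach χ,
        (∀ i ∈ P, ∀ a : (χ ⁻¹' L.branch i : Set A), ξ a = ν i a) ∧
        ∀ a, (∀ i ∈ P, a ∉ χ ⁻¹' L.branch i) → ξ a = χ a := by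
      intro P
      induction P using Finset.induction_on with
      | empty => exact ⟨χ, F.mem_reach_refl χ, by simp, fun _ _ => rfl⟩
      | @insert i P hi ih =>
        obtain ⟨ξ, r1, r2, r3⟩ := ih
        have hdisj : ∀ i' a, i' ≠ i → a ∈ χ ⁻¹' L.branch i → a ∉ χ ⁻¹' L.branch i' := by
          intro i' a hne h h'
          exact mem_branch_iff.1 h' (L.pos_eq_zero_of_ne hne (mem_branch_iff.1 h))
        obtain ⟨ξ', s1, s2, s3⟩ := exists_reach_of_restrict (ξ := ξ) (i := i) (fun a ha =>
          r3 a fun i' hi' => hdisj i' a (fun e => hi (e ▸ hi')) ha) (hν i)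
        refine ⟨ξ', reach_trans r1 s1, ?_, ?_⟩
        · intro i' hi' a
          rcases Finset.mem_insert.1 hi' with rfl | hi'
          · exact s2 a
          · rw [s3, r2 i' hi' a]
            intro h
            exact hdisj i' a (fun e => hi (e ▸ hi')) h a.2
        · intro a ha
          rw [s3 a (ha i (Finset.mem_insert_self _ _)),
            r3 a fun i' hi' => ha i' (Finset.mem_insert_of_mem hi')]
    obtain ⟨ξ, r1, r2, r3⟩ := key Finset.univ
    have : ξ = μ := by
      refine Equiv.ext fun a => ?_
      by_cases ha : χ a = L.center
      · rw [r3 a fun i _ h => mem_branch_iff.1 h (by rw [ha, L.pos_center]), ha]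
        have h := h1 _ hc
        have e : χ.symm L.center = a := by rw [← ha]; simp
        simp only [e] at h
        exact h.symm
      · obtain ⟨i, hi⟩ := L.exists_pos_ne_zero ha
        have hmem : a ∈ χ ⁻¹' L.branch i := mem_branch_iff.2 hi
        rw [r2 i (Finset.mem_univ _) ⟨a, hmem⟩, hμ i ⟨a, hmem⟩]
    rw [← this]; exact r1

end OAF

/-! ### Every generalized star has a labelling -/

namespace IsGeneralizedStar

variable {B : Type*} {G : SimpleGraph B}

/-- In a tree, a vertex other than the root `c` has exactly one neighbour nearer to `c`. -/
theorem exists_parent (hG : G.IsTree) {c b : B} (hb : b ≠ c) :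
    ∃ w, G.Adj b w ∧ G.dist c b = G.dist c w + 1 := by
  obtain ⟨p, hp⟩ := (hG.connected c b).exists_walk_length_eq_dist
  have hpos : 0 < G.dist c b := (hG.connected c b).pos_dist_of_ne hb.symm
  have hnil : ¬ p.Nil := by
    intro h
    rw [← SimpleGraph.Walk.length_eq_zero_iff] at h
    omega
  refine ⟨p.penultimate, (p.adj_penultimate hnil).symm, ?_⟩
  have h1 : G.dist c p.penultimate ≤ p.dropLast.length := SimpleGraph.dist_le _
  rw [SimpleGraph.Walk.length_dropLast] at h1
  have h2 := hG.dist_eq_dist_add_one_of_adj c (p.adj_penultimate hnil)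
  omega

theorem parent_unique (hG : G.IsTree) {c b w w' : B} (h : G.Adj b w) (h' : G.Adj b w')
    (hd : G.dist c b = G.dist c w + 1) (hd' : G.dist c b = G.dist c w' + 1) : w = w' := by
  classical
  obtain ⟨p, hp, hpl⟩ := (hG.connected c w).exists_path_of_dist
  obtain ⟨p', hp', hpl'⟩ := (hG.connected c w').exists_path_of_dist
  have key : ∀ (w : B) (p : G.Walk c w) (hadj : G.Adj w b), p.IsPath → p.length = G.dist c w →
      G.dist c b = G.dist c w + 1 → (p.concat hadj).IsPath := by
    intro w p hadj hp hl hd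
    rw [SimpleGraph.Walk.concat_isPath_iff]
    refine ⟨hp, fun hmem => ?_⟩
    have := SimpleGraph.dist_le (p.takeUntil b hmem)
    have := p.length_takeUntil_le_length hmem
    omega
  have e := (hG.existsUnique_path c b).unique (key w p h.symm hp hpl hd)
    (key w' p' h'.symm hp' hpl' hd')
  have := congrArg SimpleGraph.Walk.penultimate e
  simpa using this

/-- Any vertex such that all other vertices have degree at most two is the center of a labelling:
a branch is followed from a neighbour of the center by passing from each vertex to its only
neighbour further away from the center. -/
theorem exists_starLabelling [Finite B] (hG : G.IsTree) {c : B}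
    (hdeg : ∀ v, v ≠ c → (G.neighborSet v).encard ≤ 2) :
    ∃ L : StarLabelling G, L.center = c := by
  classical
  have child_unique : ∀ b w w', b ≠ c → G.Adj b w → G.Adj b w' → G.dist c w = G.dist c b + 1 →
      G.dist c w' = G.dist c b + 1 → w = w' := by
    intro b w w' hb h h' hd hd'
    by_contra hne
    obtain ⟨p, hp, hdp⟩ := exists_parent hG hb
    have h3 : ({p, w, w'} : Set B).encard = 3 := by
      rw [Set.encard_eq_three]
      exact ⟨p, w, w', by rintro rfl; omega, by rintro rfl; omega, hne, rfl⟩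
    have h4 : ({p, w, w'} : Set B) ⊆ G.neighborSet b := by
      rintro x (rfl | rfl | rfl) <;> assumption
    have h5 := (Set.encard_le_encard h4).trans (hdeg b hb)
    rw [h3] at h5
    exact absurd h5 (by decide)
  -- the only neighbour further away from `c`, or `b` itself if `b` is a leaf
  let next : B → B := fun b =>
    if h : ∃ w, G.Adj b w ∧ G.dist c w = G.dist c b + 1 then h.choose else b
  have next_spec : ∀ b, next b = b ∨ (G.Adj b (next b) ∧ G.dist c (next b) = G.dist c b + 1) := by
    intro b
    by_cases h : ∃ w, G.Adj b w ∧ G.dist c w = G.dist c b + 1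
    · simp only [next, dif_pos h]
      exact Or.inr h.choose_spec
    · exact Or.inl (dif_neg h)
  have next_eq : ∀ b w, b ≠ c → G.Adj b w → G.dist c w = G.dist c b + 1 → next b = w := by
    intro b w hb h hd
    have hex : ∃ w, G.Adj b w ∧ G.dist c w = G.dist c b + 1 := ⟨w, h, hd⟩
    simp only [next, dif_pos hex]
    exact child_unique b _ w hb hex.choose_spec.1 h hex.choose_spec.2 hd
  obtain ⟨N, hN⟩ : ∃ N, ∀ b, G.dist c b ≤ N := by
    obtain ⟨N, hN⟩ := (Set.finite_range (G.dist c)).bddAbove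
    exact ⟨N, fun b => hN ⟨b, rfl⟩⟩
  let f : Fin (Nat.card (G.neighborSet c)) ≃ G.neighborSet c := (Finite.equivFin _).symm
  let obj : Fin (Nat.card (G.neighborSet c)) → ℕ → B := fun i j =>
    if j = 0 then c else next^[j - 1] (f i)
  have obj0 : ∀ i, obj i 0 = c := fun i => by simp [obj]
  have obj1 : ∀ i, obj i 1 = f i := fun i => by simp [obj]
  have objS : ∀ i j, 1 ≤ j → obj i (j + 1) = next (obj i j) := by
    intro i j hj
    obtain ⟨k, rfl⟩ : ∃ k, j = k + 1 := ⟨j - 1, by omega⟩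
    simp [obj, Function.iterate_succ_apply']
  have adj1 : ∀ i, G.Adj c (f i) := fun i => (f i).2
  have dist1 : ∀ i, G.dist c (obj i 1) = 1 := by
    intro i
    rw [obj1, SimpleGraph.dist_eq_one_iff_adj]; exact adj1 i
  have dist_le : ∀ i j, G.dist c (obj i j) ≤ j := by
    intro i j
    induction j with
    | zero => simp [obj0]
    | succ j ih =>
      rcases Nat.eq_zero_or_pos j with rfl | hj
      · rw [dist1]
      · rw [objS i j hj]
        rcases next_spec (obj i j) with h | ⟨-, h⟩
        · rw [h]; omega
        · rw [h]; omega
  have valid_pred : ∀ i j, 1 ≤ j → G.dist c (obj i (j + 1)) = j + 1 →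
      G.dist c (obj i j) = j ∧ G.Adj (obj i j) (obj i (j + 1)) := by
    intro i j hj h
    rw [objS i j hj] at h ⊢
    have := dist_le i j
    rcases next_spec (obj i j) with h' | ⟨h1, h2⟩
    · rw [h'] at h; omega
    · exact ⟨by omega, h1⟩
  -- the branch ends where the distance stops growing
  let len : Fin (Nat.card (G.neighborSet c)) → ℕ := fun i =>
    Nat.findGreatest (fun j => G.dist c (obj i j) = j) (N + 1)
  have len_pos : ∀ i, 1 ≤ len i := fun i =>
    Nat.le_findGreatest (by omega) (dist1 i)
  have valid_len : ∀ i, G.dist c (obj i (len i)) = len i := fun i =>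
    Nat.findGreatest_spec (P := fun j => G.dist c (obj i j) = j) (m := 1) (by omega) (dist1 i)
  have valid : ∀ i j, j ≤ len i → G.dist c (obj i j) = j := by
    intro i j hj
    induction hj using Nat.decreasingInduction with
    | self => exact valid_len i
    | of_succ j _ ih =>
      rcases Nat.eq_zero_or_pos j with rfl | h0
      · simp [obj0]
      · exact (valid_pred i j h0 ih).1
  have le_len : ∀ i j, G.dist c (obj i j) = j → j ≤ len i := by
    intro i j h
    refine Nat.le_findGreatest ?_ h
    have := hN (obj i j)
    omega
  have hadj : ∀ i j, j < len i → G.Adj (obj i j) (obj i (j + 1)) := by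
    intro i j hj
    rcases Nat.eq_zero_or_pos j with rfl | h0
    · rw [obj0, zero_add, obj1]; exact adj1 i
    · exact (valid_pred i j h0 (valid i (j + 1) hj)).2
  -- by induction on the distance, each vertex follows its parent on a branch
  have cover : ∀ k b, G.dist c b = k → b ≠ c → ∃ i j, 1 ≤ j ∧ j ≤ len i ∧ b = obj i j := by
    intro k
    induction k with
    | zero =>
      intro b h hb
      exact absurd ((hG.connected c b).dist_eq_zero_iff.1 h).symm hb
    | succ k ih =>
      intro b h hb
      obtain ⟨w, hw, hd⟩ := exists_parent hG hb
      by_cases hwc : w = c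
      · subst hwc
        obtain ⟨i, hi⟩ := f.surjective ⟨b, hw.symm⟩
        exact ⟨i, 1, le_rfl, len_pos i, by rw [obj1, hi]⟩
      · obtain ⟨i, j, h1, h2, rfl⟩ := ih w (by omega) hwc
        have hb' : b = obj i (j + 1) := by
          rw [objS i j h1, next_eq (obj i j) b hwc hw.symm hd]
        refine ⟨i, j + 1, by omega, le_len i _ ?_, hb'⟩
        rw [← hb', hd, valid i j h2]
  -- two branches with a common vertex have the same parents and thus begin with the same vertex
  have inj : ∀ j i i', 1 ≤ j → j ≤ len i → j ≤ len i' → obj i j = obj i' j → i = i' := by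
    intro j
    induction j with
    | zero => intro i i' h; omega
    | succ j ih =>
      intro i i' _ h1 h2 h
      rcases Nat.eq_zero_or_pos j with rfl | hj
      · rw [zero_add, obj1, obj1] at h
        exact f.injective (Subtype.ext h)
      · refine ih i i' hj (by omega) (by omega) ?_
        refine parent_unique hG (c := c) (hadj i j (by omega)).symm
          (h ▸ (hadj i' j (by omega)).symm) ?_ ?_
        · rw [valid i _ h1, valid i j (by omega)]
        · rw [valid i _ h1, valid i' j (by omega)]
  refine ⟨⟨c, _, len, obj, len_pos, obj0, ?_, ?_, fun b hb => cover _ b rfl hb, ?_⟩, rfl⟩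
  · intro i j h1 h2 h
    have := valid i j h2
    rw [h, SimpleGraph.dist_self] at this
    omega
  · intro i j i' j' h1 h2 h3 h4 h
    have e : j = j' := by rw [← valid i j h2, h, valid i' j' h4]
    subst e
    exact ⟨inj j i i' h1 h2 h4 h, rfl⟩
  · have key : ∀ b b', G.Adj b b' → G.dist c b' = G.dist c b + 1 →
        ∃ i j, j < len i ∧ b = obj i j ∧ b' = obj i (j + 1) := by
      intro b b' h hd
      by_cases hb : b = c
      · subst hb
        obtain ⟨i, hi⟩ := f.surjective ⟨b', h⟩
        exact ⟨i, 0, len_pos i, (obj0 i).symm, by rw [zero_add, obj1, hi]⟩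
      · obtain ⟨i, j, h1, h2, rfl⟩ := cover _ b rfl hb
        have hb' : b' = obj i (j + 1) := by rw [objS i j h1, next_eq (obj i j) b' hb h hd]
        refine ⟨i, j, le_len i (j + 1) ?_, rfl, hb'⟩
        rw [← hb', hd, valid i j h2]
    intro b b'
    constructor
    · intro h
      rcases hG.dist_eq_dist_add_one_of_adj c h with hd | hd
      · obtain ⟨i, j, h1, h2, h3⟩ := key b' b h.symm hd
        exact ⟨i, j, h1, Or.inr ⟨h2, h3⟩⟩
      · obtain ⟨i, j, h1, h2, h3⟩ := key b b' h hd
        exact ⟨i, j, h1, Or.inl ⟨h2, h3⟩⟩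
    · rintro ⟨i, j, h1, ⟨rfl, rfl⟩ | ⟨rfl, rfl⟩⟩
      · exact hadj i j h1
      · exact (hadj i j h1).symm

end IsGeneralizedStar

namespace OAF

variable {A B : Type*} {F : OAF A B}

/-- The structural half of the theorem, for every numbering of the branches. -/
theorem twoPhase_spec [Finite A] [Finite B] (μ₀ : A ≃ B) (L : StarLabelling F.graph) :
    (∀ σ χ τ, F.Phase1 L μ₀ σ χ τ → F.Phase1Invariant L μ₀ σ χ τ ∧
      ((χ.symm L.center, L.center) ∉ τ → ∃ σ' χ' τ', F.Phase1Step L σ χ τ σ' χ' τ') ∧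
      ((χ.symm L.center, L.center) ∈ τ →
        ∀ τ', τ ⊆ τ' → F.SplitsIntoBranches L χ τ' ∧
          F.ReachAgain χ τ' = F.ReachAgain μ₀ τ')) ∧
    (∃ σ μ, F.TwoPhaseRun L μ₀ σ μ) ∧
    ∀ σ μ, F.TwoPhaseRun L μ₀ σ μ →
      σ.Nodup ∧ (∀ a, a ∈ σ) ∧ F.IsSerial μ₀ σ (matchingPairs μ) ∧
      F.IsParetoEfficientReachable μ₀ μ := by
  refine ⟨fun σ χ τ h => ?_, exists_twoPhaseRun L μ₀, fun σ μ h => h.correct⟩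
  obtain ⟨s, d, e, H⟩ := h.exists_state
  exact ⟨H.invariant, fun hc => H.exists_step hc, fun hc τ' hτ =>
    ⟨splitsIntoBranches (hτ hc), reachAgain_congr hτ H.reach⟩⟩

variable {A B : Type*} {F : OAF A B} {L : StarLabelling F.graph}

/-! ### Possible matches in terms of the greedy procedure -/

theorem numBelow_image {d : ℕ → ℕ} {k y : ℕ} (hd : ∀ t t', t < t' → t' < k → d t < d t') :
    Greedy.numBelow ((Finset.range k).image d) y = ((Finset.range k).filter (d · < y)).card := by
  unfold Greedy.numBelow
  rw [Finset.filter_image, Finset.card_image_of_injOn]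
  intro t ht t' ht' h
  simp only [Finset.coe_filter, Finset.mem_range, Set.mem_ofPred_eq] at ht ht'
  rcases Nat.lt_trichotomy t t' with h1 | h1 | h1
  · have := hd t t' h1 ht'.1; omega
  · exact h1
  · have := hd t' t h1 ht.1; omega

/-- On a branch, moving one of the destinations inward preserves feasibility. -/
theorem BranchGreedy.insert_mono {i : Fin L.m} {ag : ℕ → A} {D : Finset ℕ} {J s q q' : ℕ}
    (h : BranchGreedy L i ag (insert q D) (max J q) s) (hq : q ∉ D) (hq' : q' ∉ D) (hle : q' ≤ q) :
    BranchGreedy L i ag (insert q' D) (max J q') s := by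
  refine h.mono (by omega) fun y => ?_
  rw [Greedy.numBelow_insert D hq, Greedy.numBelow_insert D hq']
  split_ifs <;> omega

namespace State

variable {χ : A ≃ B} {τ : Set (A × B)} {s : Fin L.m → ℕ} {d : Fin L.m → ℕ → ℕ} {e : B}
  {i : Fin L.m}

/-- The destinations of the matched agents on branch `i`, including the agent at the center. -/
def destSet (s : Fin L.m → ℕ) (d : Fin L.m → ℕ → ℕ) (i : Fin L.m) : Finset ℕ :=
  (Finset.range (s i + 1)).image (d i)

theorem mem_destSet {x : ℕ} : x ∈ destSet s d i ↔ ∃ t ≤ s i, d i t = x := by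
  simp only [destSet, Finset.mem_image, Finset.mem_range, Nat.lt_succ_iff]

theorem congr_dest {d' : Fin L.m → ℕ → ℕ} (S : State L χ τ s d e)
    (h : ∀ i t, t ≤ s i → d' i t = d i t) : State L χ τ s d' e where
  s_le := S.s_le
  d_zero i := by rw [h i 0 (Nat.zero_le _), S.d_zero]
  d_one i t h1 h2 := by rw [h i t h2]; exact S.d_one i t h1 h2
  d_le i t h1 h2 := by rw [h i t h2]; exact S.d_le i t h1 h2
  d_lt i t t' h1 h2 h3 := by rw [h i t (by omega), h i t' h3]; exact S.d_lt i t t' h1 h2 h3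
  mem_iff p := by
    rw [S.mem_iff]
    refine or_congr_right ⟨?_, ?_⟩
    · rintro ⟨i, t, h1, h2, rfl⟩; exact ⟨i, t, h1, h2, by rw [h i t h2]⟩
    · rintro ⟨i, t, h1, h2, rfl⟩; exact ⟨i, t, h1, h2, by rw [h i t h2]⟩

theorem destSet_push {k : ℕ} :
    destSet (Function.update s i (s i + 1)) (pushDest s d i k) i = insert k (destSet s d i) := by
  ext x
  simp only [mem_destSet, Finset.mem_insert, Function.update_self]
  constructor
  · rintro ⟨t, ht, rfl⟩
    rcases Nat.lt_or_ge (s i) t with h | h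
    · obtain rfl : t = s i + 1 := by omega
      exact Or.inl pushDest_last
    · exact Or.inr ⟨t, h, (pushDest_self h).symm⟩
  · rintro (rfl | ⟨t, ht, rfl⟩)
    · exact ⟨s i + 1, le_rfl, pushDest_last⟩
    · exact ⟨t, by omega, pushDest_self ht⟩

theorem destSet_push_ne {k : ℕ} {i' : Fin L.m} (h : i' ≠ i) :
    destSet (Function.update s i (s i + 1)) (pushDest s d i k) i' = destSet s d i' := by
  simp only [destSet, Function.update_of_ne h, pushDest_ne h]

/-- When the agent next in line on branch `i` can end beyond all destinations fixed so far. -/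
theorem possible_push_iff [Finite A] (S : State L χ τ s d e) (hne : (F.ReachAgain χ τ).Nonempty)
    (hs : s i < L.len i) {k : ℕ} (hk : d i (s i) < k) (hk' : k ≤ L.len i) :
    F.PossibleMatch χ τ (χ.symm (L.obj i (s i + 1))) (L.obj i k) ↔
      LikesOut L i (χ.symm (L.obj i (s i + 1))) (s i + 1) k ∧
      BranchGreedy L i (fun q => χ.symm (L.obj i q)) (insert k (destSet s d i)) k (s i + 1) := by
  rw [possibleMatch_iff, (S.push hs hk hk').nonempty_iff]
  have hd := S.strictMono hne i
  have key : Feasible L χ (Function.update s i (s i + 1)) (pushDest s d i k) i ↔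
      LikesOut L i (χ.symm (L.obj i (s i + 1))) (s i + 1) k ∧
      BranchGreedy L i (fun q => χ.symm (L.obj i q)) (insert k (destSet s d i)) k (s i + 1) := by
    unfold Feasible
    rw [← destSet, destSet_push, Function.update_self, pushDest_last]
    constructor
    · rintro ⟨-, h2, h3⟩
      have := h2 (s i + 1) le_rfl
      rw [pushDest_last] at this
      exact ⟨this, h3⟩
    · rintro ⟨h2, h3⟩
      refine ⟨fun t t' h h' => ?_, fun t ht => ?_, h3⟩
      · rw [pushDest_self (show t ≤ s i by omega)]
        rcases Nat.lt_or_ge (s i) t' with h4 | h4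
        · obtain rfl : t' = s i + 1 := by omega
          rw [pushDest_last]
          rcases Nat.lt_or_ge t (s i) with h5 | h5
          · exact (hd t (s i) h5 le_rfl).trans hk
          · rwa [show t = s i by omega]
        · rw [pushDest_self h4]
          exact hd t t' h h4
      · rcases Nat.lt_or_ge (s i) t with h4 | h4
        · obtain rfl : t = s i + 1 := by omega
          rwa [pushDest_last]
        · rw [pushDest_self h4]
          exact (S.feasible hne i).2.1 t h4
  refine ⟨fun h => key.1 (h i), fun h i' => ?_⟩
  by_cases hi : i' = i
  · subst hi; exact key.2 h
  · have := S.feasible hne i'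
    unfold Feasible at this ⊢
    rwa [Function.update_of_ne hi, pushDest_ne hi]

/-- The destinations `d` with the destination of the agent at the center replaced by `b`. -/
noncomputable def withCenter (L : StarLabelling F.graph) (d : Fin L.m → ℕ → ℕ) (b : B) :
    Fin L.m → ℕ → ℕ :=
  fun i t => if t = 0 then L.pos i b else d i t

theorem withCenter_zero {b : B} : withCenter L d b i 0 = L.pos i b := if_pos rfl

theorem withCenter_pos {b : B} {t : ℕ} (ht : 1 ≤ t) : withCenter L d b i t = d i t :=
  if_neg (by omega)

theorem withCenter_congr {b b' : B} (h : L.pos i b = L.pos i b') :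
    withCenter L d b i = withCenter L d b' i := by
  funext t
  simp only [withCenter, h]

/-- Letting the agent at the center stay there preserves feasibility, since all destinations only move
inward. -/
theorem feasible_withCenter_center {b : B} (h : Feasible L χ s (withCenter L d b) i) :
    Feasible L χ s (withCenter L d L.center) i := by
  obtain ⟨h1, h2, h3⟩ := h
  have hle : ∀ t, withCenter L d L.center i t ≤ withCenter L d b i t := by
    intro t
    rcases Nat.eq_zero_or_pos t with rfl | ht
    · rw [withCenter_zero, L.pos_center]; omega
    · rw [withCenter_pos ht, withCenter_pos ht]
  have h4 : ∀ t t', t < t' → t' ≤ s i →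
      withCenter L d L.center i t < withCenter L d L.center i t' := by
    intro t t' h h'
    refine (hle t).trans_lt ?_
    rw [withCenter_pos (b := L.center) (show 1 ≤ t' by omega),
      ← withCenter_pos (L := L) (d := d) (b := b) (show 1 ≤ t' by omega)]
    exact h1 t t' h h'
  refine ⟨h4, fun t ht => (h2 t ht).mono le_rfl (hle t), h3.mono (hle _) fun y => ?_⟩
  rw [numBelow_image fun t t' h h' => h1 t t' h (by omega),
    numBelow_image fun t t' h h' => h4 t t' h (by omega)]
  refine Finset.card_le_card fun t ht => ?_
  simp only [Finset.mem_filter] at ht ⊢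
  exact ⟨ht.1, (hle t).trans_lt ht.2⟩

section Center

variable [Finite A]

/-- The agent at the center can end at `obj i q`, provided some choice is possible at all. -/
def CenterFeasible (L : StarLabelling F.graph) (χ : A ≃ B) (s : Fin L.m → ℕ)
    (d : Fin L.m → ℕ → ℕ) (i : Fin L.m) (q : ℕ) : Prop :=
  LikesOut L i (χ.symm L.center) 0 q ∧ (∀ t, 1 ≤ t → t ≤ s i → q < d i t) ∧
    BranchGreedy L i (fun q => χ.symm (L.obj i q))
      (insert q ((destSet s (withCenter L d L.center) i).erase 0))
      (max (withCenter L d L.center i (s i)) q) (s i)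

/-- The possible matches of the agent at the center. Feasibility of a destination on branch `i` can be
tested on this branch alone, because on the others the agent at the center behaves as if it stayed
there. -/
theorem possible_center_iff (S : ∀ b, State L χ (insert (χ.symm L.center, b) τ) s (withCenter L d b) b)
    (hne : (F.ReachAgain χ τ).Nonempty) (b : B) :
    F.PossibleMatch χ τ (χ.symm L.center) b ↔ b = L.center ∨
      ∃ i q, 1 ≤ q ∧ q ≤ L.len i ∧ b = L.obj i q ∧ CenterFeasible L χ s d i q := by
  have hposs : ∀ b, F.PossibleMatch χ τ (χ.symm L.center) b ↔
      ∀ i, Feasible L χ s (withCenter L d b) i := fun b => by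
    rw [possibleMatch_iff, (S b).nonempty_iff]
  obtain ⟨μ, hμ⟩ := hne
  have hc : ∀ i, Feasible L χ s (withCenter L d L.center) i := fun i =>
    feasible_withCenter_center ((hposs _).1 ⟨μ, hμ, rfl⟩ i)
  have key : ∀ i q, 1 ≤ q → q ≤ L.len i →
      (Feasible L χ s (withCenter L d (L.obj i q)) i ↔ CenterFeasible L χ s d i q) := by
    intro i q h1 h2
    have hpos : L.pos i (L.obj i q) = q := L.pos_obj i h2
    obtain ⟨c1, c2, c3⟩ := hc i
    have hsm : (∀ t t', t < t' → t' ≤ s i →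
        withCenter L d (L.obj i q) i t < withCenter L d (L.obj i q) i t') ↔
        ∀ t, 1 ≤ t → t ≤ s i → q < d i t := by
      constructor
      · intro h t ht ht'
        have := h 0 t ht ht'
        rwa [withCenter_zero, hpos, withCenter_pos ht] at this
      · intro h t t' htt ht'
        rcases Nat.eq_zero_or_pos t with rfl | h3
        · rw [withCenter_zero, hpos, withCenter_pos (by omega)]
          exact h t' (by omega) ht'
        · have := c1 t t' htt ht'
          rwa [withCenter_pos h3, withCenter_pos (by omega)] at this ⊢
    have hlo : (∀ t ≤ s i, LikesOut L i (χ.symm (L.obj i t)) t (withCenter L d (L.obj i q) i t)) ↔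
        LikesOut L i (χ.symm L.center) 0 q := by
      constructor
      · intro h
        have := h 0 (Nat.zero_le _)
        rwa [withCenter_zero, hpos, L.obj_zero] at this
      · intro h t ht
        rcases Nat.eq_zero_or_pos t with rfl | h3
        · rwa [withCenter_zero, hpos, L.obj_zero]
        · have := c2 t ht
          rwa [withCenter_pos h3] at this ⊢
    have hset : (∀ t, 1 ≤ t → t ≤ s i → q < d i t) →
        insert q ((destSet s (withCenter L d L.center) i).erase 0) =
          destSet s (withCenter L d (L.obj i q)) i := by
      intro h3
      ext x
      simp only [Finset.mem_insert, Finset.mem_erase, mem_destSet]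
      constructor
      · rintro (rfl | ⟨h6, t, ht, rfl⟩)
        · exact ⟨0, by omega, by rw [withCenter_zero, hpos]⟩
        · rcases Nat.eq_zero_or_pos t with rfl | h7
          · rw [withCenter_zero, L.pos_center] at h6; exact absurd rfl h6
          · exact ⟨t, by omega, by rw [withCenter_pos h7, withCenter_pos h7]⟩
      · rintro ⟨t, ht, rfl⟩
        rcases Nat.eq_zero_or_pos t with rfl | h7
        · left; rw [withCenter_zero, hpos]
        · right
          rw [withCenter_pos h7]
          exact ⟨by have := h3 t h7 (by omega); omega, t, by omega, withCenter_pos h7⟩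
    -- the last destination is `q` only if the agent at the center is the only fixed one
    have hmax : (∀ t, 1 ≤ t → t ≤ s i → q < d i t) →
        max (withCenter L d L.center i (s i)) q = withCenter L d (L.obj i q) i (s i) := by
      intro h3
      rcases Nat.eq_zero_or_pos (s i) with h0 | h0
      · rw [h0, withCenter_zero, withCenter_zero, hpos, L.pos_center]; omega
      · rw [withCenter_pos h0, withCenter_pos h0]
        have := h3 (s i) h0 le_rfl; omega
    unfold Feasible CenterFeasible
    rw [hsm, hlo, ← destSet]
    constructor
    · rintro ⟨h3, h4, h5⟩
      exact ⟨h4, h3, by rwa [hset h3, hmax h3]⟩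
    · rintro ⟨h4, h3, h5⟩
      exact ⟨h3, h4, by rwa [← hset h3, ← hmax h3]⟩
  constructor
  · intro h
    by_cases hb : b = L.center
    · exact Or.inl hb
    · obtain ⟨i, q, h1, h2, rfl⟩ := L.cover b hb
      exact Or.inr ⟨i, q, h1, h2, rfl, (key i q h1 h2).1 ((hposs _).1 h i)⟩
  · rintro (rfl | ⟨i, q, h1, h2, rfl, h3⟩)
    · exact (hposs _).2 hc
    · refine (hposs _).2 fun i' => ?_
      by_cases hi : i' = i
      · subst hi; exact (key i' q h1 h2).2 h3
      · have : withCenter L d (L.obj i q) i' = withCenter L d L.center i' :=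
          withCenter_congr (by rw [L.pos_center, L.pos_obj_of_ne hi h2])
        have h4 := hc i'
        unfold Feasible at h4 ⊢
        rwa [this]

end Center

end State

variable {A B : Type*} {F : OAF A B} {L : StarLabelling F.graph}

namespace State

variable {χ : A ≃ B} {τ : Set (A × B)} {s : Fin L.m → ℕ} {d : Fin L.m → ℕ → ℕ}
  {i : Fin L.m}

/-! ### The dictator of a step of the second phase -/

theorem destSet_insert {r : ℕ} (hr : r ≤ s i + 1) :
    destSet (Function.update s i (s i + 1)) (Function.update d i (insertDest (d i) r)) i =
      insert r (destSet s d i) := by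
  ext x
  have := insertDest_image (d := d i) (r := r) (p := s i + 1) hr x
  simp only [mem_destSet, Finset.mem_insert, Function.update_self, ← Nat.lt_succ_iff] at this ⊢
  exact this

/-- The innermost free position `r` is at most the starting point of the agent next in line; it lies
beyond all fixed destinations only if the fixed agents are to stay where they are. -/
theorem free_le [Finite A] (S : State L χ τ s d L.center)
    (hne : (F.ReachAgain χ τ).Nonempty) {r : ℕ}
    (hfill : ∀ x < r, x ∈ destSet s d i) (hfree : r ∉ destSet s d i) :
    1 ≤ r ∧ r ≤ s i + 1 ∧ (d i (s i) < r → r = s i + 1 ∧ d i (s i) = s i) := by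
  have hd := S.strictMono hne i
  have h0 : d i 0 = 0 := by rw [S.d_zero, L.pos_center]
  have hr0 : r ≠ 0 := by
    rintro rfl
    exact hfree (mem_destSet.2 ⟨0, Nat.zero_le _, h0⟩)
  have hself := eq_self_of_filled (d := d i) (p := s i + 1) (r := r)
    (fun t t' h h' => hd t t' h (by omega)) fun x hx => by
      obtain ⟨t, ht, h⟩ := mem_destSet.1 (hfill x hx)
      exact ⟨t, by omega, h⟩
  have h1 := hself (r - 1) (by omega)
  refine ⟨by omega, by omega, fun h2 => ?_⟩
  have h3 := S.le_d i (s i) le_rfl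
  have h4 := hself (s i) (by omega)
  exact ⟨by omega, h4.2⟩

/-- If the agent at the center stays there and `obj i r` is the innermost free object of branch
`i`, the possible matches of the agent next in line are `obj i r`, if it likes to go there, and
possibly some objects beyond all fixed destinations. -/
theorem possible_cases [Finite A] (S : State L χ τ s d L.center)
    (hne : (F.ReachAgain χ τ).Nonempty) (hs : s i < L.len i) {r : ℕ}
    (hfill : ∀ x < r, x ∈ destSet s d i) (hfree : r ∉ destSet s d i) {b : B}
    (hb : F.PossibleMatch χ τ (χ.symm (L.obj i (s i + 1))) b) :
    (b = L.obj i r ∧ r ≤ d i (s i) ∧ LikesIn L i (χ.symm (L.obj i (s i + 1))) (s i + 1) r) ∨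
      ∃ k, d i (s i) < k ∧ k ≤ L.len i ∧ b = L.obj i k := by
  obtain ⟨μ, hμ, rfl⟩ := hb
  obtain ⟨hr1, hr2, hr3⟩ := S.free_le hne hfill hfree
  have hsd := S.le_d i (s i) le_rfl
  have hc : (χ.symm L.center, L.center) ∈ τ := (S.mem_iff _).2 (Or.inl rfl)
  obtain ⟨ν, -, hν⟩ := ((splitsIntoBranches hc μ).1 hμ).2 i
  have hbr : μ (χ.symm (L.obj i (s i + 1))) ∈ L.branch i := by
    have hm : χ.symm (L.obj i (s i + 1)) ∈ χ ⁻¹' L.branch i := by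
      rw [Set.mem_preimage, Equiv.apply_symm_apply]
      exact ⟨s i + 1, by omega, hs, rfl⟩
    rw [hν ⟨_, hm⟩]
    exact Subtype.property _
  obtain ⟨y, hy1, hy2, hy⟩ := hbr
  have hpos : L.pos i (μ (χ.symm (L.obj i (s i + 1)))) = y := by rw [hy, L.pos_obj i hy2]
  by_cases hy3 : s i + 1 ≤ y
  · right
    have := S.dest_lt_pos hne hμ hs (by rwa [hpos])
    rw [hpos] at this
    exact ⟨y, this, hy2, hy⟩
  · have hfill' : ∀ x < r, ∃ t < s i + 1, d i t = x := fun x hx => by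
      obtain ⟨t, ht, h⟩ := mem_destSet.1 (hfill x hx)
      exact ⟨t, by omega, h⟩
    have hfree' : ∀ t < s i + 1, d i t ≠ r := fun t ht h =>
      hfree (mem_destSet.2 ⟨t, by omega, h⟩)
    -- the positions up to `r` are taken by fixed agents
    have hry : r ≤ y := by
      by_contra hlt
      obtain ⟨t, ht, h⟩ := hfill' y (by omega)
      have h1 := S.pos_eq hμ.2 i t (by omega)
      have h2 : μ (χ.symm (L.obj i t)) = L.obj i y := by
        rw [L.eq_obj_of_pos (i := i) (b := μ (χ.symm (L.obj i t))) (by omega), h]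
        omega
      have h3 := symm_obj_inj χ (i := i) (show t ≤ L.len i by omega) hs (μ.injective (h2.trans hy.symm))
      omega
    have hrJ : r ≤ d i (s i) := by
      by_contra hlt
      obtain ⟨h1, h2⟩ := hr3 (by omega)
      omega
    -- an agent that goes inward ends at the innermost free position
    have hyr := S.pos_le_free hne hμ hs hrJ hfill' hfree' (by omega)
    obtain ⟨χ', hm, -⟩ := exists_isMove L i (show s i + 1 ≤ L.len i from hs) hr2 χ
    left
    refine ⟨by rw [hy]; congr 1; omega, hrJ, ?_⟩
    exact (S.reach_move hne hμ hs hr2 hfill' hfree' hm hyr).1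

/-- The agent next in line can end at the innermost free position if it likes to walk there: once it
has been moved there, the remaining agents face the same greedy procedure as before. -/
theorem moveIn_nonempty [Finite A] (S : State L χ τ s d L.center)
    (hne : (F.ReachAgain χ τ).Nonempty) (hs : s i < L.len i) {r : ℕ}
    (hfill : ∀ x < r, x ∈ destSet s d i) (hfree : r ∉ destSet s d i) (hr : r ≤ d i (s i))
    (hl : LikesIn L i (χ.symm (L.obj i (s i + 1))) (s i + 1) r) :
    F.PossibleMatch χ τ (χ.symm (L.obj i (s i + 1))) (L.obj i r) := by
  obtain ⟨hr1, hr2, -⟩ := S.free_le hne hfill hfree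
  have hd := S.strictMono hne i
  have hfill' : ∀ x < r, ∃ t < s i + 1, d i t = x := fun x hx => by
    obtain ⟨t, ht, h⟩ := mem_destSet.1 (hfill x hx)
    exact ⟨t, by omega, h⟩
  have hfree' : ∀ t < s i + 1, d i t ≠ r := fun t ht h =>
    hfree (mem_destSet.2 ⟨t, by omega, h⟩)
  have hd' : ∀ t t', t < t' → t' < s i + 1 → d i t < d i t' := fun t t' h h' =>
    hd t t' h (by omega)
  -- after moving the agent to its destination, feasibility can be checked branch by branch
  obtain ⟨χ', hm, -⟩ := exists_isMove L i (show s i + 1 ≤ L.len i from hs) hr2 χ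
  obtain ⟨m1, m2, m3⟩ := hm.symm_obj hs
  rw [possibleMatch_iff, ← S.reachAgain_move hne hs hr2 hfill' hfree' hm hl
    (b := L.obj i r) (L.pos_obj i (by omega)).le,
    (S.moveIn hs hd hr1 hr2 hfill' hfree' hm).nonempty_iff]
  intro i'
  obtain ⟨f1, f2, f3⟩ := S.feasible hne i'
  by_cases hi : i' = i
  · subst hi
    unfold Feasible
    rw [← destSet, destSet_insert hr2, Function.update_self, Function.update_self,
      insertDest_succ (by
        by_contra hlt
        have := eq_self_of_filled hd' hfill' (s i') (by omega)
        omega)]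
    refine ⟨fun t t' h h' => insertDest_strictMono hd' hfill' hfree' t t' h (by omega), ?_, ?_⟩
    · intro t ht
      rcases Nat.lt_trichotomy t r with h | rfl | h
      · rw [insertDest_lt h, m3 t (by omega) (Or.inl h)]
        exact f2 t (by omega)
      · rw [insertDest_self]
        exact ⟨by omega, fun j h h' => by omega⟩
      · obtain ⟨u, rfl⟩ : ∃ u, t = u + 1 := ⟨t - 1, by omega⟩
        rw [insertDest_succ (by omega), m2 u (by omega) (by omega)]
        exact (f2 u (by omega)).mono (by omega) le_rfl
    · have h1 := Greedy.insert_inward f3 (r := r) hfree hfill hr hl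
      exact BranchGreedy.congr_agents (ag := fun q => χ.symm (L.obj i' q)) h1.2
        fun q h3 h4 => (m3 q h4 (Or.inr h3)).symm
  · have hother : ∀ t, t ≤ L.len i' → χ'.symm (L.obj i' t) = χ.symm (L.obj i' t) := by
      intro t h2
      rw [Equiv.symm_apply_eq, hm.fixed, Equiv.apply_symm_apply]
      intro t' h3 h4 h5
      rw [Equiv.apply_symm_apply] at h5
      have h6 := congrArg (L.pos i) h5
      rw [L.pos_obj_of_ne (Ne.symm hi) h2, L.pos_obj i (by omega)] at h6
      omega
    unfold Feasible
    rw [Function.update_of_ne hi, Function.update_of_ne hi]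
    refine ⟨f1, fun t ht => ?_, f3.congr_agents fun q h1 h2 => (hother q h2).symm⟩
    rw [hother t (ht.trans (S.s_le i'))]
    exact f2 t ht

/-- The best match of the agent next in line in the second phase, if it is beyond all fixed
destinations. -/
theorem bestMatch_out [Finite A] (S : State L χ τ s d L.center)
    (hne : (F.ReachAgain χ τ).Nonempty) (hs : s i < L.len i) {r k : ℕ}
    (hfill : ∀ x < r, x ∈ destSet s d i) (hfree : r ∉ destSet s d i)
    (hk : d i (s i) < k) (hk' : k ≤ L.len i)
    (hpk : F.PossibleMatch χ τ (χ.symm (L.obj i (s i + 1))) (L.obj i k))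
    (hgt : ∀ q, k < q → q ≤ L.len i →
      ¬ F.PossibleMatch χ τ (χ.symm (L.obj i (s i + 1))) (L.obj i q))
    (hr : ¬ (LikesIn L i (χ.symm (L.obj i (s i + 1))) (s i + 1) r ∧
      F.pref (χ.symm (L.obj i (s i + 1))) (L.obj i r) (L.obj i k))) :
    F.BestMatch χ τ (χ.symm (L.obj i (s i + 1))) (L.obj i k) := by
  have hlo := ((S.possible_push_iff hne hs hk hk').1 hpk).1
  have hsd := S.le_d i (s i) le_rfl
  refine ⟨hpk, fun b hb => ?_⟩
  rcases S.possible_cases hne hs hfill hfree hb with ⟨rfl, h1, h2⟩ | ⟨q, h1, h2, rfl⟩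
  · right
    rcases F.pref_trichotomy (χ.symm (L.obj i (s i + 1))) (L.obj i r) (L.obj i k) with h | h | h
    · exact absurd ⟨h2, h⟩ hr
    · have := (L.pos_obj i (show r ≤ L.len i by omega)).symm.trans
        ((congrArg (L.pos i) h).trans (L.pos_obj i hk'))
      omega
    · exact h
  · rcases Nat.lt_trichotomy q k with h | rfl | h
    · exact Or.inr (hlo.pref (by omega) h)
    · exact Or.inl rfl
    · exact absurd hb (hgt q h h2)

/-- The best match of the agent next in line in the second phase, if it is the innermost free
object. -/
theorem bestMatch_in [Finite A] (S : State L χ τ s d L.center)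
    (hne : (F.ReachAgain χ τ).Nonempty) (hs : s i < L.len i) {r k : ℕ}
    (hfill : ∀ x < r, x ∈ destSet s d i) (hfree : r ∉ destSet s d i)
    (hk : d i (s i) ≤ k) (hk' : k ≤ L.len i)
    (hpk : k = d i (s i) ∨ F.PossibleMatch χ τ (χ.symm (L.obj i (s i + 1))) (L.obj i k))
    (hgt : ∀ q, k < q → q ≤ L.len i →
      ¬ F.PossibleMatch χ τ (χ.symm (L.obj i (s i + 1))) (L.obj i q))
    (hr : d i (s i) < k → LikesIn L i (χ.symm (L.obj i (s i + 1))) (s i + 1) r ∧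
      F.pref (χ.symm (L.obj i (s i + 1))) (L.obj i r) (L.obj i k)) :
    F.BestMatch χ τ (χ.symm (L.obj i (s i + 1))) (L.obj i r) ∧ r ≤ d i (s i) ∧
      LikesIn L i (χ.symm (L.obj i (s i + 1))) (s i + 1) r := by
  obtain ⟨hr1, hr2, hr3⟩ := S.free_le hne hfill hfree
  have hsd := S.le_d i (s i) le_rfl
  rcases Nat.lt_or_ge (d i (s i)) k with h1 | h1
  · obtain ⟨hl, hp⟩ := hr h1
    have hpk := hpk.resolve_left (by omega)
    have hlo := ((S.possible_push_iff hne hs h1 hk').1 hpk).1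
    have hrJ : r ≤ d i (s i) := by
      by_contra hlt
      obtain ⟨h2, h3⟩ := hr3 (by omega)
      rcases Nat.lt_or_ge r k with h | h
      · exact F.pref_asymm hp (hlo.pref (by omega) h)
      · rw [show r = k by omega] at hp
        exact F.pref_irrefl _ _ hp
    refine ⟨⟨S.moveIn_nonempty hne hs hfill hfree hrJ hl, fun b hb => ?_⟩, hrJ, hl⟩
    rcases S.possible_cases hne hs hfill hfree hb with ⟨rfl, -⟩ | ⟨q, h4, h5, rfl⟩
    · exact Or.inl rfl
    · right
      rcases Nat.lt_trichotomy q k with h | rfl | h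
      · exact F.pref_trans hp (hlo.pref (by omega) h)
      · exact hp
      · exact absurd hb (hgt q h h5)
  · have hno : ∀ b, F.PossibleMatch χ τ (χ.symm (L.obj i (s i + 1))) b →
        b = L.obj i r ∧ r ≤ d i (s i) ∧
          LikesIn L i (χ.symm (L.obj i (s i + 1))) (s i + 1) r := by
      intro b hb
      rcases S.possible_cases hne hs hfill hfree hb with h | ⟨q, h4, h5, rfl⟩
      · exact h
      · exact absurd hb (hgt q (by omega) h5)
    obtain ⟨μ, hμ⟩ := hne
    obtain ⟨h2, h3, h4⟩ := hno _ ⟨μ, hμ, rfl⟩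
    exact ⟨⟨⟨μ, hμ, h2⟩, fun b hb => Or.inl (hno b hb).1⟩, h3, h4⟩

end State

/-- A stage of the second phase. The configuration `χ'` in which the agents that are to end between
agents already fixed have been moved there replaces the configuration `χ` after the first phase:
it allows the same matchings, and each branch begins with the agents already fixed. -/
structure Phase2State (L : StarLabelling F.graph) (μ₀ χ χ' : A ≃ B) (τ : Set (A × B))
    (s : Fin L.m → ℕ) (d : Fin L.m → ℕ → ℕ) : Prop where
  state : State L χ' τ s d L.center
  reach : F.ReachAgain χ τ = F.ReachAgain χ' τ
  nonempty : (F.ReachAgain χ' τ).Nonempty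
  agree : ∀ i q, s i < q → q ≤ L.len i → χ'.symm (L.obj i q) = μ₀.symm (L.obj i q)

theorem Phase1State.phase2 {μ₀ χ : A ≃ B} {σ : List A} {τ : Set (A × B)} {s : Fin L.m → ℕ}
    {d : Fin L.m → ℕ → ℕ} (H : Phase1State L μ₀ σ χ τ s d L.center) :
    Phase2State L μ₀ χ χ τ s d :=
  ⟨H.state, rfl, H.nonempty, H.agree⟩

namespace Phase2State

variable {μ₀ χ χ' : A ≃ B} {τ : Set (A × B)} {s : Fin L.m → ℕ} {d : Fin L.m → ℕ → ℕ}
  {i : Fin L.m}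

/-- One step of the second phase, where `k` is the outermost possible match beyond all fixed
destinations (or the outermost fixed destination, if there is none) and `r` is the innermost free
position. -/
theorem step [Finite A] (H : Phase2State L μ₀ χ χ' τ s d) (hs : s i < L.len i) {r k c : ℕ} {a : A}
    (ha : a = μ₀.symm (L.obj i (s i + 1)))
    (hfill : ∀ x < r, x ∈ State.destSet s d i) (hfree : r ∉ State.destSet s d i)
    (hk : d i (s i) ≤ k) (hk' : k ≤ L.len i)
    (hpk : k = d i (s i) ∨ F.PossibleMatch χ' τ a (L.obj i k))
    (hgt : ∀ q, k < q → q ≤ L.len i → ¬ F.PossibleMatch χ' τ a (L.obj i q))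
    (hc : (c = k ∧ d i (s i) < k ∧ ¬ (LikesIn L i a (s i + 1) r ∧
        F.pref a (L.obj i r) (L.obj i k))) ∨
      (c = r ∧ (d i (s i) < k → LikesIn L i a (s i + 1) r ∧ F.pref a (L.obj i r) (L.obj i k)))) :
    c ≤ L.len i ∧ F.BestMatch χ τ a (L.obj i c) ∧
      ∃ χ'' d', Phase2State L μ₀ χ χ'' (insert (a, L.obj i c) τ) (Function.update s i (s i + 1)) d' ∧
        State.destSet (Function.update s i (s i + 1)) d' i = insert c (State.destSet s d i) ∧
        ∀ i', i' ≠ i → State.destSet (Function.update s i (s i + 1)) d' i' = State.destSet s d i' := by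
  have S := H.state
  have hne := H.nonempty
  have ha' : a = χ'.symm (L.obj i (s i + 1)) := by
    rw [ha, H.agree i _ (Nat.lt_succ_self _) hs]
  subst ha'
  rcases hc with ⟨rfl, h1, h2⟩ | ⟨rfl, h1⟩
  · have hb := S.bestMatch_out hne hs hfill hfree h1 hk' (hpk.resolve_left (by omega)) hgt h2
    refine ⟨hk', (bestMatch_congr H.reach).2 hb, χ', State.pushDest s d i c, ⟨S.push hs h1 hk',
      reachAgain_congr (Set.subset_insert _ _) H.reach, possibleMatch_iff.1 hb.1, ?_⟩,
      State.destSet_push, fun i' h => State.destSet_push_ne h⟩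
    intro i' q h h'
    refine H.agree i' q ?_ h'
    by_cases hi : i' = i
    · subst hi; rw [Function.update_self] at h; omega
    · rwa [Function.update_of_ne hi] at h
  · obtain ⟨hb, hcJ, hl⟩ := S.bestMatch_in hne hs hfill hfree hk hk' hpk hgt h1
    obtain ⟨hr1, hr2, -⟩ := S.free_le hne hfill hfree
    have hd := S.strictMono hne i
    have hfill' : ∀ x < c, ∃ t < s i + 1, d i t = x := fun x hx => by
      obtain ⟨t, ht, h⟩ := State.mem_destSet.1 (hfill x hx)
      exact ⟨t, by omega, h⟩
    have hfree' : ∀ t < s i + 1, d i t ≠ c := fun t ht h =>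
      hfree (State.mem_destSet.2 ⟨t, by omega, h⟩)
    obtain ⟨χ'', hm, -⟩ := exists_isMove L i (show s i + 1 ≤ L.len i from hs) hr2 χ'
    have hre := S.reachAgain_move hne hs hr2 hfill' hfree' hm hl
      (b := L.obj i c) (L.pos_obj i (by omega)).le
    refine ⟨by omega, (bestMatch_congr H.reach).2 hb, χ'', _,
      ⟨S.moveIn hs hd hr1 hr2 hfill' hfree' hm, ?_, ?_, ?_⟩, State.destSet_insert hr2,
      fun i' h => ?_⟩
    · rw [hre]
      exact reachAgain_congr (Set.subset_insert _ _) H.reach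
    · rw [hre]
      exact possibleMatch_iff.1 hb.1
    · intro i' q h h'
      have h1 : χ''.symm (L.obj i' q) = χ'.symm (L.obj i' q) := by
        by_cases hi : i' = i
        · subst hi
          rw [Function.update_self] at h
          exact (hm.symm_obj hs).2.2 q h' (Or.inr h)
        · rw [Equiv.symm_apply_eq, hm.fixed, Equiv.apply_symm_apply]
          intro t' h3 h4 h5
          rw [Equiv.apply_symm_apply] at h5
          have h6 := congrArg (L.pos i) h5
          rw [L.pos_obj_of_ne (Ne.symm hi) h', L.pos_obj i (by omega)] at h6
          omega
      rw [h1]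
      refine H.agree i' q ?_ h'
      by_cases hi : i' = i
      · subst hi; rw [Function.update_self] at h; omega
      · rwa [Function.update_of_ne hi] at h
    · simp only [State.destSet, Function.update_of_ne h]

end Phase2State

end OAF

/-! ### A small structured language on top of the word RAM -/

namespace WordRAM

/-- Expressions over word variables, literals, arithmetic and array reads. -/
inductive Ex
  | lit (c : ℕ)
  | v (x : ℕ)
  | bin (o : Op) (a b : Ex)
  | get (r : ℕ) (a : Ex)

namespace Ex

instance : Add Ex := ⟨bin .add⟩
instance : Sub Ex := ⟨bin .sub⟩
instance : Mul Ex := ⟨bin .mul⟩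
instance : Div Ex := ⟨bin .div⟩
instance (c : ℕ) : OfNat Ex c := ⟨lit c⟩

/-- The value of an expression, ignoring the word size. -/
def eval (s : Mem) : Ex → ℕ
  | lit c => c
  | v x => s.var x
  | bin o a b => o.eval (a.eval s) (b.eval s)
  | get r a => s.arr r (a.eval s)

/-- The expression only uses the variables below `100` and arrays other than `99`, which are
reserved for intermediate values, and all intermediate values fit into a word. -/
def Fits (W : ℕ) (s : Mem) : Ex → Prop
  | lit c => c ≤ W
  | v x => x < 100
  | bin o a b => a.Fits W s ∧ b.Fits W s ∧ o.eval (a.eval s) (b.eval s) ≤ W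
  | get r a => r ≠ 99 ∧ a.Fits W s

/-- The number of instructions of `Ex.code`. -/
def cost : Ex → ℕ
  | lit _ => 1
  | v _ => 3
  | bin _ a b => a.cost + b.cost + 1
  | get _ a => a.cost + 1

/-- Code that stores the value of the expression in variable `k`, with the variables from `k` on
used as a stack. A variable is copied through a cell of array `99`. -/
def code : Ex → ℕ → Cmd
  | lit c, k => .const k c
  | v x, k => .seq (.const k 0) (.seq (.store 99 k x) (.load k 99 k))
  | bin o a b, k => .seq (a.code k) (.seq (b.code (k + 1)) (.arith o k k (k + 1)))
  | get r a, k => .seq (a.code k) (.load k r k)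

section
variable (W : ℕ) (s : Mem) (a b : Ex) (c x r : ℕ)

@[simp] theorem eval_v : (v x).eval s = s.var x := rfl
@[simp] theorem eval_get : (get r a).eval s = s.arr r (a.eval s) := rfl
@[simp] theorem eval_add : (a + b).eval s = a.eval s + b.eval s := rfl
@[simp] theorem eval_sub : (a - b).eval s = a.eval s - b.eval s := rfl
@[simp] theorem eval_mul : (a * b).eval s = a.eval s * b.eval s := rfl
@[simp] theorem eval_div : (a / b).eval s = a.eval s / b.eval s := rfl
@[simp] theorem fits_v : (v x).Fits W s ↔ x < 100 := Iff.rfl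
@[simp] theorem fits_get : (get r a).Fits W s ↔ r ≠ 99 ∧ a.Fits W s := Iff.rfl
@[simp] theorem fits_add :
    (a + b).Fits W s ↔ a.Fits W s ∧ b.Fits W s ∧ a.eval s + b.eval s ≤ W := Iff.rfl
@[simp] theorem fits_sub :
    (a - b).Fits W s ↔ a.Fits W s ∧ b.Fits W s ∧ a.eval s - b.eval s ≤ W := Iff.rfl
@[simp] theorem fits_mul :
    (a * b).Fits W s ↔ a.Fits W s ∧ b.Fits W s ∧ a.eval s * b.eval s ≤ W := Iff.rfl
@[simp] theorem fits_div :
    (a / b).Fits W s ↔ a.Fits W s ∧ b.Fits W s ∧ a.eval s / b.eval s ≤ W := Iff.rfl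
@[simp] theorem eval_zero : (0 : Ex).eval s = 0 := rfl
@[simp] theorem fits_zero : (0 : Ex).Fits W s ↔ 0 ≤ W := Iff.rfl
@[simp] theorem cost_zero : (0 : Ex).cost = 1 := rfl
@[simp] theorem eval_one : (1 : Ex).eval s = 1 := rfl
@[simp] theorem fits_one : (1 : Ex).Fits W s ↔ 1 ≤ W := Iff.rfl
@[simp] theorem cost_one : (1 : Ex).cost = 1 := rfl
@[simp] theorem eval_two : (2 : Ex).eval s = 2 := rfl
@[simp] theorem fits_two : (2 : Ex).Fits W s ↔ 2 ≤ W := Iff.rfl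
@[simp] theorem cost_two : (2 : Ex).cost = 1 := rfl
@[simp] theorem cost_v : (v x).cost = 3 := rfl
@[simp] theorem cost_get : (get r a).cost = a.cost + 1 := rfl
@[simp] theorem cost_add : (a + b).cost = a.cost + b.cost + 1 := rfl
@[simp] theorem cost_sub : (a - b).cost = a.cost + b.cost + 1 := rfl
@[simp] theorem cost_mul : (a * b).cost = a.cost + b.cost + 1 := rfl
@[simp] theorem cost_div : (a / b).cost = a.cost + b.cost + 1 := rfl

end

end Ex

@[simp] theorem setVar_var (s : Mem) (x c y : ℕ) :
    (s.setVar x c).var y = if y = x then c else s.var y := by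
  simp [Mem.setVar, Function.update_apply]

@[simp] theorem setVar_arr (s : Mem) (x c : ℕ) : (s.setVar x c).arr = s.arr := rfl

@[simp] theorem setArr_var (s : Mem) (r p c : ℕ) : (s.setArr r p c).var = s.var := rfl

@[simp] theorem setArr_arr (s : Mem) (r p c r' : ℕ) :
    (s.setArr r p c).arr r' = if r' = r then Function.update (s.arr r) p c else s.arr r' := by
  simp only [Mem.setArr, Function.update_apply]

/-- The memories agree up to the variables and the array reserved for intermediate values. -/
structure Sim (m s : Mem) : Prop where
  var : ∀ x < 100, m.var x = s.var x
  arr : ∀ r, r ≠ 99 → m.arr r = s.arr r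

theorem Sim.setVar {m s : Mem} (h : Sim m s) (x c : ℕ) : Sim (m.setVar x c) (s.setVar x c) :=
  ⟨fun y hy => by simp [h.var y hy], h.arr⟩

theorem Sim.setArr {m s : Mem} (h : Sim m s) {r : ℕ} (hr : r ≠ 99) (p c : ℕ) :
    Sim (m.setArr r p c) (s.setArr r p c) :=
  ⟨h.var, fun r' hr' => by simp only [setArr_arr, h.arr r hr, h.arr r' hr']⟩

theorem Sim.temp {m s : Mem} (h : Sim m s) {k : ℕ} (hk : 100 ≤ k) (c : ℕ) :
    Sim (m.setVar k c) s :=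
  ⟨fun y hy => by simp [h.var y hy]; intro; omega, h.arr⟩

theorem Sim.tempArr {m s : Mem} (h : Sim m s) (p c : ℕ) : Sim (m.setArr 99 p c) s :=
  ⟨h.var, fun r hr => by simp [h.arr r hr, hr]⟩

/-- The code of an expression computes its value in variable `k`, without touching the variables below
`k`, in as many steps as its cost. -/
theorem Ex.exec_code {W : ℕ} {s : Mem} (e : Ex) (he : e.Fits W s) :
    ∀ {k : ℕ} {m : Mem}, 100 ≤ k → Sim m s → ∃ m', Exec W (e.code k) m m' e.cost ∧ Sim m' s ∧
      m'.var k = e.eval s ∧ ∀ x < k, m'.var x = m.var x := by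
  induction e with
  | lit c =>
    intro k m hk h
    exact ⟨_, .const m k c he, h.temp hk c, by simp [eval], fun x hx => by simp; omega⟩
  | v x =>
    intro k m hk h
    have hx : x < 100 := he
    refine ⟨_, .seq (.const m k 0 (Nat.zero_le _)) (.seq (.store _ 99 k x) (.load _ k 99 k)),
      ((h.temp hk 0).tempArr _ _).temp hk _, ?_, fun y hy => ?_⟩
    · have : x ≠ k := by omega
      simp [this, h.var x hx]
    · simp only [setVar_var, setArr_var]
      rw [if_neg (by omega), if_neg (by omega)]
  | bin o a b iha ihb =>
    intro k m hk h
    obtain ⟨m1, h1, h2, h3, h4⟩ := iha he.1 hk h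
    obtain ⟨m2, h5, h6, h7, h8⟩ := ihb he.2.1 (k := k + 1) (by omega) h2
    have hv : o.eval (m2.var k) (m2.var (k + 1)) = (bin o a b).eval s := by
      rw [h8 k (by omega), h3, h7]; rfl
    refine ⟨m2.setVar k (o.eval (m2.var k) (m2.var (k + 1))), ?_, h6.temp hk _, ?_,
      fun y hy => ?_⟩
    · rw [cost, Nat.add_assoc]
      exact .seq h1 (.seq h5 (.arith m2 o k k (k + 1) (by rw [hv]; exact he.2.2)))
    · simp [hv]
    · simp only [setVar_var]
      rw [if_neg (by omega), h8 y (by omega), h4 y hy]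
  | get r a iha =>
    intro k m hk h
    obtain ⟨m1, h1, h2, h3, h4⟩ := iha he.2 hk h
    refine ⟨_, .seq h1 (.load m1 k r k), h2.temp hk _, ?_, fun y hy => ?_⟩
    · simp [h3, h2.arr r he.1, eval]
    · simp only [setVar_var]
      rw [if_neg (by omega), h4 y hy]

/-- Structured programs whose instructions and tests involve expressions. -/
inductive Prog
  | skip
  | asg (x : ℕ) (e : Ex)
  | sto (r : ℕ) (i e : Ex)
  | seq (p q : Prog)
  | ite (a b : Ex) (p q : Prog)
  | loop (a b : Ex) (p : Prog)

namespace Prog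

/-- Code that evaluates two expressions into the variables `100` and `101`. -/
def codes (a b : Ex) : Cmd := .seq (a.code 100) (b.code 101)

/-- The translation into RAM code. -/
def compile : Prog → Cmd
  | skip => .skip
  | asg x e => .seq (e.code 100) (.seq (.const 101 0) (.seq (.store 99 101 100) (.load x 99 101)))
  | sto r i e => .seq (codes i e) (.store r 100 101)
  | seq p q => .seq p.compile q.compile
  | ite a b p q => .seq (codes a b) (.ite 100 101 p.compile q.compile)
  | loop a b p => .seq (codes a b) (.loop 100 101 (.seq p.compile (codes a b)))

/-- The variables assigned by a program. -/
def wv : Prog → List ℕ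
  | skip => []
  | asg x _ => [x]
  | sto _ _ _ => []
  | seq p q => p.wv ++ q.wv
  | ite _ _ p q => p.wv ++ q.wv
  | loop _ _ p => p.wv

/-- The arrays into which a program writes. -/
def wa : Prog → List ℕ
  | skip => []
  | asg _ _ => []
  | sto r _ _ => [r]
  | seq p q => p.wa ++ q.wa
  | ite _ _ p q => p.wa ++ q.wa
  | loop _ _ p => p.wa

end Prog

infixr:55 " ;; " => Prog.seq

/-- `s'` differs from `s` at most in the variables and arrays that `p` writes. -/
structure Frame (p : Prog) (s s' : Mem) : Prop where
  var' : ∀ x, x ∉ p.wv → s'.var x = s.var x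
  arr' : ∀ r, r ∉ p.wa → s'.arr r = s.arr r

theorem Frame.var {p : Prog} {s s' : Mem} (h : Frame p s s') (x : ℕ)
    (hx : p.wv.contains x = false := by rfl) : s'.var x = s.var x :=
  h.var' x (by simpa using hx)

theorem Frame.arr {p : Prog} {s s' : Mem} (h : Frame p s s') (r : ℕ)
    (hr : p.wa.contains r = false := by rfl) : s'.arr r = s.arr r :=
  h.arr' r (by simpa using hr)

theorem Frame.refl (p : Prog) (s : Mem) : Frame p s s := ⟨fun _ _ => rfl, fun _ _ => rfl⟩

theorem Frame.trans {p : Prog} {s s' s'' : Mem} (h : Frame p s s') (h' : Frame p s' s'') :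
    Frame p s s'' :=
  ⟨fun x hx => (h'.var' x hx).trans (h.var' x hx), fun r hr => (h'.arr' r hr).trans (h.arr' r hr)⟩

/-- From every memory that agrees with `s` up to intermediate values, the program `p` halts within
`T` steps in a memory that agrees, up to intermediate values, with one that satisfies `Q` and
differs from `s` only where `p` writes. -/
def Wp (W : ℕ) (p : Prog) (s : Mem) (T : ℕ) (Q : Mem → Prop) : Prop :=
  ∀ m, Sim m s → ∃ m' t s', Exec W p.compile m m' t ∧ t ≤ T ∧ Sim m' s' ∧ Frame p s s' ∧ Q s'

variable {W : ℕ} {s : Mem} {T : ℕ} {Q : Mem → Prop}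

theorem Wp.weaken {p : Prog} {T' : ℕ} {Q' : Mem → Prop} (h : Wp W p s T Q) (hT : T ≤ T')
    (hQ : ∀ s', Frame p s s' → Q s' → Q' s') : Wp W p s T' Q' := by
  intro m hm
  obtain ⟨m', t, s', h1, h2, h3, h4, h5⟩ := h m hm
  exact ⟨m', t, s', h1, h2.trans hT, h3, h4, hQ s' h4 h5⟩

theorem Wp.seq {p q : Prog} (T₁ : ℕ) (R : Mem → Prop) (hT : T₁ ≤ T) (h : Wp W p s T₁ R)
    (h' : ∀ s', Frame p s s' → R s' → Wp W q s' (T - T₁) Q) :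
    Wp W (.seq p q) s T Q := by
  intro m hm
  obtain ⟨m1, t1, s1, h1, h2, h3, h4, h5⟩ := h m hm
  obtain ⟨m2, t2, s2, h6, h7, h8, h9, h10⟩ := h' s1 h4 h5 m1 h3
  refine ⟨m2, _, s2, .seq h1 h6, by omega, h8, ⟨fun x hx => ?_, fun r hr => ?_⟩, h10⟩
  · simp only [Prog.wv, List.mem_append, not_or] at hx
    rw [h9.var' x hx.2, h4.var' x hx.1]
  · simp only [Prog.wa, List.mem_append, not_or] at hr
    rw [h9.arr' r hr.2, h4.arr' r hr.1]

theorem exec_codes {a b : Ex} (ha : a.Fits W s) (hb : b.Fits W s) {m : Mem} (hm : Sim m s) :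
    ∃ m', Exec W (Prog.codes a b) m m' (a.cost + b.cost) ∧ Sim m' s ∧
      m'.var 100 = a.eval s ∧ m'.var 101 = b.eval s := by
  obtain ⟨m1, h1, h2, h3, -⟩ := a.exec_code ha le_rfl hm
  obtain ⟨m2, h5, h6, h7, h8⟩ := b.exec_code hb (k := 101) (by omega) h2
  exact ⟨m2, .seq h1 h5, h6, by rw [h8 100 (by omega), h3], h7⟩

theorem Wp.ite {a b : Ex} {p q : Prog} {T₁ : ℕ} (ha : a.Fits W s) (hb : b.Fits W s)
    (hT : T₁ + (a.cost + b.cost + 1) ≤ T)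
    (hp : a.eval s < b.eval s → Wp W p s T₁ Q)
    (hq : ¬ a.eval s < b.eval s → Wp W q s T₁ Q) : Wp W (.ite a b p q) s T Q := by
  intro m hm
  obtain ⟨m1, h1, h2, h3, h4⟩ := exec_codes ha hb hm
  by_cases h : a.eval s < b.eval s
  · obtain ⟨m2, t, s2, h5, h6, h7, h8, h9⟩ := hp h m1 h2
    refine ⟨m2, _, s2, .seq h1 (.ite_true (by rwa [h3, h4]) h5), by omega, h7,
      ⟨fun x hx => h8.var' x ?_, fun r hr => h8.arr' r ?_⟩, h9⟩
    · simp only [Prog.wv, List.mem_append, not_or] at hx; exact hx.1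
    · simp only [Prog.wa, List.mem_append, not_or] at hr; exact hr.1
  · obtain ⟨m2, t, s2, h5, h6, h7, h8, h9⟩ := hq h m1 h2
    refine ⟨m2, _, s2, .seq h1 (.ite_false (by rwa [h3, h4]) h5), by omega, h7,
      ⟨fun x hx => h8.var' x ?_, fun r hr => h8.arr' r ?_⟩, h9⟩
    · simp only [Prog.wv, List.mem_append, not_or] at hx; exact hx.2
    · simp only [Prog.wa, List.mem_append, not_or] at hr; exact hr.2

/-- The rule for loops, with an invariant and a potential that pays for the running time. -/
theorem Wp.loop {a b : Ex} {p : Prog} (Inv : Mem → Prop) (φ : Mem → ℕ) (h0 : Inv s)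
    (hT : φ s + (a.cost + b.cost + 1) ≤ T)
    (hfit : ∀ s', Inv s' → Frame p s s' → a.Fits W s' ∧ b.Fits W s')
    (hbody : ∀ s', Inv s' → Frame p s s' → a.eval s' < b.eval s' →
      ∃ B, Wp W p s' B (fun s'' => Inv s'' ∧ φ s'' + B + (a.cost + b.cost + 1) ≤ φ s'))
    (hend : ∀ s', Inv s' → Frame p s s' → ¬ a.eval s' < b.eval s' → Q s') :
    Wp W (.loop a b p) s T Q := by
  -- the RAM loop is entered with the two sides of its test in the variables `100` and `101`
  have key : ∀ N, ∀ s', φ s' ≤ N → Inv s' → Frame p s s' → ∀ m, Sim m s' →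
      m.var 100 = a.eval s' → m.var 101 = b.eval s' →
      ∃ m' t s'', Exec W (.loop 100 101 (.seq p.compile (Prog.codes a b))) m m' t ∧
        t ≤ φ s' + 1 ∧ Sim m' s'' ∧ Frame p s s'' ∧ Q s'' := by
    intro N
    induction N using Nat.strong_induction_on with
    | _ N ih =>
      intro s' hN hI hF m hm h1 h2
      by_cases hlt : a.eval s' < b.eval s'
      · obtain ⟨B, hB⟩ := hbody s' hI hF hlt
        obtain ⟨m1, t1, s1, e1, t1B, hm1, hF1, hI1, hφ⟩ := hB m hm
        obtain ⟨hfa, hfb⟩ := hfit s1 hI1 (hF.trans hF1)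
        obtain ⟨m2, e2, hm2, h3, h4⟩ := exec_codes hfa hfb hm1
        obtain ⟨m3, t3, s3, e3, ht3, hm3, hF3, hQ3⟩ :=
          ih (φ s1) (by omega) s1 le_rfl hI1 (hF.trans hF1) m2 hm2 h3 h4
        exact ⟨m3, _, s3, .loop_true (by rwa [h1, h2]) (.seq e1 e2) e3, by omega, hm3, hF3, hQ3⟩
      · exact ⟨m, _, s', .loop_false (by rwa [h1, h2]), by omega, hm, hF, hend s' hI hF hlt⟩
  intro m hm
  obtain ⟨hfa, hfb⟩ := hfit s h0 (Frame.refl p s)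
  obtain ⟨m1, e1, hm1, h1, h2⟩ := exec_codes hfa hfb hm
  obtain ⟨m2, t2, s2, e2, ht2, hm2, hF2, hQ2⟩ :=
    key (φ s) s le_rfl h0 (Frame.refl p s) m1 hm1 h1 h2
  exact ⟨m2, _, s2, .seq e1 e2, by omega, hm2, ⟨hF2.1, hF2.2⟩, hQ2⟩

/-- Verification condition of a program without loops, where `Q` also receives the time. -/
def Prog.vc (W : ℕ) : Prog → (Mem → ℕ → Prop) → Mem → ℕ → Prop
  | skip, Q, s, t => Q s (t + 1)
  | asg x e, Q, s, t => e.Fits W s ∧ Q (s.setVar x (e.eval s)) (t + (e.cost + 3))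
  | sto r i e, Q, s, t =>
    r ≠ 99 ∧ i.Fits W s ∧ e.Fits W s ∧
      Q (s.setArr r (i.eval s) (e.eval s)) (t + (i.cost + e.cost + 1))
  | seq p q, Q, s, t => p.vc W (fun s' t' => q.vc W Q s' t') s t
  | ite a b p q, Q, s, t =>
    a.Fits W s ∧ b.Fits W s ∧ (a.eval s < b.eval s → p.vc W Q s (t + (a.cost + b.cost + 1))) ∧
      (¬ a.eval s < b.eval s → q.vc W Q s (t + (a.cost + b.cost + 1)))
  | loop _ _ _, _, _, _ => False

/-- The verification condition is sound: the program halts, having used the time that the condition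
accounts for. -/
theorem Prog.vc.exec {p : Prog} : ∀ {R : Mem → ℕ → Prop} {s : Mem} {t : ℕ}, p.vc W R s t →
    ∀ m, Sim m s → ∃ m' δ s', Exec W p.compile m m' δ ∧ Sim m' s' ∧ Frame p s s' ∧
      R s' (t + δ) := by
  induction p with
  | skip => exact fun h m hm => ⟨m, _, _, .skip m, hm, Frame.refl _ _, h⟩
  | asg x e =>
    rintro R s t ⟨he, hQ⟩ m hm
    obtain ⟨m1, h1, h2, h3, -⟩ := e.exec_code he le_rfl hm
    refine ⟨_, _, s.setVar x (e.eval s), .seq h1 (.seq (.const m1 101 0 (Nat.zero_le _))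
      (.seq (.store _ 99 101 100) (.load _ x 99 101))), ?_,
      ⟨fun y hy => ?_, fun r _ => rfl⟩, hQ⟩
    · have h4 : ((m1.setVar 101 0).setArr 99 ((m1.setVar 101 0).var 101)
          ((m1.setVar 101 0).var 100)).arr 99
          (((m1.setVar 101 0).setArr 99 ((m1.setVar 101 0).var 101)
          ((m1.setVar 101 0).var 100)).var 101) = e.eval s := by simp [h3]
      rw [h4]
      exact ((h2.temp (by omega) _).tempArr _ _).setVar _ _
    · have : y ≠ x := by simpa [Prog.wv] using hy
      simp only [setVar_var, if_neg this]
  | sto r i e =>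
    rintro R s t ⟨hr, hi, he, hQ⟩ m hm
    obtain ⟨m1, h1, h2, h3, h4⟩ := exec_codes hi he hm
    refine ⟨_, _, s.setArr r (i.eval s) (e.eval s), .seq h1 (.store m1 r 100 101), ?_,
      ⟨fun y _ => rfl, fun r' hr' => ?_⟩, hQ⟩
    · rw [h3, h4]
      exact h2.setArr hr _ _
    · have : r' ≠ r := by simpa [Prog.wa] using hr'
      simp only [setArr_arr, if_neg this]
  | seq p q ihp ihq =>
    intro R s t h m hm
    obtain ⟨m1, t1, s1, h1, h3, h4, h5⟩ := ihp h m hm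
    obtain ⟨m2, t2, s2, h6, h8, h9, h10⟩ := ihq h5 m1 h3
    refine ⟨m2, _, s2, .seq h1 h6, h8, ⟨fun x hx => ?_, fun r hr => ?_⟩,
      by rwa [← Nat.add_assoc]⟩
    · simp only [Prog.wv, List.mem_append, not_or] at hx
      rw [h9.var' x hx.2, h4.var' x hx.1]
    · simp only [Prog.wa, List.mem_append, not_or] at hr
      rw [h9.arr' r hr.2, h4.arr' r hr.1]
  | ite a b p q ihp ihq =>
    rintro R s t ⟨ha, hb, hp, hq⟩ m hm
    obtain ⟨m1, h1, h2, h3, h4⟩ := exec_codes ha hb hm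
    by_cases h : a.eval s < b.eval s
    · obtain ⟨m2, δ, s2, h5, h7, h8, h9⟩ := ihp (hp h) m1 h2
      refine ⟨m2, _, s2, .seq h1 (.ite_true (by rwa [h3, h4]) h5), h7,
        ⟨fun x hx => h8.var' x ?_, fun r hr => h8.arr' r ?_⟩, ?_⟩
      · simp only [Prog.wv, List.mem_append, not_or] at hx; exact hx.1
      · simp only [Prog.wa, List.mem_append, not_or] at hr; exact hr.1
      · convert h9 using 1; omega
    · obtain ⟨m2, δ, s2, h5, h7, h8, h9⟩ := ihq (hq h) m1 h2
      refine ⟨m2, _, s2, .seq h1 (.ite_false (by rwa [h3, h4]) h5), h7,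
        ⟨fun x hx => h8.var' x ?_, fun r hr => h8.arr' r ?_⟩, ?_⟩
      · simp only [Prog.wv, List.mem_append, not_or] at hx; exact hx.2
      · simp only [Prog.wa, List.mem_append, not_or] at hr; exact hr.2
      · convert h9 using 1; omega
  | loop a b p => exact fun h => h.elim

theorem Wp.of_vc {p : Prog} (h : p.vc W (fun s' t => t ≤ T ∧ Q s') s 0) : Wp W p s T Q := by
  intro m hm
  obtain ⟨m', δ, s', h1, h2, h3, h4, h5⟩ := h.exec m hm
  exact ⟨m', δ, s', h1, by omega, h2, h3, h5⟩

/-- The rule for a loop that counts a variable up to a bound, where the iterations may have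
different costs. -/
theorem Wp.count {x : ℕ} {b : Ex} {p : Prog} {N : ℕ} (Inv : ℕ → Mem → Prop) (f : ℕ → ℕ)
    (h0 : Inv (s.var x) s) (hx : x < 100)
    (hle : s.var x ≤ N)
    (hb : ∀ k s', k ≤ N → Inv k s' → Frame p s s' → b.eval s' = N ∧ b.Fits W s')
    (hbody : ∀ k s', k < N → s'.var x = k → Inv k s' → Frame p s s' →
      Wp W p s' (f k) (fun s'' => Inv (k + 1) s'' ∧ s''.var x = k + 1))
    (hT : (∑ k ∈ Finset.range N, (f k + b.cost + 4)) + (b.cost + 4) ≤ T)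
    (hend : ∀ s', Inv N s' → s'.var x = N → Frame p s s' → Q s') :
    Wp W (.loop (.v x) b p) s T Q := by
  refine Wp.loop (fun s' => Inv (s'.var x) s' ∧ s'.var x ≤ N)
    (fun s' => ∑ k ∈ Finset.Ico (s'.var x) N, (f k + b.cost + 4)) ⟨h0, hle⟩ ?_ ?_ ?_ ?_
  · have : ∑ k ∈ Finset.Ico (s.var x) N, (f k + b.cost + 4) ≤
        ∑ k ∈ Finset.range N, (f k + b.cost + 4) :=
      Finset.sum_le_sum_of_subset (fun k hk => by
        simp only [Finset.mem_Ico, Finset.mem_range] at hk ⊢; exact hk.2)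
    simp only [Ex.cost_v]
    omega
  · rintro s' ⟨h1, h2⟩ hF
    exact ⟨hx, (hb _ s' h2 h1 hF).2⟩
  · rintro s' ⟨h1, h2⟩ hF hlt
    rw [(hb _ s' h2 h1 hF).1] at hlt
    replace hlt : s'.var x < N := hlt
    refine ⟨_, (hbody _ s' hlt rfl h1 hF).weaken le_rfl ?_⟩
    rintro s'' hF' ⟨h3, h4⟩
    rw [h4]
    refine ⟨⟨h3, hlt⟩, ?_⟩
    rw [Finset.sum_eq_sum_Ico_succ_bot (a := s'.var x) (b := N) hlt]
    simp only [Ex.cost_v]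
    omega
  · rintro s' ⟨h1, h2⟩ hF hlt
    rw [(hb _ s' h2 h1 hF).1] at hlt
    have hlt' : ¬ s'.var x < N := hlt
    have : s'.var x = N := by omega
    exact hend s' (this ▸ h1) this hF

/-! ### Trying out a set of destinations on one branch -/

open Ex Prog

/- Variables: the number `xN` of agents; the base address `xB`, the length `xL` and the first
undecided agent `xP` of the current branch, and its last marked slot `xJ`. Slot `j` of the branch
with first vertex `v` is stored at address `v * n + j` of each table. The rest is working space of
the greedy procedure: the innermost slot `xR` not known to be taken, the loop bound `xE`, the
outermost slot `xO` taken by an agent that was pushed outward, the next agent `xQ`, and the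
result `xK`. -/
notation "xN" => 0
notation "xB" => 1
notation "xL" => 2
notation "xP" => 3
notation "xJ" => 4
notation "xT" => 5
notation "xR" => 6
notation "xE" => 7
notation "xO" => 8
notation "xQ" => 9
notation "xK" => 10

/- Arrays: the ranks of the objects, indexed by `a * n + b`; the initial holders of the objects; the
object in each slot and the length of each branch; which slots are marked, and how many agents of
each branch are fixed; the innermost and the outermost slot to which the initial holder of each slot
is willing to walk. -/
notation "aRANK" => 5
notation "aHOLD" => 6
notation "aOBJ" => 7
notation "aLEN" => 8
notation "aMARK" => 9
notation "aCNT" => 10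
notation "aINW" => 11
notation "aOUT" => 12

/-- Finds the last marked slot of the branch with base address `xB` and length `xL`. -/
def lastMark : Prog :=
  (asg xJ 0 ;; asg xT 1) ;;
  loop (v xT) (v xL + 1)
    (ite 0 (get aMARK (v xB + v xT)) (asg xJ (v xT)) skip ;; asg xT (v xT + 1))

/-- Slot `J` is the last marked slot among `0, …, ℓ`, slot `0` counting as marked. -/
def IsLast (M : ℕ → ℕ) (ℓ J : ℕ) : Prop :=
  J ≤ ℓ ∧ (J = 0 ∨ 0 < M J) ∧ ∀ t, J < t → t ≤ ℓ → M t = 0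

theorem lastMark_spec {W : ℕ} {s : Mem} (hW : s.var xB + s.var xL + 2 ≤ W) :
    Wp W lastMark s (60 * s.var xL + 200)
      (fun s' => IsLast (fun j => s.arr aMARK (s.var xB + j)) (s.var xL) (s'.var xJ)) := by
  refine Wp.seq 20 (fun s' => s'.var xJ = 0 ∧ s'.var xT = 1) (by omega) (Wp.of_vc ?_)
    fun s1 f1 ⟨h1, h2⟩ => ?_
  · simp [vc]; omega
  refine Wp.count (N := s.var xL + 1)
    (fun k s' => s'.var xJ < k ∧ (s'.var xJ = 0 ∨ 0 < s.arr aMARK (s.var xB + s'.var xJ)) ∧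
      ∀ t, s'.var xJ < t → t < k → s.arr aMARK (s.var xB + t) = 0) (fun _ => 40)
    ?_ (by omega) (by omega) ?_ ?_ ?_ ?_
  · simp [h1, h2]; omega
  · intro k s' _ _ f
    simp [f.var xL, f1.var xL]; omega
  · intro k s' hk hx ⟨h3, h4, h5⟩ f
    refine Wp.of_vc ?_
    simp [vc, hx, f.var xB, f1.var xB, f.arr aMARK, f1.arr aMARK]
    grind
  · simp; omega
  · intro s' ⟨h3, h4, h5⟩ _ _
    exact ⟨by omega, h4, fun t ht ht' => h5 t ht (by omega)⟩

theorem IsLast.unique {M : ℕ → ℕ} {ℓ J J' : ℕ} (h : IsLast M ℓ J) (h' : IsLast M ℓ J') :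
    J = J' := by
  obtain ⟨h1, h2, h3⟩ := h
  obtain ⟨h4, h5, h6⟩ := h'
  rcases Nat.lt_trichotomy J J' with h | h | h
  · have := h3 J' h h4; omega
  · exact h
  · have := h6 J h h1; omega

/-- The greedy procedure on a branch of length `ℓ` with marked slots `M`, last marked slot `J` and
first undecided agent `p`, in terms of the tables `iw` and `ou` that hold the innermost and the
outermost slot to which an agent is willing to walk. -/
def TableGreedy (iw ou : ℕ → ℕ) (ℓ : ℕ) (M : ℕ → ℕ) (J p : ℕ) : Prop :=
  Greedy (fun p r => iw p ≤ r) (fun p q => q ≤ ou p) ℓ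
    ((Finset.range (ℓ + 1)).filter fun j => 0 < M j) J p 0 0

/-- Runs the greedy procedure, with result in `xK`. -/
def tryMarks : Prog :=
  lastMark ;;
  (asg xR 0 ;; asg xE (v xJ + 1) ;; asg xO (v xJ) ;; asg xQ (v xP) ;; asg xK 1) ;;
  loop (v xR) (v xE)
    (ite 0 (get aMARK (v xB + v xR)) (asg xR (v xR + 1))
      (ite (v xL) (v xQ) (asg xK 0 ;; asg xE 0)
        (ite (get aINW (v xB + v xQ)) (v xR + 1) (asg xR (v xR + 1) ;; asg xQ (v xQ + 1))
          (ite (v xO) (get aOUT (v xB + v xQ)) (asg xO (v xO + 1) ;; asg xQ (v xQ + 1))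
            (asg xK 0 ;; asg xE 0)))))

/-- The greedy procedure takes time linear in the length of the branch: each round either advances the
slot to be filled or decides about one more agent. -/
theorem tryMarks_spec {W : ℕ} {s : Mem} (hW : s.var xB + s.var xL + s.var xP + 5 ≤ W)
    (hou : ∀ q, s.arr aOUT (s.var xB + q) ≤ W) {J : ℕ}
    (hJ : IsLast (fun j => s.arr aMARK (s.var xB + j)) (s.var xL) J) :
    Wp W tryMarks s (300 * s.var xL + 600)
      (fun s' => (s'.var xK = 0 ∨ s'.var xK = 1) ∧ (s'.var xK = 1 ↔
        TableGreedy (fun q => s.arr aINW (s.var xB + q)) (fun q => s.arr aOUT (s.var xB + q))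
          (s.var xL) (fun j => s.arr aMARK (s.var xB + j)) J (s.var xP))) := by
  refine Wp.seq (60 * s.var xL + 200) (fun s' => s'.var xJ = J) (by omega)
    ((lastMark_spec (by omega)).weaken le_rfl fun s' _ h => h.unique hJ) fun s1 f1 h1 => ?_
  have hJL := hJ.1
  refine Wp.seq 60 (fun s' => s'.var xR = 0 ∧ s'.var xE = J + 1 ∧ s'.var xO = J ∧
    s'.var xQ = s.var xP ∧ s'.var xK = 1) (by omega) (Wp.of_vc ?_)
    fun s2 f2 ⟨h2, h3, h4, h5, h6⟩ => ?_
  · simp [vc, h1, f1.var xP]; omega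
  set iw := fun q => s.arr aINW (s.var xB + q)
  set ou := fun q => s.arr aOUT (s.var xB + q)
  set M := fun j => s.arr aMARK (s.var xB + j)
  set D := (Finset.range (s.var xL + 1)).filter fun j => 0 < M j with hD
  refine Wp.loop (fun s' =>
    (s'.var xE = J + 1 ∧ s'.var xK = 1 ∧ s'.var xR ≤ J + 1 ∧ J ≤ s'.var xO ∧
      s'.var xQ ≤ s.var xL + 1 + s.var xP ∧
      (TableGreedy iw ou (s.var xL) M J (s.var xP) ↔
        Greedy (fun p r => iw p ≤ r) (fun p q => q ≤ ou p) (s.var xL) D J (s'.var xQ) (s'.var xR)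
          (s'.var xO - J))) ∨
    (s'.var xE = 0 ∧ s'.var xK = 0 ∧ ¬ TableGreedy iw ou (s.var xL) M J (s.var xP)))
    -- the bound `xE` is set to zero in order to leave the loop when the procedure is stuck
    (fun s' => 100 * ((s'.var xE - s'.var xR) + (s.var xL + 1 - s'.var xQ))) ?_ ?_ ?_ ?_ ?_
  · exact Or.inl ⟨h3, h6, by omega, by omega, by omega, by rw [h5, h2, h4, Nat.sub_self]; rfl⟩
  · simp [h2, h3, h5]; omega
  · simp
  · intro s' hI f hlt
    simp only [eval_v] at hlt
    obtain ⟨i1, i2, i3, i4, i5, i6⟩ | hI := hI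
    swap
    · omega
    refine ⟨100 - 7, Wp.of_vc ?_⟩
    have eM : s'.arr aMARK = s.arr aMARK := by rw [f.arr aMARK, f2.arr aMARK, f1.arr aMARK]
    have eI : s'.arr aINW = s.arr aINW := by rw [f.arr aINW, f2.arr aINW, f1.arr aINW]
    have eO : s'.arr aOUT = s.arr aOUT := by rw [f.arr aOUT, f2.arr aOUT, f1.arr aOUT]
    have eB : s'.var xB = s.var xB := by rw [f.var xB, f2.var xB, f1.var xB]
    have eL : s'.var xL = s.var xL := by rw [f.var xL, f2.var xL, f1.var xL]
    have hD' : s'.var xR ∈ D ↔ 0 < s.arr aMARK (s.var xB + s'.var xR) := by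
      simp only [hD, Finset.mem_filter, Finset.mem_range]
      exact and_iff_right (by omega)
    have hskip := fun h => Greedy.skip_iff (wi := fun p r => iw p ≤ r) (wo := fun p q => q ≤ ou p)
      (ℓ := s.var xL) (D := D) (p := s'.var xQ) (v := s'.var xO - J)
      (show s'.var xR ≤ J by omega) (hD'.2 h)
    have hstuck := fun h => Greedy.not_of_stuck (wi := fun p r => iw p ≤ r)
      (wo := fun p q => q ≤ ou p) (ℓ := s.var xL) (D := D) (p := s'.var xQ) (v := s'.var xO - J)
      (show s'.var xR ≤ J by omega) (mt hD'.1 h)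
    have hin := fun h => Greedy.inward_iff (wi := fun p r => iw p ≤ r)
      (wo := fun p q => q ≤ ou p) (ℓ := s.var xL) (D := D) (p := s'.var xQ) (v := s'.var xO - J)
      (show s'.var xR ≤ J by omega) (mt hD'.1 h)
    have hout := fun h => Greedy.outward_iff (wi := fun p r => iw p ≤ r)
      (wo := fun p q => q ≤ ou p) (ℓ := s.var xL) (D := D) (p := s'.var xQ) (v := s'.var xO - J)
      (show s'.var xR ≤ J by omega) (mt hD'.1 h)
    have hi : iw (s'.var xQ) = s.arr aINW (s.var xB + s'.var xQ) := rfl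
    have ho : ou (s'.var xQ) = s.arr aOUT (s.var xB + s'.var xQ) := rfl
    have hoW := hou (s'.var xQ)
    rw [show J + (s'.var xO - J) + 1 = s'.var xO + 1 by omega] at hstuck hout
    rw [hi, ho] at hstuck hout
    rw [hi] at hin
    simp [vc, eM, eI, eO, eB, eL, i1, i2]
    clear_value iw ou M D
    clear hi ho hD hJ f f1 f2 eM eI eO eB eL hou
    refine ⟨by omega, fun h => ?_, fun h => ⟨fun h' => ?_, fun h' => ⟨by omega, by omega,
      fun hq => ?_, fun hq => ⟨by omega, fun hw => ?_, fun hw => ?_⟩⟩⟩⟩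
    · and_intros <;> first | omega | exact i6.trans (hskip h)
    · exact ⟨by rw [i6]; exact hstuck (by omega) (Or.inl h'), by omega⟩
    · and_intros <;> first | omega | exact i6.trans (hin (by omega) h' (by omega))
    · and_intros
      all_goals first
        | omega
        | rw [i6, hout (by omega) h' (by omega) (by omega),
            show s'.var xO + 1 - J = s'.var xO - J + 1 by omega]
    · exact ⟨by rw [i6]; exact hstuck (by omega) (Or.inr ⟨by omega, by omega⟩), by omega⟩
  · intro s' hI f hlt
    simp only [eval_v] at hlt
    rcases hI with ⟨i1, i2, i3, i4, i5, i6⟩ | ⟨i1, i2, i3⟩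
    · exact ⟨Or.inr i2, iff_of_true i2 (i6.2 (Greedy.done (by omega)))⟩
    · exact ⟨Or.inl i2, iff_of_false (by omega) i3⟩

/- The bounds of the binary search and the slot in between that is tried out. -/
notation "xLo" => 11
notation "xHi" => 12
notation "xM" => 13

/-! ### Binary search for the outermost feasible destination -/

/-- Binary search between `xLo` and `xHi` for the outermost slot that can be marked in addition;
the result is in `xLo`. -/
def search : Prog :=
  loop (v xLo) (v xHi)
    ((asg xM ((v xLo + v xHi + 1) / 2) ;; sto aMARK (v xB + v xM) 1) ;;
      tryMarks ;;
      (sto aMARK (v xB + v xM) 0 ;; ite 0 (v xK) (asg xLo (v xM)) (asg xHi (v xM - 1))))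

/-- The greedy procedure succeeds when slot `q` is marked in addition. -/
def Candidate (iw ou : ℕ → ℕ) (ℓ : ℕ) (M : ℕ → ℕ) (J p q : ℕ) : Prop :=
  TableGreedy iw ou ℓ (Function.update M q 1) (max J q) p

theorem IsLast.update {M : ℕ → ℕ} {ℓ J q : ℕ} (h : IsLast M ℓ J) (hq : q ≤ ℓ) :
    IsLast (Function.update M q 1) ℓ (max J q) := by
  obtain ⟨h1, h2, h3⟩ := h
  refine ⟨by omega, ?_, fun t ht ht' => ?_⟩
  · rcases le_total J q with h | h
    · rw [max_eq_right h]; simp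
    · rw [max_eq_left h]
      rcases eq_or_ne J q with rfl | hne
      · simp
      · rwa [Function.update_of_ne hne]
  · rw [Function.update_of_ne (by omega)]
    exact h3 t (by omega) ht'

theorem size_half {x : ℕ} (hx : 0 < x) : (x / 2).size + 1 ≤ x.size := by
  have h1 : (x / 2).size ≤ x.size - 1 := by
    rw [Nat.size_le]
    have h2 := Nat.lt_size_self x
    have h3 : 0 < x.size := Nat.size_pos.2 hx
    obtain ⟨k, hk⟩ : ∃ k, x.size = k + 1 := ⟨x.size - 1, by omega⟩
    rw [hk] at h2 ⊢
    rw [pow_succ] at h2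
    simp only [Nat.add_sub_cancel]
    omega
  have h3 : 0 < x.size := Nat.size_pos.2 hx
  omega

/-- Binary search finds the outermost candidate, since by `hmono` the candidates form an initial segment;
each round halves the interval at the cost of one run of the greedy procedure. -/
theorem search_spec {W : ℕ} {s : Mem} (hW : s.var xB + 3 * s.var xL + s.var xP + 5 ≤ W)
    (hou : ∀ q, s.arr aOUT (s.var xB + q) ≤ W) {J : ℕ} {iw ou M : ℕ → ℕ}
    (hiw : iw = fun q => s.arr aINW (s.var xB + q)) (houe : ou = fun q => s.arr aOUT (s.var xB + q))
    (hM : M = fun j => s.arr aMARK (s.var xB + j))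
    (hJ : IsLast M (s.var xL) J) (hle : s.var xLo ≤ s.var xHi) (hhi : s.var xHi ≤ s.var xL)
    (hfree : ∀ q, s.var xLo < q → q ≤ s.var xHi → M q = 0)
    (hmono : ∀ q q', s.var xLo < q' → q' ≤ q → q ≤ s.var xHi →
      Candidate iw ou (s.var xL) M J (s.var xP) q → Candidate iw ou (s.var xL) M J (s.var xP) q') :
    Wp W search s ((s.var xL).size * (300 * s.var xL + 1000) + 7)
      (fun s' => s'.arr aMARK = s.arr aMARK ∧ s.var xLo ≤ s'.var xLo ∧ s'.var xLo ≤ s.var xHi ∧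
        (s'.var xLo = s.var xLo ∨ Candidate iw ou (s.var xL) M J (s.var xP) (s'.var xLo)) ∧
        ∀ q, s'.var xLo < q → q ≤ s.var xHi → ¬ Candidate iw ou (s.var xL) M J (s.var xP) q) := by
  obtain ⟨C, hC⟩ : ∃ C, C = 300 * s.var xL + 1000 := ⟨_, rfl⟩
  rw [← hC]
  refine Wp.loop (fun s' => s'.arr aMARK = s.arr aMARK ∧ s.var xLo ≤ s'.var xLo ∧
      s'.var xLo ≤ s'.var xHi ∧ s'.var xHi ≤ s.var xHi ∧
      (s'.var xLo = s.var xLo ∨ Candidate iw ou (s.var xL) M J (s.var xP) (s'.var xLo)) ∧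
      ∀ q, s'.var xHi < q → q ≤ s.var xHi → ¬ Candidate iw ou (s.var xL) M J (s.var xP) q)
    (fun s' => (s'.var xHi - s'.var xLo).size * C) ?_ ?_ ?_ ?_ ?_
  · exact ⟨rfl, le_rfl, hle, le_rfl, Or.inl rfl, fun q h h' => by omega⟩
  · simp only [cost_v]
    have : (s.var xHi - s.var xLo).size ≤ (s.var xL).size := Nat.size_le_size (by omega)
    have := Nat.mul_le_mul_right C this
    omega
  · simp
  · intro s1 ⟨i1, i2, i3, i4, i5, i6⟩ f1 hlt
    simp only [eval_v] at hlt
    refine ⟨C - 100, ?_⟩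
    have eB1 := f1.var xB
    have eL1 := f1.var xL
    have eP1 := f1.var xP
    set mid := (s1.var xLo + s1.var xHi + 1) / 2 with hmid
    refine Wp.seq 100 (fun s2 => s2.arr aMARK = Function.update (s.arr aMARK) (s.var xB + mid) 1 ∧
      s2.var xM = mid) (by omega) (Wp.of_vc ?_) fun s2 f2 ⟨h1, h2⟩ => ?_
    · simp [vc, i1, eB1, hmid]; omega
    have eB2 := f2.var xB
    have eL2 := f2.var xL
    have eP2 := f2.var xP
    have eI2 := (f2.arr aINW).trans (f1.arr aINW)
    have eO2 := (f2.arr aOUT).trans (f1.arr aOUT)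
    rw [eB1] at eB2
    rw [eL1] at eL2
    rw [eP1] at eP2
    have hM2 : (fun j => s2.arr aMARK (s2.var xB + j)) = Function.update M mid 1 := by
      rw [h1, eB2, hM]
      funext j
      simp [Function.update_apply]
    have hJ2 : IsLast (fun j => s2.arr aMARK (s2.var xB + j)) (s2.var xL) (max J mid) := by
      rw [hM2, eL2]
      exact hJ.update (by omega)
    refine Wp.seq (300 * s.var xL + 600) (fun s3 => (s3.var xK = 0 ∨ s3.var xK = 1) ∧
        (s3.var xK = 1 ↔ Candidate iw ou (s.var xL) M J (s.var xP) mid)) (by omega)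
      ((tryMarks_spec (by rw [eB2, eL2, eP2]; omega) (by rw [eO2, eB2]; exact hou) hJ2).weaken
        (by rw [eL2]) fun s3 f3 h => ?_) fun s3 f3 ⟨h3, h4⟩ => ?_
    · rw [hM2, eL2, eP2, eI2, eO2, eB2, ← hiw, ← houe] at h
      exact h
    refine Wp.of_vc ?_
    have eB3 := (f3.var xB).trans eB2
    have eM3 := (f3.var xM).trans h2
    have eA3 := (f3.arr aMARK).trans h1
    have eL3 := (f3.var xLo).trans (f2.var xLo)
    have eH3 := (f3.var xHi).trans (f2.var xHi)
    have hback : Function.update (Function.update (s.arr aMARK) (s.var xB + mid) 1)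
        (s.var xB + mid) 0 = s.arr aMARK := by
      rw [Function.update_idem]
      have := hfree mid (by omega) (by omega)
      rw [hM] at this
      exact Function.update_eq_self_iff.2 this.symm
    have hs1 := size_half (x := s1.var xHi - s1.var xLo) (by omega)
    have hsz : ∀ x, x ≤ (s1.var xHi - s1.var xLo) / 2 → x.size * C +
        C ≤ (s1.var xHi - s1.var xLo).size * C := by
      intro x hx
      rw [← Nat.succ_mul]
      exact Nat.mul_le_mul_right _ ((Nat.succ_le_succ (Nat.size_le_size hx)).trans hs1)
    have hz1 := hsz (s1.var xHi - mid) (by omega)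
    have hz2 := hsz (mid - 1 - s1.var xLo) (by omega)
    simp [vc, eB3, eM3, eA3, eL3, eH3, hback]
    clear_value mid
    refine ⟨by omega, fun h => ?_, fun h => ?_⟩
    · have hc := h4.1 (by omega)
      exact ⟨by omega, ⟨by omega, by omega, by omega, Or.inr hc, i6⟩, by omega⟩
    · have hc : ¬ Candidate iw ou (s.var xL) M J (s.var xP) mid := fun hc => by
        have := h4.2 hc; omega
      refine ⟨by omega, by omega, ⟨by omega, by omega, by omega, i5, fun q hq hq' hcq => ?_⟩, by omega⟩
      exact hc (hmono q mid (by omega) (by omega) hq' hcq)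
  · intro s' ⟨i1, i2, i3, i4, i5, i6⟩ f hlt
    simp only [eval_v] at hlt
    exact ⟨i1, i2, by omega, i5, fun q h h' => i6 q (by omega) h'⟩

/- The current agent `xA`; start `xS`, result `xU` and loop bound `xV` of a walk; the center `xC`;
the best object `xBb` found so far for the agent at the center, in slot `xBj` of branch `xBv`; and
the first vertex `xI` of the current branch. -/
notation "xA" => 14
notation "xS" => 15
notation "xU" => 16
notation "xV" => 17
notation "xC" => 18
notation "xBb" => 19
notation "xBv" => 20
notation "xBj" => 21
notation "xI" => 22

/-! ### How far an agent is willing to walk -/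

/-- The rank, for agent `xA`, of slot `e` of the branch with base address `xB`. -/
def rk (e : Ex) : Ex := get aRANK (v xA * v xN + get aOBJ (v xB + e))

/-- Walks outward from slot `xS` as long as agent `xA` prefers the next slot and this slot is not
marked; the result is in `xU`. -/
def outermost : Prog :=
  (asg xU (v xS) ;; asg xV (v xL)) ;;
  loop (v xU) (v xV)
    (ite 0 (get aMARK (v xB + (v xU + 1))) (asg xV (v xU))
      (ite (rk (v xU + 1)) (rk (v xU)) (asg xU (v xU + 1)) (asg xV (v xU))))

/-- Slot `q` is where the walk outward from slot `p` ends, where `R` are the ranks and `M` the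
marks. -/
def IsOuter (R M : ℕ → ℕ) (ℓ p q : ℕ) : Prop :=
  p ≤ q ∧ q ≤ ℓ ∧ (∀ t, p ≤ t → t < q → M (t + 1) = 0 ∧ R (t + 1) < R t) ∧
    (q < ℓ → ¬ (M (q + 1) = 0 ∧ R (q + 1) < R q))

theorem outermost_spec {W : ℕ} {s : Mem} (hW : s.var xB + s.var xL + 5 ≤ W)
    (hR : ∀ q ≤ s.var xL, s.var xA * s.var xN + s.arr aOBJ (s.var xB + q) ≤ W)
    (hS : s.var xS ≤ s.var xL) :
    Wp W outermost s (100 * s.var xL + 60) (fun s' =>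
      IsOuter (fun q => s.arr aRANK (s.var xA * s.var xN + s.arr aOBJ (s.var xB + q)))
        (fun j => s.arr aMARK (s.var xB + j)) (s.var xL) (s.var xS) (s'.var xU)) := by
  refine Wp.seq 40 (fun s' => s'.var xU = s.var xS ∧ s'.var xV = s.var xL) (by omega)
    (Wp.of_vc ?_) fun s1 f1 ⟨h1, h2⟩ => ?_
  · simp [vc]
  set R := fun q => s.arr aRANK (s.var xA * s.var xN + s.arr aOBJ (s.var xB + q)) with hRdef
  set M := fun j => s.arr aMARK (s.var xB + j) with hMdef
  refine Wp.loop (fun s' => s.var xS ≤ s'.var xU ∧ s'.var xU ≤ s'.var xV ∧ s'.var xV ≤ s.var xL ∧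
      (∀ t, s.var xS ≤ t → t < s'.var xU → M (t + 1) = 0 ∧ R (t + 1) < R t) ∧
      (s'.var xV < s.var xL → s'.var xU = s'.var xV ∧
        ¬ (M (s'.var xV + 1) = 0 ∧ R (s'.var xV + 1) < R (s'.var xV))))
    (fun s' => 100 * (s'.var xV - s'.var xU)) ?_ ?_ ?_ ?_ ?_
  · exact ⟨h1.ge, by omega, h2.le, fun t h h' => by omega, fun h => by omega⟩
  · simp only [cost_v]; omega
  · simp
  · intro s' ⟨i1, i2, i3, i4, i5⟩ f hlt
    simp only [eval_v] at hlt
    refine ⟨100 - 7, Wp.of_vc ?_⟩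
    have hr1 := hR (s'.var xU) (by omega)
    have hr2 := hR (s'.var xU + 1) (by omega)
    have eB := (f.var xB).trans (f1.var xB)
    have eA := (f.var xA).trans (f1.var xA)
    have eN := (f.var xN).trans (f1.var xN)
    have eM := (f.arr aMARK).trans (f1.arr aMARK)
    have eR := (f.arr aRANK).trans (f1.arr aRANK)
    have eO := (f.arr aOBJ).trans (f1.arr aOBJ)
    have hM1 : M (s'.var xU + 1) = s.arr aMARK (s.var xB + (s'.var xU + 1)) := rfl
    have hR1 : R (s'.var xU + 1) = s.arr aRANK (s.var xA * s.var xN + s.arr aOBJ (s.var xB + (s'.var xU + 1))) := rfl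
    have hR2 : R (s'.var xU) = s.arr aRANK (s.var xA * s.var xN + s.arr aOBJ (s.var xB + s'.var xU)) := rfl
    have hP : s.var xA * s.var xN ≤ W := by omega
    simp [vc, rk, eB, eA, eN, eM, eR, eO, ← hM1, ← hR1, ← hR2]
    refine ⟨by omega, fun h => ⟨⟨i1, by omega, i4, fun _ h' => by omega⟩, by omega⟩,
      fun h => ⟨by omega, by omega, fun h' => ⟨by omega, ⟨by omega, by omega, i3, ?_,
        fun h3 => absurd (i5 h3).1 (by omega)⟩, by omega⟩,
        fun h' => ⟨⟨i1, by omega, i4, fun _ _ => h'⟩, by omega⟩⟩⟩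
    intro t ht ht'
    rcases Nat.lt_or_ge t (s'.var xU) with h3 | h3
    · exact i4 t ht h3
    · rw [show t = s'.var xU by omega]
      exact ⟨h, h'⟩
  · intro s' ⟨i1, i2, i3, i4, i5⟩ f hlt
    simp only [eval_v] at hlt
    refine ⟨i1, by omega, i4, fun h => ?_⟩
    obtain ⟨h3, h4⟩ := i5 (by omega)
    rwa [h3]

/-! ### The tables of an instance -/

/-- The tables that describe the instance: ranks, initial holders, and the branches (branch `i` is
stored under the number of its first vertex `obj i 1`). -/
structure Layout {n : ℕ} (F : OAF (Fin n) (Fin n)) (μ₀ : Fin n ≃ Fin n)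
    (L : StarLabelling F.graph) (s : Mem) : Prop where
  size : s.var xN = n
  center : s.var xC = L.center
  rank : ∀ a b b' : Fin n,
    F.pref a b b' ↔ s.arr aRANK (a * n + b) < s.arr aRANK (a * n + b')
  hold : ∀ b : Fin n, s.arr aHOLD b = μ₀.symm b
  len : ∀ i, s.arr aLEN (L.obj i 1) = L.len i
  len_zero : ∀ v < n, 0 < s.arr aLEN v → ∃ i, v = L.obj i 1
  obj : ∀ i j, j ≤ L.len i → s.arr aOBJ (L.obj i 1 * n + j) = L.obj i j

/-- The tables computed in advance: besides the description of the instance, for each agent the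
innermost and the outermost slot to which it is willing to walk. -/
structure Tables {n : ℕ} (F : OAF (Fin n) (Fin n)) (μ₀ : Fin n ≃ Fin n)
    (L : StarLabelling F.graph) (s : Mem) : Prop extends Layout F μ₀ L s where
  inw : ∀ i p r, 1 ≤ p → p ≤ L.len i → (s.arr aINW (L.obj i 1 * n + p) ≤ r ↔
    OAF.LikesIn L i (μ₀.symm (L.obj i p)) p r)
  out : ∀ i p q, 1 ≤ p → p ≤ L.len i → (q ≤ s.arr aOUT (L.obj i 1 * n + p) ↔
    OAF.LikesOut L i (μ₀.symm (L.obj i p)) p q)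
  out_le : ∀ q, s.arr aOUT q ≤ n

/-- The state of the branches: how many agents from each branch are fixed, and which slots are
taken by fixed agents. Slot `0` counts as taken if the agent at the center stays off the branch. -/
structure Marks {n : ℕ} {F : OAF (Fin n) (Fin n)} (L : StarLabelling F.graph)
    (c : Fin L.m → ℕ) (D : Fin L.m → Finset ℕ) (s : Mem) : Prop where
  count : ∀ i, s.arr aCNT (L.obj i 1) = c i
  mark : ∀ i j, j ≤ L.len i → s.arr aMARK (L.obj i 1 * n + j) = if j ∈ D i then 1 else 0

section

variable {n : ℕ} {F : OAF (Fin n) (Fin n)} {μ₀ : Fin n ≃ Fin n} {L : StarLabelling F.graph}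
  {s s' : Mem} {c : Fin L.m → ℕ} {D : Fin L.m → Finset ℕ}

theorem Layout.congr (h : Layout F μ₀ L s) (hN : s'.var xN = s.var xN) (hC : s'.var xC = s.var xC)
    (h5 : s'.arr aRANK = s.arr aRANK) (h6 : s'.arr aHOLD = s.arr aHOLD)
    (h7 : s'.arr aOBJ = s.arr aOBJ) (h8 : s'.arr aLEN = s.arr aLEN) : Layout F μ₀ L s' := by
  obtain ⟨a1, a2, a3, a4, a5, a6, a7⟩ := h
  constructor <;> simpa only [hN, hC, h5, h6, h7, h8]

theorem Tables.congr (h : Tables F μ₀ L s) (hN : s'.var xN = s.var xN) (hC : s'.var xC = s.var xC)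
    (h5 : s'.arr aRANK = s.arr aRANK) (h6 : s'.arr aHOLD = s.arr aHOLD)
    (h7 : s'.arr aOBJ = s.arr aOBJ) (h8 : s'.arr aLEN = s.arr aLEN)
    (h11 : s'.arr aINW = s.arr aINW) (h12 : s'.arr aOUT = s.arr aOUT) : Tables F μ₀ L s' := by
  obtain ⟨h, a8, a9, a10⟩ := h
  exact ⟨h.congr hN hC h5 h6 h7 h8, by simpa only [h11], by simpa only [h12], by simpa only [h12]⟩

theorem Tables.frame {p : Prog} (h : Tables F μ₀ L s) (f : Frame p s s')
    (h0 : p.wv.contains xN = false := by rfl) (h1 : p.wv.contains xC = false := by rfl)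
    (h5 : p.wa.contains aRANK = false := by rfl) (h6 : p.wa.contains aHOLD = false := by rfl)
    (h7 : p.wa.contains aOBJ = false := by rfl) (h8 : p.wa.contains aLEN = false := by rfl)
    (h11 : p.wa.contains aINW = false := by rfl)
    (h12 : p.wa.contains aOUT = false := by rfl) : Tables F μ₀ L s' :=
  h.congr (f.var _ h0) (f.var _ h1) (f.arr _ h5) (f.arr _ h6) (f.arr _ h7) (f.arr _ h8)
    (f.arr _ h11) (f.arr _ h12)

theorem Marks.congr (h : Marks L c D s) (h9 : s'.arr aMARK = s.arr aMARK)
    (h10 : s'.arr aCNT = s.arr aCNT) : Marks L c D s' := by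
  obtain ⟨a1, a2⟩ := h
  constructor <;> simpa only [h9, h10]

theorem len_lt (L : StarLabelling F.graph) (i : Fin L.m) : L.len i < n := by
  have h : Function.Injective fun j : Fin (L.len i + 1) => L.obj i j := by
    intro j j' h
    exact Fin.ext (L.obj_injOn i (Nat.lt_succ_iff.1 j.2) (Nat.lt_succ_iff.1 j'.2) h)
  have := Fintype.card_le_of_injective _ h
  simpa using this

theorem base_le (b : Fin n) : (b : ℕ) * n + n ≤ n * n := by
  have := Nat.mul_le_mul_right n (Nat.succ_le_of_lt b.2)
  rwa [Nat.succ_mul] at this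

/-- Different slots have different addresses, since a branch has fewer than `n` vertices besides the
center. -/
theorem slot_ne {i i' : Fin L.m} {j j' : ℕ} (h : L.obj i 1 * n + j = (L.obj i' 1 * n + j' : ℕ))
    (hj : j ≤ L.len i) (hj' : j' ≤ L.len i') : i = i' ∧ j = j' := by
  have h1 := len_lt L i
  have h2 := len_lt L i'
  have h3 : (L.obj i 1 : ℕ) = L.obj i' 1 := by
    have e := congrArg (· / n) h
    rwa [Nat.mul_comm, Nat.mul_add_div (by omega), Nat.div_eq_of_lt (by omega), Nat.mul_comm,
      Nat.mul_add_div (by omega), Nat.div_eq_of_lt (by omega)] at e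
  have h4 := L.obj_inj i 1 i' 1 le_rfl (L.len_pos i) le_rfl (L.len_pos i') (Fin.ext h3)
  refine ⟨h4.1, ?_⟩
  rw [h3] at h
  omega

/-- On the tables, the greedy procedure is the one of the combinatorial analysis. -/
theorem Tables.greedy_iff (H : Tables F μ₀ L s) {i : Fin L.m} {M : ℕ → ℕ} {E : Finset ℕ}
    (hM : ∀ j ≤ L.len i, 0 < M j ↔ j ∈ E) (hE : ∀ j ∈ E, j ≤ L.len i) {J p : ℕ} :
    TableGreedy (fun q => s.arr aINW (L.obj i 1 * n + q)) (fun q => s.arr aOUT (L.obj i 1 * n + q))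
        (L.len i) M J (p + 1) ↔
      OAF.BranchGreedy L i (fun q => μ₀.symm (L.obj i q)) E J p := by
  have hD : (Finset.range (L.len i + 1)).filter (fun j => 0 < M j) = E := by
    ext j
    simp only [Finset.mem_filter, Finset.mem_range, Nat.lt_succ_iff]
    constructor
    · rintro ⟨h1, h2⟩; exact (hM j h1).1 h2
    · intro h; exact ⟨hE j h, (hM j (hE j h)).2 h⟩
  unfold TableGreedy OAF.BranchGreedy
  rw [hD]
  constructor
  · exact Greedy.congr_agents fun q h1 h2 =>
      ⟨fun x => H.inw i q x (by omega) h2, fun x => H.out i q x (by omega) h2⟩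
  · exact Greedy.congr_agents fun q h1 h2 =>
      ⟨fun x => (H.inw i q x (by omega) h2).symm, fun x => (H.out i q x (by omega) h2).symm⟩

/-- The outermost slot of a walk, in terms of preferences. -/
theorem Layout.outer_iff (H : Layout F μ₀ L s) {i : Fin L.m} {a : Fin n} {M : ℕ → ℕ} {p u : ℕ}
    (h : IsOuter (fun q => s.arr aRANK (a * n + s.arr aOBJ (L.obj i 1 * n + q))) M (L.len i) p u)
    (q : ℕ) : q ≤ u ↔ OAF.LikesOut L i a p q ∧ ∀ t, p < t → t ≤ q → M t = 0 := by
  obtain ⟨h1, h2, h3, h4⟩ := h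
  have hR : ∀ t, t + 1 ≤ L.len i → (F.pref a (L.obj i (t + 1)) (L.obj i t) ↔
      s.arr aRANK (a * n + s.arr aOBJ (L.obj i 1 * n + (t + 1))) <
      s.arr aRANK (a * n + s.arr aOBJ (L.obj i 1 * n + t))) := by
    intro t ht
    rw [H.obj i (t + 1) ht, H.obj i t (by omega), H.rank]
  constructor
  · intro hq
    refine ⟨⟨by omega, fun j h5 h6 => (hR j (by omega)).2 (h3 j h5 (by omega)).2⟩, ?_⟩
    intro t ht ht'
    obtain ⟨w, rfl⟩ : ∃ w, t = w + 1 := ⟨t - 1, by omega⟩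
    exact (h3 w (by omega) (by omega)).1
  · rintro ⟨⟨h5, h6⟩, h7⟩
    by_contra hlt
    exact h4 (by omega) ⟨h7 _ (by omega) (by omega), (hR u (by omega)).1 (h6 u h1 (by omega))⟩

end

section

variable {n : ℕ} {F : OAF (Fin n) (Fin n)} {μ₀ : Fin n ≃ Fin n} {L : StarLabelling F.graph}
  {s s' : Mem} {c : Fin L.m → ℕ} {D : Fin L.m → Finset ℕ} {W : ℕ}

theorem isLast_sup {M : ℕ → ℕ} {ℓ : ℕ} {E : Finset ℕ} (hM : ∀ j, 1 ≤ j → j ≤ ℓ → (0 < M j ↔ j ∈ E))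
    (hE : ∀ j ∈ E, j ≤ ℓ) : IsLast M ℓ (E.sup id) := by
  have h1 : E.sup id ≤ ℓ := Finset.sup_le hE
  refine ⟨h1, ?_, fun t ht ht' => ?_⟩
  · rcases Nat.eq_zero_or_pos (E.sup id) with h | h
    · exact Or.inl h
    · right
      have hne : E.Nonempty := by
        rw [Finset.nonempty_iff_ne_empty]
        rintro rfl
        simp at h
      obtain ⟨j, hj, hj'⟩ := Finset.exists_mem_eq_sup E hne id
      rw [hM _ h h1, hj']
      exact hj
  · by_contra h
    have := (hM t (by omega) ht').1 (by omega)
    have : t ≤ E.sup id := Finset.le_sup (f := id) this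
    omega

/-- The branches have at most `n` vertices altogether. -/
theorem sum_len_le (L : StarLabelling F.graph) {ℓ : ℕ → ℕ} (h1 : ∀ i, ℓ (L.obj i 1) = L.len i)
    (h2 : ∀ v < n, 0 < ℓ v → ∃ i, v = L.obj i 1) : ∑ v ∈ Finset.range n, ℓ v ≤ n := by
  have hinj : Function.Injective fun i => (L.obj i 1 : ℕ) := fun i i' h =>
    (L.obj_inj i 1 i' 1 le_rfl (L.len_pos _) le_rfl (L.len_pos _) (Fin.ext h)).1
  have e : ∑ v ∈ Finset.range n, ℓ v = ∑ i, L.len i := by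
    rw [← Finset.sum_subset (s₁ := Finset.univ.image fun i => (L.obj i 1 : ℕ)),
      Finset.sum_image fun i _ i' _ h => hinj h]
    · exact Finset.sum_congr rfl fun i _ => h1 i
    · intro v hv
      obtain ⟨i, -, rfl⟩ := Finset.mem_image.1 hv
      exact Finset.mem_range.2 (L.obj i 1).2
    · intro v hv hv'
      by_contra h
      obtain ⟨i, rfl⟩ := h2 v (Finset.mem_range.1 hv) (Nat.pos_of_ne_zero h)
      exact hv' (Finset.mem_image_of_mem _ (Finset.mem_univ i))
  have hcard := Fintype.card_le_of_injective
    (fun x : (i : Fin L.m) × Fin (L.len i) => L.obj x.1 (x.2 + 1)) (by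
      rintro ⟨i, j⟩ ⟨i', j'⟩ h
      obtain ⟨rfl, h'⟩ := L.obj_inj i (j + 1) i' (j' + 1) (by omega) (by omega) (by omega)
        (by omega) h
      obtain rfl : j = j' := Fin.ext (by omega)
      rfl)
  rw [Fintype.card_sigma] at hcard
  simpa [e] using hcard

theorem Tables.sum_len_le (H : Tables F μ₀ L s) : ∑ v ∈ Finset.range n, s.arr aLEN v ≤ n :=
  WordRAM.sum_len_le L H.len H.len_zero

/-! ### The best match of the agent at the center -/

/-- Compares slot `xLo` of the current branch with the best object found so far. -/
def updateBest : Prog :=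
  ite 0 (v xLo)
    (ite (rk (v xLo)) (get aRANK (v xA * v xN + v xBb))
      (asg xBb (get aOBJ (v xB + v xLo)) ;; asg xBv (v xI) ;; asg xBj (v xLo)) skip) skip

/-- Finds the outermost slot of branch `xI` at which the agent `xA` at the center can end. -/
def branchCenter : Prog :=
  (asg xB (v xI * v xN) ;; asg xL (get aLEN (v xI)) ;; asg xP (get aCNT (v xI) + 1) ;; asg xS 0) ;;
    outermost ;; (sto aMARK (v xB) 0 ;; asg xLo 0 ;; asg xHi (v xU)) ;; search

/-- The agent `a` at the center can end at slot `q` of branch `i`. -/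
def CanEnter (L : StarLabelling F.graph) (μ₀ : Fin n ≃ Fin n) (c : Fin L.m → ℕ)
    (D : Fin L.m → Finset ℕ) (a : Fin n) (i : Fin L.m) (q : ℕ) : Prop :=
  OAF.LikesOut L i a 0 q ∧ (∀ t ∈ D i, 1 ≤ t → q < t) ∧
    OAF.BranchGreedy L i (fun q => μ₀.symm (L.obj i q)) (insert q ((D i).erase 0))
      (max ((D i).sup id) q) (c i)

/-- The agent at the center can walk up to slot `xU`, and among the slots up to there binary search finds
the outermost one that leaves the other agents of the branch enough room. Slot `0` of the branch is
left unmarked. -/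
theorem branchCenter_spec (H : Tables F μ₀ L s) (hM : Marks L c D s) (hW : 10 * (n * n) + 10 * n + 1000 ≤ W)
    (i : Fin L.m) (hI : s.var xI = L.obj i 1) (a : Fin n) (hA : s.var xA = a)
    (hc : ∀ i, c i ≤ L.len i) (hD : ∀ i, ∀ j ∈ D i, j ≤ L.len i) (h0 : 0 ∈ D i) :
    Wp W branchCenter s (n.size * (300 * L.len i + 1000) + 100 * L.len i + 200)
      (fun s' => s'.var xB = L.obj i 1 * n ∧ s'.var xL = L.len i ∧
        s'.arr aMARK = Function.update (s.arr aMARK) (L.obj i 1 * n) 0 ∧ s'.var xLo ≤ L.len i ∧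
        (s'.var xLo = 0 ∨ CanEnter L μ₀ c D a i (s'.var xLo)) ∧
        ∀ q, s'.var xLo < q → ¬ CanEnter L μ₀ c D a i q) := by
  have hlen := len_lt L i
  have hbase := base_le (L.obj i 1)
  have hcn := hc i
  have hAn := base_le a
  refine Wp.seq 60 (fun s' => s'.var xB = L.obj i 1 * n ∧ s'.var xL = L.len i ∧
    s'.var xP = c i + 1 ∧ s'.var xS = 0) (by omega) (Wp.of_vc ?_) fun s1 f1 ⟨h1, h2, h3, h4⟩ => ?_
  · simp [vc, hI, H.size, H.len, hM.count]
    omega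
  have H1 := H.frame f1
  have eA1 := (f1.var xA).trans hA
  have eM1 := f1.arr aMARK
  have hOBJ : ∀ q ≤ L.len i, s1.var xA * s1.var xN + s1.arr aOBJ (s1.var xB + q) ≤ W := by
    intro q hq
    rw [eA1, H1.size, h1, H1.obj i q hq]
    have := (L.obj i q).2
    omega
  refine Wp.seq (100 * L.len i + 60) (fun s' => ∀ q, q ≤ s'.var xU ↔ OAF.LikesOut L i a 0 q ∧
      ∀ t ∈ D i, 1 ≤ t → q < t) (by omega)
    ((outermost_spec (by rw [h1, h2]; omega) (by rw [h2]; exact hOBJ) (by rw [h4]; omega)).weaken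
      (by rw [h2]) fun s2 f2 h => ?_) fun s2 f2 hU => ?_
  · rw [eA1, H1.size, h1, h2, h4] at h
    intro q
    rw [H1.outer_iff h q]
    refine and_congr_right fun hl => ?_
    constructor
    · intro h5 t ht ht'
      by_contra hlt
      have h6 := h5 t ht' (by omega)
      rw [eM1, hM.mark i t (hD i t ht), if_pos ht] at h6
      omega
    · intro h5 t ht ht'
      have h7 := hl.1
      rw [eM1, hM.mark i t (by omega), if_neg]
      intro h6
      have := h5 t h6 ht
      omega
  have eB2 := (f2.var xB).trans h1
  have eL2 := (f2.var xL).trans h2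
  have eP2 := (f2.var xP).trans h3
  have eM2 := (f2.arr aMARK).trans eM1
  have H2 := H1.frame f2
  have hUle : s2.var xU ≤ L.len i := ((hU _).1 le_rfl).1.1
  refine Wp.seq 30 (fun s' => s'.var xLo = 0 ∧ s'.var xHi = s2.var xU ∧
    s'.arr aMARK = Function.update (s.arr aMARK) (L.obj i 1 * n) 0) (by omega) (Wp.of_vc ?_)
    fun s3 f3 ⟨h5, h6, h7⟩ => ?_
  · simp [vc, eB2, eM2]
  have eB3 := (f3.var xB).trans eB2
  have eL3 := (f3.var xL).trans eL2
  have eP3 := (f3.var xP).trans eP2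
  have H3 := H2.frame f3
  set M : ℕ → ℕ := fun j => s3.arr aMARK (s3.var xB + j) with hMdef
  have hM1 : ∀ j, M j = if j = 0 then 0 else s.arr aMARK (L.obj i 1 * n + j) := by
    intro j
    simp only [hMdef, h7, eB3, Function.update_apply]
    simp
  have hM2 : ∀ j ≤ L.len i, (0 < M j ↔ j ∈ (D i).erase 0) := by
    intro j hj
    rw [hM1, Finset.mem_erase]
    split_ifs with h
    · simp [h]
    · rw [hM.mark i j hj]
      split_ifs with h' <;> simp [h, h']
  have hE : ∀ j ∈ (D i).erase 0, j ≤ L.len i := fun j hj => hD i j (Finset.mem_of_mem_erase hj)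
  have hsup : ((D i).erase 0).sup id = (D i).sup id := by
    conv_rhs => rw [← Finset.insert_erase h0]
    rw [Finset.sup_insert]
    simp
  have hJ : IsLast M (s3.var xL) ((D i).sup id) := by
    rw [eL3, ← hsup]
    exact isLast_sup (fun j _ h => hM2 j h) hE
  have hcand : ∀ q, 1 ≤ q → q ≤ L.len i →
      (Candidate (fun q => s3.arr aINW (s3.var xB + q)) (fun q => s3.arr aOUT (s3.var xB + q))
        (s3.var xL) M ((D i).sup id) (s3.var xP) q ↔
      OAF.BranchGreedy L i (fun q => μ₀.symm (L.obj i q)) (insert q ((D i).erase 0))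
        (max ((D i).sup id) q) (c i)) := by
    intro q h8 h9
    unfold Candidate
    rw [eB3, eL3, eP3]
    refine H3.greedy_iff (fun j hj => ?_) (fun j hj => ?_)
    · rw [Function.update_apply, Finset.mem_insert]
      split_ifs with h
      · simp [h]
      · rw [hM2 j hj]; simp [h]
    · rcases Finset.mem_insert.1 hj with rfl | h
      · exact h9
      · exact hE j h
  have hnot : ∀ q, q ≤ s2.var xU → q ∉ (D i).erase 0 := by
    intro q hq h
    have := ((hU q).1 hq).2 q (Finset.mem_of_mem_erase h)
      (Nat.one_le_iff_ne_zero.2 (Finset.ne_of_mem_erase h))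
    omega
  refine (search_spec (J := (D i).sup id) (by rw [eB3, eL3, eP3]; omega) (fun q => ?_) rfl rfl rfl hJ
    (by rw [h5]; omega) (by rw [h6, eL3]; exact hUle) (fun q h8 h9 => ?_)
    (fun q q' h8 h9 h10 h11 => ?_)).weaken ?_ fun s4 f4 ⟨g1, g2, g3, g4, g5⟩ => ?_
  · exact (H3.out_le _).trans (by omega)
  · by_contra h
    exact hnot q (by omega) ((hM2 q (by omega)).1 (Nat.pos_of_ne_zero h))
  · rw [h5] at h8
    rw [h6] at h10
    rw [hcand q (by omega) (by omega)] at h11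
    rw [hcand q' (by omega) (by omega)]
    exact h11.insert_mono (hnot q h10) (hnot q' (by omega)) h9
  · rw [eL3]
    have : (L.len i).size ≤ n.size := Nat.size_le_size (by omega)
    refine (Nat.add_le_add_right (Nat.mul_le_mul_right (300 * L.len i + 1000) this) 7).trans ?_
    generalize n.size * (300 * L.len i + 1000) = y
    omega
  · rw [h6] at g3 g5
    rw [h5] at g4
    refine ⟨(f4.var xB).trans eB3, (f4.var xL).trans eL3, g1.trans h7, by omega, ?_, ?_⟩
    · rcases g4 with g4 | g4
      · exact Or.inl g4
      · rcases Nat.eq_zero_or_pos (s4.var xLo) with h | h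
        · exact Or.inl h
        · right
          obtain ⟨u1, u2⟩ := (hU _).1 g3
          exact ⟨u1, u2, (hcand _ h (by omega)).1 g4⟩
    · rintro q hq ⟨u1, u2, u3⟩
      have hqU := (hU q).2 ⟨u1, u2⟩
      exact g5 q hq hqU ((hcand q (by omega) (by omega)).2 u3)

/-- The best match of the agent `xA` at the center, provided some choice is possible: object
`xBb`, which is the center if `xBj` is zero, and otherwise slot `xBj` of branch `xBv`. -/
def bestCenter : Prog :=
  (asg xBb (v xC) ;; asg xBv 0 ;; asg xBj 0 ;; asg xI 0) ;;
  loop (v xI) (v xN)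
    (ite 0 (get aLEN (v xI)) (branchCenter ;; (sto aMARK (v xB) 1 ;; updateBest)) skip ;;
      asg xI (v xI + 1))

/-- The object `b` is the center or slot `j` of the branch stored under `w`. -/
def IsSlot (L : StarLabelling F.graph) (w j : ℕ) (b : Fin n) : Prop :=
  (j = 0 ∧ b = L.center) ∨ ∃ i, 1 ≤ j ∧ j ≤ L.len i ∧ w = L.obj i 1 ∧ b = L.obj i j

/-- The object `b`, in slot `j` of branch `w`, is the best match of the agent `a` at the center
among the center and the branches stored under numbers less than `k`. -/
def IsBestCenter (L : StarLabelling F.graph) (μ₀ : Fin n ≃ Fin n) (c : Fin L.m → ℕ)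
    (D : Fin L.m → Finset ℕ) (a : Fin n) (k w j : ℕ) (b : Fin n) : Prop :=
  IsSlot L w j b ∧
    (b = L.center ∨ ∃ i q, 1 ≤ q ∧ q ≤ L.len i ∧ b = L.obj i q ∧ CanEnter L μ₀ c D a i q) ∧
    (b = L.center ∨ F.pref a b L.center) ∧
    ∀ i q, L.obj i 1 < k → 1 ≤ q → CanEnter L μ₀ c D a i q → b = L.obj i q ∨ F.pref a b (L.obj i q)

/-- Since the agent at the center prefers each slot that it can enter to the slots before it, only the
outermost slot of a branch has to be compared. -/
theorem IsBestCenter.next {a b : Fin n} {i : Fin L.m} {w j q : ℕ}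
    (h : IsBestCenter L μ₀ c D a (L.obj i 1) w j b) (hq : q ≤ L.len i)
    (h1 : q = 0 ∨ CanEnter L μ₀ c D a i q) (h2 : ∀ x, q < x → ¬ CanEnter L μ₀ c D a i x) :
    (0 < q → F.pref a (L.obj i q) b →
      IsBestCenter L μ₀ c D a (L.obj i 1 + 1) (L.obj i 1) q (L.obj i q)) ∧
    ((0 < q → ¬ F.pref a (L.obj i q) b) → IsBestCenter L μ₀ c D a (L.obj i 1 + 1) w j b) := by
  obtain ⟨g3, g4, g5, g6⟩ := h
  have hnew : ∀ b' : Fin n, (0 < q → b' = L.obj i q ∨ F.pref a b' (L.obj i q)) →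
      (b' = b ∨ F.pref a b' b) →
      ∀ i' x, (L.obj i' 1 : ℕ) < L.obj i 1 + 1 → 1 ≤ x → CanEnter L μ₀ c D a i' x →
      b' = L.obj i' x ∨ F.pref a b' (L.obj i' x) := by
    intro b' hb1 hb2 i' x hi' hx hcan
    rcases Nat.lt_or_ge (L.obj i' 1 : ℕ) (L.obj i 1) with h7 | h7
    · have h8 := g6 i' x h7 hx hcan
      rcases hb2 with rfl | hb2
      · exact h8
      · rcases h8 with rfl | h8
        · exact Or.inr hb2
        · exact Or.inr (F.pref_trans hb2 h8)
    · obtain ⟨rfl, -⟩ := L.obj_inj i' 1 i 1 le_rfl (L.len_pos i') le_rfl (L.len_pos i)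
        (Fin.ext (by omega))
      have hqle : x ≤ q := by
        by_contra h9
        exact h2 x (by omega) hcan
      have hb1 := hb1 (by omega)
      have hcan' := h1.resolve_left (by omega)
      rcases Nat.eq_or_lt_of_le hqle with rfl | h9
      · exact hb1
      · have h10 := hcan'.1.pref (Nat.zero_le x) h9
        rcases hb1 with rfl | hb1
        · exact Or.inr h10
        · exact Or.inr (F.pref_trans hb1 h10)
  constructor
  · intro h0 hp
    have hcan := h1.resolve_left (by omega)
    refine ⟨Or.inr ⟨i, h0, hq, rfl, rfl⟩, Or.inr ⟨i, q, h0, hq, rfl, hcan⟩, Or.inr ?_,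
      hnew _ (fun _ => Or.inl rfl) (Or.inr hp)⟩
    rcases g5 with rfl | g5
    · exact hp
    · exact F.pref_trans hp g5
  · intro hp
    refine ⟨g3, g4, g5, hnew b (fun h0 => ?_) (Or.inl rfl)⟩
    rcases F.pref_trichotomy a b (L.obj i q) with h | h | h
    · exact Or.inr h
    · exact Or.inl h
    · exact absurd h (hp h0)

/-- A branch of length `ℓ` costs `O(ℓ log n)`, and the lengths add up to at most `n`; so the best match of
the agent at the center is found in time `O(n log n)`. -/
theorem bestCenter_spec (H : Tables F μ₀ L s) (hM : Marks L c D s)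
    (hW : 10 * (n * n) + 10 * n + 1000 ≤ W) (a : Fin n) (hA : s.var xA = a)
    (hc : ∀ i, c i ≤ L.len i) (hD : ∀ i, ∀ j ∈ D i, j ≤ L.len i) (h0 : ∀ i, 0 ∈ D i) :
    Wp W bestCenter s (3000 * ((n + 1) * (n.size + 1)))
      (fun s' => s'.arr aMARK = s.arr aMARK ∧ ∃ b : Fin n, s'.var xBb = b ∧
        IsBestCenter L μ₀ c D a n (s'.var xBv) (s'.var xBj) b) := by
  have hAn := base_le a
  refine Wp.seq 60 (fun s' => s'.var xBb = L.center ∧ s'.var xBv = 0 ∧ s'.var xBj = 0 ∧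
    s'.var xI = 0) ?_ (Wp.of_vc ?_) fun s1 f1 ⟨h1, h2, h3, h4⟩ => ?_
  · have : 1 ≤ (n + 1) * (n.size + 1) := Nat.mul_pos (by omega) (by omega)
    omega
  · simp [vc, H.center]
  have eA1 := (f1.var xA).trans hA
  have H1 := H.frame f1
  refine Wp.count (N := n) (fun k s' => s'.arr aMARK = s.arr aMARK ∧ ∃ b : Fin n, s'.var xBb = b ∧
      IsBestCenter L μ₀ c D a k (s'.var xBv) (s'.var xBj) b)
    (fun k => n.size * (300 * s.arr aLEN k + 1000) + 100 * s.arr aLEN k + 400) ?_ (by omega)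
    (by omega) ?_ ?_ ?_ fun s' h _ _ => h
  · exact ⟨f1.arr aMARK, L.center, h1, Or.inl ⟨h3, rfl⟩, Or.inl rfl, Or.inl rfl,
      fun i q h => by omega⟩
  · intro k s' _ _ f
    simp [f.var xN, H1.size]
  · intro k s2 hk hI ⟨g1, b, g2, g3⟩ f2
    have H2 := H1.frame f2
    have eA2 := (f2.var xA).trans eA1
    have hM2 := hM.congr g1 ((f2.arr aCNT).trans (f1.arr aCNT))
    have eL2 := (f2.arr aLEN).trans (f1.arr aLEN)
    refine Wp.seq (n.size * (300 * s.arr aLEN k + 1000) + 100 * s.arr aLEN k + 380)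
      (fun s' => s'.var xI = k ∧ s'.arr aMARK = s.arr aMARK ∧ ∃ b : Fin n, s'.var xBb = b ∧
        IsBestCenter L μ₀ c D a (k + 1) (s'.var xBv) (s'.var xBj) b) (by omega) ?_
        fun s3 f3 ⟨h5, h6⟩ => ?_
    swap
    · refine Wp.of_vc ?_
      simp [vc, h5, h6]
      omega
    refine Wp.ite (T₁ := n.size * (300 * s.arr aLEN k + 1000) + 100 * s.arr aLEN k + 360)
      (by simp) (by simp) (by simp) (fun hlt => ?_) fun hlt => ?_
    · simp only [eval_zero, eval_get, eval_v, hI, eL2] at hlt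
      obtain ⟨i, rfl⟩ := H.len_zero k hk hlt
      rw [H.len i]
      refine Wp.seq (n.size * (300 * L.len i + 1000) + 100 * L.len i + 200) _ (by omega)
        (branchCenter_spec H2 hM2 hW i hI a eA2 hc hD (h0 i))
        fun s3 f3 ⟨k1, k2, k3, k4, k5, k6⟩ => ?_
      have H3 := H2.frame f3
      have eA3 := (f3.var xA).trans eA2
      have eI3 := (f3.var xI).trans hI
      have eN3 := H3.size
      -- the mark on slot `0` is restored
      have hback : Function.update (Function.update (s.arr aMARK) (L.obj i 1 * n) 0)
          (L.obj i 1 * n) 1 = s.arr aMARK := by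
        rw [Function.update_idem]
        have := hM.mark i 0 (Nat.zero_le _)
        rw [if_pos (h0 i)] at this
        exact Function.update_eq_self_iff.2 this.symm
      rw [g1] at k3
      have hlen := len_lt L i
      have hbase := base_le (L.obj i 1)
      have hobj := H3.obj i _ k4
      have hlt1 := (L.obj i (s3.var xLo)).2
      have hlt2 := b.2
      have eb3 := (f3.var xBb).trans g2
      have ev3 := f3.var xBv
      have ej3 := f3.var xBj
      have hrank := H3.rank a (L.obj i (s3.var xLo)) b
      obtain ⟨n1, n2⟩ := g3.next k4 k5 k6
      obtain ⟨K, hK⟩ : ∃ K, K = (L.obj i 1 : ℕ) + 1 := ⟨_, rfl⟩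
      rw [← hK] at n1 n2 ⊢
      refine Wp.of_vc ?_
      simp [vc, updateBest, rk, k1, k3, hback, hobj, eA3, eN3, eb3, eI3, ev3, ej3, ← hrank]
      exact ⟨by omega, fun h => ⟨by omega, by omega,
        fun h' => ⟨by omega, _, rfl, n1 h h'⟩, fun h' => ⟨b, rfl, n2 fun _ => h'⟩⟩,
        fun h => ⟨b, rfl, n2 fun h' => by omega⟩⟩
    · simp only [eval_zero, eval_get, eval_v, hI, eL2] at hlt
      refine Wp.of_vc ?_
      simp only [vc]
      refine ⟨by omega, hI, g1, b, g2, g3.1, g3.2.1, g3.2.2.1, fun i q hi => ?_⟩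
      refine g3.2.2.2 i q ?_
      rcases Nat.lt_or_ge (L.obj i 1) k with h | h
      · exact h
      · exfalso
        rw [show k = L.obj i 1 by omega, H.len] at hlt
        exact hlt (L.len_pos i)
  · have hs := H.sum_len_le
    have e : ∑ k ∈ Finset.range n, (n.size * (300 * s.arr aLEN k + 1000) + 100 * s.arr aLEN k +
        400 + 3 + 4) = (300 * n.size + 100) * (∑ k ∈ Finset.range n, s.arr aLEN k) +
          n * (1000 * n.size + 407) := by
      rw [Finset.mul_sum, ← smul_eq_mul n, ← Finset.card_range n, ← Finset.sum_const,
        Finset.card_range, ← Finset.sum_add_distrib]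
      exact Finset.sum_congr rfl fun k _ => by ring
    have hcost : (v xN).cost = 3 := rfl
    rw [hcost, e]
    have h1 := Nat.mul_le_mul_left (300 * n.size + 100) hs
    refine (Nat.add_le_add_right (Nat.add_le_add_right h1 _) _).trans ?_
    have h2 : (300 * n.size + 100) * n + n * (1000 * n.size + 407) + (3 + 4) + 60 ≤
        3000 * ((n + 1) * (n.size + 1)) := by nlinarith
    exact Nat.le_sub_of_add_le h2

end

end WordRAM

namespace OAF

/-! ### The tables decide which matches are possible -/

section

variable {A B : Type*} {F : OAF A B} {L : StarLabelling F.graph} {χ : A ≃ B} {τ : Set (A × B)}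
  {s : Fin L.m → ℕ} {d : Fin L.m → ℕ → ℕ} {e : B} {i : Fin L.m}

theorem BranchGreedy.congr_agents_iff {ag ag' : ℕ → A} {D : Finset ℕ} {J p : ℕ}
    (he : ∀ q, p < q → q ≤ L.len i → ag q = ag' q) :
    BranchGreedy L i ag D J p ↔ BranchGreedy L i ag' D J p :=
  ⟨fun h => h.congr_agents he, fun h => h.congr_agents fun q h1 h2 => (he q h1 h2).symm⟩

namespace State

theorem d_le_len (S : State L χ τ s d e) {t : ℕ} (ht : t ≤ s i) : d i t ≤ L.len i := by
  rcases Nat.eq_zero_or_pos t with rfl | h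
  · rw [S.d_zero]; exact L.pos_le i e
  · exact S.d_le i t h ht

theorem destSet_le (S : State L χ τ s d e) : ∀ j ∈ destSet s d i, j ≤ L.len i := by
  intro j hj
  obtain ⟨t, ht, rfl⟩ := mem_destSet.1 hj
  exact S.d_le_len ht

theorem le_last (hd : ∀ t t', t < t' → t' ≤ s i → d i t < d i t') :
    ∀ j ∈ destSet s d i, j ≤ d i (s i) := by
  intro j hj
  obtain ⟨t, ht, rfl⟩ := mem_destSet.1 hj
  rcases ht.eq_or_lt with rfl | h
  · exact le_rfl
  · exact (hd t _ h le_rfl).le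

theorem sup_destSet (hd : ∀ t t', t < t' → t' ≤ s i → d i t < d i t') :
    (destSet s d i).sup id = d i (s i) :=
  le_antisymm (Finset.sup_le (le_last hd))
    (Finset.le_sup (f := id) (mem_destSet.2 ⟨s i, le_rfl, rfl⟩))

end State

end

end OAF

namespace WordRAM

open Ex Prog OAF

section

variable {n : ℕ} {F : OAF (Fin n) (Fin n)} {μ₀ χ : Fin n ≃ Fin n} {L : StarLabelling F.graph}
  {τ : Set (Fin n × Fin n)} {s s' : Mem} {c : Fin L.m → ℕ} {d : Fin L.m → ℕ → ℕ}
  {D : Fin L.m → Finset ℕ} {W : ℕ} {e : Fin n} {i : Fin L.m}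

/-- What the tables yield for the agent at the center is its best match. -/
theorem IsBestCenter.bestMatch {a b : Fin n} {w j : ℕ}
    (S : ∀ b, State L χ (insert (χ.symm L.center, b) τ) c (State.withCenter L d b) b)
    (hne : (F.ReachAgain χ τ).Nonempty)
    (hD : ∀ i, D i = State.destSet c (State.withCenter L d L.center) i)
    (hag : ∀ i q, c i < q → q ≤ L.len i → χ.symm (L.obj i q) = μ₀.symm (L.obj i q))
    (ha : a = χ.symm L.center) (h : IsBestCenter L μ₀ c D a n w j b) :
    F.BestMatch χ τ a b := by
  subst ha
  have hposs := State.possible_center_iff S hne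
  have hne' := possibleMatch_iff.1 ((hposs L.center).2 (Or.inl rfl))
  have hcan : ∀ i q, CanEnter L μ₀ c D (χ.symm L.center) i q ↔
      State.CenterFeasible L χ c d i q := by
    intro i q
    unfold CanEnter State.CenterFeasible
    rw [BranchGreedy.congr_agents_iff fun q h1 h2 => (hag i q h1 h2).symm, hD,
      State.sup_destSet ((S L.center).strictMono hne' i)]
    refine and_congr_right fun _ => and_congr_left fun _ => ⟨fun h t h1 h2 => ?_, fun h t h1 h2 => ?_⟩
    · have h3 := (S L.center).d_one i t h1 h2
      rw [State.withCenter_pos h1] at h3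
      exact h _ (State.mem_destSet.2 ⟨t, h2, State.withCenter_pos h1⟩) h3
    · obtain ⟨u, hu, rfl⟩ := State.mem_destSet.1 h1
      rcases Nat.eq_zero_or_pos u with rfl | h3
      · rw [State.withCenter_zero, L.pos_center] at h2; omega
      · rw [State.withCenter_pos h3]; exact h u h3 hu
  obtain ⟨-, g1, g2, g3⟩ := h
  refine ⟨(hposs b).2 (g1.imp_right fun ⟨i, q, h1, h2, h3, h4⟩ =>
    ⟨i, q, h1, h2, h3, (hcan i q).1 h4⟩), fun b' hb' => ?_⟩
  rcases (hposs b').1 hb' with rfl | ⟨i, q, h1, h2, rfl, h4⟩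
  · exact g2.imp_left Eq.symm
  · exact (g3 i q (L.obj i 1).2 h1 ((hcan i q).2 h4)).imp_left Eq.symm

/-- When the agent next in line on a branch can end beyond all destinations fixed so far, in terms
of the initial matching. -/
theorem possible_push_iff' (S : State L χ τ c d e) (hne : (F.ReachAgain χ τ).Nonempty)
    (hs : c i < L.len i)
    (hag : ∀ i q, c i < q → q ≤ L.len i → χ.symm (L.obj i q) = μ₀.symm (L.obj i q)) {k : ℕ}
    (hk : d i (c i) < k) (hk' : k ≤ L.len i) :
    F.PossibleMatch χ τ (μ₀.symm (L.obj i (c i + 1))) (L.obj i k) ↔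
      LikesOut L i (μ₀.symm (L.obj i (c i + 1))) (c i + 1) k ∧
      BranchGreedy L i (fun q => μ₀.symm (L.obj i q)) (insert k (State.destSet c d i)) k
        (c i + 1) := by
  rw [← hag i (c i + 1) (Nat.lt_succ_self _) hs, S.possible_push_iff hne hs hk hk',
    BranchGreedy.congr_agents_iff fun q h1 h2 => hag i q (by omega) h2]

/-! ### The outermost match of the agent next in line on a branch -/

/- The length `xD` of the dictator sequence; the last marked slot `xJj` and the outermost possible
match `xKk` of the agent next in line; the destination of the agent at the center, namely slot `xCj`
of branch `xCv`, or the center itself if `xCj` is zero; and the arrays of the output. -/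
notation "xD" => 23
notation "xJj" => 24
notation "xKk" => 25
notation "xCv" => 26
notation "xCj" => 27
notation "aRES" => 3
notation "aSEQ" => 4

/-- Finds, for the agent next in line on branch `xI`, the outermost slot `xKk` beyond the last
marked slot `xJj` that is a possible match; if there is none, then `xKk` equals `xJj`. -/
def branchPush : Prog :=
  (asg xB (v xI * v xN) ;; asg xL (get aLEN (v xI)) ;; asg xP (get aCNT (v xI) + 1)) ;;
    lastMark ;;
    (asg xA (get aHOLD (get aOBJ (v xB + v xP))) ;; asg xJj (v xJ) ;; asg xLo (v xJ) ;;
      ite (v xJ) (get aOUT (v xB + v xP)) (asg xHi (get aOUT (v xB + v xP))) (asg xHi (v xJ)) ;;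
      asg xP (v xP + 1)) ;;
    search ;; asg xKk (v xLo)

/-- Between the last marked slot and the outermost slot to which the agent is willing to walk, the
possible matches form an initial segment, which is explored by binary search in `O(ℓ log n)` steps. -/
theorem branchPush_spec (H : Tables F μ₀ L s) (hM : Marks L c (State.destSet c d) s)
    (hW : 10 * (n * n) + 10 * n + 1000 ≤ W) (hI : s.var xI = L.obj i 1) (S : State L χ τ c d e)
    (hne : (F.ReachAgain χ τ).Nonempty) (hs : c i < L.len i)
    (hag : ∀ i q, c i < q → q ≤ L.len i → χ.symm (L.obj i q) = μ₀.symm (L.obj i q)) :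
    Wp W branchPush s (n.size * (300 * L.len i + 1000) + 60 * L.len i + 400)
      (fun s' => s'.var xB = L.obj i 1 * n ∧ s'.var xL = L.len i ∧ s'.var xP = c i + 2 ∧
        s'.var xA = μ₀.symm (L.obj i (c i + 1)) ∧ s'.arr aMARK = s.arr aMARK ∧
        s'.var xJj = d i (c i) ∧ d i (c i) ≤ s'.var xKk ∧ s'.var xKk ≤ L.len i ∧
        (s'.var xKk = d i (c i) ∨
          F.PossibleMatch χ τ (μ₀.symm (L.obj i (c i + 1))) (L.obj i (s'.var xKk))) ∧
        ∀ q, s'.var xKk < q → q ≤ L.len i →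
          ¬ F.PossibleMatch χ τ (μ₀.symm (L.obj i (c i + 1))) (L.obj i q)) := by
  have hlen := len_lt L i
  have hbase := base_le (L.obj i 1)
  have hd := S.strictMono hne i
  have hJlen : d i (c i) ≤ L.len i := S.d_le_len le_rfl
  refine Wp.seq 60 (fun s' => s'.var xB = L.obj i 1 * n ∧ s'.var xL = L.len i ∧
    s'.var xP = c i + 1) (by omega) (Wp.of_vc ?_) fun s1 f1 ⟨h1, h2, h3⟩ => ?_
  · simp [vc, hI, H.size, H.len, hM.count]
    omega
  have H1 := H.frame f1
  have eM1 := f1.arr aMARK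
  set M : ℕ → ℕ := fun j => s.arr aMARK (L.obj i 1 * n + j) with hMdef
  have hM1 : ∀ j ≤ L.len i, (0 < M j ↔ j ∈ State.destSet c d i) := by
    intro j hj
    simp only [hMdef]
    rw [hM.mark i j hj]
    split_ifs with h <;> simp [h]
  have hJ : IsLast M (L.len i) (d i (c i)) := by
    rw [← State.sup_destSet hd]
    exact isLast_sup (fun j _ h => hM1 j h) S.destSet_le
  refine Wp.seq (60 * L.len i + 200) (fun s' => s'.var xJ = d i (c i)) (by omega)
    ((lastMark_spec (by rw [h1, h2]; omega)).weaken (by rw [h2]) fun s2 f2 h => ?_)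
    fun s2 f2 h4 => ?_
  · rw [h1, h2, eM1] at h
    exact h.unique hJ
  have H2 := H1.frame f2
  have eB2 := (f2.var xB).trans h1
  have eL2 := (f2.var xL).trans h2
  have eP2 := (f2.var xP).trans h3
  have eM2 := (f2.arr aMARK).trans eM1
  have hobj := H2.obj i (c i + 1) hs
  have hhold := H2.hold (L.obj i (c i + 1))
  have hout := fun q => H2.out i (c i + 1) q (by omega) hs
  obtain ⟨u, hu⟩ : ∃ u, u = s2.arr aOUT (L.obj i 1 * n + (c i + 1)) := ⟨_, rfl⟩
  rw [← hu] at hout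
  have hulen : u ≤ L.len i := ((hout u).1 le_rfl).1
  refine Wp.seq 100 (fun s' => s'.var xA = μ₀.symm (L.obj i (c i + 1)) ∧ s'.var xJj = d i (c i) ∧
    s'.var xLo = d i (c i) ∧ s'.var xHi = max u (d i (c i)) ∧ s'.var xP = c i + 2) (by omega)
    (Wp.of_vc ?_) fun s3 f3 ⟨h5, h6, h7, h8, h9⟩ => ?_
  · simp [vc, eB2, eP2, h4, hobj, hhold, ← hu]
    omega
  have H3 := H2.frame f3
  have eB3 := (f3.var xB).trans eB2
  have eL3 := (f3.var xL).trans eL2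
  have eM3 := (f3.arr aMARK).trans eM2
  have hM3 : (fun j => s3.arr aMARK (s3.var xB + j)) = M := by rw [eB3, eM3]
  have hcand : ∀ q, d i (c i) < q → q ≤ L.len i →
      (Candidate (fun q => s3.arr aINW (s3.var xB + q)) (fun q => s3.arr aOUT (s3.var xB + q))
        (s3.var xL) M (d i (c i)) (s3.var xP) q ↔
      BranchGreedy L i (fun q => μ₀.symm (L.obj i q)) (insert q (State.destSet c d i)) q
        (c i + 1)) := by
    intro q h10 h11
    unfold Candidate
    rw [eB3, eL3, h9, max_eq_right h10.le]
    refine H3.greedy_iff (fun j hj => ?_) (fun j hj => ?_)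
    · rw [Function.update_apply, Finset.mem_insert]
      split_ifs with h
      · simp [h]
      · rw [hM1 j hj]; simp [h]
    · rcases Finset.mem_insert.1 hj with rfl | h
      · exact h11
      · exact S.destSet_le j h
  have hnot : ∀ q, d i (c i) < q → q ∉ State.destSet c d i := by
    intro q hq h
    have := State.le_last hd q h
    omega
  have hposs := fun q => possible_push_iff' (μ₀ := μ₀) S hne hs hag (k := q)
  refine Wp.seq (n.size * (300 * L.len i + 1000) + 7) (fun s' =>
    s'.arr aMARK = s.arr aMARK ∧ d i (c i) ≤ s'.var xLo ∧ s'.var xLo ≤ L.len i ∧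
        (s'.var xLo = d i (c i) ∨
          F.PossibleMatch χ τ (μ₀.symm (L.obj i (c i + 1))) (L.obj i (s'.var xLo))) ∧
        ∀ q, s'.var xLo < q → q ≤ L.len i →
          ¬ F.PossibleMatch χ τ (μ₀.symm (L.obj i (c i + 1))) (L.obj i q))
    (by omega) ?_ fun s4 f4 ⟨g1, g2, g3, g4, g5⟩ => ?_
  · refine (search_spec (J := d i (c i)) (by rw [eB3, eL3, h9]; omega) (fun q => ?_) rfl rfl hM3.symm
      (by rw [eL3]; exact hJ) (by rw [h7, h8]; omega) (by rw [h8, eL3]; omega) (fun q k1 k2 => ?_)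
      (fun q q' k1 k2 k3 k4 => ?_)).weaken ?_ fun s4 f4 ⟨g1, g2, g3, g4, g5⟩ => ?_
    · exact (H3.out_le _).trans (by omega)
    · rw [h7] at k1
      rw [h8] at k2
      by_contra h
      exact hnot q k1 ((hM1 q (by omega)).1 (Nat.pos_of_ne_zero h))
    · rw [h7] at k1
      rw [h8] at k3
      rw [hcand q (by omega) (by omega)] at k4
      rw [hcand q' (by omega) (by omega)]
      -- moving the destination inward preserves feasibility
      rw [show q = max q q from (max_self q).symm] at k4
      have := BranchGreedy.insert_mono (J := d i (c i)) (D := State.destSet c d i) (q := q)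
        (by rw [max_eq_right (show d i (c i) ≤ q by omega)]; simpa using k4)
        (hnot q (by omega)) (hnot q' (by omega)) k2
      rwa [max_eq_right (show d i (c i) ≤ q' by omega)] at this
    · rw [eL3]
      have : (L.len i).size ≤ n.size := Nat.size_le_size (by omega)
      exact Nat.add_le_add_right (Nat.mul_le_mul_right (300 * L.len i + 1000) this) 7
    · rw [h7] at g2 g4
      rw [h8] at g3 g5
      refine ⟨g1.trans eM3, g2, by omega, ?_, fun q k1 k2 hp => ?_⟩
      · rcases g4 with g4 | g4
        · exact Or.inl g4
        · rcases Nat.eq_or_lt_of_le g2 with h | h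
          · exact Or.inl h.symm
          · right
            rw [hposs _ h (by omega)]
            exact ⟨(hout _).1 (by omega), (hcand _ h (by omega)).1 g4⟩
      · rw [hposs q (by omega) k2] at hp
        have := (hout q).2 hp.1
        exact g5 q k1 (by omega) ((hcand q (by omega) k2).2 hp.2)
  · have eB4 := (f4.var xB).trans eB3
    have eL4 := (f4.var xL).trans eL3
    have eP4 := (f4.var xP).trans h9
    have eA4 := (f4.var xA).trans h5
    have eJ4 := (f4.var xJj).trans h6
    obtain ⟨y, hy⟩ : ∃ y, y = n.size * (300 * L.len i + 1000) := ⟨_, rfl⟩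
    rw [← hy]
    refine Wp.of_vc ?_
    simp only [vc, fits_v, eval_v, cost_v, setVar_var, setVar_arr]
    exact ⟨by omega, by omega, eB4, eL4, eP4, eA4, g1, eJ4, g2, g3, g4, g5⟩

end

section

variable {n : ℕ} {F : OAF (Fin n) (Fin n)} {μ₀ χ : Fin n ≃ Fin n} {L : StarLabelling F.graph}
  {τ : Set (Fin n × Fin n)} {σ : List (Fin n)} {s s' : Mem} {c : Fin L.m → ℕ}
  {d : Fin L.m → ℕ → ℕ} {D : Fin L.m → Finset ℕ} {W : ℕ} {e : Fin n} {i : Fin L.m}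

/-! ### Recording choices -/

/-- The memory holds the dictator sequence `σ` and the pairs `τ` fixed so far. -/
structure Records (σ : List (Fin n)) (τ : Set (Fin n × Fin n)) (s : Mem) : Prop where
  count : s.var xD = σ.length
  seq : ∀ (k : ℕ) (h : k < σ.length), s.arr aSEQ k = σ[k]
  out : ∀ a b, (a, b) ∈ τ → s.arr aRES a = b

theorem Records.congr (h : Records σ τ s) (h1 : s'.var xD = s.var xD)
    (h2 : s'.arr aSEQ = s.arr aSEQ) (h3 : s'.arr aRES = s.arr aRES) : Records σ τ s' := by
  obtain ⟨a1, a2, a3⟩ := h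
  constructor <;> simpa only [h1, h2, h3]

theorem Records.frame {p : Prog} (h : Records σ τ s) (f : Frame p s s')
    (h1 : p.wv.contains xD = false := by rfl) (h2 : p.wa.contains aSEQ = false := by rfl)
    (h3 : p.wa.contains aRES = false := by rfl) : Records σ τ s' :=
  h.congr (f.var _ h1) (f.arr _ h2) (f.arr _ h3)

/-- The dictator `xA` chooses the object `xBb`. -/
def record : Prog :=
  sto aRES (v xA) (v xBb) ;; sto aSEQ (v xD) (v xA) ;; asg xD (v xD + 1)

theorem record_spec {a b : Fin n} (h : Records σ τ s) (hA : s.var xA = a) (hB : s.var xBb = b)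
    (hW : σ.length + 1 ≤ W) (hτ : ∀ b', (a, b') ∈ τ → b' = b) :
    Wp W record s 30 (Records (σ ++ [a]) (insert (a, b) τ)) := by
  refine Wp.of_vc ?_
  simp [vc, record, h.count, hA, hB]
  refine ⟨by omega, by simp, fun k hk => ?_, fun a' b' hab => ?_⟩
  · simp only [List.length_append, List.length_singleton] at hk
    have e : (((s.setArr 3 a b).setArr 4 σ.length a).setVar 23 (σ.length + 1)).arr 4 k =
        if k = σ.length then (a : ℕ) else s.arr 4 k := by
      simp [Function.update_apply]
    rw [e]
    split_ifs with h1
    · simp [h1]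
    · rw [List.getElem_append_left (by omega), h.seq]
  · have e : (((s.setArr 3 a b).setArr 4 σ.length a).setVar 23 (σ.length + 1)).arr 3 a' =
        if (a' : ℕ) = a then (b : ℕ) else s.arr 3 a' := by
      simp [Function.update_apply]
    rw [e]
    split_ifs with h1
    · have h1 : a' = a := Fin.ext h1
      subst h1
      rcases Set.mem_insert_iff.1 hab with h2 | h2
      · rw [(Prod.mk.inj h2).2]
      · rw [hτ _ h2]
    · rcases Set.mem_insert_iff.1 hab with h2 | h2
      · exact absurd (congrArg Fin.val (Prod.mk.inj h2).1) h1
      · exact h.out _ _ h2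

theorem eq_of_mem_of_nonempty {a b b' : Fin n} (h : (F.ReachAgain χ (insert (a, b) τ)).Nonempty)
    (hb : (a, b') ∈ τ) : b' = b := by
  obtain ⟨μ, -, h⟩ := h
  exact (h _ (Set.mem_insert_of_mem _ hb)).symm.trans (h _ (Set.mem_insert _ _))

/-- Marks slot `xBj` of branch `xBv` as the destination of the agent at the center and frees slot
`0` of that branch, unless the agent stays at the center. -/
def enter : Prog :=
  ite 0 (v xBj) (sto aMARK (v xBv * v xN) 0 ;; sto aMARK (v xBv * v xN + v xBj) 1) skip ;;
    asg xCv (v xBv) ;; asg xCj (v xBj)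

/-- Marks slot `xKk` of branch `xCv`. -/
def pushSlot : Prog :=
  asg xB (v xCv * v xN) ;; sto aMARK (v xB + v xKk) 1 ;; asg xBb (get aOBJ (v xB + v xKk))

theorem Marks.set (hM : Marks L c D s) {x y : ℕ} (hx : x ≤ L.len i)
    (h : s'.arr aMARK = Function.update (s.arr aMARK) (L.obj i 1 * n + x) y)
    (hc : s'.arr aCNT = s.arr aCNT) {E : Finset ℕ} (hy : y = if x ∈ E then 1 else 0)
    (hE : ∀ j ≠ x, j ∈ E ↔ j ∈ D i) : Marks L c (Function.update D i E) s' := by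
  refine ⟨fun i' => by rw [hc]; exact hM.count i', fun i' j hj => ?_⟩
  rw [h, Function.update_apply]
  by_cases hi : i' = i
  · subst hi
    rw [Function.update_self]
    split_ifs with h1 h2 h2
    · obtain rfl : j = x := by omega
      rw [hy, if_pos h2]
    · obtain rfl : j = x := by omega
      rw [hy, if_neg h2]
    · rw [hM.mark i' j hj, if_pos ((hE j (by rintro rfl; exact h1 rfl)).1 h2)]
    · rw [hM.mark i' j hj, if_neg (mt (hE j (by rintro rfl; exact h1 rfl)).2 h2)]
  · rw [Function.update_of_ne hi, if_neg fun h1 => hi (slot_ne h1 hj hx).1]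
    exact hM.mark i' j hj

/-- Slot `0` of a branch counts as taken unless the agent at the center is to enter this branch, in which
case it leaves slot `0` free for the others. -/
theorem enter_spec (hN : s.var xN = n) (hM : Marks L c D s) (h0 : ∀ i, 0 ∈ D i)
    (hW : 10 * (n * n) + 10 * n + 1000 ≤ W) {b : Fin n}
    (hb : IsSlot L (s.var xBv) (s.var xBj) b) :
    Wp W enter s 100 (fun s' => IsSlot L (s'.var xCv) (s'.var xCj) b ∧ (s'.var xCj = 0 ↔ b = L.center) ∧
      Marks L c (fun i => insert (L.pos i b) ((D i).erase 0)) s') := by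
  rcases hb with ⟨hj, rfl⟩ | ⟨i, h1, h2, h3, rfl⟩
  · have key : ∀ s' : Mem, s'.arr = s.arr →
        Marks L c (fun i => insert (L.pos i L.center) ((D i).erase 0)) s' := by
      intro s' hs'
      have : (fun i => insert (L.pos i L.center) ((D i).erase 0)) = D := by
        funext i
        rw [L.pos_center, Finset.insert_erase (h0 i)]
      rw [this]
      exact hM.congr (by rw [hs']) (by rw [hs'])
    refine Wp.of_vc ?_
    simp [vc, enter, hj]
    exact ⟨Or.inl ⟨rfl, rfl⟩, key _ rfl⟩
  · have hlen := len_lt L i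
    have hbase := base_le (L.obj i 1)
    obtain ⟨j, hj⟩ : ∃ j, s.var xBj = j := ⟨_, rfl⟩
    rw [hj] at h1 h2 ⊢
    have hD : (fun i' => insert (L.pos i' (L.obj i j)) ((D i').erase 0)) =
        Function.update (Function.update D i ((D i).erase 0)) i (insert j ((D i).erase 0)) := by
      funext i'
      by_cases hi : i' = i
      · subst hi; rw [Function.update_self, L.pos_obj _ h2]
      · rw [Function.update_of_ne hi, Function.update_of_ne hi, L.pos_obj_of_ne hi h2,
          Finset.insert_erase (h0 i')]
    rw [hD]
    refine Wp.of_vc ?_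
    simp [vc, enter, hj, h3, hN]
    refine ⟨fun _ => ⟨by omega, by omega, by omega, ?_⟩, by omega⟩
    refine ⟨Or.inr ⟨i, h1, h2, rfl, rfl⟩,
      iff_of_false (by omega) (L.obj_ne i j h1 h2), ?_⟩
    have hM' : Marks L c (Function.update D i ((D i).erase 0))
        (s.setArr aMARK (L.obj i 1 * n) 0) := by
      refine hM.set (x := 0) (y := 0) (Nat.zero_le _) (by simp) (by simp) (by simp)
        fun j hj => by simp [hj]
    have := Marks.set (i := i) (x := j) (y := 1) (s' := ((s.setArr aMARK (L.obj i 1 * n) 0).setArr aMARK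
      (L.obj i 1 * n + j) 1)) (E := insert j ((D i).erase 0)) hM' h2 (by simp) (by simp) (by simp)
      fun j' hj' => by simp [hj']
    rw [Function.update_idem] at this
    exact this.congr rfl rfl

theorem pushSlot_spec (H : Tables F μ₀ L s) (hM : Marks L c D s)
    (hW : 10 * (n * n) + 10 * n + 1000 ≤ W) (hv : s.var xCv = L.obj i 1) {k : ℕ}
    (hk : s.var xKk = k) (hkl : k ≤ L.len i) :
    Wp W pushSlot s 60 (fun s' => s'.var xBb = L.obj i k ∧
      Marks L c (Function.update D i (insert k (D i))) s') := by
  have hlen := len_lt L i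
  have hbase := base_le (L.obj i 1)
  have hobj := H.obj i k hkl
  refine Wp.of_vc ?_
  simp [vc, pushSlot, hv, hk, H.size, hobj]
  refine ⟨by omega, by omega, by omega, by omega, ?_⟩
  refine hM.set (x := k) (y := 1) (E := insert k (D i)) hkl ?_ (by rfl)
    (if_pos (Finset.mem_insert_self _ _)).symm fun j hj => by simp [hj]
  simp

end

end WordRAM

namespace OAF

/-! ### One iteration of the first phase -/

section

variable {A B : Type*} {F : OAF A B} {L : StarLabelling F.graph} {μ₀ χ : A ≃ B} {σ : List A}
  {τ : Set (A × B)} {s : Fin L.m → ℕ} {d : Fin L.m → ℕ → ℕ} {e : B} {i : Fin L.m}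

namespace State

theorem center_not_mem (S : State L χ τ s d e) (h0 : 0 < d i 0) :
    (χ.symm L.center, L.center) ∉ τ := by
  intro h
  rcases (S.mem_iff _).1 h with h | ⟨i', t, h1, h2, h⟩
  · rw [S.d_zero, ← (Prod.mk.inj h).2, L.pos_center] at h0
    exact h0.false
  · exact L.obj_ne i' t h1 (h2.trans (S.s_le i')) (χ.symm.injective (Prod.mk.inj h).1).symm

theorem destSet_withCenter (S : State L χ τ s (withCenter L d L.center) L.center) (b : B) :
    destSet s (withCenter L d b) i =
      insert (L.pos i b) ((destSet s (withCenter L d L.center) i).erase 0) := by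
  ext x
  simp only [Finset.mem_insert, Finset.mem_erase, mem_destSet]
  constructor
  · rintro ⟨t, ht, rfl⟩
    rcases Nat.eq_zero_or_pos t with rfl | h
    · exact Or.inl withCenter_zero
    · right
      have := S.d_one i t h ht
      rw [withCenter_pos h] at this ⊢
      exact ⟨by omega, t, ht, withCenter_pos h⟩
  · rintro (rfl | ⟨h1, t, ht, rfl⟩)
    · exact ⟨0, Nat.zero_le _, withCenter_zero⟩
    · rcases Nat.eq_zero_or_pos t with rfl | h
      · rw [withCenter_zero, L.pos_center] at h1; exact absurd rfl h1
      · exact ⟨t, ht, by rw [withCenter_pos h, withCenter_pos h]⟩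

theorem zero_mem_destSet_center {i : Fin L.m} : 0 ∈ destSet s (withCenter L d L.center) i :=
  mem_destSet.2 ⟨0, Nat.zero_le _, by rw [withCenter_zero, L.pos_center]⟩

/-- The destinations after the move to the center are obtained by replacing the destination of the
agent at the center. -/
theorem centerDest_eq (b : B) : centerDest L d i b =
    withCenter L (fun i' t => if i' = i then d i (t - 1) else d i' t) b := rfl

theorem destSet_centerDest (S : State L χ τ s d e) (h0 : 0 < d i 0) (i' : Fin L.m) :
    destSet (Function.update s i (s i + 1)) (centerDest L d i L.center) i' =
      Function.update (destSet s d) i (insert 0 (destSet s d i)) i' := by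
  by_cases hi : i' = i
  · subst hi
    ext x
    simp only [Function.update_self, Finset.mem_insert, mem_destSet]
    constructor
    · rintro ⟨t, ht, rfl⟩
      rcases Nat.eq_zero_or_pos t with rfl | h
      · left; rw [centerDest_zero, L.pos_center]
      · obtain ⟨u, rfl⟩ : ∃ u, t = u + 1 := ⟨t - 1, by omega⟩
        exact Or.inr ⟨u, by omega, centerDest_succ.symm⟩
    · rintro (rfl | ⟨t, ht, rfl⟩)
      · exact ⟨0, Nat.zero_le _, by rw [centerDest_zero, L.pos_center]⟩
      · exact ⟨t + 1, by omega, centerDest_succ⟩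
  · have h0' : L.pos i' L.center = d i' 0 := by
      rw [L.pos_center, S.d_zero, L.pos_eq_zero_of_ne hi (by rw [← S.d_zero]; omega)]
    ext x
    rw [Function.update_of_ne hi]
    simp only [mem_destSet, Function.update_of_ne hi]
    have key : ∀ t, centerDest L d i L.center i' t = d i' t := by
      intro t
      rcases Nat.eq_zero_or_pos t with rfl | h
      · rw [centerDest_zero, h0']
      · exact centerDest_ne hi h
    simp only [key]

end State

namespace Phase1State

variable [Finite A]

/-- The number `k` of the algorithm, from the outermost possible match beyond all destinations. -/
theorem isGreatest_ite (H : Phase1State L μ₀ σ χ τ s d e) (h0 : 0 < d i 0) {a : A} {k : ℕ}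
    (ha : a = χ.symm (L.obj i (s i + 1))) (hk : d i (s i) ≤ k) (hkl : k ≤ L.len i)
    (hpk : k = d i (s i) ∨ F.PossibleMatch χ τ a (L.obj i k))
    (hgt : ∀ q, k < q → q ≤ L.len i → ¬ F.PossibleMatch χ τ a (L.obj i q)) :
    IsGreatest {j | j = 0 ∨ (1 ≤ j ∧ j ≤ L.len i ∧ F.PossibleMatch χ τ a (L.obj i j))}
      (if k = d i (s i) then 0 else k) := by
  subst ha
  constructor
  · split_ifs with h
    · exact Or.inl rfl
    · exact Or.inr ⟨by omega, hkl, hpk.resolve_left h⟩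
  · rintro j (rfl | ⟨h1, h2, h3⟩)
    · exact Nat.zero_le _
    · have h4 : j ≤ k := by
        by_contra h
        exact hgt j (by omega) h2 h3
      have h5 : d i (s i) < j := by
        obtain ⟨μ, hμ, hj⟩ := h3
        have := H.state.pos_cases H.nonempty hμ h0
        rw [hj, L.pos_obj i h2] at this
        omega
      rw [if_neg (by omega)]
      exact h4

theorem run_push (H : Phase1State L μ₀ σ χ τ s d e) (h : F.Phase1 L μ₀ σ χ τ) (h0 : 0 < d i 0)
    {a : A} {k : ℕ} (ha : a = χ.symm (L.obj i (s i + 1))) (hk : d i (s i) < k)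
    (hg : IsGreatest {j | j = 0 ∨ (1 ≤ j ∧ j ≤ L.len i ∧ F.PossibleMatch χ τ a (L.obj i j))} k)
    (hc : LikesIn L i a (s i + 1) 0 → ∃ χs b, IsMove L i (s i + 1) 0 χ χs ∧
      F.BestMatch χs τ a b ∧ ¬ F.pref a b (L.obj i k)) :
    F.Phase1 L μ₀ (σ ++ [a]) χ (insert (a, L.obj i k) τ) ∧
      Phase1State L μ₀ (σ ++ [a]) χ (insert (a, L.obj i k) τ) (Function.update s i (s i + 1))
        (State.pushDest s d i k) e := by
  subst ha
  obtain ⟨h1, h2, h3⟩ := H.bestMatch_push h0 hg (by omega) hc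
  exact ⟨h.step (H.state.center_not_mem h0) (H.phase1Step_push h0 hg (by omega) hc),
    H.push (H.state.lt_len H.nonempty h0) h2 h1 h3⟩

theorem run_move (H : Phase1State L μ₀ σ χ τ s d e) (h : F.Phase1 L μ₀ σ χ τ) (h0 : 0 < d i 0)
    {a : A} {k : ℕ} (ha : a = χ.symm (L.obj i (s i + 1)))
    (hg : IsGreatest {j | j = 0 ∨ (1 ≤ j ∧ j ≤ L.len i ∧ F.PossibleMatch χ τ a (L.obj i j))} k)
    (hl : LikesIn L i a (s i + 1) 0) {χ' : A ≃ B} (hm : IsMove L i (s i + 1) 0 χ χ') {b : B}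
    (hb : F.BestMatch χ' τ a b) (hkb : k = 0 ∨ F.pref a b (L.obj i k)) :
    F.Phase1 L μ₀ (σ ++ [a]) χ' (insert (a, b) τ) ∧
      Phase1State L μ₀ (σ ++ [a]) χ' (insert (a, b) τ) (Function.update s i (s i + 1))
        (State.centerDest L d i b) b := by
  subst ha
  obtain ⟨h1, h2⟩ := H.bestMatch_move h0 hg hm hl hb hkb
  exact ⟨h.step (H.state.center_not_mem h0) (H.phase1Step_move h0 hg hl hm hb hkb),
    H.move h0 hm hl h1 h2⟩

end Phase1State

end

end OAF

namespace WordRAM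

open Ex Prog OAF

section

variable {n : ℕ} {F : OAF (Fin n) (Fin n)} {μ₀ χ : Fin n ≃ Fin n} {L : StarLabelling F.graph}
  {τ : Set (Fin n × Fin n)} {σ : List (Fin n)} {s s' : Mem} {c : Fin L.m → ℕ}
  {d : Fin L.m → ℕ → ℕ} {D : Fin L.m → Finset ℕ} {W : ℕ} {e : Fin n} {i : Fin L.m}

/-! ### The program for the first phase -/

/-- The memory holds a state of the first phase. -/
structure Phase1Mem (L : StarLabelling F.graph) (μ₀ : Fin n ≃ Fin n) (s : Mem) (σ : List (Fin n))
    (χ : Fin n ≃ Fin n) (τ : Set (Fin n × Fin n)) (c : Fin L.m → ℕ) (d : Fin L.m → ℕ → ℕ)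
    (e : Fin n) : Prop where
  run : F.Phase1 L μ₀ σ χ τ
  state : Phase1State L μ₀ σ χ τ c d e
  tables : Tables F μ₀ L s
  marks : Marks L c (State.destSet c d) s
  slot : IsSlot L (s.var xCv) (s.var xCj) e
  zero : s.var xCj = 0 ↔ e = L.center
  records : Records σ τ s

/-- The first choice, made by the agent at the center. -/
def phase1Init : Prog := asg xA (get aHOLD (v xC)) ;; bestCenter ;; enter ;; record

/-- One iteration of the first phase. -/
def phase1Step : Prog :=
  asg xI (v xCv) ;; branchPush ;; sto aCNT (v xI) (v xP - 1) ;;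
    -- by now `xP` exceeds the slot of the dictator by one; the test is whether the dictator is unwilling
    -- to walk to the center; slot `0` is marked while the move to the center is tried out
    ite 0 (get aINW (v xB + (v xP - 1))) pushSlot
      (sto aMARK (v xB) 1 ;; bestCenter ;;
        ite (v xJj) (v xKk)
          (ite (get aRANK (v xA * v xN + v xBb))
            (get aRANK (v xA * v xN + get aOBJ (v xCv * v xN + v xKk))) enter
            (sto aMARK (v xCv * v xN) 0 ;; pushSlot))
          enter) ;;
    record

theorem length_le_of_nodup {σ : List (Fin n)} (h : σ.Nodup) : σ.length ≤ n := by
  simpa using h.length_le_card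

theorem four_le (c : Fin n) : 4 ≤ (n + 1) * (n.size + 1) := by
  have h1 : 1 ≤ n := c.pos
  have h2 : 0 < n.size := Nat.size_pos.2 h1
  nlinarith

theorem phase1Init_spec (H : Tables F μ₀ L s) (hM : Marks L (fun _ => 0) (fun _ => {0}) s)
    (hR : Records (n := n) [] ∅ s) (hW : 10 * (n * n) + 10 * n + 1000 ≤ W) :
    Wp W phase1Init s (4000 * ((n + 1) * (n.size + 1)))
      (fun s' => ∃ σ χ τ c d e, Phase1Mem L μ₀ s' σ χ τ c d e) := by
  obtain ⟨K, hK⟩ : ∃ K, K = (n + 1) * (n.size + 1) := ⟨_, rfl⟩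
  have h4 := four_le L.center
  rw [← hK] at h4 ⊢
  have hn := L.center.2
  have hhold := H.hold L.center
  refine Wp.seq 20 (fun s' => s'.var xA = μ₀.symm L.center) (by omega) (Wp.of_vc ?_)
    fun s1 f1 h1 => ?_
  · simp [vc, H.center, hhold]
  have H1 := H.frame f1
  have hM1 := hM.congr (f1.arr _) (f1.arr _)
  refine Wp.seq (3000 * K) _ (by omega) (hK ▸ bestCenter_spec H1 hM1 hW _ h1 (fun i => Nat.zero_le _)
    (by simp) (by simp)) fun s2 f2 ⟨g1, b, g2, g3⟩ => ?_
  have S : ∀ b, State L μ₀ (insert (μ₀.symm L.center, b) ∅) (fun _ => 0)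
      (State.withCenter L (fun _ _ => 0) b) b := fun b => State.init fun i => State.withCenter_zero
  have hD : ∀ b, State.destSet (fun _ => 0) (State.withCenter L (fun _ _ => 0) b) =
      fun i => insert (L.pos i b) (({0} : Finset ℕ).erase 0) := by
    intro b
    funext i
    ext x
    simp [State.mem_destSet, State.withCenter_zero, eq_comm]
  have hbest : F.BestMatch μ₀ ∅ (μ₀.symm L.center) b := by
    refine g3.bestMatch S ⟨μ₀, F.mem_reach_refl μ₀, by simp⟩ (fun i => ?_) (fun _ _ _ _ => rfl) rfl
    simp [hD L.center, L.pos_center]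
  refine Wp.seq 100 _ (by omega) (enter_spec ((f2.var xN).trans H1.size)
    (hM1.congr g1 (f2.arr _)) (by simp) hW g3.1) fun s3 f3 ⟨g4, g5, g6⟩ => ?_
  have eA3 := (f3.var xA).trans ((f2.var xA).trans h1)
  have eB3 := (f3.var xBb).trans g2
  refine (record_spec (((hR.frame f1).frame f2).frame f3) eA3 eB3 (by simp; omega)
    (by simp)).weaken (by omega) fun s4 f4 g7 => ?_
  have P := phase1State_init hbest
  refine ⟨_, _, _, _, State.withCenter L (fun _ _ => 0) b, b, Phase1.init hbest,
    ⟨P.state.congr_dest fun i t ht => ?_, P.reach, P.nonempty, P.serial, P.nodup, P.mem, P.agree⟩,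
    ((H1.frame f2).frame f3).frame f4, ?_, ?_, ?_, ?_⟩
  · obtain rfl : t = 0 := by omega
    exact State.withCenter_zero
  · rw [hD b]
    exact g6.congr (f4.arr _) (f4.arr _)
  · rw [f4.var xCv, f4.var xCj]; exact g4
  · rw [f4.var xCj]; exact g5
  · rw [insert_empty_eq] at g7; exact g7

/-- An iteration takes one binary search on a branch and at most one search for the best match of the
agent at the center, which makes `O(n log n)` steps. -/
theorem phase1Step_spec (P : Phase1Mem L μ₀ s σ χ τ c d e) (h0 : 0 < s.var xCj)
    (hW : 10 * (n * n) + 10 * n + 1000 ≤ W) :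
    Wp W phase1Step s (5000 * ((n + 1) * (n.size + 1)))
      (fun s' => ∃ σ' χ' τ' c' d' e', Phase1Mem L μ₀ s' σ' χ' τ' c' d' e' ∧
        σ'.length = σ.length + 1) := by
  obtain ⟨K, hK⟩ : ∃ K, K = (n + 1) * (n.size + 1) := ⟨_, rfl⟩
  have h4 := four_le L.center
  obtain ⟨hrun, PS, H, hM, hslot, hzero, hR⟩ := P
  obtain ⟨i, hj1, hjl, hv, he⟩ := hslot.resolve_left (by omega)
  have hlen := len_lt L i
  have hbase := base_le (L.obj i 1)
  have hcost : n.size * (300 * L.len i + 1000) + 60 * L.len i + 400 ≤ 1000 * K := by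
    rw [hK]; nlinarith
  rw [← hK] at h4 ⊢
  obtain ⟨y, hy⟩ : ∃ y, y = n.size * (300 * L.len i + 1000) := ⟨_, rfl⟩
  rw [← hy] at hcost
  have hd0 : 0 < d i 0 := by rw [PS.state.d_zero, he, L.pos_obj i hjl]; exact hj1
  have hs := PS.state.lt_len PS.nonempty hd0
  have hd := PS.state.strictMono PS.nonempty i
  obtain ⟨χ', hm, -, -⟩ := F.exists_isMove L i hs (Nat.zero_le _) χ
  set a := μ₀.symm (L.obj i (c i + 1)) with ha
  have haχ : a = χ.symm (L.obj i (c i + 1)) := (PS.agree i _ (Nat.lt_succ_self _) hs).symm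
  have hσ := length_le_of_nodup (PS.append_nodup hs)
  rw [List.length_append, List.length_singleton] at hσ
  refine Wp.seq 20 (fun s' => s'.var xI = L.obj i 1) (by omega) (Wp.of_vc ?_) fun s1 f1 h1 => ?_
  · simp [vc, hv]
  have H1 := H.frame f1
  refine Wp.seq (1000 * K) _ (by omega) ((branchPush_spec H1 (hM.congr (f1.arr _) (f1.arr _)) hW h1
    PS.state PS.nonempty hs PS.agree).weaken (by rw [← hy]; omega) fun _ _ h => h)
    fun s2 f2 ⟨eB, eL, eP, eA, eM, eJ, hk1, hk2, hk3, hk4⟩ => ?_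
  have H2 := H1.frame f2
  have hM2 := hM.congr (eM.trans (f1.arr _)) ((f2.arr aCNT).trans (f1.arr _))
  have hR2 := (hR.frame f1).frame f2
  have eI2 := (f2.var xI).trans h1
  have eCv2 := ((f2.var xCv).trans (f1.var xCv)).trans hv
  have eCj2 := (f2.var xCj).trans (f1.var xCj)
  obtain ⟨k, hk⟩ : ∃ k, s2.var xKk = k := ⟨_, rfl⟩
  rw [hk] at hk1 hk2 hk3 hk4
  have hg := PS.isGreatest_ite hd0 haχ hk1 hk2 hk3 hk4
  have hinw := H2.inw i (c i + 1) 0 (by omega) hs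
  set c' := Function.update c i (c i + 1) with hc'
  refine Wp.seq 50 (fun s' => s'.arr aCNT = Function.update (s2.arr aCNT) (L.obj i 1) (c i + 1))
    (by omega) (Wp.of_vc ?_) fun s3 f3 h3 => ?_
  · simp [vc, eI2, eP]
    omega
  have H3 := H2.frame f3
  have hM3 : Marks L c' (State.destSet c d) s3 := by
    refine ⟨fun i' => ?_, fun i' j hj => ?_⟩
    · rw [h3, Function.update_apply, hc']
      by_cases hi : i' = i
      · subst hi; simp
      · rw [if_neg, Function.update_of_ne hi]
        · exact hM2.count i'
        · intro h
          exact hi (L.obj_inj i' 1 i 1 le_rfl (L.len_pos _) le_rfl (L.len_pos _) (Fin.ext h)).1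
    · rw [f3.arr aMARK]
      exact hM2.mark i' j hj
  have hR3 := hR2.frame f3
  have eB3 := (f3.var xB).trans eB
  have eP3 := (f3.var xP).trans eP
  have eA3 : s3.var xA = a := (f3.var xA).trans eA
  have eJ3 := (f3.var xJj).trans eJ
  have eK3 := (f3.var xKk).trans hk
  have eCv3 := (f3.var xCv).trans eCv2
  have eCj3 := (f3.var xCj).trans eCj2
  -- the result of the case distinction, before the choice is recorded
  let R : Mem → Prop := fun s' => ∃ (b : Fin n) (χ' : Fin n ≃ Fin n) (d' : Fin L.m → ℕ → ℕ)
    (e' : Fin n), s'.var xBb = b ∧ F.Phase1 L μ₀ (σ ++ [a]) χ' (insert (a, b) τ) ∧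
      Phase1State L μ₀ (σ ++ [a]) χ' (insert (a, b) τ) c' d' e' ∧
      Marks L c' (State.destSet c' d') s' ∧ IsSlot L (s'.var xCv) (s'.var xCj) e' ∧
      (s'.var xCj = 0 ↔ e' = L.center)
  -- the dictator is matched on the branch
  have hpush : ∀ s', Tables F μ₀ L s' → Marks L c' (State.destSet c d) s' →
      s'.var xCv = L.obj i 1 → s'.var xCj = s.var xCj → s'.var xKk = k → d i (c i) < k →
      (LikesIn L i a (c i + 1) 0 → ∃ χs b, IsMove L i (c i + 1) 0 χ χs ∧
        F.BestMatch χs τ a b ∧ ¬ F.pref a b (L.obj i k)) →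
      Wp W pushSlot s' 60 R := by
    intro s' H' hM' h5 h6 h7 h8 h9
    rw [if_neg (by omega)] at hg
    obtain ⟨u1, u2⟩ := PS.run_push hrun hd0 haχ h8 hg h9
    refine (pushSlot_spec H' hM' hW h5 h7 hk2).weaken le_rfl fun s'' f'' ⟨k1, k2⟩ =>
      ⟨L.obj i k, χ, State.pushDest c d i k, e, k1, u1, u2, ?_, ?_, ?_⟩
    · convert k2 using 1
      funext i'
      by_cases hi : i' = i
      · subst hi; rw [Function.update_self, State.destSet_push]
      · rw [Function.update_of_ne hi, State.destSet_push_ne hi]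
    · rw [f''.var xCv, f''.var xCj, h5, h6]
      exact Or.inr ⟨i, hj1, hjl, rfl, he⟩
    · rw [f''.var xCj, h6]; exact hzero
  refine Wp.seq (3500 * K) R (by omega) ?_ fun s4 f4 ⟨b, χ'', d', e', r1, r2, r3, r4, r5, r6⟩ => ?_
  swap
  · have eA4 := (f4.var xA).trans eA3
    refine (record_spec (hR3.frame f4) eA4 r1 (by omega)
      fun b' hb' => eq_of_mem_of_nonempty r3.nonempty hb').weaken (by omega) fun s5 f5 h5 => ?_
    refine ⟨_, _, _, c', d', e', ⟨r2, r3, (H3.frame f4).frame f5,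
      r4.congr (f5.arr _) (f5.arr _), ?_, ?_, h5⟩, by simp⟩
    · rw [f5.var xCv, f5.var xCj]; exact r5
    · rw [f5.var xCj]; exact r6
  have eIn3 := f3.arr aINW
  have hbaseW : (L.obj i 1 : ℕ) * n + (c i + 1) ≤ W := by omega
  refine Wp.ite (T₁ := 3500 * K - 50) (by simp) ?_ ?_ (fun hlt => ?_) fun hlt => ?_
  · simp [eB3, eP3]; omega
  · simp; omega
  · -- the dictator does not like to go to the center
    simp only [eval_zero, eval_get, eval_add, eval_sub, eval_one, eval_v, eB3, eP3, eIn3,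
      show c i + 2 - 1 = c i + 1 by omega] at hlt
    have hnl : ¬ LikesIn L i a (c i + 1) 0 := by
      rw [← hinw]; omega
    have hkJ : d i (c i) < k := by
      by_contra h
      rw [if_pos (by omega), haχ] at hg
      rw [haχ] at hnl
      exact absurd (PS.greatest_pos hd0 hg hnl) (by omega)
    exact (hpush s3 H3 hM3 eCv3 (eCj3) eK3 hkJ fun h => absurd h hnl).weaken (by omega)
      fun _ _ h => h
  · simp only [eval_zero, eval_get, eval_add, eval_sub, eval_one, eval_v, eB3, eP3, eIn3,
      show c i + 2 - 1 = c i + 1 by omega] at hlt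
    have hl : LikesIn L i a (c i + 1) 0 := by
      rw [← hinw]; omega
    have hlχ := hl
    rw [haχ] at hlχ
    have S' := PS.state.moveCenter hs hd0 hd hm
    have hac : χ'.symm L.center = a := by
      rw [haχ, ← L.obj_zero i]; exact (hm.symm_obj hs).1
    have hne' : (F.ReachAgain χ' τ).Nonempty := by
      obtain ⟨μ, hμ⟩ := PS.state.nonempty_move PS.nonempty hd0 hm hlχ
      exact ⟨μ, (mem_reachAgain_insert.1 hμ).1⟩
    have hD := PS.state.destSet_centerDest hd0
    set D' : Fin L.m → Finset ℕ := State.destSet c' (State.centerDest L d i L.center) with hD'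
    have hD0 : ∀ i', 0 ∈ D' i' := fun i' => by
      rw [hD', State.centerDest_eq]
      exact State.zero_mem_destSet_center
    refine Wp.seq 20 (Marks L c' D') (by omega) (Wp.of_vc ?_) fun s5 f5 hM5 => ?_
    · simp [vc, eB3]
      refine ⟨by omega, ?_⟩
      rw [show D' = Function.update (State.destSet c d) i (insert 0 (State.destSet c d i)) from
        funext hD]
      refine hM3.set (x := 0) (y := 1) (Nat.zero_le _) ?_ (by rfl)
        (if_pos (Finset.mem_insert_self _ _)).symm fun j hj => by simp [hj]
      simp
    have H5 := H3.frame f5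
    have eA5 := (f5.var xA).trans eA3
    refine Wp.seq (3000 * K) _ (by omega) (hK ▸ bestCenter_spec H5 hM5 hW a eA5 (S' L.center).s_le
      (fun i' => (S' L.center).destSet_le) hD0) fun s6 f6 ⟨g1, b, g2, g3⟩ => ?_
    have hbest : F.BestMatch χ' τ a b := by
      refine g3.bestMatch (d := fun i' t => if i' = i then d i (t - 1) else d i' t) (fun b => ?_)
        hne' (fun i' => rfl) (PS.agree_move hs hm) hac.symm
      rw [hac, haχ]
      exact S' b
    have H6 := H5.frame f6
    have hM6 := hM5.congr g1 (f6.arr _)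
    have eA6 := (f6.var xA).trans eA5
    have eJ6 := ((f6.var xJj).trans (f5.var xJj)).trans eJ3
    have eK6 := ((f6.var xKk).trans (f5.var xKk)).trans eK3
    have eCv6 := ((f6.var xCv).trans (f5.var xCv)).trans eCv3
    have eCj6 := ((f6.var xCj).trans (f5.var xCj)).trans eCj3
    -- the dictator is matched from the center
    have hcenter : (k = d i (c i) ∨ F.pref a b (L.obj i k)) → Wp W enter s6 100 R := by
      intro hkb
      obtain ⟨u1, u2⟩ := PS.run_move hrun hd0 haχ hg hl hm hbest (by
        split_ifs with h
        · exact Or.inl rfl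
        · exact Or.inr (hkb.resolve_left h))
      refine (enter_spec H6.size hM6 hD0 hW g3.1).weaken le_rfl fun s7 f7 ⟨k1, k2, k3⟩ =>
        ⟨b, χ', State.centerDest L d i b, b, (f7.var xBb).trans g2, u1, u2, ?_, k1, k2⟩
      convert k3 using 1
      funext i'
      rw [hD', State.centerDest_eq b, State.centerDest_eq L.center]
      exact State.destSet_withCenter (S' L.center) b
    have hrank := H6.rank a b (L.obj i k)
    have hobj := H6.obj i k hk2
    have hAn := base_le a
    have hb2 := b.2
    have ho2 := (L.obj i k).2
    refine Wp.ite (T₁ := 400) (by simp) (by simp) (by simp; omega) (fun hlt' => ?_) fun hlt' => ?_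
    · simp only [eval_v, eJ6, eK6] at hlt'
      refine Wp.ite (T₁ := 300) ?_ ?_ (by simp) (fun hlt'' => ?_) fun hlt'' => ?_
      · simp [eA6, H6.size, g2]; omega
      · simp [eA6, H6.size, eCv6, eK6, hobj]; omega
      · simp only [eval_get, eval_add, eval_mul, eval_v, eA6, H6.size, g2, eCv6, eK6, hobj] at hlt''
        exact (hcenter (Or.inr (hrank.2 hlt''))).weaken (by omega) fun _ _ h => h
      · simp only [eval_get, eval_add, eval_mul, eval_v, eA6, H6.size, g2, eCv6, eK6, hobj] at hlt''
        refine Wp.seq 40 (Marks L c' (State.destSet c d)) (by omega) (Wp.of_vc ?_) fun s7 f7 hM7 => ?_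
        · simp [vc, eCv6, H6.size]
          refine ⟨by omega, ?_⟩
          have e1 : State.destSet c d = Function.update D' i (State.destSet c d i) := by
            funext i'
            by_cases hi : i' = i
            · subst hi; rw [Function.update_self]
            · rw [Function.update_of_ne hi, hD i', Function.update_of_ne hi]
          have h0n : 0 ∉ State.destSet c d i := by
            intro h
            obtain ⟨t, ht, h⟩ := State.mem_destSet.1 h
            have := PS.state.lt_dest PS.nonempty hd0 t ht
            omega
          rw [e1]
          refine hM6.set (x := 0) (y := 0) (Nat.zero_le _) ?_ (by rfl) (by simp [h0n]) fun j hj => ?_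
          · simp
          · rw [hD i, Function.update_self]; simp [hj]
        · exact (hpush s7 (H6.frame f7) hM7 ((f7.var _).trans eCv6) ((f7.var _).trans eCj6)
            ((f7.var _).trans eK6) hlt' fun _ => ⟨χ', b, hm, hbest, mt hrank.1 hlt''⟩).weaken
            (by omega) fun _ _ h => h
    · simp only [eval_v, eJ6, eK6] at hlt'
      exact (hcenter (Or.inl (by omega))).weaken (by omega) fun _ _ h => h

/-- The first phase. -/
def phase1 : Prog := phase1Init ;; loop 0 (v xCj) phase1Step

/-- There are at most `n` iterations, because the dictators are distinct. -/
theorem phase1_spec (H : Tables F μ₀ L s) (hM : Marks L (fun _ => 0) (fun _ => {0}) s)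
    (hR : Records (n := n) [] ∅ s) (hW : 10 * (n * n) + 10 * n + 1000 ≤ W) :
    Wp W phase1 s (6000 * (n + 1) * ((n + 1) * (n.size + 1)))
      (fun s' => ∃ σ χ τ c d, F.Phase1 L μ₀ σ χ τ ∧ Phase1State L μ₀ σ χ τ c d L.center ∧
        Tables F μ₀ L s' ∧ Marks L c (State.destSet c d) s' ∧ Records σ τ s') := by
  have hinit := phase1Init_spec H hM hR hW
  have h4 := four_le L.center
  have hstep : ∀ s' σ χ τ c d e, Phase1Mem L μ₀ s' σ χ τ c d e → 0 < s'.var xCj → _ :=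
    fun s' σ χ τ c d e P h => phase1Step_spec (W := W) P h hW
  obtain ⟨K, hK⟩ : ∃ K, K = (n + 1) * (n.size + 1) := ⟨_, rfl⟩
  rw [← hK] at hinit h4 hstep ⊢
  have hT : 6000 * (n + 1) * K = 6000 * (n * K) + 6000 * K := by ring
  rw [hT]
  refine Wp.seq (4000 * K) _ (by omega) hinit fun s1 f1 h1 => ?_
  refine Wp.loop (fun s' => ∃ σ χ τ c d e, Phase1Mem L μ₀ s' σ χ τ c d e)
    (fun s' => 6000 * ((n - s'.var xD) * K)) h1 ?_ ?_ ?_ ?_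
  · have : (n - s1.var xD) * K ≤ n * K := Nat.mul_le_mul_right _ (Nat.sub_le _ _)
    simp only [cost_zero, cost_v]
    omega
  · simp
  · rintro s' ⟨σ, χ, τ, c, d, e, P⟩ f hlt
    refine ⟨5000 * K, (hstep s' σ χ τ c d e P hlt).weaken le_rfl ?_⟩
    rintro s'' f'' ⟨σ', χ', τ', c', d', e', P', hl⟩
    refine ⟨⟨σ', χ', τ', c', d', e', P'⟩, ?_⟩
    have h5 := length_le_of_nodup P'.state.nodup
    rw [P.records.count, P'.records.count, hl]
    obtain ⟨r, hr⟩ : ∃ r, n - σ.length = r + 1 := ⟨n - σ.length - 1, by omega⟩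
    rw [hr, show n - (σ.length + 1) = r by omega, show (r + 1) * K = r * K + K by ring]
    simp only [cost_zero, cost_v]
    omega
  · rintro s' ⟨σ, χ, τ, c, d, e, P⟩ f hlt
    have he := P.zero.1 (Nat.eq_zero_of_not_pos hlt)
    subst he
    exact ⟨σ, χ, τ, c, d, P.run, P.state, P.tables, P.marks, P.records⟩

end

section

variable {n : ℕ} {F : OAF (Fin n) (Fin n)} {μ₀ χ χ' : Fin n ≃ Fin n} {L : StarLabelling F.graph}
  {τ : Set (Fin n × Fin n)} {σ : List (Fin n)} {s s' : Mem} {c : Fin L.m → ℕ}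
  {d : Fin L.m → ℕ → ℕ} {W : ℕ} {i : Fin L.m}

/-! ### The program for the second phase -/

/-- The memory holds a state of the second phase, which started in the configuration `χ`. -/
structure Phase2Mem (L : StarLabelling F.graph) (μ₀ χ : Fin n ≃ Fin n) (s : Mem)
    (σ : List (Fin n)) (χ' : Fin n ≃ Fin n) (τ : Set (Fin n × Fin n)) (c : Fin L.m → ℕ)
    (d : Fin L.m → ℕ → ℕ) : Prop where
  state : Phase2State L μ₀ χ χ' τ c d
  tables : Tables F μ₀ L s
  marks : Marks L c (State.destSet c d) s
  records : Records σ τ s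
  nodup : σ.Nodup
  mem : ∀ a ∈ σ, ∃ b, (a, b) ∈ τ

/-- Finds the innermost slot that is not marked. -/
def firstFree : Prog :=
  asg xR 0 ;; loop 0 (get aMARK (v xB + v xR)) (asg xR (v xR + 1))

theorem firstFree_spec {M : ℕ → ℕ} {ℓ r : ℕ} (hM : ∀ j, M j = s.arr aMARK (s.var xB + j))
    (hr : r ≤ ℓ) (h0 : M r = 0) (hW : s.var xB + ℓ + 1 ≤ W) :
    Wp W firstFree s (40 * ℓ + 40) (fun s' => (∀ x < s'.var xR, M x ≠ 0) ∧ M (s'.var xR) = 0 ∧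
      s'.var xR ≤ ℓ) := by
  refine Wp.seq 10 (fun s' => s'.var xR = 0) (by omega) (Wp.of_vc ?_) fun s1 f1 h1 => ?_
  · simp [vc]
  have hM1 : ∀ j, M j = s1.arr aMARK (s1.var xB + j) := by
    intro j; rw [f1.arr aMARK, f1.var xB, hM]
  have hB := f1.var xB
  refine Wp.loop (fun s' => s'.var xR ≤ r ∧ ∀ x < s'.var xR, M x ≠ 0)
    (fun s' => 40 * (r - s'.var xR)) ⟨by omega, fun x hx => by omega⟩ ?_ ?_ ?_ ?_
  · simp [h1]; omega
  · rintro s' ⟨h2, h3⟩ f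
    simp [f.var xB, hB]; omega
  · rintro s' ⟨h2, h3⟩ f hlt
    simp only [eval_zero, eval_get, eval_add, eval_v, f.var xB, f.arr aMARK, ← hM1] at hlt
    have hne : s'.var xR ≠ r := by
      intro h
      rw [h, h0] at hlt
      exact absurd hlt (lt_irrefl 0)
    refine ⟨20, Wp.of_vc ?_⟩
    simp [vc]
    refine ⟨by omega, ⟨by omega, fun x hx => ?_⟩, by omega⟩
    rcases Nat.lt_or_ge x (s'.var xR) with h | h
    · exact h3 x h
    · rw [show x = s'.var xR by omega]; exact hlt.ne'
  · rintro s' ⟨h2, h3⟩ f hlt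
    simp only [eval_zero, eval_get, eval_add, eval_v, f.var xB, f.arr aMARK, ← hM1] at hlt
    exact ⟨h3, Nat.eq_zero_of_not_pos hlt, by omega⟩

/-- One choice of the second phase, by the agent next in line on branch `xI`: it takes the
outermost possible slot or the innermost free one, whichever it prefers. -/
def phase2Step : Prog :=
  branchPush ;; firstFree ;;
    (asg xBj (v xR) ;;
      ite (v xJj) (v xKk)
        -- the first test is whether the dictator is unwilling to walk to the innermost free slot
        (ite (v xR) (get aINW (v xB + (v xP - 1)))
          (asg xBj (v xKk)) (ite (rk (v xR)) (rk (v xKk)) skip (asg xBj (v xKk)))) skip ;;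
      sto aMARK (v xB + v xBj) 1 ;; sto aCNT (v xI) (v xP - 1) ;;
      asg xBb (get aOBJ (v xB + v xBj))) ;; record

theorem phase2Step_spec (P : Phase2Mem L μ₀ χ s σ χ' τ c d) (hI : s.var xI = L.obj i 1)
    (hs : c i < L.len i) (hW : 10 * (n * n) + 10 * n + 1000 ≤ W) :
    Wp W phase2Step s (2000 * ((n + 1) * (n.size + 1))) (fun s' => ∃ b χ'' d',
      F.BestMatch χ τ (μ₀.symm (L.obj i (c i + 1))) b ∧
      Phase2Mem L μ₀ χ s' (σ ++ [μ₀.symm (L.obj i (c i + 1))]) χ''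
        (insert (μ₀.symm (L.obj i (c i + 1)), b) τ) (Function.update c i (c i + 1)) d') := by
  obtain ⟨K, hK⟩ : ∃ K, K = (n + 1) * (n.size + 1) := ⟨_, rfl⟩
  have h4 := four_le L.center
  have hlen := len_lt L i
  have hbase := base_le (L.obj i 1)
  have hcost : n.size * (300 * L.len i + 1000) + 60 * L.len i + 400 ≤ 1000 * K := by
    rw [hK]; nlinarith
  have hcost2 : 40 * L.len i + 40 ≤ 200 * K := by rw [hK]; nlinarith
  rw [← hK] at h4 ⊢
  obtain ⟨y, hy⟩ : ∃ y, y = n.size * (300 * L.len i + 1000) := ⟨_, rfl⟩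
  rw [← hy] at hcost
  obtain ⟨P2, H, hM, hR, hnd, hmem⟩ := P
  have S := P2.state
  have hne := P2.nonempty
  obtain ⟨a, ha⟩ : ∃ a, a = μ₀.symm (L.obj i (c i + 1)) := ⟨_, rfl⟩
  have hnew : ∀ b, (a, b) ∉ τ := by
    rw [ha, ← P2.agree i (c i + 1) (Nat.lt_succ_self _) hs]
    exact S.not_mem_of_lt (Nat.lt_succ_self _) hs
  have hnd' : (σ ++ [a]).Nodup := by
    rw [List.nodup_append]
    refine ⟨hnd, List.nodup_singleton _, ?_⟩
    rintro x hx x' hx' rfl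
    rw [List.mem_singleton] at hx'
    subst hx'
    obtain ⟨b, hb⟩ := hmem x hx
    exact hnew b hb
  have hσ := length_le_of_nodup hnd'
  rw [List.length_append, List.length_singleton] at hσ
  refine Wp.seq (1000 * K) _ (by omega) ((branchPush_spec H hM hW hI S hne hs P2.agree).weaken
    (by rw [← hy]; omega) fun _ _ h => h)
    fun s1 f1 ⟨eB, eL, eP, eA, eM, eJ, hk1, hk2, hk3, hk4⟩ => ?_
  rw [← ha] at eA hk3 hk4 ⊢
  have H1 := H.frame f1
  have hM1 := hM.congr eM (f1.arr aCNT)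
  have eI1 := (f1.var xI).trans hI
  obtain ⟨k, hk⟩ : ∃ k, s1.var xKk = k := ⟨_, rfl⟩
  rw [hk] at hk1 hk2 hk3 hk4
  obtain ⟨M, hMdef⟩ : ∃ M : ℕ → ℕ, ∀ j, M j = s1.arr aMARK (s1.var xB + j) := ⟨_, fun _ => rfl⟩
  have hM2 : ∀ j ≤ L.len i, (M j = 0 ↔ j ∉ State.destSet c d i) := by
    intro j hj
    rw [hMdef, eB, hM1.mark i j hj]
    split_ifs with h <;> simp [h]
  -- there is a free slot, since fewer than all agents of the branch are fixed
  obtain ⟨r₀, hr₀, hr₀'⟩ : ∃ r ≤ L.len i, r ∉ State.destSet c d i := by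
    by_contra hall
    push Not at hall
    have h1 : Finset.range (L.len i + 1) ⊆ State.destSet c d i := fun x hx =>
      hall x (Nat.lt_succ_iff.1 (Finset.mem_range.1 hx))
    have h2 := (Finset.card_le_card h1).trans Finset.card_image_le
    simp only [Finset.card_range] at h2
    omega
  refine Wp.seq (200 * K) _ (by omega) ((firstFree_spec hMdef hr₀ ((hM2 r₀ hr₀).2 hr₀')
    (by rw [eB]; omega)).weaken hcost2 fun _ _ h => h) fun s2 f2 ⟨g1, g2, g3⟩ => ?_
  obtain ⟨r, hr⟩ : ∃ r, s2.var xR = r := ⟨_, rfl⟩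
  rw [hr] at g1 g2 g3
  have hfill : ∀ x < r, x ∈ State.destSet c d i := fun x hx => by
    by_contra h
    exact g1 x hx ((hM2 x (by omega)).2 h)
  have hfree := (hM2 r g3).1 g2
  have H2 := H1.frame f2
  have eB2 := (f2.var xB).trans eB
  have eP2 := (f2.var xP).trans eP
  have eA2 := (f2.var xA).trans eA
  have eJ2 := (f2.var xJj).trans eJ
  have eK2 := (f2.var xKk).trans hk
  have eI2 := (f2.var xI).trans eI1
  have hinw := H2.inw i (c i + 1) r (by omega) hs
  rw [← ha] at hinw
  have hrank := H2.rank a (L.obj i r) (L.obj i k)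
  have hobj := fun j => H2.obj i j
  have hor := hobj r g3
  have hok := hobj k hk2
  have hAn := base_le a
  have hr2 := (L.obj i r).2
  have hk2' := (L.obj i k).2
  have hcs : c i + 2 - 1 = c i + 1 := by omega
  have hM3 := hM1.congr (f2.arr aMARK) (f2.arr aCNT)
  refine Wp.seq 300 (fun s' => ∃ x ≤ L.len i, s'.var xBb = L.obj i x ∧
    s'.arr aMARK = Function.update (s2.arr aMARK) (L.obj i 1 * n + x) 1 ∧
    s'.arr aCNT = Function.update (s2.arr aCNT) (L.obj i 1) (c i + 1) ∧
    ((x = k ∧ d i (c i) < k ∧ ¬ (LikesIn L i a (c i + 1) r ∧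
        F.pref a (L.obj i r) (L.obj i k))) ∨
      (x = r ∧ (d i (c i) < k → LikesIn L i a (c i + 1) r ∧ F.pref a (L.obj i r) (L.obj i k)))))
    (by omega) (Wp.of_vc ?_) fun s3 f3 ⟨x, hx, k1, k2, k3, k4⟩ => ?_
  · simp [vc, rk, hr, eB2, eP2, eA2, eJ2, eK2, eI2, H2.size, hor, hok, hcs, ← hrank]
    refine ⟨fun h1 => ⟨by omega, fun h2 => ⟨by omega, by omega, by omega, by omega, k, hk2, rfl, rfl,
      Or.inl ⟨rfl, h1, fun h => by have := hinw.2 h; omega⟩⟩, fun h2 => ⟨by omega, by omega,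
      fun h3 => ⟨by omega, by omega, by omega, by omega, r, g3, rfl, rfl,
        Or.inr ⟨rfl, fun _ => ⟨hinw.1 h2, h3⟩⟩⟩,
      fun h3 => ⟨by omega, by omega, by omega, by omega, k, hk2, rfl, rfl,
        Or.inl ⟨rfl, h1, fun _ => h3⟩⟩⟩⟩,
      fun h1 => ⟨by omega, by omega, by omega, by omega, r, g3, rfl, rfl,
        Or.inr ⟨rfl, fun h => by omega⟩⟩⟩
  have hstep := P2.step hs ha hfill hfree hk1 hk2 hk3 hk4 k4
  obtain ⟨-, hbest, χ'', d', Q, hD1, hD2⟩ := hstep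
  have eA3 := (f3.var xA).trans eA2
  refine (record_spec ((hR.frame f1).frame f2 |>.frame f3) eA3 k1 (by omega)
    fun b' hb' => absurd hb' (hnew b')).weaken (by omega) fun s4 f4 h5 => ?_
  refine ⟨L.obj i x, χ'', d', hbest, Q, (H2.frame f3).frame f4, ?_, h5, hnd', ?_⟩
  · refine Marks.congr (s := s3) ⟨fun i' => ?_, ?_⟩ (f4.arr _) (f4.arr _)
    · rw [k3, Function.update_apply]
      by_cases hi : i' = i
      · subst hi; simp
      · rw [if_neg, Function.update_of_ne hi]
        · exact hM3.count i'
        · intro h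
          exact hi (L.obj_inj i' 1 i 1 le_rfl (L.len_pos _) le_rfl (L.len_pos _) (Fin.ext h)).1
    · have hM4 : Marks L c (Function.update (State.destSet c d) i (insert x (State.destSet c d i)))
          (s2.setArr aMARK (L.obj i 1 * n + x) 1) :=
        hM3.set (x := x) (y := 1) hx (by simp) (by rfl)
          (if_pos (Finset.mem_insert_self _ _)).symm fun j hj => by simp [hj]
      intro i' j hj
      rw [k2]
      have := hM4.mark i' j hj
      simp only [setArr_arr, if_true] at this
      rw [this]
      by_cases hi : i' = i
      · subst hi; rw [Function.update_self, hD1]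
      · rw [Function.update_of_ne hi, hD2 i' hi]
  · intro a' ha'
    rcases List.mem_append.1 ha' with h | h
    · obtain ⟨b, hb⟩ := hmem a' h
      exact ⟨b, Set.mem_insert_of_mem _ hb⟩
    · rw [List.mem_singleton.1 h]; exact ⟨_, Set.mem_insert _ _⟩

/-- The choices of all agents of branch `xI` that are not matched yet. -/
def phase2Branch : Prog := loop (get aCNT (v xI)) (get aLEN (v xI)) phase2Step

theorem phase2Branch_spec (P : Phase2Mem L μ₀ χ s σ χ' τ c d) (hI : s.var xI = L.obj i 1)
    (hχ : ∀ q, c i < q → q ≤ L.len i → χ.symm (L.obj i q) = μ₀.symm (L.obj i q))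
    (hW : 10 * (n * n) + 10 * n + 1000 ≤ W) :
    Wp W phase2Branch s (L.len i * (3000 * ((n + 1) * (n.size + 1))) + 30) (fun s' => ∃ χ'' τ' d',
      F.SerialFrom χ τ (Phase1State.phase2Dictators L χ c [i]) τ' ∧
      Phase2Mem L μ₀ χ s' (σ ++ Phase1State.phase2Dictators L χ c [i]) χ'' τ'
        (Function.update c i (L.len i)) d') := by
  have h4 := four_le L.center
  have hstep : ∀ s' σ χ' τ c d, Phase2Mem L μ₀ χ s' σ χ' τ c d → s'.var xI = L.obj i 1 →
      c i < L.len i → _ := fun s' σ χ' τ c d P h1 h2 => phase2Step_spec (W := W) P h1 h2 hW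
  obtain ⟨K, hK⟩ : ∃ K, K = (n + 1) * (n.size + 1) := ⟨_, rfl⟩
  rw [← hK] at h4 hstep ⊢
  have hci := P.state.state.s_le i
  refine Wp.loop (fun s' => ∃ t χ'' τ' d', c i + t ≤ L.len i ∧
      F.SerialFrom χ τ ((List.range' (c i + 1) t).map fun j => χ.symm (L.obj i j)) τ' ∧
      Phase2Mem L μ₀ χ s' (σ ++ (List.range' (c i + 1) t).map fun j => χ.symm (L.obj i j)) χ'' τ'
        (Function.update c i (c i + t)) d')
    (fun s' => (L.len i - s'.arr aCNT (L.obj i 1)) * (3000 * K)) ?_ ?_ ?_ ?_ ?_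
  · refine ⟨0, χ', τ, d, by omega, .nil _, ?_⟩
    simpa using P
  · have : (L.len i - s.arr aCNT (L.obj i 1)) * (3000 * K) ≤ L.len i * (3000 * K) :=
      Nat.mul_le_mul_right _ (Nat.sub_le _ _)
    simp only [cost_get, cost_v]
    omega
  · simp
  · rintro s' ⟨t, χ'', τ', d', h1, h2, P'⟩ f hlt
    have hI' := (f.var xI).trans hI
    have hc := P'.marks.count i
    rw [Function.update_self] at hc
    simp only [eval_get, eval_v, hI', hc, P'.tables.len] at hlt
    refine ⟨2000 * K, (hstep s' _ _ _ _ _ P' hI' (by rwa [Function.update_self])).weaken le_rfl ?_⟩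
    rintro s'' f'' ⟨b, χ₃, d₃, h5, P₃⟩
    rw [Function.update_self, Function.update_idem] at P₃
    rw [Function.update_self] at h5
    have hc₃ := P₃.marks.count i
    rw [Function.update_self] at hc₃
    have hseg : (List.range' (c i + 1) (t + 1)).map (fun j => χ.symm (L.obj i j)) =
        (List.range' (c i + 1) t).map (fun j => χ.symm (L.obj i j)) ++
          [μ₀.symm (L.obj i (c i + t + 1))] := by
      rw [List.range'_1_concat, List.map_append, List.map_singleton,
        show c i + 1 + t = c i + t + 1 by omega, hχ _ (by omega) hlt]
    refine ⟨⟨t + 1, χ₃, insert (μ₀.symm (L.obj i (c i + t + 1)), b) τ', d₃, by omega, ?_, ?_⟩, ?_⟩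
    · rw [hseg]
      exact h2.append (.cons h5 (.nil _))
    · rw [hseg, ← List.append_assoc]
      exact P₃
    · rw [hc, hc₃]
      obtain ⟨x, hx⟩ : ∃ x, L.len i - (c i + t) = x + 1 := ⟨L.len i - (c i + t) - 1, by omega⟩
      rw [hx, show L.len i - (c i + t + 1) = x by omega,
        show (x + 1) * (3000 * K) = x * (3000 * K) + 3000 * K by ring]
      simp only [cost_get, cost_v]
      omega
  · rintro s' ⟨t, χ'', τ', d', h1, h2, P'⟩ f hlt
    have hI' := (f.var xI).trans hI
    have hc := P'.marks.count i
    rw [Function.update_self] at hc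
    simp only [eval_get, eval_v, hI', hc, P'.tables.len] at hlt
    obtain rfl : t = L.len i - c i := by omega
    rw [show c i + (L.len i - c i) = L.len i by omega] at P'
    refine ⟨χ'', τ', d', ?_, ?_⟩ <;>
      simp only [Phase1State.phase2Dictators, List.flatMap_cons, List.flatMap_nil, List.append_nil]
    · exact h2
    · exact P'

/-- The second phase. -/
def phase2 : Prog := asg xI 0 ;; loop (v xI) (v xN) (phase2Branch ;; asg xI (v xI + 1))

/-- The branches are treated in the order of their first vertices, at a cost of `O(n log n)` for each
agent. -/
theorem phase2_spec (hrun : F.Phase1 L μ₀ σ χ τ) (PS : Phase1State L μ₀ σ χ τ c d L.center)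
    (H : Tables F μ₀ L s) (hM : Marks L c (State.destSet c d) s) (hR : Records σ τ s)
    (hW : 10 * (n * n) + 10 * n + 1000 ≤ W) :
    Wp W phase2 s (4000 * (n + 1) * ((n + 1) * (n.size + 1)))
      (fun s' => ∃ σ' μ, F.TwoPhaseRun L μ₀ σ' μ ∧ Records σ' (matchingPairs μ) s') := by
  have h4 := four_le L.center
  have hbr : ∀ s' σ χ' τ c d i, Phase2Mem L μ₀ χ s' σ χ' τ c d → s'.var xI = L.obj i 1 → _ → _ :=
    fun s' σ χ' τ c d i P h1 h2 => phase2Branch_spec (W := W) P h1 h2 hW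
  obtain ⟨K, hK⟩ : ∃ K, K = (n + 1) * (n.size + 1) := ⟨_, rfl⟩
  rw [← hK] at h4 hbr ⊢
  refine Wp.seq 10 (fun s' => s'.var xI = 0) (by nlinarith) (Wp.of_vc ?_) fun s1 f1 h1 => ?_
  · simp [vc]
  have H1 := H.frame f1
  refine Wp.count (N := n) (fun k s' => ∃ (order : List (Fin L.m)) (χ' : Fin n ≃ Fin n)
      (τ' : Set (Fin n × Fin n)) (c' : Fin L.m → ℕ) (d' : Fin L.m → ℕ → ℕ), order.Nodup ∧
      (∀ i, i ∈ order ↔ (L.obj i 1 : ℕ) < k) ∧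
      F.SerialFrom χ τ (Phase1State.phase2Dictators L χ c order) τ' ∧
      Phase2Mem L μ₀ χ s' (σ ++ Phase1State.phase2Dictators L χ c order) χ' τ' c' d' ∧
      ∀ i, k ≤ (L.obj i 1 : ℕ) → c' i = c i)
    (fun k => s.arr aLEN k * (3000 * K) + 60) ?_ (by omega) (by omega) ?_ ?_ ?_ ?_
  · rw [h1]
    refine ⟨[], χ, τ, c, d, List.nodup_nil, by simp, .nil _, ⟨PS.phase2, H1,
      hM.congr (f1.arr _) (f1.arr _), ?_, ?_, ?_⟩, fun _ _ => rfl⟩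
    · rw [Phase1State.phase2Dictators, List.flatMap_nil, List.append_nil]
      exact hR.frame f1
    · rw [Phase1State.phase2Dictators, List.flatMap_nil, List.append_nil]
      exact PS.nodup
    · rw [Phase1State.phase2Dictators, List.flatMap_nil, List.append_nil]
      exact fun a => (PS.mem a).1
  · rintro k s' _ ⟨order, χ', τ', c', d', -, -, -, P, -⟩ f
    simp [P.tables.size]
  · rintro k s2 hk hI ⟨order, χ', τ', c', d', h2, h3, h5, P, h6⟩ f2
    have eL2 := (f2.arr aLEN).trans (f1.arr aLEN)
    refine Wp.seq (s.arr aLEN k * (3000 * K) + 40) (fun s' => ∃ (order : List (Fin L.m))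
        (χ' : Fin n ≃ Fin n) (τ' : Set (Fin n × Fin n)) (c' : Fin L.m → ℕ) (d' : Fin L.m → ℕ → ℕ),
        order.Nodup ∧ (∀ i, i ∈ order ↔ (L.obj i 1 : ℕ) < k + 1) ∧
        F.SerialFrom χ τ (Phase1State.phase2Dictators L χ c order) τ' ∧
        Phase2Mem L μ₀ χ s' (σ ++ Phase1State.phase2Dictators L χ c order) χ' τ' c' d' ∧
        ∀ i, k + 1 ≤ (L.obj i 1 : ℕ) → c' i = c i) (by omega) ?_ fun s3 f3 h => ?_
    swap
    · have hI3 := (f3.var xI).trans hI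
      refine Wp.of_vc ?_
      simp only [vc, fits_add, fits_v, fits_one, eval_add, eval_v, eval_one, hI3, cost_add, cost_v,
        cost_one, setVar_var, if_true, and_true]
      obtain ⟨order, χ', τ', c', d', h2, h3, h5, ⟨q1, q2, q3, q4, q5, q6⟩, h6⟩ := h
      exact ⟨by omega, by omega, order, χ', τ', c', d', h2, h3, h5,
        ⟨q1, q2.congr rfl rfl rfl rfl rfl rfl rfl rfl, q3.congr rfl rfl, q4.congr rfl rfl rfl, q5,
          q6⟩, h6⟩
    rcases Nat.eq_zero_or_pos (s.arr aLEN k) with hz | hz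
    · have hno : ∀ i, (L.obj i 1 : ℕ) ≠ k := by
        rintro i rfl
        have := L.len_pos i
        rw [H.len] at hz
        omega
      refine Wp.loop (fun s' => s' = s2) (fun _ => 0) rfl ?_ (by simp) ?_ ?_
      · simp [hz]
      · rintro s' rfl _ hlt
        simp only [eval_get, eval_v, hI, eL2, hz] at hlt
        omega
      · rintro s' rfl _ _
        exact ⟨order, χ', τ', c', d', h2, fun i => by rw [h3]; have := hno i; omega, h5, P,
          fun i hi => h6 i (by omega)⟩
    · obtain ⟨i, rfl⟩ := H.len_zero k hk hz
      rw [H.len]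
      have hci := h6 i le_rfl
      refine (hbr s2 _ _ _ _ _ i P hI ?_).weaken (by omega) ?_
      · rw [hci]; exact PS.agree i
      · rintro s3 f3 ⟨χ'', τ'', d'', k1, k2⟩
        have e1 : Phase1State.phase2Dictators L χ c' [i] =
            Phase1State.phase2Dictators L χ c [i] := by
          simp only [Phase1State.phase2Dictators, List.flatMap_cons, List.flatMap_nil, hci]
        have e2 : Phase1State.phase2Dictators L χ c order ++ Phase1State.phase2Dictators L χ c [i] =
            Phase1State.phase2Dictators L χ c (order ++ [i]) := by
          simp only [Phase1State.phase2Dictators, List.flatMap_append]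
        rw [e1] at k1 k2
        rw [List.append_assoc, e2] at k2
        refine ⟨order ++ [i], χ'', τ'', _, d'', ?_, fun i' => ?_, e2 ▸ h5.append k1, k2,
          fun i' hi' => ?_⟩
        · rw [List.nodup_append]
          refine ⟨h2, List.nodup_singleton _, ?_⟩
          rintro x hx x' hx' rfl
          rw [List.mem_singleton] at hx'
          subst hx'
          exact absurd ((h3 x).1 hx) (lt_irrefl _)
        · rw [List.mem_append, h3, List.mem_singleton]
          constructor
          · rintro (h | rfl) <;> omega
          · intro h
            rcases Nat.lt_or_ge (L.obj i' 1 : ℕ) (L.obj i 1) with h7 | h7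
            · exact Or.inl h7
            · exact Or.inr (L.obj_inj i' 1 i 1 le_rfl (L.len_pos _) le_rfl (L.len_pos _)
                (Fin.ext (by omega))).1
        · rw [Function.update_of_ne, h6 i' (by omega)]
          rintro rfl
          omega
  · have hs := H.sum_len_le
    have e : ∑ k ∈ Finset.range n, (s.arr aLEN k * (3000 * K) + 60 + 3 + 4) =
        (∑ k ∈ Finset.range n, s.arr aLEN k) * (3000 * K) + n * 67 := by
      rw [Finset.sum_mul, ← smul_eq_mul n, ← Finset.card_range n, ← Finset.sum_const,
        Finset.card_range, ← Finset.sum_add_distrib]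
    have hcost : (v xN).cost = 3 := rfl
    rw [hcost, e]
    have h1 := Nat.mul_le_mul_right (3000 * K) hs
    have h2 : n * (3000 * K) + n * 67 + (3 + 4) + 10 ≤ 4000 * (n + 1) * K := by nlinarith
    have h3 := (Nat.add_le_add_right (Nat.add_le_add_right (Nat.add_le_add_right h1 (n * 67)) (3 + 4)) 10).trans h2
    exact Nat.le_sub_of_add_le h3
  · rintro s' ⟨order, χ', τ', c', d', h2, h3, h5, P, -⟩ _ _
    have hperm : order.Perm (List.finRange L.m) :=
      (List.perm_ext_iff_of_nodup h2 (List.nodup_finRange _)).2 fun i => by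
        rw [h3]; simp
    obtain ⟨μ, rfl⟩ := h5.exists_matching PS.nonempty fun a => by
      have := (PS.dictators_perm hperm).2 a
      rwa [List.mem_append, PS.mem] at this
    exact ⟨_, μ, twoPhaseRun_iff.2 ⟨σ, χ, τ, c, d, order, hrun, PS, hperm, h5, rfl⟩, P.records⟩

end

section

variable {n : ℕ} {F : OAF (Fin n) (Fin n)} {μ₀ : Fin n ≃ Fin n} {s : Mem} {W : ℕ}

/-! ### Ranks, holders and the center -/

/-- The number of objects that agent `a` prefers to `b`. -/
noncomputable def rankOf (F : OAF (Fin n) (Fin n)) (a b : Fin n) : ℕ := {b' | F.pref a b' b}.ncard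

theorem rankOf_lt_of_pref {a b b' : Fin n} (h : F.pref a b b') : rankOf F a b < rankOf F a b' := by
  have := F.strict a
  refine Set.ncard_lt_ncard ⟨fun x hx => _root_.trans hx h, fun hsub => ?_⟩ (Set.toFinite _)
  exact irrefl_of (F.pref a) b (hsub h)

theorem pref_iff_rankOf_lt {a b b' : Fin n} : F.pref a b b' ↔ rankOf F a b < rankOf F a b' := by
  have := F.strict a
  refine ⟨rankOf_lt_of_pref, fun h => ?_⟩
  rcases trichotomous_of (F.pref a) b b' with h1 | rfl | h1
  · exact h1
  · exact absurd h (lt_irrefl _)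
  · exact absurd (rankOf_lt_of_pref h1) h.not_gt

theorem rankOf_lt (F : OAF (Fin n) (Fin n)) (a b : Fin n) : rankOf F a b < n := by
  have := F.strict a
  have h : rankOf F a b < (Set.univ : Set (Fin n)).ncard :=
    Set.ncard_lt_ncard ⟨Set.subset_univ _, fun h => irrefl_of (F.pref a) b (h (Set.mem_univ b))⟩
      (Set.toFinite _)
  simpa using h

theorem exists_rankOf_eq (F : OAF (Fin n) (Fin n)) (a : Fin n) {k : ℕ} (hk : k < n) :
    ∃ b, rankOf F a b = k := by
  have := F.strict a
  have hinj : Function.Injective fun b => (⟨rankOf F a b, rankOf_lt F a b⟩ : Fin n) := by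
    intro b b' h
    have h : rankOf F a b = rankOf F a b' := congrArg Fin.val h
    rcases trichotomous_of (F.pref a) b b' with h1 | h1 | h1
    · exact absurd h (rankOf_lt_of_pref h1).ne
    · exact h1
    · exact absurd h (rankOf_lt_of_pref h1).ne'
  obtain ⟨b, hb⟩ := (Finite.injective_iff_surjective.1 hinj) ⟨k, hk⟩
  exact ⟨b, congrArg Fin.val hb⟩

theorem cell_div (a : ℕ) {k : ℕ} (hk : k < n) : (a * n + k) / n = a := by
  rw [Nat.mul_comm, Nat.mul_add_div (by omega), Nat.div_eq_of_lt hk, Nat.add_zero]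

theorem cell_inj {a b a' b' : ℕ} (hb : b < n) (hb' : b' < n) (h : a * n + b = a' * n + b') :
    a = a' ∧ b = b' := by
  have e := congrArg (· / n) h
  simp only [cell_div _ hb, cell_div _ hb'] at e
  subst e
  exact ⟨rfl, by omega⟩

theorem exists_cell {k : ℕ} (hk : k < n * n) : ∃ (a b : Fin n), k = a * n + b :=
  ⟨⟨k / n, Nat.div_lt_of_lt_mul hk⟩, ⟨k % n, Nat.mod_lt _ (by by_contra h; simp_all)⟩,
    (Nat.div_add_mod' k n).symm⟩

theorem cell_lt (a b : Fin n) : (a : ℕ) * n + b < n * n := by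
  have := base_le a
  omega

/-- Inverts the preference lists. -/
def rankTable : Prog :=
  asg xT 0 ;; loop (v xT) (v xN * v xN)
    -- cell `a * n + k` holds the object of rank `k`; subtracting `xU = a * n` from its address yields `k`
    (asg xU (v xT / v xN * v xN) ;; sto aRANK (v xU + get 0 (v xT)) (v xT - v xU) ;;
      asg xT (v xT + 1))

theorem rankTable_spec (hN : s.var xN = n)
    (hp : ∀ a b : Fin n, s.arr 0 (a * n + rankOf F a b) = b) (hW : 10 * (n * n) + 1000 ≤ W) :
    Wp W rankTable s (60 * (n * n) + 60)
      (fun s' => ∀ a b : Fin n, s'.arr aRANK (a * n + b) = rankOf F a b) := by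
  refine Wp.seq 10 (fun s' => s'.var xT = 0) (by omega) (Wp.of_vc ?_) fun s1 f1 h1 => ?_
  · simp [vc]
  refine Wp.count (N := n * n) (fun k s' => ∀ a b : Fin n, a * n + rankOf F a b < k →
    s'.arr aRANK (a * n + b) = rankOf F a b) (fun _ => 40) ?_ (by omega) (by omega) ?_ ?_ ?_ ?_
  · intro a b h; omega
  · intro k s' _ _ f
    simp [f.var xN, f1.var xN, hN]; omega
  · intro k s' hk hx h f
    obtain ⟨a, c, hac⟩ := exists_cell hk
    obtain ⟨b, hb⟩ := exists_rankOf_eq F a c.2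
    have hq := hp a b
    rw [hb, ← hac] at hq
    have eN : s'.var xN = n := by rw [f.var xN, f1.var xN, hN]
    have hdiv : k / n = a := by rw [hac, cell_div _ c.2]
    have ha := base_le a
    have hb2 := b.2
    have hc2 := c.2
    have hb1 : k - a * n = rankOf F a b := by omega
    refine Wp.of_vc ?_
    simp [vc, hx, eN, f.arr 0, f1.arr 0, hq, hdiv, hb1]
    refine ⟨by omega, by omega, by omega, by omega, fun a' b' hlt => ?_⟩
    rw [Function.update_apply]
    split_ifs with h2
    · obtain ⟨h3, h4⟩ := cell_inj b'.2 b.2 h2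
      rw [Fin.ext h3, Fin.ext h4]
    · refine h a' b' ?_
      rcases Nat.lt_or_ge (a' * n + rankOf F a' b') k with h3 | h3
      · exact h3
      · exfalso
        obtain ⟨h4, h5⟩ := cell_inj (rankOf_lt F a' b') c.2 
          (show (a' : ℕ) * n + rankOf F a' b' = a * n + c by omega)
        have h4 := Fin.ext h4
        subst h4
        rw [← hb] at h5
        rcases eq_or_ne b' b with rfl | hne
        · exact h2 rfl
        · have := F.strict a'
          rcases trichotomous_of (F.pref a') b' b with h6 | h6 | h6
          · exact absurd h5 (rankOf_lt_of_pref h6).ne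
          · exact hne h6
          · exact absurd h5 (rankOf_lt_of_pref h6).ne'
  · simp; omega
  · intro s' h _ _ a b
    have := base_le a
    have := rankOf_lt F a b
    exact h a b (by omega)

/-- Inverts the initial matching. -/
def holdTable : Prog :=
  asg xT 0 ;; loop (v xT) (v xN) (sto aHOLD (get 2 (v xT)) (v xT) ;; asg xT (v xT + 1))

theorem holdTable_spec (hN : s.var xN = n) (hμ : ∀ a : Fin n, s.arr 2 a = μ₀ a)
    (hW : n + 1000 ≤ W) :
    Wp W holdTable s (60 * n + 60) (fun s' => ∀ b : Fin n, s'.arr aHOLD b = μ₀.symm b) := by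
  refine Wp.seq 10 (fun s' => s'.var xT = 0) (by omega) (Wp.of_vc ?_) fun s1 f1 h1 => ?_
  · simp [vc]
  refine Wp.count (N := n) (fun k s' => ∀ a : Fin n, a < k → s'.arr aHOLD (μ₀ a) = a)
    (fun _ => 40) ?_ (by omega) (by omega) ?_ ?_ ?_ ?_
  · intro a h; omega
  · intro k s' _ _ f
    simp [f.var xN, f1.var xN, hN]
  · intro k s' hk hx h f
    have hq := hμ ⟨k, hk⟩
    simp only at hq
    refine Wp.of_vc ?_
    simp [vc, hx, f.arr 2, f1.arr 2, hq]
    refine ⟨by omega, fun a ha => ?_⟩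
    rw [Function.update_apply]
    split_ifs with h2
    · have := μ₀.injective (Fin.ext h2)
      rw [this]
    · refine h a ?_
      rcases Nat.lt_or_ge a k with h3 | h3
      · exact h3
      · exact absurd (congrArg (fun x => (μ₀ x : ℕ)) (Fin.ext (by simp; omega) : a = ⟨k, hk⟩)) h2
  · simp; omega
  · intro s' h _ _ b
    simpa using h (μ₀.symm b) (μ₀.symm b).2

/-- Computes the degrees of the vertices in array `13`. -/
def degrees : Prog :=
  asg xT 0 ;; loop (v xT) (v xN * v xN)
    (sto 13 (v xT / v xN) (get 13 (v xT / v xN) + get 1 (v xT)) ;; asg xT (v xT + 1))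

open Classical in
theorem degrees_spec {G : SimpleGraph (Fin n)} (hN : s.var xN = n)
    (hadj : ∀ b b' : Fin n, s.arr 1 (b * n + b') = if G.Adj b b' then 1 else 0)
    (h0 : ∀ p, s.arr 13 p = 0) (hW : 10 * (n * n) + 1000 ≤ W) :
    Wp W degrees s (60 * (n * n) + 60)
      (fun s' => ∀ b : Fin n, ((s'.arr 13 b : ℕ) : ℕ∞) = (G.neighborSet b).encard) := by
  refine Wp.seq 10 (fun s' => s'.var xT = 0) (by omega) (Wp.of_vc ?_) fun s1 f1 h1 => ?_
  · simp [vc]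
  refine Wp.count (N := n * n) (fun k s' => ∀ b : Fin n, s'.arr 13 b =
    (Finset.univ.filter fun w : Fin n => G.Adj b w ∧ b * n + w < k).card)
    (fun _ => 40) ?_ (by omega) (by omega) ?_ ?_ ?_ ?_
  · intro b
    rw [f1.arr' 13 (by simp [Prog.wa]), h0, h1]
    simp
  · intro k s' _ _ f
    simp [f.var xN, f1.var xN, hN]; omega
  · intro k s' hk hx h f
    obtain ⟨a, c, hac⟩ := exists_cell hk
    have eN : s'.var xN = n := by rw [f.var xN, f1.var xN, hN]
    have hdiv : k / n = a := by rw [hac, cell_div _ c.2]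
    have ha2 := a.2
    have hnn := Nat.le_mul_self n
    have hq : s'.arr 1 k = if G.Adj a c then 1 else 0 := by
      rw [f.arr 1, f1.arr 1, hac, hadj]
    have hle : s'.arr 13 a ≤ n := by
      rw [h]
      exact (Finset.card_le_univ _).trans (by simp)
    have hle' : s'.arr 1 k ≤ 1 := by rw [hq]; split_ifs <;> omega
    refine Wp.of_vc ?_
    simp [vc, hx, eN, hdiv]
    refine ⟨by omega, by omega, by omega, fun b => ?_⟩
    rw [Function.update_apply]
    split_ifs with h2
    · have h2 := Fin.ext h2
      subst h2
      rw [h, hq]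
      by_cases hA : G.Adj b c
      · rw [if_pos hA, ← Finset.card_insert_of_notMem (a := c) (by simp [hac])]
        congr 1
        ext w
        simp only [Finset.mem_insert, Finset.mem_filter, Finset.mem_univ, true_and]
        constructor
        · rintro (rfl | ⟨h3, h4⟩)
          · exact ⟨hA, by omega⟩
          · exact ⟨h3, by omega⟩
        · rintro ⟨h3, h4⟩
          rcases eq_or_ne w c with h5 | h5
          · exact Or.inl h5
          · have : (w : ℕ) ≠ c := fun h => h5 (Fin.ext h)
            exact Or.inr ⟨h3, by omega⟩
      · rw [if_neg hA, Nat.add_zero]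
        congr 1
        ext w
        simp only [Finset.mem_filter, Finset.mem_univ, true_and]
        refine and_congr_right fun h3 => ?_
        have : (w : ℕ) ≠ c := fun h => hA (Fin.ext h ▸ h3)
        omega
    · rw [h]
      congr 1
      ext w
      simp only [Finset.mem_filter, Finset.mem_univ, true_and]
      refine and_congr_right fun h3 => ?_
      have : (b : ℕ) * n + w ≠ k := fun h => h2 (cell_inj w.2 c.2 (h.trans hac)).1
      omega
  · simp; omega
  · intro s' h _ _ b
    rw [h, ← Set.encard_coe_eq_coe_finsetCard]
    congr 1
    ext w
    simp [cell_lt]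

/-- Finds a vertex such that all other vertices have degree at most two. -/
def findCenter : Prog :=
  degrees ;; asg xT 0 ;; loop (v xT) (v xN)
    (ite 2 (get 13 (v xT)) (asg xC (v xT)) skip ;; asg xT (v xT + 1))

open Classical in
/-- If no vertex has degree greater than two, vertex `0` serves as the center. -/
theorem findCenter_spec {G : SimpleGraph (Fin n)} (hG : IsGeneralizedStar G) (hN : s.var xN = n)
    (hadj : ∀ b b' : Fin n, s.arr 1 (b * n + b') = if G.Adj b b' then 1 else 0)
    (h0 : ∀ p, s.arr 13 p = 0) (hC : s.var xC = 0) (hW : 10 * (n * n) + 1000 ≤ W) :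
    Wp W findCenter s (150 * (n * n) + 150)
      (fun s' => ∃ L : StarLabelling G, s'.var xC = L.center) := by
  have hnn := Nat.le_mul_self n
  refine Wp.seq _ _ (by omega) (degrees_spec hN hadj h0 hW) fun s1 f1 h1 => ?_
  refine Wp.seq 10 (fun s' => s'.var xT = 0) (by omega) (Wp.of_vc ?_) fun s2 f2 h2 => ?_
  · simp [vc]
  obtain ⟨v₀⟩ := hG.1.1.nonempty
  refine Wp.count (N := n) (fun k s' => ∃ c : Fin n, s'.var xC = c ∧
    ∀ b : Fin n, b < k → 2 < s1.arr 13 b → b = c) (fun _ => 40) ?_ (by omega) (by omega) ?_ ?_ ?_ ?_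
  · refine ⟨⟨0, v₀.pos⟩, ?_, fun b hb => by omega⟩
    rw [f2.var xC, f1.var xC, hC]
  · intro k s' _ _ f
    simp [f.var xN, f2.var xN, f1.var xN, hN]
  · rintro k s' hk hx ⟨c, hc, h⟩ f
    have e : s'.arr 13 = s1.arr 13 := by rw [f.arr 13, f2.arr 13]
    refine Wp.of_vc ?_
    simp [vc, hx, e]
    refine ⟨by omega, fun h3 => ⟨by omega, ⟨k, hk⟩, rfl, fun b hb hd => ?_⟩,
      fun h3 => ⟨by omega, c, hc, fun b hb hd => h b ?_ hd⟩⟩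
    · refine hG.2 (x := b) ?_ (y := ⟨k, hk⟩) ?_
      · rw [Set.mem_ofPred_eq, ← h1]; exact_mod_cast hd
      · rw [Set.mem_ofPred_eq, ← h1]; exact_mod_cast h3
    · rcases eq_or_ne (b : ℕ) k with h4 | h4
      · rw [h4] at hd; omega
      · omega
  · simp; omega
  · rintro s' ⟨c, hc, h⟩ _ _
    obtain ⟨L, hL⟩ := IsGeneralizedStar.exists_starLabelling hG.1 (c := c) fun b hb => by
      rw [← h1]
      exact_mod_cast not_lt.1 fun h' => hb (h b b.2 h')
    exact ⟨L, by rw [hL, hc]⟩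

end

section

variable {n : ℕ} {G : SimpleGraph (Fin n)} {L : StarLabelling G} {s : Mem} {W : ℕ}

/-! ### Following the branches -/

theorem adj_center_iff (L : StarLabelling G) (w : Fin n) :
    G.Adj L.center w ↔ ∃ i, w = L.obj i 1 := by
  rw [L.adj_iff]
  constructor
  · rintro ⟨i, j, h1, ⟨h2, rfl⟩ | ⟨-, h2⟩⟩
    · rcases Nat.eq_zero_or_pos j with rfl | h
      · exact ⟨i, rfl⟩
      · exact absurd h2.symm (L.obj_ne i j h h1.le)
    · exact absurd h2.symm (L.obj_ne i (j + 1) (by omega) h1)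
  · rintro ⟨i, rfl⟩
    exact ⟨i, 0, L.len_pos i, Or.inl ⟨(L.obj_zero i).symm, rfl⟩⟩

/-- From slot `j + 1` of a branch, the only way that does not lead back to slot `j` is to slot `j + 2`. -/
theorem adj_outward_iff (L : StarLabelling G) (i : Fin L.m) {j : ℕ} (hj : j + 1 ≤ L.len i)
    (w : Fin n) : G.Adj (L.obj i (j + 1)) w ∧ w ≠ L.obj i j ↔
      j + 2 ≤ L.len i ∧ w = L.obj i (j + 2) := by
  rw [L.adj_iff]
  constructor
  · rintro ⟨⟨i', j', h1, ⟨h2, rfl⟩ | ⟨rfl, h2⟩⟩, h3⟩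
    · rcases Nat.eq_zero_or_pos j' with rfl | h
      · rw [L.obj_zero] at h2
        exact absurd h2 (L.obj_ne i _ (by omega) hj)
      · obtain ⟨rfl, rfl⟩ := L.obj_inj i _ i' j' (by omega) hj h h1.le h2
        exact ⟨h1, rfl⟩
    · obtain ⟨rfl, h4⟩ := L.obj_inj i _ i' _ (by omega) hj (by omega) h1 h2
      obtain rfl : j = j' := by omega
      exact absurd rfl h3
  · rintro ⟨h1, rfl⟩
    refine ⟨⟨i, j + 1, h1, Or.inl ⟨rfl, rfl⟩⟩, fun h => ?_⟩
    have := L.obj_injOn i h1 (by omega : j ≤ L.len i) h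
    omega

/-- Finds a neighbour of vertex `xU` other than `xS`; the result is in `xV`, which is `n` if there
is none. -/
def nextVertex : Prog :=
  (asg xV (v xN) ;; asg xT 0) ;; loop (v xT) (v xN)
    (ite 0 (get 1 (v xU * v xN + v xT))
      (ite (v xT) (v xS) (asg xV (v xT)) (ite (v xS) (v xT) (asg xV (v xT)) skip)) skip ;;
      asg xT (v xT + 1))

open Classical in
theorem nextVertex_spec (hN : s.var xN = n)
    (hadj : ∀ b b' : Fin n, s.arr 1 (b * n + b') = if G.Adj b b' then 1 else 0)
    {u p : Fin n} (hu : s.var xU = u) (hp : s.var xS = p) (hW : 10 * (n * n) + 1000 ≤ W) :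
    Wp W nextVertex s (80 * n + 60) (fun s' => (∃ w, (G.Adj u w ∧ w ≠ p) ∧ s'.var xV = w) ∨
      (s'.var xV = n ∧ ∀ w, ¬ (G.Adj u w ∧ w ≠ p))) := by
  have hbase := base_le u
  refine Wp.seq 20 (fun s' => s'.var xT = 0 ∧ s'.var xV = n) (by omega) (Wp.of_vc ?_)
    fun s1 f1 ⟨h1, h2⟩ => ?_
  · simp [vc, hN]
  refine Wp.count (N := n) (fun k s' => (∃ w, (G.Adj u w ∧ w ≠ p) ∧ s'.var xV = w) ∨
      (s'.var xV = n ∧ ∀ w : Fin n, w < k → ¬ (G.Adj u w ∧ w ≠ p))) (fun _ => 60)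
    ?_ (by omega) (by omega) ?_ ?_ ?_ ?_
  · exact Or.inr ⟨h2, fun w hw => by omega⟩
  · intro k s' _ _ f
    simp [f.var xN, f1.var xN, hN]
  · intro k s' hk hx h f
    have eN : s'.var xN = n := by rw [f.var xN, f1.var xN, hN]
    have eU : s'.var xU = u := by rw [f.var xU, f1.var xU, hu]
    have eS : s'.var xS = p := by rw [f.var xS, f1.var xS, hp]
    have hq : s'.arr 1 (u * n + k) = if G.Adj u ⟨k, hk⟩ then 1 else 0 := by
      rw [f.arr 1, f1.arr 1, ← hadj]
    have hnew : G.Adj u ⟨k, hk⟩ → k ≠ p → ∃ w : Fin n, (G.Adj u w ∧ w ≠ p) ∧ k = w :=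
      fun h3 h4 => ⟨⟨k, hk⟩, ⟨h3, fun h5 => h4 (congrArg Fin.val h5)⟩, rfl⟩
    have hold : ¬ (G.Adj u ⟨k, hk⟩ ∧ k ≠ p) → (∃ w, (G.Adj u w ∧ w ≠ p) ∧ s'.var xV = w) ∨
        (s'.var xV = n ∧ ∀ w : Fin n, w < k + 1 → ¬ (G.Adj u w ∧ w ≠ p)) := by
      refine fun h3 => h.imp_right fun ⟨h4, h5⟩ => ⟨h4, fun w hw h6 => ?_⟩
      rcases Nat.lt_or_ge w k with h7 | h7
      · exact h5 w h7 h6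
      · obtain rfl : w = ⟨k, hk⟩ := Fin.ext (by simp; omega)
        exact h3 ⟨h6.1, fun h8 => h6.2 (Fin.ext h8)⟩
    refine Wp.of_vc ?_
    by_cases hA : G.Adj u ⟨k, hk⟩
    · rw [if_pos hA] at hq
      simp [vc, hx, eN, eU, eS, hq]
      refine ⟨by omega, fun h3 => ⟨by omega, Or.inl (hnew hA (by omega))⟩, fun h3 =>
        ⟨fun h4 => ⟨by omega, Or.inl (hnew hA (by omega))⟩, fun h4 => ⟨by omega, ?_⟩⟩⟩
      simpa [Nat.lt_succ_iff] using hold fun h5 => h5.2 (by omega)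
    · rw [if_neg hA] at hq
      simp [vc, hx, eN, eU, eS, hq]
      exact ⟨by omega, by omega, by simpa [Nat.lt_succ_iff] using hold fun h5 => hA h5.1⟩
  · simp; omega
  · rintro s' (h | ⟨h3, h4⟩) _ _
    · exact Or.inl h
    · exact Or.inr ⟨h3, fun w => h4 w w.2⟩

/-- Stores the branch that starts at the neighbour `xI` of the center. -/
def followBranch : Prog :=
  (asg xB (v xI * v xN) ;; sto aOBJ (v xB) (v xC) ;; sto aMARK (v xB) 1 ;; asg xS (v xC) ;;
    asg xU (v xI) ;; asg xL 0) ;;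
  loop (v xU) (v xN)
    ((asg xL (v xL + 1) ;; sto aOBJ (v xB + v xL) (v xU)) ;; nextVertex ;;
      (asg xS (v xU) ;; asg xU (v xV))) ;;
  sto aLEN (v xI) (v xL)

open Classical in
/-- Reading one row of the adjacency matrix for each vertex of the branch takes `O(ℓ n)` steps. -/
theorem followBranch_spec (hN : s.var xN = n) (hC : s.var xC = L.center)
    (hadj : ∀ b b' : Fin n, s.arr 1 (b * n + b') = if G.Adj b b' then 1 else 0)
    {i : Fin L.m} (hI : s.var xI = L.obj i 1) (hlen : L.len i < n)
    (hW : 10 * (n * n) + 1000 ≤ W) :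
    Wp W followBranch s (L.len i * (80 * n + 200) + 200) (fun s' =>
      s'.arr aLEN = Function.update (s.arr aLEN) (L.obj i 1) (L.len i) ∧
      s'.arr aMARK = Function.update (s.arr aMARK) (L.obj i 1 * n) 1 ∧
      (∀ j ≤ L.len i, s'.arr aOBJ (L.obj i 1 * n + j) = L.obj i j) ∧
      ∀ q, (∀ j ≤ L.len i, q ≠ L.obj i 1 * n + j) → s'.arr aOBJ q = s.arr aOBJ q) := by
  have hbase := base_le (L.obj i 1)
  obtain ⟨C, hCe⟩ : ∃ C, C = 80 * n + 200 := ⟨_, rfl⟩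
  rw [← hCe]
  refine Wp.seq 100 (fun s' => s'.var xB = L.obj i 1 * n ∧ s'.var xS = L.center ∧
      s'.var xU = L.obj i 1 ∧ s'.var xL = 0 ∧
      s'.arr aMARK = Function.update (s.arr aMARK) (L.obj i 1 * n) 1 ∧
      s'.arr aOBJ = Function.update (s.arr aOBJ) (L.obj i 1 * n) L.center) (by omega)
    (Wp.of_vc ?_) fun s1 f1 ⟨h1, h2, h3, h4, h5, h6⟩ => ?_
  · simp [vc, hN, hC, hI]; omega
  refine Wp.seq (L.len i * C + 10) (fun s' => s'.var xL = L.len i ∧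
      (∀ j ≤ L.len i, s'.arr aOBJ (L.obj i 1 * n + j) = L.obj i j) ∧
      ∀ q, (∀ j ≤ L.len i, q ≠ L.obj i 1 * n + j) → s'.arr aOBJ q = s.arr aOBJ q) (by omega)
    ?_ fun s2 f2 ⟨h7, h8⟩ => Wp.of_vc ?_
  swap
  · simp [vc, f2.var xI, f1.var xI, hI, h7, f2.arr aLEN, f1.arr aLEN, f2.arr aMARK, h5]
    exact h8
  refine Wp.loop (fun s' => s'.var xL ≤ L.len i ∧
      (s'.var xL < L.len i → s'.var xU = L.obj i (s'.var xL + 1) ∧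
        s'.var xS = L.obj i (s'.var xL)) ∧
      (s'.var xL = L.len i → s'.var xU = n) ∧
      (∀ j ≤ s'.var xL, s'.arr aOBJ (L.obj i 1 * n + j) = L.obj i j) ∧
      ∀ q, (∀ j ≤ L.len i, q ≠ L.obj i 1 * n + j) → s'.arr aOBJ q = s.arr aOBJ q)
    (fun s' => (L.len i - s'.var xL) * C) ?_ ?_ ?_ ?_ ?_
  · have := L.len_pos i
    rw [h4, h6]
    refine ⟨by omega, fun _ => ⟨h3, by rw [h2, L.obj_zero]⟩, by omega, fun j hj => ?_,
      fun q hq => Function.update_of_ne (hq 0 (Nat.zero_le _)) _ _⟩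
    obtain rfl : j = 0 := by omega
    simp [L.obj_zero]
  · simp [h4]
  · simp
  · rintro s2 ⟨i1, i2, i3, i4, i5⟩ f2 hlt
    have eN : s2.var xN = n := by rw [f2.var xN, f1.var xN, hN]
    simp only [eval_v, eN] at hlt
    obtain ⟨j, hj⟩ : ∃ j, s2.var xL = j := ⟨_, rfl⟩
    rw [hj] at i1 i2 i3 i4
    have hjl : j < L.len i := by
      rcases Nat.lt_or_ge j (L.len i) with h | h
      · exact h
      · have := i3 (by omega); omega
    obtain ⟨i6, i7⟩ := i2 hjl
    have eB : s2.var xB = L.obj i 1 * n := by rw [f2.var xB, h1]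
    refine ⟨80 * n + 150, ?_⟩
    refine Wp.seq 40 (fun s3 => s3.var xL = j + 1 ∧
      s3.arr aOBJ = Function.update (s2.arr aOBJ) (L.obj i 1 * n + (j + 1)) (L.obj i (j + 1)))
      (by omega) (Wp.of_vc ?_) fun s3 f3 ⟨h7, h8⟩ => ?_
    · simp [vc, hj, eB, i6]; omega
    have eU : s3.var xU = L.obj i (j + 1) := by rw [f3.var xU, i6]
    refine Wp.seq _ _ (by omega) (nextVertex_spec (G := G) (u := L.obj i (j + 1)) (p := L.obj i j)
      (by rw [f3.var xN, eN]) (by rw [f3.arr 1, f2.arr 1, f1.arr 1]; exact hadj)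
      eU (by rw [f3.var xS, i7]) hW)
      fun s4 f4 h9 => Wp.of_vc ?_
    simp only [adj_outward_iff L i hjl] at h9
    have eV : (j + 1 < L.len i → s4.var xV = L.obj i (j + 1 + 1)) ∧
        (j + 1 = L.len i → s4.var xV = n) := by
      rcases h9 with ⟨w, ⟨h9, rfl⟩, h10⟩ | ⟨h9, h10⟩
      · exact ⟨fun _ => h10, fun h => by omega⟩
      · exact ⟨fun h => absurd ⟨h, rfl⟩ (h10 (L.obj i (j + 2))), fun _ => h9⟩
    have eL4 : s4.var xL = j + 1 := by rw [f4.var xL, h7]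
    have eU4 : s4.var xU = L.obj i (j + 1) := by rw [f4.var xU, eU]
    simp [vc, eL4, eU4, f4.arr aOBJ, h8, hj]
    refine ⟨⟨hjl, eV.1, eV.2, fun j' hj' => ?_, fun q hq => ?_⟩, ?_⟩
    · rw [Function.update_apply]
      split_ifs with h11
      · rw [show j' = j + 1 by omega]
      · exact i4 j' (by omega)
    · rw [Function.update_of_ne (hq (j + 1) hjl)]
      exact i5 q hq
    · obtain ⟨r, hr⟩ : ∃ r, L.len i - j = r + 1 := ⟨L.len i - j - 1, by omega⟩
      rw [hr, show L.len i - (j + 1) = r by omega, Nat.add_mul, Nat.one_mul, hCe]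
      omega
  · rintro s2 ⟨i1, i2, i3, i4, i5⟩ f2 hlt
    have eN : s2.var xN = n := by rw [f2.var xN, f1.var xN, hN]
    simp only [eval_v, eN] at hlt
    have h : s2.var xL = L.len i := by
      rcases Nat.lt_or_ge (s2.var xL) (L.len i) with h | h
      · have := (i2 h).1
        have := (L.obj i (s2.var xL + 1)).2
        omega
      · omega
    rw [h] at i4
    exact ⟨h, i4, i5⟩

/-- Stores all branches. -/
def branches : Prog :=
  asg xI 0 ;; loop (v xI) (v xN)
    (ite 0 (get 1 (v xC * v xN + v xI)) followBranch skip ;; asg xI (v xI + 1))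

end

section

variable {n : ℕ} {F : OAF (Fin n) (Fin n)} {L : StarLabelling F.graph} {s : Mem} {W : ℕ}

open Classical in
theorem branches_spec (hN : s.var xN = n) (hC : s.var xC = L.center)
    (hadj : ∀ b b' : Fin n, s.arr 1 (b * n + b') = if F.graph.Adj b b' then 1 else 0)
    (hlen : ∀ p, s.arr aLEN p = 0) (hmark : ∀ p, s.arr aMARK p = 0) (hcnt : ∀ p, s.arr aCNT p = 0)
    (hW : 10 * (n * n) + 1000 ≤ W) :
    Wp W branches s (500 * (n * n) + 500 * n + 500) (fun s' =>
      (∀ i, s'.arr aLEN (L.obj i 1) = L.len i) ∧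
      (∀ v, 0 < s'.arr aLEN v → ∃ i, v = L.obj i 1) ∧
      (∀ i j, j ≤ L.len i → s'.arr aOBJ (L.obj i 1 * n + j) = L.obj i j) ∧
      Marks L (fun _ => 0) (fun _ => {0}) s') := by
  have hbase := base_le L.center
  obtain ⟨ℓ, hℓ⟩ : ∃ ℓ : ℕ → ℕ, (∀ i, ℓ (L.obj i 1) = L.len i) ∧
      ∀ v < n, 0 < ℓ v → ∃ i, v = L.obj i 1 := by
    refine ⟨fun v => if h : ∃ i, v = L.obj i 1 then L.len h.choose else 0, fun i => ?_,
      fun v _ hv => ?_⟩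
    · have h : ∃ i', (L.obj i 1 : ℕ) = L.obj i' 1 := ⟨i, rfl⟩
      beta_reduce
      rw [dif_pos h]
      exact congrArg L.len (L.obj_inj _ 1 _ 1 le_rfl (L.len_pos _) le_rfl (L.len_pos _)
        (Fin.ext h.choose_spec.symm)).1
    · by_contra h
      simp [h] at hv
  have hsum := sum_len_le L hℓ.1 hℓ.2
  refine Wp.seq 10 (fun s' => s'.var xI = 0) (by omega) (Wp.of_vc ?_) fun s1 f1 h1 => ?_
  · simp [vc]
  refine Wp.count (N := n) (fun k s' =>
      (∀ i, (L.obj i 1 : ℕ) < k → s'.arr aLEN (L.obj i 1) = L.len i ∧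
        s'.arr aMARK (L.obj i 1 * n) = 1 ∧
        ∀ j ≤ L.len i, s'.arr aOBJ (L.obj i 1 * n + j) = L.obj i j) ∧
      (∀ v, 0 < s'.arr aLEN v → ∃ i, v = L.obj i 1) ∧
      ∀ q, s'.arr aMARK q = 0 ∨ s'.arr aMARK q = 1 ∧ ∃ i, q = L.obj i 1 * n)
    (fun k => ℓ k * (80 * n + 200) + 250) ?_ (by omega) (by omega) ?_ ?_ ?_ ?_
  · refine ⟨fun i hi => by omega, fun v hv => ?_, fun q => Or.inl ?_⟩
    · rw [f1.arr' aLEN (by simp [Prog.wa]), hlen] at hv; omega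
    · rw [f1.arr' aMARK (by simp [Prog.wa]), hmark]
  · intro k s' _ _ f
    simp [f.var xN, f1.var xN, hN]
  · rintro k s2 hk hx ⟨i1, i2, i3⟩ f2
    have eN : s2.var xN = n := by rw [f2.var xN, f1.var xN, hN]
    have eC : s2.var xC = L.center := by rw [f2.var xC, f1.var xC, hC]
    have e1 : s2.arr 1 = s.arr 1 := by rw [f2.arr 1, f1.arr 1]
    have hq : s2.arr 1 (L.center * n + k) = if F.graph.Adj L.center ⟨k, hk⟩ then 1 else 0 := by
      rw [e1, ← hadj]
    obtain ⟨X, hX⟩ : ∃ X, X = ℓ k * (80 * n + 200) := ⟨_, rfl⟩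
    rw [← hX]
    refine Wp.seq (X + 230) (fun s' =>
      (∀ i, (L.obj i 1 : ℕ) < k + 1 → s'.arr aLEN (L.obj i 1) = L.len i ∧
        s'.arr aMARK (L.obj i 1 * n) = 1 ∧
        ∀ j ≤ L.len i, s'.arr aOBJ (L.obj i 1 * n + j) = L.obj i j) ∧
      (∀ v, 0 < s'.arr aLEN v → ∃ i, v = L.obj i 1) ∧
      ∀ q, s'.arr aMARK q = 0 ∨ s'.arr aMARK q = 1 ∧ ∃ i, q = L.obj i 1 * n) (by omega)
      (Wp.ite (T₁ := X + 200) ?_ ?_ ?_ (fun hlt => ?_) fun hlt => ?_)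
      fun s3 f3 h3 => Wp.of_vc ?_
    · simp
    · simp [eN, eC, hx]; omega
    · simp
    · simp only [eval_zero, eval_get, eval_add, eval_mul, eval_v, eN, eC, hx, hq] at hlt
      have hA : F.graph.Adj L.center ⟨k, hk⟩ := by
        by_contra h; simp [h] at hlt
      obtain ⟨i, hi⟩ := (adj_center_iff L _).1 hA
      have hki : k = L.obj i 1 := congrArg Fin.val hi
      rw [hki, hℓ.1] at hX
      rw [hX]
      refine (followBranch_spec (L := L) eN eC (by rw [e1]; exact hadj) (hx.trans hki)
        (len_lt L i) hW).weaken le_rfl fun s3 f3 ⟨h1, h2, h3, h4⟩ => ⟨fun i' hi' => ?_, ?_, ?_⟩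
      · rcases eq_or_ne i' i with rfl | hne
        · exact ⟨by rw [h1, Function.update_self], by rw [h2, Function.update_self], h3⟩
        · have hne1 : (L.obj i' 1 : ℕ) ≠ L.obj i 1 := fun h =>
            hne (L.obj_inj _ 1 _ 1 le_rfl (L.len_pos _) le_rfl (L.len_pos _) (Fin.ext h)).1
          obtain ⟨h5, h6, h7⟩ := i1 i' (by omega)
          refine ⟨by rw [h1, Function.update_of_ne hne1, h5], ?_, fun j hj => ?_⟩
          · rw [h2, Function.update_apply]
            split_ifs
            · rfl
            · exact h6
          · rw [h4 _ fun j' hj' h => hne (slot_ne h hj hj').1, h7 j hj]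
      · intro v hv
        rw [h1, Function.update_apply] at hv
        split_ifs at hv with h
        · exact ⟨i, h⟩
        · exact i2 v hv
      · intro q
        rw [h2, Function.update_apply]
        split_ifs with h
        · exact Or.inr ⟨rfl, i, h⟩
        · exact i3 q
    · simp only [eval_zero, eval_get, eval_add, eval_mul, eval_v, eN, eC, hx, hq] at hlt
      refine Wp.of_vc ?_
      simp only [vc]
      refine ⟨by omega, fun i hi => i1 i ?_, i2, i3⟩
      rcases Nat.lt_or_ge (L.obj i 1 : ℕ) k with h | h
      · exact h
      · exfalso
        apply hlt
        rw [if_pos ((adj_center_iff L _).2 ⟨i, Fin.ext (by simp; omega)⟩)]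
        exact Nat.one_pos
    · have := f3.var xI
      simp [vc, this, hx]
      exact ⟨by omega, by simpa [Nat.lt_succ_iff] using h3⟩
  · have e : ∑ k ∈ Finset.range n, (ℓ k * (80 * n + 200) + 250 + 3 + 4) =
        (∑ k ∈ Finset.range n, ℓ k) * (80 * n + 200) + n * 257 := by
      rw [Finset.sum_mul, ← smul_eq_mul n, ← Finset.card_range n, ← Finset.sum_const,
        Finset.card_range, ← Finset.sum_add_distrib]
    have hcost : (v xN).cost = 3 := rfl
    rw [hcost, e]
    have h1 := Nat.mul_le_mul_right (80 * n + 200) hsum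
    have h2 : n * (80 * n + 200) + n * 257 + (3 + 4) + 10 ≤ 500 * (n * n) + 500 * n + 500 := by
      nlinarith
    omega
  · rintro s' ⟨i1, i2, i3⟩ _ f
    refine ⟨fun i => (i1 i (L.obj i 1).2).1, i2, fun i => (i1 i (L.obj i 1).2).2.2,
      fun i => ?_, fun i j hj => ?_⟩
    · rw [f.arr aCNT, f1.arr' aCNT (by simp [Prog.wa]), hcnt]
    · rcases Nat.eq_zero_or_pos j with rfl | h
      · simpa using (i1 i (L.obj i 1).2).2.1
      · rw [if_neg (by simp; omega)]
        rcases i3 (L.obj i 1 * n + j) with h3 | ⟨-, i', h3⟩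
        · exact h3
        · have := (slot_ne (j' := 0) h3 hj (Nat.zero_le _)).2
          omega

end

section

variable {n : ℕ} {F : OAF (Fin n) (Fin n)} {μ₀ : Fin n ≃ Fin n} {L : StarLabelling F.graph}
  {s s' : Mem} {W : ℕ}

/-! ### Tabulating how far each agent is willing to walk -/

/-- Walks inward from slot `xP` as long as agent `xA` prefers the next slot; the result is in
`xU`. -/
def innermost : Prog :=
  (asg xU (v xP) ;; asg xV 0) ;;
  loop (v xV) (v xU)
    (ite (rk (v xU - 1)) (rk (v xU)) (asg xU (v xU - 1)) (asg xV (v xU)))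

theorem innermost_spec {R : ℕ → ℕ}
    (hR : ∀ q, R q = s.arr aRANK (s.var xA * s.var xN + s.arr aOBJ (s.var xB + q)))
    (hle : ∀ q ≤ s.var xP, s.var xA * s.var xN + s.arr aOBJ (s.var xB + q) ≤ W)
    (hW : s.var xB + s.var xP + 5 ≤ W) :
    Wp W innermost s (100 * s.var xP + 60) (fun s' => s'.var xU ≤ s.var xP ∧
      ∀ r, s'.var xU ≤ r ↔ ∀ j, r ≤ j → j < s.var xP → R j < R (j + 1)) := by
  refine Wp.seq 40 (fun s' => s'.var xU = s.var xP ∧ s'.var xV = 0) (by omega)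
    (Wp.of_vc ?_) fun s1 f1 ⟨h1, h2⟩ => ?_
  · simp [vc]
  refine Wp.loop (fun s' => s'.var xV ≤ s'.var xU ∧ s'.var xU ≤ s.var xP ∧
      (∀ t, s'.var xU ≤ t → t < s.var xP → R t < R (t + 1)) ∧
      (0 < s'.var xV → s'.var xU = s'.var xV ∧ ¬ R (s'.var xV - 1) < R (s'.var xV)))
    (fun s' => 100 * (s'.var xU - s'.var xV)) ?_ ?_ ?_ ?_ ?_
  · exact ⟨by omega, h1.le, fun t h h' => by omega, fun h => by omega⟩
  · simp only [cost_v]; omega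
  · simp
  · intro s' ⟨i1, i2, i3, i4⟩ f hlt
    simp only [eval_v] at hlt
    refine ⟨100 - 7, Wp.of_vc ?_⟩
    have hr1 := hle (s'.var xU) i2
    have hr2 := hle (s'.var xU - 1) (by omega)
    have eB := (f.var xB).trans (f1.var xB)
    have eA := (f.var xA).trans (f1.var xA)
    have eN := (f.var xN).trans (f1.var xN)
    have eR := (f.arr aRANK).trans (f1.arr aRANK)
    have eO := (f.arr aOBJ).trans (f1.arr aOBJ)
    have hP : s.var xA * s.var xN ≤ W := by omega
    simp [vc, rk, eB, eA, eN, eR, eO, ← hR]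
    refine ⟨by omega, by omega, fun h => ⟨by omega, ⟨by omega, by omega, fun t ht ht' => ?_,
        fun h3 => absurd (i4 h3).1 (by omega)⟩, by omega⟩,
      fun h => ⟨⟨i2, i3, fun _ => h⟩, by omega⟩⟩
    rcases Nat.lt_or_ge t (s'.var xU) with h3 | h3
    · rw [show t = s'.var xU - 1 by omega, show s'.var xU - 1 + 1 = s'.var xU by omega]
      exact h
    · exact i3 t h3 ht'
  · intro s' ⟨i1, i2, i3, i4⟩ f hlt
    simp only [eval_v] at hlt
    refine ⟨i2, fun r => ⟨fun hr j hj hj' => i3 j (by omega) hj', fun h => ?_⟩⟩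
    by_contra hr
    have h5 := h (s'.var xU - 1) (by omega) (by omega)
    obtain ⟨h6, h7⟩ := i4 (by omega)
    rw [h6] at h5
    rw [show s'.var xV - 1 + 1 = s'.var xV by omega] at h5
    exact h7 h5

/-- Fills the entries of slot `xP`. -/
def slotEntries : Prog :=
  (asg xA (get aHOLD (get aOBJ (v xB + v xP))) ;; asg xS (v xP)) ;;
    innermost ;; sto aINW (v xB + v xP) (v xU) ;; outermost ;;
    (sto aOUT (v xB + v xP) (v xU) ;; asg xP (v xP + 1))

theorem slotEntries_spec (H : Layout F μ₀ L s) (hM : Marks L (fun _ => 0) (fun _ => {0}) s)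
    {i : Fin L.m} (hB : s.var xB = L.obj i 1 * n) (hL : s.var xL = L.len i) {p : ℕ}
    (hP : s.var xP = p) (hp : 1 ≤ p) (hpl : p ≤ L.len i) (hW : 10 * (n * n) + 10 * n + 1000 ≤ W) :
    Wp W slotEntries s (200 * n + 300) (fun s' => ∃ x y,
      s'.arr aINW = Function.update (s.arr aINW) (L.obj i 1 * n + p) x ∧
      s'.arr aOUT = Function.update (s.arr aOUT) (L.obj i 1 * n + p) y ∧
      (∀ r, x ≤ r ↔ LikesIn L i (μ₀.symm (L.obj i p)) p r) ∧
      (∀ q, q ≤ y ↔ LikesOut L i (μ₀.symm (L.obj i p)) p q) ∧ s'.var xP = p + 1) := by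
  have hlen := len_lt L i
  have hbase := base_le (L.obj i 1)
  set a := μ₀.symm (L.obj i p) with ha
  have hbasea := base_le a
  have ha2 := a.2
  have hobj : ∀ q ≤ L.len i, a * n + s.arr aOBJ (L.obj i 1 * n + q) ≤ W := by
    intro q hq
    rw [H.obj i q hq]
    have := (L.obj i q).2
    omega
  refine Wp.seq 30 (fun s' => s'.var xA = a ∧ s'.var xS = p) (by omega) (Wp.of_vc ?_)
    fun s1 f1 ⟨h1, h2⟩ => ?_
  · simp [vc, hB, hP, H.obj i p hpl, H.hold]
    omega
  have eN1 := (f1.var xN).trans H.size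
  have eB1 := (f1.var xB).trans hB
  have eL1 := (f1.var xL).trans hL
  have eP1 := (f1.var xP).trans hP
  refine Wp.seq (100 * p + 60) (fun s2 => s2.var xU ≤ p ∧ ∀ r, s2.var xU ≤ r ↔ LikesIn L i a p r)
    (by omega) ?_ fun s2 f2 ⟨h3, h4⟩ => ?_
  · refine (innermost_spec (R := fun q => s.arr aRANK (a * n + s.arr aOBJ (L.obj i 1 * n + q)))
      (fun q => by rw [h1, eN1, eB1, f1.arr aRANK, f1.arr aOBJ])
      (fun q hq => ?_) ?_).weaken (by rw [eP1]) fun s2 _ ⟨h3, h4⟩ => ?_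
    · rw [h1, eN1, eB1, f1.arr aOBJ]
      exact hobj q (by omega)
    · rw [eB1, eP1]; omega
    · rw [eP1] at h3 h4
      refine ⟨h3, fun r => (h4 r).trans ?_⟩
      refine forall_congr' fun j => imp_congr_right fun _ => forall_congr' fun hj => ?_
      rw [H.obj i j (by omega), H.obj i (j + 1) (by omega), ← H.rank]
  have eB2 := (f2.var xB).trans eB1
  have eP2 := (f2.var xP).trans eP1
  refine Wp.seq 20 (fun s3 => s3.arr aINW =
      Function.update (s.arr aINW) (L.obj i 1 * n + p) (s2.var xU)) (by omega) (Wp.of_vc ?_)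
    fun s3 f3 h5 => ?_
  · simp [vc, eB2, eP2, f2.arr aINW, f1.arr aINW]
    omega
  have eB3 := (f3.var xB).trans eB2
  have eP3 := (f3.var xP).trans eP2
  have eA3 : s3.var xA = a := by rw [f3.var xA, f2.var xA, h1]
  have eS3 : s3.var xS = p := by rw [f3.var xS, f2.var xS, h2]
  have eN3 : s3.var xN = n := by rw [f3.var xN, f2.var xN, eN1]
  have eL3 : s3.var xL = L.len i := by rw [f3.var xL, f2.var xL, eL1]
  have eO3 : s3.arr aOBJ = s.arr aOBJ := by rw [f3.arr aOBJ, f2.arr aOBJ, f1.arr aOBJ]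
  have eR3 : s3.arr aRANK = s.arr aRANK := by rw [f3.arr aRANK, f2.arr aRANK, f1.arr aRANK]
  have eM3 : s3.arr aMARK = s.arr aMARK := by rw [f3.arr aMARK, f2.arr aMARK, f1.arr aMARK]
  refine Wp.seq (100 * L.len i + 60) (fun s4 => s4.var xU ≤ n ∧
      ∀ q, q ≤ s4.var xU ↔ LikesOut L i a p q) (by omega) ?_ fun s4 f4 ⟨h6, h7⟩ => Wp.of_vc ?_
  · refine (outermost_spec ?_ (fun q hq => ?_) ?_).weaken (by rw [eL3]) fun s4 _ h => ?_
    · rw [eB3, eL3]; omega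
    · rw [eA3, eN3, eO3, eB3]
      exact hobj q (eL3 ▸ hq)
    · rw [eS3, eL3]; exact hpl
    · rw [eA3, eN3, eO3, eB3, eL3, eS3, eR3, eM3] at h
      refine ⟨by have := h.2.1; omega, fun q => (H.outer_iff h q).trans (and_iff_left_of_imp ?_)⟩
      intro hq t ht ht'
      rw [hM.mark i t (ht'.trans hq.1), if_neg (by simp; omega)]
  · have eB4 := (f4.var xB).trans eB3
    have eP4 := (f4.var xP).trans eP3
    have eI4 : s4.arr aINW = _ := (f4.arr aINW).trans h5
    have eO4 : s4.arr aOUT = s.arr aOUT := by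
      rw [f4.arr aOUT, f3.arr aOUT, f2.arr aOUT, f1.arr aOUT]
    simp [vc, eB4, eP4, eO4]
    refine ⟨by omega, by omega, by omega, s2.var xU, eI4, s4.var xU, rfl, h4, h7⟩

/-- Fills the two tables. -/
def walkTables : Prog :=
  asg xI 0 ;; loop (v xI) (v xN)
    ((asg xB (v xI * v xN) ;; asg xL (get aLEN (v xI)) ;; asg xP 1) ;;
      loop (v xP) (v xL + 1) slotEntries ;; asg xI (v xI + 1))

theorem Layout.frame {p : Prog} (h : Layout F μ₀ L s) (f : Frame p s s')
    (h0 : p.wv.contains xN = false := by rfl) (h1 : p.wv.contains xC = false := by rfl)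
    (h5 : p.wa.contains aRANK = false := by rfl) (h6 : p.wa.contains aHOLD = false := by rfl)
    (h7 : p.wa.contains aOBJ = false := by rfl) (h8 : p.wa.contains aLEN = false := by rfl) :
    Layout F μ₀ L s' :=
  h.congr (f.var _ h0) (f.var _ h1) (f.arr _ h5) (f.arr _ h6) (f.arr _ h7) (f.arr _ h8)

theorem walkTables_spec (H : Layout F μ₀ L s) (hM : Marks L (fun _ => 0) (fun _ => {0}) s)
    (hout : ∀ q, s.arr aOUT q = 0) (hW : 10 * (n * n) + 10 * n + 1000 ≤ W) :
    Wp W walkTables s (1000 * (n * n) + 1000 * n + 1000) (Tables F μ₀ L) := by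
  refine Wp.seq 10 (fun s' => s'.var xI = 0) (by omega) (Wp.of_vc ?_) fun s1 f1 h1 => ?_
  · simp [vc]
  have H1 := H.frame f1
  have M1 := hM.congr (f1.arr aMARK) (f1.arr aCNT)
  let Good : Fin L.m → ℕ → Mem → Prop := fun i p s' =>
    (∀ r, s'.arr aINW (L.obj i 1 * n + p) ≤ r ↔ LikesIn L i (μ₀.symm (L.obj i p)) p r) ∧
    ∀ q, q ≤ s'.arr aOUT (L.obj i 1 * n + p) ↔ LikesOut L i (μ₀.symm (L.obj i p)) p q
  refine Wp.count (N := n) (fun k s' => (∀ q, s'.arr aOUT q ≤ n) ∧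
      ∀ i p, (L.obj i 1 : ℕ) < k → 1 ≤ p → p ≤ L.len i → Good i p s')
    (fun k => (s.arr aLEN k + 1) * (200 * n + 310) + 100) ?_ (by omega) (by omega) ?_ ?_ ?_ ?_
  · refine ⟨fun q => ?_, fun i p h => by omega⟩
    rw [f1.arr' aOUT (by simp [Prog.wa]), hout]
    exact Nat.zero_le _
  · intro k s' _ _ f
    simp [f.var xN, H1.size]
  · rintro k s2 hk hx ⟨i1, i2⟩ f2
    have H2 : Layout F μ₀ L s2 := H1.congr (f2.var xN) (f2.var xC) (f2.arr aRANK) (f2.arr aHOLD)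
      (f2.arr aOBJ) (f2.arr aLEN)
    have M2 := M1.congr (f2.arr aMARK) (f2.arr aCNT)
    have eL2 : s2.arr aLEN k = s.arr aLEN k := by rw [f2.arr aLEN, f1.arr aLEN]
    have hkn := Nat.mul_le_mul_right n hk.le
    obtain ⟨ℓ, hℓ⟩ : ∃ ℓ, s.arr aLEN k = ℓ := ⟨_, rfl⟩
    rw [hℓ] at eL2 ⊢
    have hℓn : ℓ < n := by
      rcases Nat.eq_zero_or_pos ℓ with h | h
      · omega
      · obtain ⟨i, hi⟩ := H2.len_zero k hk (by omega)
        rw [← eL2, hi, H2.len]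
        exact len_lt L i
    refine Wp.seq 50 (fun s' => s'.var xB = k * n ∧ s'.var xL = ℓ ∧ s'.var xP = 1) (by omega)
      (Wp.of_vc ?_) fun s3 f3 ⟨h3, h4, h5⟩ => ?_
    · simp [vc, hx, H2.size, eL2]
      omega
    have H3 := H2.frame f3
    have M3 := M2.congr (f3.arr aMARK) (f3.arr aCNT)
    have eI3 := f3.var xI
    refine Wp.seq ((ℓ + 1) * (200 * n + 310) + 20) (fun s' => (∀ q, s'.arr aOUT q ≤ n) ∧
      ∀ i p, (L.obj i 1 : ℕ) < k + 1 → 1 ≤ p → p ≤ L.len i → Good i p s') (by omega)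
      (Wp.count (N := ℓ + 1) (fun t s' => 1 ≤ t ∧ (∀ q, s'.arr aOUT q ≤ n) ∧
        ∀ i p, (L.obj i 1 : ℕ) < k ∨ (L.obj i 1 : ℕ) = k ∧ p < t → 1 ≤ p → p ≤ L.len i →
          Good i p s') (fun _ => 200 * n + 300) ?_ (by omega) (by omega) ?_ ?_ ?_ ?_)
      fun s4 f4 h4 => Wp.of_vc ?_
    · refine ⟨h5.ge, fun q => by rw [f3.arr aOUT]; exact i1 q, ?_⟩
      rintro i p (h | h) hp hpl
      · simp only [Good, f3.arr aINW, f3.arr aOUT]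
        exact i2 i p h hp hpl
      · omega
    · intro t s' _ _ f
      simp [f.var xL, h4]; omega
    · rintro t s4 ht hx4 ⟨j1, j2, j3⟩ f4
      have H4 := H3.frame f4
      have M4 := M3.congr (f4.arr aMARK) (f4.arr aCNT)
      have e4 : s4.arr aLEN k = ℓ := by rw [f4.arr aLEN, f3.arr aLEN, eL2]
      obtain ⟨i, hi⟩ := H4.len_zero k hk (by omega)
      have hlen : L.len i = ℓ := by rw [← e4, hi, H4.len]
      refine (slotEntries_spec H4 M4 (i := i) (by rw [f4.var xB, h3, hi])
        (by rw [f4.var xL, h4, hlen]) hx4 j1 (by omega) hW).weaken le_rfl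
        fun s5 f5 ⟨x, y, g1, g2, g3, g4, g5⟩ => ⟨⟨by omega, fun q => ?_, fun i' p' h hp hpl => ?_⟩, g5⟩
      · rw [g2, Function.update_apply]
        split_ifs
        · exact ((g4 y).1 le_rfl).1.trans (len_lt L i).le
        · exact j2 q
      · simp only [Good, g1, g2, Function.update_apply]
        split_ifs with h6
        · obtain ⟨rfl, rfl⟩ := slot_ne h6 hpl (by omega)
          exact ⟨g3, g4⟩
        · refine j3 i' p' (h.imp_right fun ⟨h7, h8⟩ => ⟨h7, ?_⟩) hp hpl
          have : p' ≠ t := by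
            rintro rfl
            exact h6 (by rw [h7, hi])
          omega
    · simp [Nat.add_assoc, Nat.mul_add, Nat.add_mul]
      omega
    · rintro s' ⟨-, j2, j3⟩ _ f
      refine ⟨j2, fun i p h hp hpl => j3 i p ?_ hp hpl⟩
      rcases Nat.lt_or_ge (L.obj i 1 : ℕ) k with h6 | h6
      · exact Or.inl h6
      · have h7 : (L.obj i 1 : ℕ) = k := by omega
        have h8 := H3.len i
        rw [h7, f3.arr aLEN, eL2] at h8
        exact Or.inr ⟨h7, by omega⟩
    · have e := (f4.var xI).trans eI3
      simp [vc, e, hx]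
      exact ⟨by omega, h4.1, fun i p h => h4.2 i p (by omega)⟩
  · have hs := sum_len_le L H.len H.len_zero
    have e : ∑ k ∈ Finset.range n, ((s.arr aLEN k + 1) * (200 * n + 310) + 100 + 3 + 4) =
        (∑ k ∈ Finset.range n, s.arr aLEN k) * (200 * n + 310) + n * (200 * n + 417) := by
      rw [Finset.sum_mul, ← smul_eq_mul n, ← Finset.card_range n, ← Finset.sum_const,
        Finset.card_range, ← Finset.sum_add_distrib]
      exact Finset.sum_congr rfl fun k _ => by ring
    have hcost : (v xN).cost = 3 := rfl
    rw [hcost, e]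
    have h1 := Nat.mul_le_mul_right (200 * n + 310) hs
    have h2 : n * (200 * n + 310) + n * (200 * n + 417) + (3 + 4) + 10 ≤
        1000 * (n * n) + 1000 * n + 1000 := by nlinarith
    refine Nat.le_sub_of_add_le (le_trans ?_ h2)
    gcongr
  · rintro s2 ⟨i1, i2⟩ _ f2
    have H2 : Layout F μ₀ L s2 := H1.congr (f2.var xN) (f2.var xC) (f2.arr aRANK) (f2.arr aHOLD)
      (f2.arr aOBJ) (f2.arr aLEN)
    exact ⟨H2, fun i p r hp hpl => (i2 i p (L.obj i 1).2 hp hpl).1 r,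
      fun i p q hp hpl => (i2 i p (L.obj i 1).2 hp hpl).2 q, i1⟩

/-! ### The complete program -/

/-- Computes all tables. -/
def preprocess : Prog := rankTable ;; holdTable ;; findCenter ;; branches ;; walkTables

theorem preprocess_spec (hG : IsGeneralizedStar F.graph) (h : IsInput F μ₀ s)
    (hW : 10 * (n * n) + 10 * n + 1000 ≤ W) :
    Wp W preprocess s (2000 * (n * n) + 2000 * n + 2000) (fun s' => ∃ L : StarLabelling F.graph,
      Tables F μ₀ L s' ∧ Marks L (fun _ => 0) (fun _ => {0}) s' ∧
      Records (n := n) [] ∅ s') := by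
  classical
  have hz : ∀ r p, 2 < r → s.arr r p = 0 := fun r p hr => h.arr_zero r p (Or.inr (Or.inr hr))
  have hadj : ∀ b b' : Fin n, s.arr 1 (b * n + b') = if F.graph.Adj b b' then 1 else 0 := by
    intro b b'
    split_ifs with hA
    · exact h.adj b b' hA
    · exact h.not_adj b b' hA
  refine Wp.seq _ _ (by omega) (rankTable_spec h.size h.prefs (by omega)) fun s1 f1 h1 => ?_
  refine Wp.seq _ _ (by omega) (holdTable_spec (μ₀ := μ₀) ((f1.var xN).trans h.size)
    (by rw [f1.arr 2]; exact h.matching) (by omega)) fun s2 f2 h2 => ?_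
  refine Wp.seq _ _ (by omega) (findCenter_spec hG (by rw [f2.var xN, f1.var xN, h.size])
    (by rw [f2.arr 1, f1.arr 1]; exact hadj)
    (fun p => by rw [f2.arr 13, f1.arr 13, hz 13 p (by omega)])
    (by rw [f2.var xC, f1.var xC, h.var_zero xC (by omega)]) (by omega)) fun s3 f3 ⟨L, h3⟩ => ?_
  have eN3 : s3.var xN = n := by rw [f3.var xN, f2.var xN, f1.var xN, h.size]
  refine Wp.seq _ _ (by omega) (branches_spec (L := L) eN3 h3
    (by rw [f3.arr 1, f2.arr 1, f1.arr 1]; exact hadj)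
    (fun p => by rw [f3.arr aLEN, f2.arr aLEN, f1.arr aLEN, hz aLEN p (by omega)])
    (fun p => by rw [f3.arr aMARK, f2.arr aMARK, f1.arr aMARK, hz aMARK p (by omega)])
    (fun p => by rw [f3.arr aCNT, f2.arr aCNT, f1.arr aCNT, hz aCNT p (by omega)]) (by omega))
    fun s4 f4 ⟨h4, h5, h6, h7⟩ => ?_
  have H4 : Layout F μ₀ L s4 := by
    refine ⟨(f4.var xN).trans eN3, (f4.var xC).trans h3, fun a b b' => ?_, fun b => ?_, h4,
      fun v _ => h5 v, h6⟩
    · rw [f4.arr aRANK, f3.arr aRANK, f2.arr aRANK, h1, h1, pref_iff_rankOf_lt]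
    · rw [f4.arr aHOLD, f3.arr aHOLD, h2]
  refine (walkTables_spec H4 h7 (fun q => ?_) hW).weaken (by omega) fun s5 f5 h8 =>
    ⟨L, h8, h7.congr (f5.arr aMARK) (f5.arr aCNT), ?_, fun k hk => ?_, fun a b hab => hab.elim⟩
  · rw [f4.arr aOUT, f3.arr aOUT, f2.arr aOUT, f1.arr aOUT, hz aOUT q (by omega)]
  · rw [f5.var xD, f4.var xD, f3.var xD, f2.var xD, f1.var xD, h.var_zero xD (by omega)]
    rfl
  · simp at hk

/-- The two-phase algorithm. -/
def twoPhase : Prog := preprocess ;; phase1 ;; phase2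

theorem twoPhase_exec (hG : IsGeneralizedStar F.graph) (h : IsInput F μ₀ s)
    (hW : 10 * (n * n) + 10 * n + 1000 ≤ W) :
    ∃ s' t μ σ, Exec W twoPhase.compile s s' t ∧ t ≤ 20000 * ((n + 1) * ((n + 1) * (n.size + 1))) ∧
      IsOutput μ σ s' ∧ ∃ L : StarLabelling F.graph, F.TwoPhaseRun L μ₀ σ μ := by
  obtain ⟨v₀⟩ := hG.1.1.nonempty
  obtain ⟨K, hK⟩ : ∃ K, K = (n + 1) * (n.size + 1) := ⟨_, rfl⟩
  have hnK : n + 1 ≤ K := by rw [hK]; exact Nat.le_mul_of_pos_right _ (Nat.succ_pos _)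
  have hT1 : 2000 * (n * n) + 2000 * n + 2000 ≤ 2000 * ((n + 1) * K) := by nlinarith
  have hrun : Wp W twoPhase s (20000 * ((n + 1) * K)) (fun s' => ∃ (L : StarLabelling F.graph) (σ : _)
      (μ : _), F.TwoPhaseRun L μ₀ σ μ ∧ Records σ (matchingPairs μ) s') := by
    refine Wp.seq _ _ (by omega) (preprocess_spec hG h hW) fun s1 f1 ⟨L, h1, h2, h3⟩ => ?_
    refine Wp.seq _ _ ?_ (phase1_spec h1 h2 h3 hW)
      fun s2 f2 ⟨σ, χ, τ, c, d, hr, PS, h4, h5, h6⟩ => ?_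
    · rw [← hK, Nat.mul_assoc]; omega
    refine (phase2_spec hr PS h4 h5 h6 hW).weaken ?_ fun s3 f3 ⟨σ', μ, h7, h8⟩ => ⟨L, σ', μ, h7, h8⟩
    rw [← hK, Nat.mul_assoc, Nat.mul_assoc]; omega
  obtain ⟨m', t, s', h1, h2, h3, -, L, σ, μ, h4, h5⟩ := hrun s ⟨fun _ _ => rfl, fun _ _ => rfl⟩
  refine ⟨m', t, μ, σ, h1, h2.trans (by rw [hK]), ⟨fun a => ?_, fun k hk => ?_⟩, L, h4⟩
  · rw [h3.arr aRES (by omega)]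
    exact h5.out a (μ a) rfl
  · rw [h3.arr aSEQ (by omega)]
    exact h5.seq k hk

end

end WordRAM

/-! ### The running time -/

theorem Nat.size_le_log {n : ℕ} (hn : 3 ≤ n) : ((n.size : ℕ) : ℝ) ≤ 3 * Real.log n := by
  have hpos : 0 < n.size := Nat.size_pos.2 (by omega)
  have h1 : 2 ^ (n.size - 1) ≤ n := by
    by_contra h
    have := Nat.size_le.2 (not_le.1 h)
    omega
  have h2 : ((n.size - 1 : ℕ) : ℝ) * Real.log 2 ≤ Real.log n := by
    rw [← Real.log_pow]
    exact Real.log_le_log (by positivity) (by exact_mod_cast h1)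
  have h3 : (1 : ℝ) ≤ Real.log n := by
    rw [Real.le_log_iff_exp_le (by positivity)]
    have : (3 : ℝ) ≤ n := by exact_mod_cast hn
    linarith [Real.exp_one_lt_d9]
  rw [Nat.cast_sub hpos] at h2
  push_cast at h2
  have h4 := Real.log_two_gt_d9
  nlinarith

theorem timeBound_isBigO (C : ℕ) :
    (fun n : ℕ => ((C * ((n + 1) * ((n + 1) * (n.size + 1))) : ℕ) : ℝ)) =O[atTop]
      fun n => (n : ℝ) ^ 2 * Real.log n := by
  refine IsBigO.of_bound (16 * C) ?_
  filter_upwards [eventually_ge_atTop 3] with n hn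
  have h1 := Nat.size_le_log hn
  have h2 : (3 : ℝ) ≤ n := by exact_mod_cast hn
  have h3 : (1 : ℝ) ≤ Real.log n := by
    rw [Real.le_log_iff_exp_le (by positivity)]
    linarith [Real.exp_one_lt_d9]
  rw [Real.norm_of_nonneg (by positivity), Real.norm_of_nonneg (by positivity)]
  push_cast
  have h4 : ((n : ℝ) + 1) * ((n + 1) * (n.size + 1)) ≤ (2 * n) * ((2 * n) * (4 * Real.log n)) := by
    gcongr <;> linarith
  calc (C : ℝ) * ((n + 1) * ((n + 1) * (n.size + 1)))
      ≤ C * ((2 * n) * ((2 * n) * (4 * Real.log n))) := by gcongr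
    _ = 16 * C * (n ^ 2 * Real.log n) := by ring

/-- Words of `2000 * log n + O(1)` bits hold all addresses and all intermediate values. -/
theorem word_size_le (n : ℕ) : 10 * (n * n) + 10 * n + 1000 ≤ n ^ 2000 + 2000 := by
  rcases Nat.lt_or_ge n 2 with h | h
  · interval_cases n <;> simp
  · have h1 : n ^ 10 ≤ n ^ 2000 := Nat.pow_le_pow_right (by omega) (by omega)
    have h2 : n * n * n ^ 8 = n ^ 10 := by ring
    have h3 : 2 ^ 8 ≤ n ^ 8 := Nat.pow_le_pow_left h 8
    have h4 := Nat.mul_le_mul_left (n * n) h3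
    have h5 := Nat.le_mul_self n
    omega

theorem mainTheorem3 :
    ∃ (P : WordRAM.Cmd) (T : ℕ → ℕ) (d : ℕ),
      ((fun n => (T n : ℝ)) =O[atTop] fun n => (n : ℝ) ^ 2 * Real.log n) ∧
      ∀ (n : ℕ) (F : OAF (Fin n) (Fin n)) (μ₀ : Fin n ≃ Fin n), IsGeneralizedStar F.graph →
        -- the program computes a Pareto-efficient reachable matching within the time bound,
        -- using words of `O(log n)` bits, by a run of the two-phase algorithm
        (∀ s, WordRAM.IsInput F μ₀ s →
          ∃ (s' : WordRAM.Mem) (t : ℕ) (μ : Fin n ≃ Fin n) (σ : List (Fin n)),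
            WordRAM.Exec (n ^ d + d) P s s' t ∧ t ≤ T n ∧ WordRAM.IsOutput μ σ s' ∧
            F.IsParetoEfficientReachable μ₀ μ ∧
            ∃ L : StarLabelling F.graph, F.TwoPhaseRun L μ₀ σ μ) ∧
        -- for every choice of the center and numbering of the branches:
        ∀ L : StarLabelling F.graph,
          -- in the first phase the invariant holds, and the algorithm can continue until the
          -- agent at the center is to stay there
          (∀ σ χ τ, F.Phase1 L μ₀ σ χ τ → F.Phase1Invariant L μ₀ σ χ τ ∧
            ((χ.symm L.center, L.center) ∉ τ → ∃ σ' χ' τ', F.Phase1Step L σ χ τ σ' χ' τ') ∧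
            -- from then on, the problem splits into independent path problems
            ((χ.symm L.center, L.center) ∈ τ →
              ∀ τ', τ ⊆ τ' → F.SplitsIntoBranches L χ τ' ∧
                F.ReachAgain χ τ' = F.ReachAgain μ₀ τ')) ∧
          -- every complete run is serial dictatorship along a permutation of all agents, and
          -- its output is Pareto-efficient
          (∃ σ μ, F.TwoPhaseRun L μ₀ σ μ) ∧
          ∀ σ μ, F.TwoPhaseRun L μ₀ σ μ →
            σ.Nodup ∧ (∀ a, a ∈ σ) ∧ F.IsSerial μ₀ σ (matchingPairs μ) ∧
            F.IsParetoEfficientReachable μ₀ μ := by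
  refine ⟨WordRAM.twoPhase.compile, _, 2000, timeBound_isBigO 20000, fun n F μ₀ hG =>
    ⟨fun s hs => ?_, OAF.twoPhase_spec μ₀⟩⟩
  obtain ⟨s', t, μ, σ, h1, h2, h3, L, h4⟩ := WordRAM.twoPhase_exec hG hs (word_size_le n)
  exact ⟨s', t, μ, σ, h1, h2, h3, h4.correct.2.2.2, L, h4⟩
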